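/- Let $e>0$, $L>0$, $k_m=2\pi m/L$ for $m\in\mathbb Z$. **Fock space.** Let $\mathcal F$ be the algebraic fermionic Fock space with vacuum $\Omega_0$, creation/annihilation operators $b_n^\dagger,b_n,c_n^\dagger,c_n$ ($n\in\mathbb Z$) satisfying the canonical anticommutation relations, and orthonormal basis $\Omega_{\mathbf m,\mathbf n}=\prod b^\dagger_{m_i}\prod c^\dagger_{n_j}\Omega_0$ (indices increasing from left to right), $\mathbf m,\mathbf n$ finite subsets of $\mathbb Z$. Let $\mathcal F_0$ be the span of those with $|\mathbf m|=|\mathbf n|$ and $\mathcal H_0$ its completion. For $P\ge 0$ let $\Omega_P=\Omega_{\{0,\dots,P-1\},\{-(P-1),\dots,0\}}$, for $P<0$ let $\Omega_P=\Omega_{\{P,\dots,-1\},\{1,\dots,-P\}}$. Let $\mathbf\Gamma$ be the operator with $\mathbf\Gamma\Omega_0=b_{-1}^\dagger c_1^\dagger\Omega_0$, $\mathbf\Gamma b_n^\dagger\mathbf\Gamma^{-1}=b_{n-1}^\dagger$ and $\mathbf\Gamma c_n^\dagger\mathbf\Gamma^{-1}=c_{n+1}^\dagger$ for $n\ne0$,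 $\mathbf\Gamma b_0^\dagger\mathbf\Gamma^{-1}=c_1$, $\mathbf\Gamma c_0^\dagger\mathbf\Gamma^{-1}=b_{-1}$. Put $H_D=\sum_m|k_m|(b_m^\dagger b_m+c_m^\dagger c_m)$, $Q^5=\sum_{n\ge0}b_n^\dagger b_n-\sum_{n<0}b_n^\dagger b_n-\sum_{n>0}c_n^\dagger c_n+\sum_{n\le0}c_n^\dagger c_n$, $Q^{5,reg}=Q^5-\frac{aL}{\pi}-1$, and for $m\ge1$ $$\varrho^R(m)=-\sum_{k>m}c_k^\dagger c_{k-m}+\sum_{0<k\le m}b_{m-k}^\dagger c_k^\dagger+\sum_{k\ge0}b_{k+m}^\dagger b_k,\qquad \varrho^L(m)=\sum_{k<-m}b_{k+m}^\dagger b_k+\sum_{-m\le k<0}c_{-k-m}b_k-\sum_{k\le0}c_k^\dagger c_{k-m},$$ with $\varrho^{R}(-m)$, $\varrho^L(-m)$ their adjoints. The normal ordered Coulomb energy is $:\!H_{coul}\!:\;=\frac{e^2}{2L}\sum_{m\ne0}k_m^{-2}\bigl(\varrho^R(|m|)\varrho^R(-|m|)+\varrho^L(m)\varrho^R(-m)+\varrho^R(m)\varrho^L(-m)+\varrho^L(-|m|)\varrho^L(|m|)\bigr)$.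 **Hamiltonian.** Let $\mathcal K=L^2([0,\frac{2\pi}L];\mathcal H_0)$ and let $\mathcal D\subset\mathcal K$ be the space of (restrictions to $[0,\frac{2\pi}{L}]$ of) smooth functions $\Psi:\mathbb R\to\mathcal F_0$, locally with values in a finite dimensional subspace, with $\Psi(a+\frac{2\pi}L)=\mathbf\Gamma^{-1}\Psi(a)$. On $\mathcal D$ let $$H=-\frac{e^2}{2L}\frac{d^2}{da^2}+H_D-\frac{a^2L}{2\pi}-a\,Q^{5,reg}+\frac{\pi}{2L}+:\!H_{coul}\!:\,.$$ **Dressing.** Put $\lambda=\frac{e^2}2$, $V_m=k_m^{-2}$, define $\zeta(m)$ by $-\tanh2\zeta(m)=\frac{\lambda V_m}{\lambda V_m+\pi}$, and let $Z=\frac{2\pi i}{L}\sum_{m\neq0}\frac{\zeta(m)}{k_m}\varrho^R(m)\varrho^L(-m)$ on $\mathcal F_0$. For $m\ge1$ let $A_m^\dagger=-im^{-1/2}\varrho^R(m)$, $A_m=im^{-1/2}\varrho^R(-m)$, $A_{-m}^\dagger=im^{-1/2}\varrho^L(-m)$, $A_{-m}=-im^{-1/2}\varrho^L(m)$. Let $$C_0=\frac{2\pi}L\sum_{m\ge1}m\Bigl[\bigl(1+\tfrac{2\lambda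 V_m}{\pi}\bigr)^{1/2}-\tfrac{\lambda V_m}{\pi}-1\Bigr],\quad E_0=\frac{e}{2\sqrt\pi},\quad f(x)=\frac{L^{1/4}}{\pi^{3/8}e^{1/4}}\exp\Bigl(-\frac{Lx^2}{2\sqrt\pi\,e}\Bigr),$$ where $e$ is the coupling constant throughout. **Claim.** The sums defining $:\!H_{coul}\!:$ and $Z$ on basis vectors converge in $\mathcal H_0$, the series $C_0$ converges, and $C_0<0$. $H$ is densely defined, symmetric and closable; $Z$ is closable, and $\mathbf U=e^{iZ}$ exists, i.e. there is a strongly continuous one-parameter unitary group $(e^{itZ})_{t\in\mathbb R}$ on $\mathcal H_0$ whose generator is $i$ times the closure of $Z$, and $\mathbf U$ is its value at $t=1$. Letting $\mathbf U$ act on $\mathcal K$ pointwise in $a$, and writing $H$ also for the closure, $$\mathbf U H\mathbf U^{-1}=-\frac{e^2}{2L}\frac{d^2}{da^2}+\frac{\pi}{2L}(Q^{5,reg})^2+\sum_{m\ge1}\bigl(k_m^2+\tfrac{e^2}{\pi}\bigr)^{1/2}\bigl[A_m^\dagger A_m+A_{-m}^\dagger A_{-m}\bigr]+C_0,$$ the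 right side being the closure of the operator with this expression and domain $\mathcal D$ (which is closable): the zero-mode part plus the Hamiltonian of a free scalar field of mass $e/\sqrt\pi$ plus $C_0$. With $\mathbf\Omega_P=\mathbf U^{-1}\Omega_P$, the series $$\mathbf\Psi_0(a)=\sum_{P\in\mathbb Z}f\Bigl(a-\frac{2\pi}{L}\bigl(P-\tfrac12\bigr)\Bigr)\mathbf\Omega_P$$ converges in $\mathcal H_0$ for every $a$ and defines a unit vector of $\mathcal K$ in the domain of $H$ with $H\mathbf\Psi_0=(E_0+C_0)\mathbf\Psi_0$, and $E_0+C_0$ is the vacuum energy: the minimum of $\langle\Psi,H\Psi\rangle$ over unit vectors $\Psi$ in the domain of $H$. -/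

import Mathlib

open MeasureTheory Set Filter Topology
open scoped ContDiff

noncomputable section

namespace Schwinger

/-! ### Fermionic Fock space -/

/-- Labels `(𝐦, 𝐧)` of the Fock basis: the occupied fermion modes `𝐦` and the occupied
anti-fermion modes `𝐧`, both finite subsets of `ℤ`. -/
abbrev Cfg : Type := Finset ℤ × Finset ℤ

/-- The algebraic Fock space: finite linear combinations of the vectors
`Ω_{𝐦,𝐧} = ∏ b†_{m_i} ∏ c†_{n_j} Ω₀`, where both products are ordered from left to right by
increasing index. -/
abbrev Fock : Type := Cfg →₀ ℂ

/-- The basis vector `Ω_{𝐦,𝐧}`. -/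
def basisVec (s : Cfg) : Fock := Finsupp.single s 1

/-- The sign picked up when a mode `k` is moved past the modes of `m` that precede it. -/
def passSign (m : Finset ℤ) (k : ℤ) : ℂ := (-1) ^ (m.filter (· < k)).card

/-- Fermion creation operator `b†_k`. -/
def bCr (k : ℤ) : Module.End ℂ Fock :=
  Finsupp.linearCombination ℂ fun s : Cfg =>
    if k ∈ s.1 then 0 else passSign s.1 k • basisVec (insert k s.1, s.2)

/-- Fermion annihilation operator `b_k`. -/
def bAn (k : ℤ) : Module.End ℂ Fock :=
  Finsupp.linearCombination ℂ fun s : Cfg =>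
    if k ∈ s.1 then passSign s.1 k • basisVec (s.1.erase k, s.2) else 0

/-- Anti-fermion creation operator `c†_k`; it anti-commutes with the fermion operators, whence the
sign `(-1)^|𝐦|`. -/
def cCr (k : ℤ) : Module.End ℂ Fock :=
  Finsupp.linearCombination ℂ fun s : Cfg =>
    if k ∈ s.2 then 0
    else ((-1 : ℂ) ^ s.1.card * passSign s.2 k) • basisVec (s.1, insert k s.2)

/-- Anti-fermion annihilation operator `c_k`. -/
def cAn (k : ℤ) : Module.End ℂ Fock :=
  Finsupp.linearCombination ℂ fun s : Cfg =>
    if k ∈ s.2 then ((-1 : ℂ) ^ s.1.card * passSign s.2 k) • basisVec (s.1, s.2.erase k)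
    else 0

/-- The sum `∑ᵢ Aᵢ` of a family of operators of which only finitely many act non-trivially on any
given basis vector. -/
def opSum {ι : Type} (A : ι → Module.End ℂ Fock) : Module.End ℂ Fock :=
  Finsupp.linearCombination ℂ fun s : Cfg => ∑ᶠ i, A i (basisVec s)

/-! ### Zero charge sector -/

/-- Labels of zero charge: equally many fermions and anti-fermions. -/
abbrev Cfg0 : Type := {s : Cfg // s.1.card = s.2.card}

/-- The algebraic zero charge Fock space `𝓕₀`. -/
abbrev Fock0 : Type := Cfg0 →₀ ℂ

/-- The zero charge Fock space `𝓗₀`, with orthonormal basis the `Ω_{𝐦,𝐧}` of zero charge. -/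
abbrev Hilb0 : Type := lp (fun _ : Cfg0 => ℂ) 2

/-- The basis vector of `𝓕₀`. -/
def basisVec0 (s : Cfg0) : Fock0 := Finsupp.single s 1

/-- The inclusion `𝓕₀ → 𝓗₀`. -/
def emb : Fock0 →ₗ[ℂ] Hilb0 :=
  Finsupp.linearCombination ℂ fun s : Cfg0 => lp.single 2 s (1 : ℂ)

/-- The restriction to `𝓕₀` of a charge preserving operator on `𝓕` (all operators to which this is
applied preserve the charge). -/
def restrict0 (A : Module.End ℂ Fock) : Module.End ℂ Fock0 :=
  (Finsupp.lsubtypeDomain {s : Cfg | s.1.card = s.2.card}) ∘ₗ A ∘ₗ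
    (Finsupp.lmapDomain ℂ ℂ (Subtype.val : Cfg0 → Cfg))

theorem unexcited_card (P : ℤ) :
    (Finset.Ico 0 P ∪ Finset.Ico P 0).card = (Finset.Ioc (-P) 0 ∪ Finset.Ioc 0 (-P)).card := by
  rcases le_total 0 P with h | h
  · rw [Finset.Ico_eq_empty (a := P) (by omega), Finset.Ioc_eq_empty (a := (0 : ℤ)) (by omega)]
    simp
  · rw [Finset.Ico_eq_empty (b := P) (by omega), Finset.Ioc_eq_empty (b := (0 : ℤ)) (by omega)]
    simp

/-- The unexcited states `Ω_P`: for `P ≥ 0` the fermion modes `0, …, P - 1` and the anti-fermion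
modes `-(P - 1), …, 0` are occupied, for `P < 0` the fermion modes `P, …, -1` and the anti-fermion
modes `1, …, -P`. -/
def unexcited (P : ℤ) : Fock0 :=
  basisVec0 ⟨(Finset.Ico 0 P ∪ Finset.Ico P 0, Finset.Ioc (-P) 0 ∪ Finset.Ioc 0 (-P)),
    unexcited_card P⟩

/-! ### The large gauge transformation `𝚪` -/

/-- `𝚪 b†_n 𝚪⁻¹`. -/
def gaugeB (n : ℤ) : Module.End ℂ Fock := if n = 0 then cAn 1 else bCr (n - 1)

/-- `𝚪 c†_n 𝚪⁻¹`. -/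
def gaugeC (n : ℤ) : Module.End ℂ Fock := if n = 0 then bAn (-1) else cCr (n + 1)

/-- The operator `𝚪`, determined by its action on the creation operators and by
`𝚪 Ω₀ = b†₋₁ c†₁ Ω₀`. -/
def gauge : Module.End ℂ Fock :=
  Finsupp.linearCombination ℂ fun s : Cfg =>
    ((s.1.sort (· ≤ ·)).map gaugeB).prod (((s.2.sort (· ≤ ·)).map gaugeC).prod
      (bCr (-1) (cCr 1 (basisVec (∅, ∅)))))

/-! ### Bilinear operators -/

/-- `k_m = 2πm/L`. -/
def mom (L : ℝ) (m : ℤ) : ℝ := 2 * Real.pi * m / L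

/-- The free Dirac Hamiltonian `∑ |k_m| (b†_m b_m + c†_m c_m)`. -/
def diracH (L : ℝ) : Module.End ℂ Fock :=
  opSum fun m : ℤ => ((|mom L m| : ℝ) : ℂ) • (bCr m * bAn m + cCr m * cAn m)

/-- The axial charge `Q⁵`. -/
def axial : Module.End ℂ Fock :=
  opSum fun n : ℤ => (if 0 ≤ n then (1 : ℂ) else -1) • (bCr n * bAn n) +
    (if 0 < n then (-1 : ℂ) else 1) • (cCr n * cAn n)

/-- The regularized axial charge `Q⁵ - aL/π - 1`, on `𝓕₀`. -/
def axialReg (L a : ℝ) : Module.End ℂ Fock0 :=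
  restrict0 axial - ((a * L / Real.pi + 1 : ℝ) : ℂ) • 1

/-- The right-moving density modes `ϱᴿ(m)`, `m ≠ 0`. -/
def rhoR (m : ℤ) : Module.End ℂ Fock :=
  if 0 < m then
    -(opSum fun k : ℤ => if m < k then cCr k * cAn (k - m) else 0)
      + ∑ k ∈ Finset.Ioc 0 m, bCr (-k + m) * cCr k
      + opSum fun k : ℤ => if 0 ≤ k then bCr (k + m) * bAn k else 0
  else
    -(opSum fun k : ℤ => if -m < k then cCr (k + m) * cAn k else 0)
      + ∑ k ∈ Finset.Ioc 0 (-m), cAn k * bAn (-k - m)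
      + opSum fun k : ℤ => if 0 ≤ k then bCr k * bAn (k - m) else 0

/-- The left-moving density modes `ϱᴸ(m)`, `m ≠ 0`. -/
def rhoL (m : ℤ) : Module.End ℂ Fock :=
  if 0 < m then
    (opSum fun k : ℤ => if k < -m then bCr (k + m) * bAn k else 0)
      + ∑ k ∈ Finset.Ico (-m) 0, cAn (-k - m) * bAn k
      - opSum fun k : ℤ => if k ≤ 0 then cCr k * cAn (k - m) else 0
  else
    (opSum fun k : ℤ => if k < m then bCr k * bAn (k - m) else 0)
      + ∑ k ∈ Finset.Ico m 0, bCr k * cCr (-k + m)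
      - opSum fun k : ℤ => if k ≤ 0 then cCr (k + m) * cAn k else 0

/-- The normal ordered product `:ȷ⁰(-m) ȷ⁰(m):` for `m ≠ 0`, where
`ȷ⁰(m) = (ϱᴿ(-m) + ϱᴸ(-m)) / L`; normal ordering puts the annihilation operators `ϱᴿ(-p)`, `ϱᴸ(p)`,
`p > 0`, to the right. -/
def currentSq (L : ℝ) (m : ℤ) : Module.End ℂ Fock :=
  ((1 / L ^ 2 : ℝ) : ℂ) •
    (rhoR |m| * rhoR (-|m|) + rhoL m * rhoR (-m) + rhoR m * rhoL (-m) + rhoL (-|m|) * rhoL |m|)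

/-- The terms of the normal ordered Coulomb energy, applied to a basis vector. -/
def coulombTerm (e L : ℝ) (s : Cfg0) (m : {m : ℤ // m ≠ 0}) : Hilb0 :=
  ((e ^ 2 * L / 2 * (1 / mom L m ^ 2) : ℝ) : ℂ) • emb (restrict0 (currentSq L m) (basisVec0 s))

/-- The normal ordered Coulomb energy `:H_coul:` on `𝓕₀`; its values are infinite sums in `𝓗₀`. -/
def coulomb (e L : ℝ) : Fock0 →ₗ[ℂ] Hilb0 :=
  Finsupp.linearCombination ℂ fun s : Cfg0 => ∑' m, coulombTerm e L s m

/-! ### Unbounded operators -/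

/-- The unbounded operator with domain `j(D)` given by `j x ↦ B x`. -/
def mkOp {D E : Type*} [AddCommGroup D] [Module ℂ D] [AddCommGroup E] [Module ℂ E]
    (j B : D →ₗ[ℂ] E) (h : LinearMap.ker j ≤ LinearMap.ker B) : E →ₗ.[ℂ] E where
  domain := LinearMap.range j
  toFun := (LinearMap.ker j).liftQ B h ∘ₗ j.quotKerEquivRange.symm.toLinearMap

/-- `U = e^{iA}` for a self-adjoint operator `A`: `U` is the value at time `1` of the strongly
continuous one-parameter unitary group `V(t) = e^{itA}`, i.e. the group for which `iA` is the
infinitesimal generator (with exactly the domain of `A`). -/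
def IsExpI {E : Type*} [NormedAddCommGroup E] [InnerProductSpace ℂ E]
    (A : E →ₗ.[ℂ] E) (U : E ≃ₗᵢ[ℂ] E) : Prop :=
  ∃ V : ℝ → (E ≃ₗᵢ[ℂ] E),
    (∀ x, V 0 x = x) ∧
    (∀ s t x, V (s + t) x = V s (V t x)) ∧
    (∀ x, Continuous fun t => V t x) ∧
    (∀ x y, (x, y) ∈ A.graph ↔ HasDerivAt (fun t => V t x) (Complex.I • y) 0) ∧
    V 1 = U

/-! ### The Bogoliubov transformation -/

/-- `λ V_m` with `λ = e²/2` and `V_m = k_m⁻²`. -/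
def lamV (e L : ℝ) (m : ℤ) : ℝ := e ^ 2 / 2 * (1 / mom L m ^ 2)

/-- The function `ζ` with `-tanh (2 ζ(m)) = λV_m / (λV_m + π)`. -/
def zeta (e L : ℝ) (m : ℤ) : ℝ := -(Real.artanh (lamV e L m / (lamV e L m + Real.pi))) / 2

/-- The terms of `Z = (2πi/L) ∑_{m ≠ 0} (ζ(m)/k_m) ϱᴿ(m) ϱᴸ(-m)`, applied to a basis vector. -/
def bogoliubovTerm (e L : ℝ) (s : Cfg0) (m : {m : ℤ // m ≠ 0}) : Hilb0 :=
  (Complex.I * ((2 * Real.pi / L * (zeta e L m / mom L m) : ℝ) : ℂ)) •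
    emb (restrict0 (rhoR m * rhoL (-m)) (basisVec0 s))

theorem emb_apply (x : Fock0) (s : Cfg0) : emb x s = x s := by
  classical
  have h : emb x = ∑ t ∈ x.support, x t • (lp.single 2 t (1 : ℂ) : Hilb0) := by
    simp [emb, Finsupp.linearCombination_apply, Finsupp.sum]
  rw [h, lp.coeFn_sum, Finset.sum_apply]
  simp only [lp.coeFn_smul, Pi.smul_apply, lp.coeFn_single, Pi.single_apply, smul_eq_mul,
    mul_ite, mul_one, mul_zero]
  simp [eq_comm]

theorem ker_emb : LinearMap.ker emb = ⊥ := by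
  refine LinearMap.ker_eq_bot'.2 fun x hx => Finsupp.ext fun s => ?_
  rw [← emb_apply, hx]
  rfl

/-- The operator `Z` with domain `𝓕₀`. -/
def bogoliubov (e L : ℝ) : Hilb0 →ₗ.[ℂ] Hilb0 :=
  mkOp emb (Finsupp.linearCombination ℂ fun s : Cfg0 => ∑' m, bogoliubovTerm e L s m)
    (by rw [ker_emb]; exact bot_le)

/-! ### The Hilbert space `𝓚` and the domain `𝓓` -/

/-- Lebesgue measure on `[0, 2π/L]`. -/
def meas (L : ℝ) : Measure ℝ := volume.restrict (Icc 0 (2 * Real.pi / L))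

instance (L : ℝ) : IsFiniteMeasure (meas L) := by
  unfold meas; infer_instance

/-- The total Hilbert space `𝓚 = L²([0, 2π/L]; 𝓗₀)`. -/
abbrev Tot (L : ℝ) : Type := Lp Hilb0 2 (meas L)

/-- The domain `𝓓` of smooth twisted periodic functions with values in `𝓕₀`. A smooth function into
the algebraic space `𝓕₀` takes, locally, values in a finite dimensional subspace; by the twisted
periodicity `𝚪 Ψ(a + 2π/L) = Ψ(a)` it is enough to say this on one period. -/
def smoothDom (L : ℝ) : Submodule ℂ (ℝ → Fock0) where
  carrier := {Ψ | ContDiff ℝ ∞ (fun a => emb (Ψ a)) ∧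
    (∃ S : Finset Cfg0, ∀ a ∈ Icc 0 (2 * Real.pi / L), (Ψ a).support ⊆ S) ∧
    ∀ a, restrict0 gauge (Ψ (a + 2 * Real.pi / L)) = Ψ a}
  zero_mem' := by
    refine ⟨?_, ⟨∅, fun a _ => by simp⟩, fun a => by simp⟩
    simpa using contDiff_const
  add_mem' := by
    classical
    rintro Ψ Φ ⟨h1, ⟨S, hS⟩, h3⟩ ⟨g1, ⟨T, hT⟩, g3⟩
    refine ⟨?_, ⟨S ∪ T, fun a ha => ?_⟩, fun a => ?_⟩
    · simpa using h1.add g1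
    · exact Finsupp.support_add.trans (Finset.union_subset_union (hS a ha) (hT a ha))
    · simp [h3 a, g3 a]
  smul_mem' := by
    rintro c Ψ ⟨h1, ⟨S, hS⟩, h3⟩
    refine ⟨?_, ⟨S, fun a ha => ?_⟩, fun a => ?_⟩
    · simpa using h1.const_smul c
    · exact Finsupp.support_smul.trans (hS a ha)
    · simp [h3 a]

/-- The function `-(e²/2L) Ψ'' + B(a) Ψ(a)`. -/
def actFun (e L : ℝ) (B : ℝ → Fock0 →ₗ[ℂ] Hilb0) (Ψ : ℝ → Fock0) (a : ℝ) : Hilb0 :=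
  ((-(e ^ 2 / (2 * L)) : ℝ) : ℂ) • iteratedDeriv 2 (fun a => emb (Ψ a)) a + B a (Ψ a)

theorem two_le_infty : (2 : WithTop ℕ∞) ≤ ∞ := by
  have h : (((2 : ℕ∞)) : WithTop ℕ∞) ≤ ((⊤ : ℕ∞) : WithTop ℕ∞) := WithTop.coe_le_coe.2 le_top
  exact h

theorem memLp_of_continuousOn (L : ℝ) (F : ℝ → Hilb0)
    (hF : ContinuousOn F (Icc 0 (2 * Real.pi / L))) : MemLp F 2 (meas L) := by
  obtain ⟨C, hC⟩ := isCompact_Icc.exists_bound_of_continuousOn hF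
  exact MemLp.of_bound (hF.aestronglyMeasurable measurableSet_Icc) C
    ((ae_restrict_iff' measurableSet_Icc).2 (Eventually.of_forall hC))

theorem memLp_emb (L : ℝ) (Ψ : smoothDom L) : MemLp (fun a => emb (Ψ.1 a)) 2 (meas L) :=
  memLp_of_continuousOn L _ Ψ.2.1.continuous.continuousOn

theorem memLp_act (e L : ℝ) (B : ℝ → Fock0 →ₗ[ℂ] Hilb0)
    (hB : ∀ s, Continuous fun a => B a (basisVec0 s)) (Ψ : smoothDom L) :
    MemLp (actFun e L B Ψ.1) 2 (meas L) := by
  obtain ⟨S, hS⟩ := Ψ.2.2.1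
  refine memLp_of_continuousOn L _ (ContinuousOn.add ?_ ?_)
  · have h : Continuous (iteratedDeriv 2 fun a => emb (Ψ.1 a)) :=
      Ψ.2.1.continuous_iteratedDeriv 2 two_le_infty
    exact (h.const_smul ((-(e ^ 2 / (2 * L)) : ℝ) : ℂ)).continuousOn
  · have hc : ∀ s, Continuous fun a => Ψ.1 a s := fun s => by
      have h : Continuous fun a => emb (Ψ.1 a) := Ψ.2.1.continuous
      have h' := (lp.evalCLM ℂ (fun _ : Cfg0 => ℂ) 2 s).continuous.comp h
      refine h'.congr fun a => ?_
      exact emb_apply _ _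
    have : ContinuousOn (fun a => ∑ s ∈ S, Ψ.1 a s • B a (basisVec0 s))
        (Icc 0 (2 * Real.pi / L)) :=
      (continuous_finsetSum _ fun s _ => (hc s).smul (hB s)).continuousOn
    refine this.congr fun a ha => ?_
    have hx : Ψ.1 a = ∑ s ∈ S, Ψ.1 a s • basisVec0 s := by
      conv_lhs => rw [← Finsupp.sum_single (Ψ.1 a)]
      rw [Finsupp.sum_of_support_subset _ (hS a ha) _ (by simp)]
      simp [basisVec0]
    conv_lhs => rw [hx]
    simp

theorem actFun_add (e L : ℝ) (B : ℝ → Fock0 →ₗ[ℂ] Hilb0) (Ψ Φ : smoothDom L) :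
    actFun e L B (Ψ.1 + Φ.1) = actFun e L B Ψ.1 + actFun e L B Φ.1 := by
  funext a
  have h1 : ContDiffAt ℝ 2 (fun a => emb (Ψ.1 a)) a :=
    (Ψ.2.1.of_le two_le_infty).contDiffAt
  have h2 : ContDiffAt ℝ 2 (fun a => emb (Φ.1 a)) a :=
    (Φ.2.1.of_le two_le_infty).contDiffAt
  have h3 : iteratedDeriv 2 (fun a => emb ((Ψ.1 + Φ.1) a)) a =
      iteratedDeriv 2 (fun a => emb (Ψ.1 a)) a + iteratedDeriv 2 (fun a => emb (Φ.1 a)) a := by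
    rw [← iteratedDeriv_add h1 h2]
    congr 1
    funext x
    simp
  unfold actFun
  rw [h3]
  simp only [Pi.add_apply, map_add, smul_add]
  abel

theorem actFun_smul (e L : ℝ) (B : ℝ → Fock0 →ₗ[ℂ] Hilb0) (c : ℂ) (Ψ : smoothDom L) :
    actFun e L B (c • Ψ.1) = c • actFun e L B Ψ.1 := by
  funext a
  have h1 : ContDiffAt ℝ 2 (fun a => emb (Ψ.1 a)) a :=
    (Ψ.2.1.of_le two_le_infty).contDiffAt
  have h3 : iteratedDeriv 2 (fun a => emb ((c • Ψ.1) a)) a =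
      c • iteratedDeriv 2 (fun a => emb (Ψ.1 a)) a := by
    rw [← iteratedDeriv_const_smul h1 c]
    congr 1
    funext x
    simp
  unfold actFun
  rw [h3]
  simp only [Pi.smul_apply, map_smul, smul_add]
  rw [smul_comm]

/-- The map `𝓓 → 𝓚`. -/
def domMap (L : ℝ) : smoothDom L →ₗ[ℂ] Tot L where
  toFun Ψ := (memLp_emb L Ψ).toLp _
  map_add' Ψ Φ := by
    rw [← MemLp.toLp_add]
    exact MemLp.toLp_congr _ _ (Eventually.of_forall fun a => by simp)
  map_smul' c Ψ := by
    rw [RingHom.id_apply, ← MemLp.toLp_const_smul]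
    exact MemLp.toLp_congr _ _ (Eventually.of_forall fun a => by simp)

/-- The map `𝓓 → 𝓚`, `Ψ ↦ -(e²/2L) Ψ'' + B Ψ`. -/
def actMap (e L : ℝ) (B : ℝ → Fock0 →ₗ[ℂ] Hilb0)
    (hB : ∀ s, Continuous fun a => B a (basisVec0 s)) : smoothDom L →ₗ[ℂ] Tot L where
  toFun Ψ := (memLp_act e L B hB Ψ).toLp _
  map_add' Ψ Φ := by
    rw [← MemLp.toLp_add]
    exact MemLp.toLp_congr _ _ (Eventually.of_forall fun a => congrFun (actFun_add e L B Ψ Φ) a)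
  map_smul' c Ψ := by
    rw [RingHom.id_apply, ← MemLp.toLp_const_smul]
    exact MemLp.toLp_congr _ _ (Eventually.of_forall fun a => congrFun (actFun_smul e L B c Ψ) a)

theorem ker_domMap_le (e L : ℝ) (B : ℝ → Fock0 →ₗ[ℂ] Hilb0)
    (hB : ∀ s, Continuous fun a => B a (basisVec0 s)) :
    LinearMap.ker (domMap L) ≤ LinearMap.ker (actMap e L B hB) := by
  intro Ψ hΨ
  rw [LinearMap.mem_ker] at hΨ ⊢
  have h0 : (fun a => emb (Ψ.1 a)) =ᵐ[volume.restrict (Icc 0 (2 * Real.pi / L))] fun _ => 0 := by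
    have h1 : (memLp_emb L Ψ).toLp _ = (0 : Tot L) := hΨ
    have h2 := (memLp_emb L Ψ).coeFn_toLp
    rw [h1] at h2
    exact h2.symm.trans (Lp.coeFn_zero _ _ _)
  have h1 : EqOn (fun a => emb (Ψ.1 a)) (fun _ => 0) (Ioo 0 (2 * Real.pi / L)) := by
    refine Measure.eqOn_open_of_ae_eq (μ := volume) ?_ isOpen_Ioo
      Ψ.2.1.continuous.continuousOn continuousOn_const
    exact ae_restrict_of_ae_restrict_of_subset Ioo_subset_Icc_self h0
  have h2 : actFun e L B Ψ.1 =ᵐ[meas L] 0 := by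
    unfold meas
    rw [← restrict_Ioo_eq_restrict_Icc]
    filter_upwards [ae_restrict_mem measurableSet_Ioo] with a ha
    have hz : Ψ.1 a = 0 := by
      have := LinearMap.ker_eq_bot.1 ker_emb
      exact this (by simpa using h1 ha)
    have hd : iteratedDeriv 2 (fun a => emb (Ψ.1 a)) a = 0 := by
      have : (fun a => emb (Ψ.1 a)) =ᶠ[𝓝 a] fun _ => 0 :=
        h1.eventuallyEq_of_mem (isOpen_Ioo.mem_nhds ha)
      rw [this.iteratedDeriv_eq]
      simp
    simp [actFun, hz, hd]
  exact (MemLp.toLp_eq_toLp_iff (memLp_act e L B hB Ψ) MemLp.zero).2 h2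

/-- The operator `-(e²/2L) d²/da² + B(a)` in `𝓚`, with domain `𝓓`. -/
def schrOp (e L : ℝ) (B : ℝ → Fock0 →ₗ[ℂ] Hilb0)
    (hB : ∀ s, Continuous fun a => B a (basisVec0 s)) : Tot L →ₗ.[ℂ] Tot L :=
  mkOp (D := smoothDom L) (E := Tot L) (domMap L) (actMap e L B hB) (ker_domMap_le e L B hB)

/-! ### The Hamiltonian, before and after dressing -/

/-- `∑ |k_m| (b†_m b_m + c†_m c_m) - a²L/(2π) - a Q⁵ʳᵉᵍ + π/(2L) + :H_coul:`. The additive constant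
`π/(2L)` is the one for which the zero-mode potential is the complete square `(π/2L) (Q⁵ʳᵉᵍ)²`. -/
def hamFiber (e L a : ℝ) : Fock0 →ₗ[ℂ] Hilb0 :=
  emb ∘ₗ (restrict0 (diracH L) - ((a ^ 2 * L / (2 * Real.pi) : ℝ) : ℂ) • 1
    - (a : ℂ) • axialReg L a + ((Real.pi / (2 * L) : ℝ) : ℂ) • 1) + coulomb e L

theorem hamFiber_continuous (e L : ℝ) (s : Cfg0) :
    Continuous fun a => hamFiber e L a (basisVec0 s) := by
  simp only [hamFiber, axialReg, LinearMap.add_apply, LinearMap.comp_apply, LinearMap.sub_apply,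
    LinearMap.smul_apply, map_add, map_sub, map_smul]
  fun_prop

/-- The full Hamiltonian `H = H₀ + :H_coul:`, with domain `𝓓`. -/
def ham (e L : ℝ) : Tot L →ₗ.[ℂ] Tot L :=
  schrOp e L (hamFiber e L) (hamFiber_continuous e L)

/-- The mass `e/√π`. -/
def mass (e : ℝ) : ℝ := e / √Real.pi

/-- `ω_m = √(k_m² + (e/√π)²)`. -/
def omega (e L : ℝ) (m : ℤ) : ℝ := √(mom L m ^ 2 + mass e ^ 2)

/-- The boson creation operators `A†_m`, `m ≠ 0`. -/
def aCr (m : ℤ) : Module.End ℂ Fock :=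
  if 0 < m then (-Complex.I * ((1 / √(m : ℝ) : ℝ) : ℂ)) • rhoR m
  else (Complex.I * ((1 / √(-m : ℝ) : ℝ) : ℂ)) • rhoL m

/-- The boson annihilation operators `A_m`, `m ≠ 0`. -/
def aAn (m : ℤ) : Module.End ℂ Fock :=
  if 0 < m then (Complex.I * ((1 / √(m : ℝ) : ℝ) : ℂ)) • rhoR (-m)
  else (-Complex.I * ((1 / √(-m : ℝ) : ℝ) : ℂ)) • rhoL (-m)

/-- The free scalar field Hamiltonian `∑_{m ≥ 1} ω_m (A†_m A_m + A†_{-m} A_{-m})` of mass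
`e/√π` (non-zero modes). -/
def scalarH (e L : ℝ) : Module.End ℂ Fock :=
  opSum fun m : ℕ+ => (omega e L (m : ℤ) : ℂ) •
    (aCr (m : ℤ) * aAn (m : ℤ) + aCr (-(m : ℤ)) * aAn (-(m : ℤ)))

/-- The terms of `C₀`. -/
def shiftTerm (e L : ℝ) (m : ℕ+) : ℝ :=
  2 * Real.pi / L * ((m : ℝ) *
    (√(1 + 2 * lamV e L (m : ℤ) / Real.pi) - lamV e L (m : ℤ) / Real.pi - 1))

/-- The energy shift `C₀`. -/
def shift (e L : ℝ) : ℝ := ∑' m, shiftTerm e L m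

/-- `(π/2L) (Q⁵ʳᵉᵍ)² + ∑_{m ≥ 1} ω_m (A†_m A_m + A†_{-m} A_{-m}) + C₀`. -/
def dressedFiber (e L a : ℝ) : Fock0 →ₗ[ℂ] Hilb0 :=
  emb ∘ₗ (((Real.pi / (2 * L) : ℝ) : ℂ) • (axialReg L a * axialReg L a)
    + restrict0 (scalarH e L) + (shift e L : ℂ) • 1)

theorem dressedFiber_continuous (e L : ℝ) (s : Cfg0) :
    Continuous fun a => dressedFiber e L a (basisVec0 s) := by
  simp only [dressedFiber, axialReg, LinearMap.add_apply, LinearMap.comp_apply,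
    LinearMap.sub_apply, LinearMap.smul_apply, Module.End.mul_apply, map_add, map_sub, map_smul]
  fun_prop

/-- The dressed Hamiltonian: the zero-mode part `-(e²/2L) d²/da² + (π/2L) (Q⁵ʳᵉᵍ)²` plus the free
scalar field Hamiltonian plus `C₀`, with domain `𝓓`. -/
def dressedHam (e L : ℝ) : Tot L →ₗ.[ℂ] Tot L :=
  schrOp e L (dressedFiber e L) (dressedFiber_continuous e L)

/-- The action of a unitary operator of `𝓗₀` on `𝓚`, pointwise in `a`. -/
def liftTot (L : ℝ) (U : Hilb0 ≃ₗᵢ[ℂ] Hilb0) : Tot L →L[ℂ] Tot L :=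
  ContinuousLinearMap.compLpL 2 (meas L) (U.toContinuousLinearEquiv : Hilb0 →L[ℂ] Hilb0)

/-! ### The vacuum -/

/-- `E₀ = e/(2√π)`. -/
def baseEnergy (e : ℝ) : ℝ := e / (2 * √Real.pi)

/-- The normalized oscillator ground state
`f(x) = L^{1/4} π^{-3/8} e^{-1/4} exp(-L x² / (2 √π e))`. -/
def gauss (e L x : ℝ) : ℝ :=
  L ^ (1 / 4 : ℝ) / (Real.pi ^ (3 / 8 : ℝ) * e ^ (1 / 4 : ℝ)) *
    Real.exp (-L * x ^ 2 / (2 * √Real.pi * e))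

/-- The summands `f(a - (2π/L)(P - 1/2)) U⁻¹ Ω_P` of the interacting vacuum at `a`. -/
def vacuumTerm (e L : ℝ) (U : Hilb0 ≃ₗᵢ[ℂ] Hilb0) (a : ℝ) (P : ℤ) : Hilb0 :=
  (gauss e L (a - 2 * Real.pi / L * (P - 1 / 2)) : ℂ) • U.symm (emb (unexcited P))

end Schwinger

end

open Schwinger

open MeasureTheory Set Filter Topology
open scoped ContDiff

noncomputable section

namespace Schwinger

/-! ### Creation and annihilation operators on basis vectors -/

theorem bCr_basis (k : ℤ) (s : Cfg) : bCr k (basisVec s) =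
    if k ∈ s.1 then 0 else passSign s.1 k • basisVec (insert k s.1, s.2) := by
  simp [bCr, basisVec]

theorem bAn_basis (k : ℤ) (s : Cfg) : bAn k (basisVec s) =
    if k ∈ s.1 then passSign s.1 k • basisVec (s.1.erase k, s.2) else 0 := by
  simp [bAn, basisVec]

theorem cCr_basis (k : ℤ) (s : Cfg) : cCr k (basisVec s) =
    if k ∈ s.2 then 0
    else ((-1 : ℂ) ^ s.1.card * passSign s.2 k) • basisVec (s.1, insert k s.2) := by
  simp [cCr, basisVec]

theorem cAn_basis (k : ℤ) (s : Cfg) : cAn k (basisVec s) =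
    if k ∈ s.2 then ((-1 : ℂ) ^ s.1.card * passSign s.2 k) • basisVec (s.1, s.2.erase k)
    else 0 := by
  simp [cAn, basisVec]

theorem end_ext {M : Type*} [AddCommMonoid M] [Module ℂ M] {A B : Fock →ₗ[ℂ] M}
    (h : ∀ s, A (basisVec s) = B (basisVec s)) : A = B :=
  Finsupp.lhom_ext' fun s => LinearMap.ext_ring (h s)

theorem passSign_insert {m : Finset ℤ} {k : ℤ} (hk : k ∉ m) (j : ℤ) :
    passSign (insert k m) j = (if k < j then -1 else 1) * passSign m j := by
  unfold passSign
  rw [Finset.filter_insert]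
  split_ifs with h
  · rw [Finset.card_insert_of_notMem (by simp [hk]), pow_succ]; ring
  · ring

theorem passSign_erase {m : Finset ℤ} {k : ℤ} (hk : k ∈ m) (j : ℤ) :
    passSign (m.erase k) j = (if k < j then -1 else 1) * passSign m j := by
  conv_rhs => rw [← Finset.insert_erase hk, passSign_insert (Finset.notMem_erase k m)]
  split_ifs <;> ring

theorem passSign_mul_self (m : Finset ℤ) (k : ℤ) : passSign m k * passSign m k = 1 := by
  unfold passSign
  rw [← mul_pow]; simp

theorem neg_one_pow_mul_self (n : ℕ) : (-1 : ℂ) ^ n * (-1 : ℂ) ^ n = 1 := by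
  rw [← mul_pow]; simp

theorem neg_one_pow_erase {m : Finset ℤ} {k : ℤ} (hk : k ∈ m) :
    (-1 : ℂ) ^ (m.erase k).card = -(-1) ^ m.card := by
  conv_rhs => rw [← Finset.insert_erase hk, Finset.card_insert_of_notMem (Finset.notMem_erase k m)]
  rw [pow_succ]; ring

theorem neg_one_pow_insert {m : Finset ℤ} {k : ℤ} (hk : k ∉ m) :
    (-1 : ℂ) ^ (insert k m).card = -(-1) ^ m.card := by
  rw [Finset.card_insert_of_notMem hk, pow_succ]; ring

/-! ### The canonical anticommutation relations -/

theorem bCr_bCr (i j : ℤ) : bCr i * bCr j + bCr j * bCr i = 0 := by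
  refine end_ext fun s => ?_
  simp only [LinearMap.add_apply, Module.End.mul_apply, bCr_basis, LinearMap.zero_apply]
  rcases eq_or_ne i j with rfl | hij
  · by_cases hi : i ∈ s.1 <;> simp [hi, bCr_basis]
  by_cases hi : i ∈ s.1 <;> by_cases hj : j ∈ s.1 <;>
    simp [hi, hj, hij, bCr_basis, passSign_insert, smul_smul, Ne.symm hij]
  rw [Finset.insert_comm]
  rcases lt_or_gt_of_ne hij with h | h <;> simp only [h, h.not_gt, if_true, if_false] <;> module

theorem bAn_bAn (i j : ℤ) : bAn i * bAn j + bAn j * bAn i = 0 := by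
  refine end_ext fun s => ?_
  simp only [LinearMap.add_apply, Module.End.mul_apply, bAn_basis, LinearMap.zero_apply]
  rcases eq_or_ne i j with rfl | hij
  · by_cases hi : i ∈ s.1 <;> simp [hi, bAn_basis]
  by_cases hi : i ∈ s.1 <;> by_cases hj : j ∈ s.1 <;>
    simp [hi, hj, hij, bAn_basis, passSign_erase, smul_smul, Ne.symm hij]
  rw [Finset.erase_right_comm]
  rcases lt_or_gt_of_ne hij with h | h <;> simp only [h, h.not_gt, if_true, if_false] <;> module

theorem bAn_bCr (i j : ℤ) : bAn i * bCr j + bCr j * bAn i = if i = j then 1 else 0 := by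
  refine end_ext fun s => ?_
  rcases eq_or_ne i j with rfl | hij
  · simp only [LinearMap.add_apply, Module.End.mul_apply, bAn_basis, bCr_basis]
    by_cases hi : i ∈ s.1 <;>
      simp [hi, bAn_basis, bCr_basis, passSign_erase, passSign_insert, smul_smul,
        passSign_mul_self]
  · simp only [LinearMap.add_apply, Module.End.mul_apply, bAn_basis, bCr_basis]
    by_cases hi : i ∈ s.1 <;> by_cases hj : j ∈ s.1 <;>
      simp [hi, hj, hij, bAn_basis, bCr_basis, passSign_erase, passSign_insert, smul_smul,
        Ne.symm hij]
    rw [Finset.erase_insert_of_ne (Ne.symm hij)]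
    rcases lt_or_gt_of_ne hij with h | h <;> simp only [h, h.not_gt, if_true, if_false] <;> module

theorem cCr_cCr (i j : ℤ) : cCr i * cCr j + cCr j * cCr i = 0 := by
  refine end_ext fun s => ?_
  simp only [LinearMap.add_apply, Module.End.mul_apply, cCr_basis, LinearMap.zero_apply]
  rcases eq_or_ne i j with rfl | hij
  · by_cases hi : i ∈ s.2 <;> simp [hi, cCr_basis]
  by_cases hi : i ∈ s.2 <;> by_cases hj : j ∈ s.2 <;>
    simp [hi, hj, hij, cCr_basis, passSign_insert, smul_smul, Ne.symm hij]
  rw [Finset.insert_comm]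
  rcases lt_or_gt_of_ne hij with h | h <;> simp only [h, h.not_gt, if_true, if_false] <;> module

theorem cAn_cAn (i j : ℤ) : cAn i * cAn j + cAn j * cAn i = 0 := by
  refine end_ext fun s => ?_
  simp only [LinearMap.add_apply, Module.End.mul_apply, cAn_basis, LinearMap.zero_apply]
  rcases eq_or_ne i j with rfl | hij
  · by_cases hi : i ∈ s.2 <;> simp [hi, cAn_basis]
  by_cases hi : i ∈ s.2 <;> by_cases hj : j ∈ s.2 <;>
    simp [hi, hj, hij, cAn_basis, passSign_erase, smul_smul, Ne.symm hij]
  rw [Finset.erase_right_comm]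
  rcases lt_or_gt_of_ne hij with h | h <;> simp only [h, h.not_gt, if_true, if_false] <;> module

theorem cAn_cCr (i j : ℤ) : cAn i * cCr j + cCr j * cAn i = if i = j then 1 else 0 := by
  refine end_ext fun s => ?_
  have h1 := neg_one_pow_mul_self s.1.card
  rcases eq_or_ne i j with rfl | hij
  · have h2 := passSign_mul_self s.2 i
    have h3 : (-1 : ℂ) ^ s.1.card * passSign s.2 i * ((-1) ^ s.1.card * passSign s.2 i) = 1 := by
      linear_combination (passSign s.2 i * passSign s.2 i) * h1 + h2
    simp only [LinearMap.add_apply, Module.End.mul_apply, cAn_basis, cCr_basis]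
    by_cases hi : i ∈ s.2 <;>
      simp [hi, cAn_basis, cCr_basis, passSign_erase, passSign_insert, smul_smul, h3]
  · simp only [LinearMap.add_apply, Module.End.mul_apply, cAn_basis, cCr_basis]
    by_cases hi : i ∈ s.2 <;> by_cases hj : j ∈ s.2 <;>
      simp [hi, hj, hij, cAn_basis, cCr_basis, passSign_erase, passSign_insert, smul_smul,
        Ne.symm hij]
    rw [Finset.erase_insert_of_ne (Ne.symm hij)]
    rcases lt_or_gt_of_ne hij with h | h <;> simp only [h, h.not_gt, if_true, if_false] <;> module

theorem bCr_cCr (i j : ℤ) : bCr i * cCr j + cCr j * bCr i = 0 := by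
  refine end_ext fun s => ?_
  simp only [LinearMap.add_apply, Module.End.mul_apply, cCr_basis, bCr_basis]
  by_cases hi : i ∈ s.1 <;> by_cases hj : j ∈ s.2 <;>
    simp [hi, hj, bCr_basis, cCr_basis, smul_smul, neg_one_pow_insert,
      -Finset.card_insert_of_notMem]
  module

theorem bCr_cAn (i j : ℤ) : bCr i * cAn j + cAn j * bCr i = 0 := by
  refine end_ext fun s => ?_
  simp only [LinearMap.add_apply, Module.End.mul_apply, cAn_basis, bCr_basis]
  by_cases hi : i ∈ s.1 <;> by_cases hj : j ∈ s.2 <;>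
    simp [hi, hj, bCr_basis, cAn_basis, smul_smul, neg_one_pow_insert,
      -Finset.card_insert_of_notMem]
  module

theorem bAn_cCr (i j : ℤ) : bAn i * cCr j + cCr j * bAn i = 0 := by
  refine end_ext fun s => ?_
  simp only [LinearMap.add_apply, Module.End.mul_apply, cCr_basis, bAn_basis]
  by_cases hi : i ∈ s.1 <;> by_cases hj : j ∈ s.2 <;>
    simp [hi, hj, bAn_basis, cCr_basis, smul_smul, neg_one_pow_erase,
      -Finset.card_erase_of_mem]
  module

theorem bAn_cAn (i j : ℤ) : bAn i * cAn j + cAn j * bAn i = 0 := by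
  refine end_ext fun s => ?_
  simp only [LinearMap.add_apply, Module.End.mul_apply, cAn_basis, bAn_basis]
  by_cases hi : i ∈ s.1 <;> by_cases hj : j ∈ s.2 <;>
    simp [hi, hj, bAn_basis, cAn_basis, smul_smul, neg_one_pow_erase,
      -Finset.card_erase_of_mem]
  module

/-! ### Generation of the Fock space from the vacuum -/

/-- The vacuum `Ω₀`. -/
def vac : Fock := basisVec (∅, ∅)

theorem basis_insert_b {k : ℤ} {m n : Finset ℤ} (h : k ∉ m) :
    basisVec (insert k m, n) = passSign m k • bCr k (basisVec (m, n)) := by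
  rw [bCr_basis]; simp [h, smul_smul, passSign_mul_self]

theorem basis_insert_c {k : ℤ} {m n : Finset ℤ} (h : k ∉ n) :
    basisVec (m, insert k n) =
      ((-1 : ℂ) ^ m.card * passSign n k) • cCr k (basisVec (m, n)) := by
  have h3 : (-1 : ℂ) ^ m.card * passSign n k * ((-1) ^ m.card * passSign n k) = 1 := by
    linear_combination (passSign n k * passSign n k) * neg_one_pow_mul_self m.card +
      passSign_mul_self n k
  rw [cCr_basis]; simp [h, smul_smul, h3]

/-- Induction along the generation of basis vectors by creation operators. -/
theorem basis_induction {p : Cfg → Prop} (h0 : p (∅, ∅))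
    (hc : ∀ k n, k ∉ n → p (∅, n) → p (∅, insert k n))
    (hb : ∀ k m n, k ∉ m → p (m, n) → p (insert k m, n)) (s : Cfg) : p s := by
  obtain ⟨m, n⟩ := s
  induction m using Finset.induction_on with
  | empty =>
    induction n using Finset.induction_on with
    | empty => exact h0
    | insert k n hk ih => exact hc k n hk ih
  | insert k m hk ih => exact hb k m n hk ih

/-- A linear map intertwining the creation operators is determined by its value on the vacuum. -/
theorem eq_zero_of_intertwine {M : Type*} [AddCommGroup M] [Module ℂ M] (X : Fock →ₗ[ℂ] M)
    (B C : ℤ → Module.End ℂ M) (hb : ∀ k x, X (bCr k x) = B k (X x))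
    (hc : ∀ k x, X (cCr k x) = C k (X x)) (h0 : X vac = 0) : X = 0 := by
  refine end_ext fun s => ?_
  refine basis_induction (p := fun s => X (basisVec s) = (0 : Fock →ₗ[ℂ] M) (basisVec s))
    (by simpa [vac] using h0) ?_ ?_ s
  · intro k n hk ih
    rw [basis_insert_c hk, map_smul, hc, ih]; simp
  · intro k m n hk ih
    rw [basis_insert_b hk, map_smul, hb, ih]; simp

/-! ### Locally finite sums of operators -/

/-- A family of operators of which only finitely many act non-trivially on any given vector. -/
def LocFin {ι : Type} (A : ι → Module.End ℂ Fock) : Prop :=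
  ∀ x, (Function.support fun i => A i x).Finite

theorem opSum_apply {ι : Type} {A : ι → Module.End ℂ Fock} (h : LocFin A) (x : Fock) :
    opSum A x = ∑ᶠ i, A i x := by
  induction x using Finsupp.induction_linear with
  | zero => simp
  | add x y hx hy =>
    rw [map_add, hx, hy, ← finsum_add_distrib (h x) (h y)]
    simp
  | single s a =>
    have : Finsupp.single s a = a • basisVec s := by simp [basisVec]
    rw [this, map_smul]
    simp only [map_smul]
    rw [← smul_finsum]
    simp [opSum, basisVec]

theorem opSum_apply_eq_sum {ι : Type} {A : ι → Module.End ℂ Fock} (h : LocFin A) (x : Fock)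
    {S : Finset ι} (hS : ∀ i, i ∉ S → A i x = 0) : opSum A x = ∑ i ∈ S, A i x := by
  rw [opSum_apply h]
  refine finsum_eq_sum_of_support_subset _ fun i hi => ?_
  by_contra hc
  exact hi (hS i (by simpa using hc))

theorem LocFin.add {ι : Type} {A B : ι → Module.End ℂ Fock} (hA : LocFin A) (hB : LocFin B) :
    LocFin fun i => A i + B i := fun x =>
  ((hA x).union (hB x)).subset fun i hi => by
    by_contra hc
    simp only [mem_union, Function.mem_support, not_or, not_not] at hc
    exact hi (by simp [hc.1, hc.2])

theorem LocFin.neg {ι : Type} {A : ι → Module.End ℂ Fock} (hA : LocFin A) :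
    LocFin fun i => -A i := fun x => (hA x).subset fun i hi => by
  simpa using hi

theorem LocFin.sub {ι : Type} {A B : ι → Module.End ℂ Fock} (hA : LocFin A) (hB : LocFin B) :
    LocFin fun i => A i - B i := fun x =>
  ((hA x).union (hB x)).subset fun i hi => by
    by_contra hc
    simp only [mem_union, Function.mem_support, not_or, not_not] at hc
    exact hi (by simp [hc.1, hc.2])

theorem LocFin.smul {ι : Type} {A : ι → Module.End ℂ Fock} (hA : LocFin A) (c : ι → ℂ) :
    LocFin fun i => c i • A i := fun x => (hA x).subset fun i hi => by
  intro h0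
  exact hi (by simp [h0])

theorem LocFin.mul_left {ι : Type} {A : ι → Module.End ℂ Fock} (hA : LocFin A)
    (X : ι → Module.End ℂ Fock) : LocFin fun i => X i * A i := fun x =>
  (hA x).subset fun i hi => by
    intro h0
    exact hi (by simp [Module.End.mul_apply, h0])

theorem LocFin.mul_right {ι : Type} {A : ι → Module.End ℂ Fock} (hA : LocFin A)
    (X : Module.End ℂ Fock) : LocFin fun i => A i * X := fun x => hA (X x)

theorem LocFin.comp {ι κ : Type} {A : ι → Module.End ℂ Fock} (hA : LocFin A) {f : κ → ι}
    (hf : Function.Injective f) : LocFin fun i => A (f i) := fun x =>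
  (hA x).preimage hf.injOn

theorem LocFin.of_finite {ι : Type} {A : ι → Module.End ℂ Fock} (S : Set ι) (hS : S.Finite)
    (h : ∀ i, i ∉ S → A i = 0) : LocFin A := fun x => hS.subset fun i hi => by
  by_contra hc
  exact hi (by simp [h i hc])

theorem LocFin.ite {ι : Type} {A : ι → Module.End ℂ Fock} (hA : LocFin A) (p : ι → Prop)
    [DecidablePred p] : LocFin fun i => if p i then A i else 0 := fun x =>
  (hA x).subset fun i hi => by
    intro h0
    refine hi ?_
    dsimp only
    split_ifs
    · exact h0
    · rfl

theorem opSum_add {ι : Type} {A B : ι → Module.End ℂ Fock} (hA : LocFin A) (hB : LocFin B) :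
    opSum (fun i => A i + B i) = opSum A + opSum B := LinearMap.ext fun x => by
  rw [opSum_apply (hA.add hB), LinearMap.add_apply, opSum_apply hA, opSum_apply hB,
    ← finsum_add_distrib (hA x) (hB x)]
  rfl

theorem opSum_neg {ι : Type} {A : ι → Module.End ℂ Fock} (hA : LocFin A) :
    opSum (fun i => -A i) = -opSum A := LinearMap.ext fun x => by
  rw [opSum_apply hA.neg, LinearMap.neg_apply, opSum_apply hA, ← finsum_neg_distrib]
  rfl

theorem opSum_sub {ι : Type} {A B : ι → Module.End ℂ Fock} (hA : LocFin A) (hB : LocFin B) :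
    opSum (fun i => A i - B i) = opSum A - opSum B := LinearMap.ext fun x => by
  rw [opSum_apply (hA.sub hB), LinearMap.sub_apply, opSum_apply hA, opSum_apply hB,
    ← finsum_sub_distrib (hA x) (hB x)]
  rfl

theorem mul_opSum {ι : Type} {A : ι → Module.End ℂ Fock} (hA : LocFin A)
    (X : Module.End ℂ Fock) : X * opSum A = opSum fun i => X * A i := LinearMap.ext fun x => by
  rw [Module.End.mul_apply, opSum_apply hA, opSum_apply (hA.mul_left fun _ => X)]
  exact X.toAddMonoidHom.map_finsum (hA x)

theorem opSum_mul {ι : Type} {A : ι → Module.End ℂ Fock} (hA : LocFin A)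
    (X : Module.End ℂ Fock) : opSum A * X = opSum fun i => A i * X := LinearMap.ext fun x => by
  rw [Module.End.mul_apply, opSum_apply hA, opSum_apply (hA.mul_right X)]
  rfl

theorem opSum_smul {ι : Type} {A : ι → Module.End ℂ Fock} (hA : LocFin A) (c : ℂ) :
    opSum (fun i => c • A i) = c • opSum A := LinearMap.ext fun x => by
  rw [opSum_apply (hA.smul fun _ => c), LinearMap.smul_apply, opSum_apply hA, smul_finsum]
  rfl

theorem opSum_reindex {ι κ : Type} (A : ι → Module.End ℂ Fock) (e : κ ≃ ι) :
    opSum (fun i => A (e i)) = opSum A := by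
  unfold opSum
  congr 1
  funext s
  exact finsum_comp_equiv (f := fun i => A i (basisVec s)) e

theorem opSum_eq_sum {ι : Type} {A : ι → Module.End ℂ Fock} (S : Finset ι)
    (h : ∀ i, i ∉ S → A i = 0) : opSum A = ∑ i ∈ S, A i := LinearMap.ext fun x => by
  rw [opSum_apply_eq_sum (LocFin.of_finite (S : Set ι) S.finite_toSet (by simpa using h)) x
    (S := S) (fun i hi => by simp [h i hi])]
  simp

theorem opSum_single {ι : Type} [DecidableEq ι] (A : ι → Module.End ℂ Fock) (j : ι) :
    (opSum fun i => if i = j then A i else 0) = A j := by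
  rw [opSum_eq_sum {j} (fun i hi => if_neg (by simpa using hi))]
  simp

theorem opSum_congr {ι : Type} {A B : ι → Module.End ℂ Fock} (h : ∀ i, A i = B i) :
    opSum A = opSum B := congrArg opSum (funext h)

theorem opSum_zero {ι : Type} : opSum (fun _ : ι => (0 : Module.End ℂ Fock)) = 0 := by
  rw [opSum_eq_sum ∅ (fun _ _ => rfl)]; simp

/-- Splitting a sum over `ℤ` into the term at `0` and the pairs of terms at `±m`, `m ≥ 1`. -/
theorem opSum_int {A : ℤ → Module.End ℂ Fock} (hA : LocFin A) :
    opSum A = A 0 + opSum fun m : ℕ+ => A (m : ℤ) + A (-(m : ℤ)) := by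
  have hp : Function.Injective fun m : ℕ+ => (m : ℤ) := fun a b h => by
    simpa using h
  have hn : Function.Injective fun m : ℕ+ => -(m : ℤ) := fun a b h => by
    simpa using h
  refine LinearMap.ext fun x => ?_
  rw [LinearMap.add_apply, opSum_apply hA, opSum_apply ((hA.comp hp).add (hA.comp hn))]
  simp only [LinearMap.add_apply]
  rw [finsum_add_distrib ((hA.comp hp) x) ((hA.comp hn) x)]
  have h1 : ∑ᶠ m : ℕ+, A (m : ℤ) x = ∑ᶠ k ∈ Set.range (fun m : ℕ+ => (m : ℤ)), A k x :=
    (finsum_mem_range (f := fun k => A k x) hp).symm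
  have h2 : ∑ᶠ m : ℕ+, A (-(m : ℤ)) x = ∑ᶠ k ∈ Set.range (fun m : ℕ+ => -(m : ℤ)), A k x :=
    (finsum_mem_range (f := fun k => A k x) hn).symm
  have h3 : A 0 x = ∑ᶠ k ∈ ({0} : Set ℤ), A k x := by simp
  have hu : (Set.univ : Set ℤ) = {0} ∪ (Set.range (fun m : ℕ+ => (m : ℤ)) ∪
      Set.range (fun m : ℕ+ => -(m : ℤ))) := by
    ext k
    simp only [mem_univ, true_iff, mem_union, mem_singleton_iff, mem_range]
    rcases lt_trichotomy k 0 with h | h | h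
    · exact Or.inr (Or.inr ⟨⟨(-k).toNat, by omega⟩, by simp; omega⟩)
    · exact Or.inl h
    · exact Or.inr (Or.inl ⟨⟨k.toNat, by omega⟩, by simp; omega⟩)
  rw [h1, h2, h3, ← finsum_mem_univ, hu]
  have hd1 : Disjoint (Set.range (fun m : ℕ+ => (m : ℤ))) (Set.range (fun m : ℕ+ => -(m : ℤ))) := by
    rw [Set.disjoint_left]
    rintro _ ⟨a, rfl⟩ ⟨b, hb⟩
    have := a.pos; have := b.pos
    simp only at hb
    omega
  have hd2 : Disjoint ({0} : Set ℤ) (Set.range (fun m : ℕ+ => (m : ℤ)) ∪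
      Set.range (fun m : ℕ+ => -(m : ℤ))) := by
    rw [Set.disjoint_left]
    rintro k hk (⟨a, ha⟩ | ⟨a, ha⟩) <;> have := a.pos <;> simp at ha hk <;> omega
  rw [finsum_mem_union' hd2 ((hA x).inter_of_right _) ((hA x).inter_of_right _),
    finsum_mem_union' hd1 ((hA x).inter_of_right _) ((hA x).inter_of_right _)]

/-! ### The scalar product and adjoints -/

/-- The scalar product of the algebraic Fock space. -/
def ip (x : Fock) : Fock →ₗ[ℂ] ℂ := Finsupp.linearCombination ℂ fun s => star (x s)

theorem ip_basis_right (x : Fock) (s : Cfg) : ip x (basisVec s) = star (x s) := by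
  simp [ip, basisVec]

theorem ip_add_left (x y z : Fock) : ip (x + y) z = ip x z + ip y z := by
  have : ip (x + y) = ip x + ip y := end_ext fun s => by simp [ip_basis_right]
  rw [this]; rfl

theorem ip_smul_left (c : ℂ) (x z : Fock) : ip (c • x) z = star c * ip x z := by
  have : ip (c • x) = star c • ip x := end_ext fun s => by simp [ip_basis_right]
  rw [this]; rfl

theorem ip_zero_left (z : Fock) : ip 0 z = 0 := by
  simpa using ip_smul_left 0 0 z

theorem ip_basis_left (s : Cfg) (y : Fock) : ip (basisVec s) y = y s := by
  have : ip (basisVec s) = Finsupp.lapply s := end_ext fun t => by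
    rw [ip_basis_right]
    simp only [basisVec, Finsupp.lapply_apply, Finsupp.single_apply, eq_comm]
    split_ifs <;> simp
  rw [this]; rfl

theorem ip_sum_left {ι : Type*} (S : Finset ι) (x : ι → Fock) (z : Fock) :
    ip (∑ i ∈ S, x i) z = ∑ i ∈ S, ip (x i) z := by
  classical
  induction S using Finset.induction_on with
  | empty => simp [ip_zero_left]
  | insert a S ha ih => rw [Finset.sum_insert ha, Finset.sum_insert ha, ip_add_left, ih]

theorem ip_conj (x y : Fock) : star (ip x y) = ip y x := by
  induction y using Finsupp.induction_linear with
  | zero => simp [ip_zero_left]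
  | add y z hy hz => rw [map_add, star_add, hy, hz, ip_add_left]
  | single s a =>
    have : Finsupp.single s a = a • basisVec s := by simp [basisVec]
    rw [this, map_smul, ip_smul_left, ip_basis_right, ip_basis_left]
    simp

/-- `B` is the formal adjoint of `A`. -/
def IsAdj (A B : Module.End ℂ Fock) : Prop := ∀ x y, ip (A x) y = ip x (B y)

theorem IsAdj.symm {A B : Module.End ℂ Fock} (h : IsAdj A B) : IsAdj B A := fun x y => by
  rw [← ip_conj, ← h, ip_conj]

theorem IsAdj.of_basis {A B : Module.End ℂ Fock}
    (h : ∀ s t, (B (basisVec t)) s = star ((A (basisVec s)) t)) : IsAdj A B := by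
  intro x y
  induction x using Finsupp.induction_linear with
  | zero => simp [ip_zero_left]
  | add x z hx hz => rw [map_add, ip_add_left, hx, hz, ip_add_left]
  | single s a =>
    have : Finsupp.single s a = a • basisVec s := by simp [basisVec]
    rw [this, map_smul, ip_smul_left, ip_smul_left]
    congr 1
    have : ip (A (basisVec s)) = ip (basisVec s) ∘ₗ B := end_ext fun t => by
      rw [ip_basis_right, LinearMap.comp_apply, ip_basis_left, h]
    rw [this]; rfl

theorem IsAdj.add {A B A' B' : Module.End ℂ Fock} (h : IsAdj A B) (h' : IsAdj A' B') :
    IsAdj (A + A') (B + B') := fun x y => by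
  simp [ip_add_left, h x y, h' x y]

theorem IsAdj.smul {A B : Module.End ℂ Fock} (h : IsAdj A B) (c : ℂ) :
    IsAdj (c • A) (star c • B) := fun x y => by
  simp [ip_smul_left, h x y]

theorem IsAdj.neg {A B : Module.End ℂ Fock} (h : IsAdj A B) : IsAdj (-A) (-B) := fun x y => by
  have := ip_smul_left (-1) (A x) y
  simp only [neg_smul, one_smul, star_neg, star_one, neg_mul, one_mul] at this
  rw [LinearMap.neg_apply, this, h x y, LinearMap.neg_apply, map_neg]

theorem IsAdj.sub {A B A' B' : Module.End ℂ Fock} (h : IsAdj A B) (h' : IsAdj A' B') :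
    IsAdj (A - A') (B - B') := fun x y => by
  have := h.add h'.neg x y
  simpa only [LinearMap.sub_apply, sub_eq_add_neg, LinearMap.add_apply, LinearMap.neg_apply]
    using this

theorem IsAdj.mul {A B A' B' : Module.End ℂ Fock} (h : IsAdj A B) (h' : IsAdj A' B') :
    IsAdj (A * A') (B' * B) := fun x y => by
  simp [Module.End.mul_apply, h _ y, h' x _]

theorem IsAdj.one : IsAdj 1 1 := fun _ _ => rfl

theorem IsAdj.opSum {ι : Type} {A B : ι → Module.End ℂ Fock} (hA : LocFin A) (hB : LocFin B)
    (h : ∀ i, IsAdj (A i) (B i)) : IsAdj (opSum A) (opSum B) := fun x y => by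
  classical
  have h1 : ∀ i, i ∉ (hA x).toFinset ∪ (hB y).toFinset → A i x = 0 := fun i hi => by
    simp at hi; tauto
  have h2 : ∀ i, i ∉ (hA x).toFinset ∪ (hB y).toFinset → B i y = 0 := fun i hi => by
    simp at hi; tauto
  rw [opSum_apply_eq_sum hA x h1, opSum_apply_eq_sum hB y h2, ip_sum_left, map_sum]
  exact Finset.sum_congr rfl fun i _ => h i x y

theorem IsAdj.eq_zero {A B : Module.End ℂ Fock} (h : IsAdj A B) (hA : A = 0) : B = 0 := by
  refine end_ext fun t => Finsupp.ext fun s => ?_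
  have := h (basisVec s) (basisVec t)
  rw [ip_basis_left, hA] at this
  rw [← this]; simp [ip_zero_left]

theorem isAdj_b (k : ℤ) : IsAdj (bCr k) (bAn k) := by
  refine IsAdj.of_basis fun s t => ?_
  rw [bCr_basis, bAn_basis]
  by_cases ht : k ∈ t.1
  · by_cases hs : k ∈ s.1
    · simp only [ht, hs, if_true, basisVec, Finsupp.smul_apply, Finsupp.single_apply]
      rw [if_neg]
      · simp
      · rintro rfl; simp at hs
    · simp only [ht, hs, if_true, if_false, basisVec, Finsupp.smul_apply, Finsupp.single_apply]
      by_cases h : s = (t.1.erase k, t.2)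
      · subst h
        have := passSign_erase ht k
        simp only [lt_irrefl, if_false, one_mul] at this
        simp only [Finset.insert_erase ht, if_true, this]
        simp [passSign]
      · rw [if_neg (Ne.symm h), if_neg]
        · simp
        · rintro rfl
          exact h (by simp [Finset.erase_insert hs])
  · by_cases hs : k ∈ s.1
    · simp [ht, hs]
    · simp only [ht, hs, if_false, basisVec, Finsupp.smul_apply, Finsupp.single_apply]
      rw [if_neg]
      · simp
      · rintro rfl; simp at ht

theorem isAdj_c (k : ℤ) : IsAdj (cCr k) (cAn k) := by
  refine IsAdj.of_basis fun s t => ?_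
  rw [cCr_basis, cAn_basis]
  by_cases ht : k ∈ t.2
  · by_cases hs : k ∈ s.2
    · simp only [ht, hs, if_true, basisVec, Finsupp.smul_apply, Finsupp.single_apply]
      rw [if_neg]
      · simp
      · rintro rfl; simp at hs
    · simp only [ht, hs, if_true, if_false, basisVec, Finsupp.smul_apply, Finsupp.single_apply]
      by_cases h : s = (t.1, t.2.erase k)
      · subst h
        have := passSign_erase ht k
        simp only [lt_irrefl, if_false, one_mul] at this
        simp only [Finset.insert_erase ht, if_true, this]
        simp [passSign]
      · rw [if_neg (Ne.symm h), if_neg]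
        · simp
        · rintro rfl
          exact h (by simp [Finset.erase_insert hs])
  · by_cases hs : k ∈ s.2
    · simp [ht, hs]
    · simp only [ht, hs, if_false, basisVec, Finsupp.smul_apply, Finsupp.single_apply]
      rw [if_neg]
      · simp
      · rintro rfl; simp at ht

/-- A vector killed by all annihilation operators is a multiple of the vacuum. -/
theorem eq_smul_vac (v : Fock) (hb : ∀ k, bAn k v = 0) (hc : ∀ k, cAn k v = 0) :
    v = v (∅, ∅) • vac := by
  refine Finsupp.ext fun s => ?_
  obtain ⟨m, n⟩ := s
  rcases m.eq_empty_or_nonempty with rfl | ⟨k, hk⟩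
  · rcases n.eq_empty_or_nonempty with rfl | ⟨k, hk⟩
    · simp [vac, basisVec]
    · rw [← ip_basis_left, ← Finset.insert_erase hk, basis_insert_c (Finset.notMem_erase k n),
        ip_smul_left, isAdj_c, hc]
      simp [vac, basisVec]
  · rw [← ip_basis_left, ← Finset.insert_erase hk, basis_insert_b (Finset.notMem_erase k m),
      ip_smul_left, isAdj_b, hb]
    simp [vac, basisVec]

/-! ### The charge grading -/

/-- The vectors of charge `q`. -/
def chargeSub (q : ℤ) : Submodule ℂ Fock :=
  Finsupp.supported ℂ ℂ {s : Cfg | (s.1.card : ℤ) - s.2.card = q}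

/-- `A` raises the charge by `d`. -/
def HasCharge (d : ℤ) (A : Module.End ℂ Fock) : Prop :=
  ∀ q, ∀ x ∈ chargeSub q, A x ∈ chargeSub (q + d)

theorem basis_mem_chargeSub (s : Cfg) : basisVec s ∈ chargeSub ((s.1.card : ℤ) - s.2.card) :=
  Finsupp.single_mem_supported ℂ (1 : ℂ) rfl

theorem vac_mem_chargeSub : vac ∈ chargeSub 0 := basis_mem_chargeSub (∅, ∅)

theorem HasCharge.of_basis {d : ℤ} {A : Module.End ℂ Fock}
    (h : ∀ s : Cfg, A (basisVec s) ∈ chargeSub ((s.1.card : ℤ) - s.2.card + d)) :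
    HasCharge d A := by
  intro q x hx
  rw [← Finsupp.sum_single x, Finsupp.sum, map_sum]
  refine Submodule.sum_mem _ fun s hs => ?_
  have h1 : (s.1.card : ℤ) - s.2.card = q := hx hs
  have h2 : Finsupp.single s (x s) = x s • basisVec s := by simp [basisVec]
  rw [h2, map_smul, ← h1]
  exact Submodule.smul_mem _ _ (h s)

theorem HasCharge.add {d : ℤ} {A B : Module.End ℂ Fock} (hA : HasCharge d A)
    (hB : HasCharge d B) : HasCharge d (A + B) := fun q x hx =>
  Submodule.add_mem _ (hA q x hx) (hB q x hx)

theorem HasCharge.smul {d : ℤ} {A : Module.End ℂ Fock} (hA : HasCharge d A) (c : ℂ) :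
    HasCharge d (c • A) := fun q x hx => Submodule.smul_mem _ c (hA q x hx)

theorem HasCharge.sub {d : ℤ} {A B : Module.End ℂ Fock} (hA : HasCharge d A)
    (hB : HasCharge d B) : HasCharge d (A - B) := fun q x hx =>
  Submodule.sub_mem _ (hA q x hx) (hB q x hx)

theorem HasCharge.mul {d d' : ℤ} {A B : Module.End ℂ Fock} (hA : HasCharge d A)
    (hB : HasCharge d' B) : HasCharge (d' + d) (A * B) := fun q x hx => by
  rw [← add_assoc]
  exact hA _ _ (hB q x hx)

theorem HasCharge.mul' {d d' d'' : ℤ} {A B : Module.End ℂ Fock} (hB : HasCharge d' B)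
    (hA : HasCharge d A) (h : d' + d = d'') : HasCharge d'' (A * B) := h ▸ hA.mul hB

theorem HasCharge.one : HasCharge 0 (1 : Module.End ℂ Fock) := fun q x hx => by simpa using hx

theorem HasCharge.zero (d : ℤ) : HasCharge d (0 : Module.End ℂ Fock) := fun _ _ _ => by simp

theorem HasCharge.opSum {ι : Type} {d : ℤ} {A : ι → Module.End ℂ Fock} (hL : LocFin A)
    (hA : ∀ i, HasCharge d (A i)) : HasCharge d (opSum A) := fun q x hx => by
  rw [opSum_apply hL]
  exact finsum_induction (fun y => y ∈ chargeSub (q + d)) (Submodule.zero_mem _)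
    (fun _ _ => Submodule.add_mem _) (fun i => hA i q x hx)

theorem hasCharge_bCr (k : ℤ) : HasCharge 1 (bCr k) := .of_basis fun s => by
  rw [bCr_basis]
  split_ifs with h
  · simp
  · refine Submodule.smul_mem _ _ ?_
    convert basis_mem_chargeSub _ using 1
    simp [Finset.card_insert_of_notMem h]; ring_nf

theorem hasCharge_bAn (k : ℤ) : HasCharge (-1) (bAn k) := .of_basis fun s => by
  rw [bAn_basis]
  split_ifs with h
  · refine Submodule.smul_mem _ _ ?_
    convert basis_mem_chargeSub _ using 2
    have := Finset.card_erase_add_one h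
    push_cast [← this]; ring
  · simp

theorem hasCharge_cCr (k : ℤ) : HasCharge (-1) (cCr k) := .of_basis fun s => by
  rw [cCr_basis]
  split_ifs with h
  · simp
  · refine Submodule.smul_mem _ _ ?_
    convert basis_mem_chargeSub _ using 1
    simp [Finset.card_insert_of_notMem h]; ring_nf

theorem hasCharge_cAn (k : ℤ) : HasCharge 1 (cAn k) := .of_basis fun s => by
  rw [cAn_basis]
  split_ifs with h
  · refine Submodule.smul_mem _ _ ?_
    convert basis_mem_chargeSub _ using 2
    have := Finset.card_erase_add_one h
    push_cast [← this]; ring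
  · simp

/-! ### Commutator identities -/

section CommutatorIdentities

variable {I : Type}

local notation "R" => Module.End ℂ (I →₀ ℂ)

@[simp] theorem end_sub_zero (A : R) : A - 0 = A := LinearMap.ext fun v => by simp

@[simp] theorem end_zero_sub (A : R) : 0 - A = -A := LinearMap.ext fun v => by simp

@[simp] theorem end_sub_self (A : R) : A - A = 0 := LinearMap.ext fun v => by simp

@[simp] theorem end_neg_zero : -(0 : R) = 0 := LinearMap.ext fun v => by simp

theorem comm_mul_of_anticomm {C A x p q : R} (h1 : A * x + x * A = p) (h2 : C * x + x * C = q) :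
    C * A * x - x * (C * A) = C * p - q * A := by
  subst h1 h2
  refine LinearMap.ext fun v => ?_
  simp only [LinearMap.sub_apply, LinearMap.add_apply, Module.End.mul_apply, map_add]
  abel

theorem comm_mul_of_comm {A B x p q : R} (h1 : A * x - x * A = p) (h2 : B * x - x * B = q) :
    A * B * x - x * (A * B) = A * q + p * B := by
  subst h1 h2
  refine LinearMap.ext fun v => ?_
  simp only [LinearMap.sub_apply, LinearMap.add_apply, Module.End.mul_apply, map_sub]
  abel

theorem anticomm_mul_right {X W x p w : R} (h1 : X * x + x * X = p) (h2 : W * x - x * W = w) :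
    X * W * x + x * (X * W) = X * w + p * W := by
  subst h1 h2
  refine LinearMap.ext fun v => ?_
  simp only [LinearMap.sub_apply, LinearMap.add_apply, Module.End.mul_apply, map_sub]
  abel

theorem anticomm_mul_left {X W x p w : R} (h1 : X * x + x * X = p) (h2 : W * x - x * W = w) :
    W * X * x + x * (W * X) = W * p - w * X := by
  subst h1 h2
  refine LinearMap.ext fun v => ?_
  simp only [LinearMap.sub_apply, LinearMap.add_apply, Module.End.mul_apply, map_add]
  abel

theorem add_comm_of {A B x p q : R} (h1 : A * x - x * A = p) (h2 : B * x - x * B = q) :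
    (A + B) * x - x * (A + B) = p + q := by
  subst h1 h2
  refine LinearMap.ext fun v => ?_
  simp only [LinearMap.sub_apply, LinearMap.add_apply, Module.End.mul_apply, map_add]
  abel

theorem add_anticomm_of {A B x p q : R} (h1 : A * x + x * A = p) (h2 : B * x + x * B = q) :
    (A + B) * x + x * (A + B) = p + q := by
  subst h1 h2
  refine LinearMap.ext fun v => ?_
  simp only [LinearMap.add_apply, Module.End.mul_apply, map_add]
  abel

theorem sub_anticomm_of {A B x p q : R} (h1 : A * x + x * A = p) (h2 : B * x + x * B = q) :
    (A - B) * x + x * (A - B) = p - q := by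
  subst h1 h2
  refine LinearMap.ext fun v => ?_
  simp only [LinearMap.sub_apply, LinearMap.add_apply, Module.End.mul_apply, map_sub]
  abel

theorem comm_swap {A x p : R} (h : A * x - x * A = p) : x * A - A * x = -p := by
  subst h
  refine LinearMap.ext fun v => ?_
  simp only [LinearMap.sub_apply, LinearMap.neg_apply, Module.End.mul_apply]
  abel

theorem sub_comm_of {A B x p q : R} (h1 : A * x - x * A = p) (h2 : B * x - x * B = q) :
    (A - B) * x - x * (A - B) = p - q := by
  subst h1 h2
  refine LinearMap.ext fun v => ?_
  simp only [LinearMap.sub_apply, Module.End.mul_apply, map_sub]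
  abel

theorem end_sub_eq_zero {A B : R} (h : A = B) : A - B = 0 := by
  subst h
  refine LinearMap.ext fun v => ?_
  simp

theorem smul_comm_of {A x p : R} (c : ℂ) (h : A * x - x * A = p) :
    (c • A) * x - x * (c • A) = c • p := by
  subst h
  refine LinearMap.ext fun v => ?_
  simp only [LinearMap.sub_apply, LinearMap.smul_apply, Module.End.mul_apply, map_smul, smul_sub]

end CommutatorIdentities

theorem opSum_comm {ι : Type} {A C : ι → Module.End ℂ Fock} {X : Module.End ℂ Fock}
    (hA : LocFin A) (h : ∀ i, A i * X - X * A i = C i) :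
    opSum A * X - X * opSum A = opSum C := by
  rw [opSum_mul hA, mul_opSum hA, ← opSum_sub (hA.mul_right X) (hA.mul_left fun _ => X)]
  exact opSum_congr h

theorem opSum_anticomm {ι : Type} {A C : ι → Module.End ℂ Fock} {X : Module.End ℂ Fock}
    (hA : LocFin A) (h : ∀ i, A i * X + X * A i = C i) :
    opSum A * X + X * opSum A = opSum C := by
  rw [opSum_mul hA, mul_opSum hA, ← opSum_add (hA.mul_right X) (hA.mul_left fun _ => X)]
  exact opSum_congr h

/-! ### A chiral fermion field -/

/-- The modes `ψ k`, `ψd k`, `k ∈ ℤ`, of a chiral fermion field: they satisfy the canonical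
anticommutation relations, and the modes `k < 0` are filled in the vacuum. -/
structure Chiral (ψ ψd : ℤ → Module.End ℂ Fock) : Prop where
  an_an : ∀ i j, ψ i * ψ j + ψ j * ψ i = 0
  cr_cr : ∀ i j, ψd i * ψd j + ψd j * ψd i = 0
  an_cr : ∀ i j, ψ i * ψd j + ψd j * ψ i = if i = j then 1 else 0
  adj : ∀ i, IsAdj (ψd i) (ψ i)
  charge : ∀ i, HasCharge (-1) (ψ i)
  charge_cr : ∀ i, HasCharge 1 (ψd i)
  fin : ∀ x, ∃ K, ∀ k, K < k → ψ k x = 0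
  fin_cr : ∀ x, ∃ K, ∀ k, k < K → ψd k x = 0
  vac_an : ∀ k, 0 ≤ k → ψ k vac = 0
  vac_cr : ∀ k, k < 0 → ψd k vac = 0

/-- The density modes of a chiral fermion field. -/
def rho (ψ ψd : ℤ → Module.End ℂ Fock) (m : ℤ) : Module.End ℂ Fock :=
  opSum fun k : ℤ => ψd (k + m) * ψ k

/-- The normal ordered number operator of a mode. -/
def num (ψ ψd : ℤ → Module.End ℂ Fock) (k : ℤ) : Module.End ℂ Fock :=
  ψd k * ψ k - if k < 0 then 1 else 0

/-- The normal ordered charge. -/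
def chg (ψ ψd : ℤ → Module.End ℂ Fock) : Module.End ℂ Fock := opSum (num ψ ψd)

/-- The normal ordered energy `∑ k :ψd k ψ k:`. -/
def erg (ψ ψd : ℤ → Module.End ℂ Fock) : Module.End ℂ Fock :=
  opSum fun k : ℤ => (k : ℂ) • num ψ ψd k

namespace Chiral

variable {ψ ψd : ℤ → Module.End ℂ Fock} (h : Chiral ψ ψd)
include h

theorem cr_an (i j : ℤ) : ψd i * ψ j + ψ j * ψd i = if i = j then 1 else 0 := by
  rw [add_comm, h.an_cr]
  simp only [eq_comm]

theorem cr_an_apply {i j : ℤ} (hij : i ≠ j) (x : Fock) : ψd i (ψ j x) = -ψ j (ψd i x) := by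
  have := LinearMap.congr_fun (h.cr_an i j) x
  rw [if_neg hij] at this
  exact eq_neg_of_add_eq_zero_left this

theorem cr_cr_apply (i j : ℤ) (x : Fock) : ψd i (ψd j x) = -ψd j (ψd i x) :=
  eq_neg_of_add_eq_zero_left (LinearMap.congr_fun (h.cr_cr i j) x)

theorem an_cr_of_ne {i j : ℤ} (hij : i ≠ j) : ψ i * ψd j = -(ψd j * ψ i) := by
  refine LinearMap.ext fun x => ?_
  have := h.cr_an_apply (Ne.symm hij) x
  simp [Module.End.mul_apply, this]

theorem exists_bound (x : Fock) : ∃ K : ℤ, 0 ≤ K ∧ (∀ k, K < k → ψ k x = 0) ∧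
    ∀ k, k < -K → ψd k x = 0 := by
  obtain ⟨K, hK⟩ := h.fin x
  obtain ⟨K', hK'⟩ := h.fin_cr x
  exact ⟨|K| + |K'|, by positivity, fun k hk => hK k (by
    have := le_abs_self K; have := abs_nonneg K'; omega), fun k hk => hK' k (by
    have := neg_abs_le K'; have := abs_nonneg K; omega)⟩

theorem locFin_rho {m : ℤ} (hm : m ≠ 0) : LocFin fun k : ℤ => ψd (k + m) * ψ k := fun x => by
  obtain ⟨K, -, h1, h2⟩ := h.exists_bound x
  refine (Set.finite_Icc (-K - m) K).subset fun k hk => ?_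
  by_contra hc
  refine hk ?_
  rw [Set.mem_Icc, not_and_or, not_le, not_le] at hc
  simp only [Module.End.mul_apply]
  rcases hc with hc | hc
  · rw [h.cr_an_apply (by omega), h2 _ (by omega)]; simp
  · rw [h1 _ hc]; simp

theorem rho_apply_eq_zero {x : Fock} {K : ℤ} (h1 : ∀ k, K < k → ψ k x = 0)
    (h2 : ∀ k, k < -K → ψd k x = 0) {m : ℤ} (hm : 2 * K < m) (hm0 : m ≠ 0) :
    rho ψ ψd (-m) x = 0 := by
  unfold rho
  rw [opSum_apply_eq_sum (h.locFin_rho (by omega)) x (S := ∅)]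
  · simp
  · intro k _
    rw [Module.End.mul_apply]
    rcases lt_or_ge K k with hk | hk
    · rw [h1 k hk]; simp
    · rw [h.cr_an_apply (by omega), h2 _ (by omega)]; simp

theorem rho_vac {m : ℤ} (hm : 0 < m) : rho ψ ψd (-m) vac = 0 := by
  unfold rho
  rw [opSum_apply_eq_sum (h.locFin_rho (by omega)) vac (S := ∅)]
  · simp
  · intro k _
    rw [Module.End.mul_apply]
    rcases le_or_gt 0 k with hk | hk
    · rw [h.vac_an k hk]; simp
    · rw [h.cr_an_apply (by omega), h.vac_cr _ (by omega)]; simp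

theorem locFin_num : LocFin (num ψ ψd) := fun x => by
  obtain ⟨K, hK, h1, h2⟩ := h.exists_bound x
  refine (Set.finite_Icc (-K) K).subset fun k hk => ?_
  by_contra hc
  refine hk ?_
  rw [Set.mem_Icc, not_and_or, not_le, not_le] at hc
  simp only [num, LinearMap.sub_apply, Module.End.mul_apply]
  rcases hc with hc | hc
  · rw [if_pos (by omega)]
    have := LinearMap.congr_fun (h.cr_an k k) x
    simp only [LinearMap.add_apply, Module.End.mul_apply, if_true, h2 k hc, map_zero,
      add_zero] at this
    rw [this]; simp
  · rw [if_neg (by omega), h1 k hc]; simp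

theorem num_vac (k : ℤ) : num ψ ψd k vac = 0 := by
  simp only [num, LinearMap.sub_apply, Module.End.mul_apply]
  rcases le_or_gt 0 k with hk | hk
  · rw [h.vac_an k hk, if_neg (by omega)]; simp
  · rw [if_pos hk]
    have := LinearMap.congr_fun (h.cr_an k k) vac
    simp only [LinearMap.add_apply, Module.End.mul_apply, if_true, h.vac_cr k hk, map_zero,
      add_zero] at this
    rw [this]; simp

theorem chg_vac : chg ψ ψd vac = 0 := by
  unfold chg
  rw [opSum_apply_eq_sum h.locFin_num vac (S := ∅) (fun k _ => h.num_vac k)]; simp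

theorem erg_vac : erg ψ ψd vac = 0 := by
  unfold erg
  rw [opSum_apply_eq_sum (h.locFin_num.smul _) vac (S := ∅) (fun k _ => by simp [h.num_vac k])]
  simp

/-! #### Commutators with the modes -/

theorem rho_cr {m : ℤ} (hm : m ≠ 0) (j : ℤ) :
    rho ψ ψd m * ψd j - ψd j * rho ψ ψd m = ψd (j + m) := by
  unfold rho
  rw [opSum_comm (C := fun k => if k = j then ψd (k + m) else 0) (h.locFin_rho hm), opSum_single]
  intro k
  rw [comm_mul_of_anticomm (h.an_cr k j) (h.cr_cr (k + m) j)]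
  split_ifs <;> simp

theorem rho_an {m : ℤ} (hm : m ≠ 0) (j : ℤ) :
    rho ψ ψd m * ψ j - ψ j * rho ψ ψd m = -ψ (j - m) := by
  unfold rho
  rw [opSum_comm (C := fun k => if k = j - m then -ψ k else 0) (h.locFin_rho hm), opSum_single]
  intro k
  rw [comm_mul_of_anticomm (h.an_an k j) (h.cr_an (k + m) j)]
  by_cases hk : k = j - m
  · rw [if_pos hk, if_pos (by omega)]; simp
  · rw [if_neg hk, if_neg (by omega)]; simp

theorem num_cr (k j : ℤ) :
    num ψ ψd k * ψd j - ψd j * num ψ ψd k = if k = j then ψd k else 0 := by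
  have h1 := comm_mul_of_anticomm (h.an_cr k j) (h.cr_cr k j)
  have h2 : (if k < 0 then 1 else 0 : Module.End ℂ Fock) * ψd j -
      ψd j * (if k < 0 then 1 else 0) = 0 := by split_ifs <;> simp
  have h3 := sub_comm_of h1 h2
  rw [num, h3]
  split_ifs <;> simp

theorem num_an (k j : ℤ) :
    num ψ ψd k * ψ j - ψ j * num ψ ψd k = if k = j then -ψ k else 0 := by
  have h1 := comm_mul_of_anticomm (h.an_an k j) (h.cr_an k j)
  have h2 : (if k < 0 then 1 else 0 : Module.End ℂ Fock) * ψ j -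
      ψ j * (if k < 0 then 1 else 0) = 0 := by split_ifs <;> simp
  have h3 := sub_comm_of h1 h2
  rw [num, h3]
  split_ifs <;> simp

theorem chg_cr (j : ℤ) : chg ψ ψd * ψd j - ψd j * chg ψ ψd = ψd j := by
  unfold chg
  rw [opSum_comm h.locFin_num fun k => h.num_cr k j, opSum_single]

theorem chg_an (j : ℤ) : chg ψ ψd * ψ j - ψ j * chg ψ ψd = -ψ j := by
  unfold chg
  rw [opSum_comm h.locFin_num fun k => h.num_an k j, opSum_single (fun k => -ψ k)]

theorem erg_cr (j : ℤ) : erg ψ ψd * ψd j - ψd j * erg ψ ψd = (j : ℂ) • ψd j := by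
  unfold erg
  rw [opSum_comm (C := fun k => if k = j then (k : ℂ) • ψd k else 0) (h.locFin_num.smul _),
    opSum_single (fun k : ℤ => (k : ℂ) • ψd k)]
  intro k
  rw [smul_comm_of _ (h.num_cr k j)]
  split_ifs <;> simp

theorem rho_chg {m : ℤ} (hm : m ≠ 0) :
    rho ψ ψd m * chg ψ ψd - chg ψ ψd * rho ψ ψd m = 0 := by
  unfold rho
  rw [opSum_comm (C := fun _ => 0) (h.locFin_rho hm), opSum_zero]
  intro k
  have h1 := comm_swap (h.chg_cr (k + m))
  have h2 := comm_swap (h.chg_an k)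
  rw [comm_mul_of_comm h1 h2]
  refine LinearMap.ext fun x => ?_
  simp

/-! #### The commutators of the densities -/

theorem rho_rho {m n : ℤ} (hm : m ≠ 0) (hn : n ≠ 0) (hmn : m + n ≠ 0) :
    rho ψ ψd n * rho ψ ψd m - rho ψ ψd m * rho ψ ψd n = 0 := by
  conv_lhs => enter [1, 1]; unfold rho
  conv_lhs => enter [2, 2]; unfold rho
  have h1 : ∀ k, ψd (k + n) * ψ k * rho ψ ψd m - rho ψ ψd m * (ψd (k + n) * ψ k) =
      ψd (k + n) * ψ (k - m) - ψd (k + n + m) * ψ k := fun k => by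
    rw [comm_mul_of_comm (comm_swap (h.rho_cr hm (k + n))) (comm_swap (h.rho_an hm k))]
    refine LinearMap.ext fun x => ?_
    simp only [neg_neg, LinearMap.sub_apply, LinearMap.add_apply, Module.End.mul_apply,
      LinearMap.neg_apply]
    abel
  rw [opSum_comm (h.locFin_rho hn) h1]
  have h2 : LocFin fun k : ℤ => ψd (k + n + m) * ψ k := by
    simpa [add_assoc] using h.locFin_rho (m := n + m) (by omega)
  have h3 : LocFin fun k : ℤ => ψd (k + n) * ψ (k - m) := by
    have := h2.comp (f := fun k : ℤ => k - m) (fun a b hab => by simpa using hab)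
    refine fun x => (this x).subset fun k hk => ?_
    simpa [show k - m + n + m = k + n by ring] using hk
  rw [opSum_sub h3 h2]
  refine end_sub_eq_zero ?_
  rw [← opSum_reindex (fun k : ℤ => ψd (k + n + m) * ψ k) (Equiv.subRight m)]
  refine opSum_congr fun k => ?_
  simp only [Equiv.subRight_apply]
  rw [show k - m + n + m = k + n by ring]

theorem rho_rho_neg {m : ℤ} (hm : 0 < m) :
    rho ψ ψd (-m) * rho ψ ψd m - rho ψ ψd m * rho ψ ψd (-m) = (m : ℂ) • 1 := by
  conv_lhs => enter [1, 1]; unfold rho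
  conv_lhs => enter [2, 2]; unfold rho
  have hf : LocFin fun k : ℤ => (if 0 ≤ k ∧ k < m then 1 else 0 : Module.End ℂ Fock) :=
    LocFin.of_finite (Set.Ico 0 m) (Set.finite_Ico 0 m) fun k hk => if_neg hk
  have hs := h.locFin_num.comp (f := fun k : ℤ => k - m) (fun a b hab => by simpa using hab)
  have h1 : ∀ k, ψd (k + -m) * ψ k * rho ψ ψd m - rho ψ ψd m * (ψd (k + -m) * ψ k) =
      (num ψ ψd (k - m) - num ψ ψd k) + if 0 ≤ k ∧ k < m then 1 else 0 := fun k => by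
    rw [comm_mul_of_comm (comm_swap (h.rho_cr hm.ne' (k + -m))) (comm_swap (h.rho_an hm.ne' k))]
    simp only [num]
    rw [show k + -m + m = k by ring, show k + -m = k - m by ring]
    refine LinearMap.ext fun x => ?_
    simp only [LinearMap.sub_apply, LinearMap.add_apply, Module.End.mul_apply,
      LinearMap.neg_apply]
    by_cases h1 : k < 0
    · rw [if_pos h1, if_pos (by omega), if_neg (by omega)]
      simp; abel
    · by_cases h2 : k < m
      · rw [if_neg h1, if_pos (by omega), if_pos (by omega)]
        simp; abel
      · rw [if_neg h1, if_neg (by omega), if_neg (by omega)]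
        simp; abel
  rw [opSum_comm (h.locFin_rho (by omega)) h1, opSum_add (hs.sub h.locFin_num) hf,
    opSum_sub hs h.locFin_num,
    end_sub_eq_zero (show (opSum fun i => num ψ ψd (i - m)) = opSum (num ψ ψd) from
      opSum_reindex (num ψ ψd) (Equiv.subRight m)), zero_add,
    opSum_eq_sum (Finset.Ico 0 m) (fun k hk => if_neg (by simpa using hk))]
  rw [Finset.sum_congr rfl fun k hk => if_pos (by simpa using hk)]
  simp only [Finset.sum_const, Int.card_Ico, sub_zero]
  rw [← Nat.cast_smul_eq_nsmul ℂ]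
  congr 1
  have : ((m.toNat : ℤ) : ℂ) = m := by rw [Int.toNat_of_nonneg hm.le]
  exact_mod_cast this

/-! #### Adjoints and charges -/

theorem adj_rho {m : ℤ} (hm : m ≠ 0) : IsAdj (rho ψ ψd m) (rho ψ ψd (-m)) := by
  have h1 : rho ψ ψd (-m) = opSum fun k : ℤ => ψd k * ψ (k + m) := by
    unfold rho
    rw [← opSum_reindex (fun k : ℤ => ψd (k + -m) * ψ k) (Equiv.addRight m)]
    refine opSum_congr fun k => ?_
    simp
  have h2 : LocFin fun k : ℤ => ψd k * ψ (k + m) := by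
    have := (h.locFin_rho (m := -m) (by omega)).comp (f := fun k : ℤ => k + m)
      (fun a b hab => by simpa using hab)
    refine fun x => (this x).subset fun k hk => ?_
    simpa using hk
  rw [h1]
  exact IsAdj.opSum (h.locFin_rho hm) h2 fun k => (h.adj (k + m)).mul (h.adj k).symm

theorem adj_num (k : ℤ) : IsAdj (num ψ ψd k) (num ψ ψd k) := by
  refine ((h.adj k).mul (h.adj k).symm).sub ?_
  split_ifs
  · exact IsAdj.one
  · exact fun x y => by simp [ip_zero_left]

theorem adj_chg : IsAdj (chg ψ ψd) (chg ψ ψd) := .opSum h.locFin_num h.locFin_num h.adj_num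

theorem adj_erg : IsAdj (erg ψ ψd) (erg ψ ψd) :=
  .opSum (h.locFin_num.smul _) (h.locFin_num.smul _) fun k => by
    simpa using (h.adj_num k).smul (k : ℂ)

theorem charge_rho {m : ℤ} (hm : m ≠ 0) : HasCharge 0 (rho ψ ψd m) :=
  .opSum (h.locFin_rho hm) fun k => (h.charge_cr (k + m)).mul (h.charge k)

theorem charge_num (k : ℤ) : HasCharge 0 (num ψ ψd k) := by
  refine ((h.charge_cr k).mul (h.charge k)).sub ?_
  split_ifs
  · exact HasCharge.one
  · exact HasCharge.zero 0

theorem charge_chg : HasCharge 0 (chg ψ ψd) := .opSum h.locFin_num h.charge_num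

end Chiral

/-! ### Two independent chiral fields -/

/-- Two anticommuting chiral fermion fields which together act irreducibly on the Fock space. -/
structure FieldPair (ψ ψd φ φd : ℤ → Module.End ℂ Fock) : Prop where
  fst : Chiral ψ ψd
  snd : Chiral φ φd
  an_an : ∀ i j, ψ i * φ j + φ j * ψ i = 0
  an_cr : ∀ i j, ψ i * φd j + φd j * ψ i = 0
  cr_an : ∀ i j, ψd i * φ j + φ j * ψd i = 0
  cr_cr : ∀ i j, ψd i * φd j + φd j * ψd i = 0
  irr_even : ∀ X : Module.End ℂ Fock, (∀ k, X * ψ k - ψ k * X = 0) →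
    (∀ k, X * ψd k - ψd k * X = 0) → (∀ k, X * φ k - φ k * X = 0) →
    (∀ k, X * φd k - φd k * X = 0) → X vac = 0 → X = 0
  irr_odd : ∀ X : Module.End ℂ Fock, (∀ k, X * ψ k + ψ k * X = 0) →
    (∀ k, X * ψd k + ψd k * X = 0) → (∀ k, X * φ k + φ k * X = 0) →
    (∀ k, X * φd k + φd k * X = 0) → X vac = 0 → X = 0
  vac_unique : ∀ v : Fock, (∀ k, 0 ≤ k → ψ k v = 0) → (∀ k, k < 0 → ψd k v = 0) →
    (∀ k, 0 ≤ k → φ k v = 0) → (∀ k, k < 0 → φd k v = 0) → v = v (∅, ∅) • vac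

/-- `∑_{m ≥ 1} ϱ(m) ϱ(-m)`. -/
def sug (ψ ψd : ℤ → Module.End ℂ Fock) : Module.End ℂ Fock :=
  opSum fun m : ℕ+ => rho ψ ψd (m : ℤ) * rho ψ ψd (-(m : ℤ))

theorem pnat_ne (m : ℕ+) : (m : ℤ) ≠ 0 := by have := m.pos; omega

theorem pnat_pos (m : ℕ+) : (0 : ℤ) < m := by have := m.pos; omega

theorem mem_pnat_Ico {n : ℕ} {m : ℕ+} : m ∈ Finset.Ico 1 n.succPNat ↔ (m : ℕ) ≤ n := by
  rw [Finset.mem_Ico, ← PNat.coe_lt_coe, Nat.succPNat_coe]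
  simp [Nat.lt_succ_iff]

theorem card_pnat_Ico (n : ℕ) : (Finset.Ico 1 n.succPNat).card = n := by
  rw [PNat.card_Ico, Nat.succPNat_coe]
  simp

theorem finite_pnat_le (K : ℤ) : {m : ℕ+ | (m : ℤ) ≤ K}.Finite := by
  refine (Finset.Ico 1 K.toNat.succPNat).finite_toSet.subset fun m hm => ?_
  have h1 : (m : ℤ) ≤ K := hm
  rw [Finset.mem_coe, mem_pnat_Ico]
  omega

namespace Chiral

variable {ψ ψd : ℤ → Module.End ℂ Fock} (h : Chiral ψ ψd)
include h

theorem locFin_rho_neg : LocFin fun m : ℕ+ => rho ψ ψd (-(m : ℤ)) := fun x => by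
  obtain ⟨K, -, h1, h2⟩ := h.exists_bound x
  refine (finite_pnat_le (2 * K)).subset fun m hm => ?_
  by_contra hc
  exact hm (h.rho_apply_eq_zero h1 h2 (by simpa using hc) (pnat_ne m))

theorem locFin_sug : LocFin fun m : ℕ+ => rho ψ ψd (m : ℤ) * rho ψ ψd (-(m : ℤ)) :=
  h.locFin_rho_neg.mul_left _

theorem locFin_cr_sub (k : ℤ) : LocFin fun m : ℕ+ => ψd (k - m) := fun x => by
  obtain ⟨K, -, h1, h2⟩ := h.exists_bound x
  refine (finite_pnat_le (k + K)).subset fun m hm => ?_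
  by_contra hc
  have : ¬((m : ℤ) ≤ k + K) := hc
  exact hm (h2 _ (by omega))

theorem adj_sug : IsAdj (sug ψ ψd) (sug ψ ψd) := by
  refine IsAdj.opSum h.locFin_sug h.locFin_sug fun m => ?_
  have h1 := h.adj_rho (pnat_ne m)
  exact h1.mul h1.symm

theorem sug_vac : sug ψ ψd vac = 0 := by
  unfold sug
  rw [opSum_apply_eq_sum h.locFin_sug vac (S := ∅)]
  · simp
  · intro m _
    rw [Module.End.mul_apply, h.rho_vac (pnat_pos m), map_zero]

/-- The commutator of `∑ ϱ(m) ϱ(-m)` with `ψd k`. -/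
theorem sug_cr (k : ℤ) : sug ψ ψd * ψd k - ψd k * sug ψ ψd =
    opSum fun m : ℕ+ => rho ψ ψd m * ψd (k - m) + ψd (k + m) * rho ψ ψd (-(m : ℤ)) := by
  refine opSum_comm h.locFin_sug fun m => ?_
  rw [comm_mul_of_comm (h.rho_cr (pnat_ne m) k) (h.rho_cr (neg_ne_zero.2 (pnat_ne m)) k)]
  rfl

theorem locFin_sug_cr (k : ℤ) : LocFin fun m : ℕ+ =>
    rho ψ ψd m * ψd (k - m) + ψd (k + m) * rho ψ ψd (-(m : ℤ)) :=
  ((h.locFin_cr_sub k).mul_left _).add (h.locFin_rho_neg.mul_left _)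

theorem locFin_cr_cr (k j : ℤ) : LocFin fun m : ℤ => ψd (k + m) * ψd (j - m) := fun x => by
  obtain ⟨K, -, h1, h2⟩ := h.exists_bound x
  refine (Set.finite_Icc (-K - k) (K + j)).subset fun m hm => ?_
  by_contra hc
  refine hm ?_
  rw [Set.mem_Icc, not_and_or, not_le, not_le] at hc
  simp only [Module.End.mul_apply]
  rcases hc with hc | hc
  · rw [h.cr_cr_apply, h2 _ (by omega)]; simp
  · rw [h2 _ (by omega)]; simp

theorem opSum_cr_cr (k j : ℤ) : opSum (fun m : ℤ => ψd (k + m) * ψd (j - m)) = 0 := by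
  have h1 : opSum (fun m : ℤ => ψd (k + m) * ψd (j - m)) =
      -opSum (fun m : ℤ => ψd (k + m) * ψd (j - m)) := by
    conv_lhs => rw [← opSum_reindex _ (Equiv.subLeft (j - k))]
    rw [← opSum_neg (h.locFin_cr_cr k j)]
    refine opSum_congr fun m => LinearMap.ext fun x => ?_
    simp only [Equiv.subLeft_apply, Module.End.mul_apply, LinearMap.neg_apply]
    rw [show k + (j - k - m) = j - m by ring, show j - (j - k - m) = k + m by ring,
      h.cr_cr_apply]
  refine LinearMap.ext fun x => ?_
  have h2 := LinearMap.congr_fun h1 x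
  exact self_eq_neg.1 h2

theorem locFin_cr_an (k j : ℤ) (hkj : k ≠ j) :
    LocFin fun m : ℤ => ψd (k + m) * ψ (j + m) := by
  have := (h.locFin_rho (m := k - j) (by omega)).comp (f := fun m : ℤ => j + m)
    (fun a b hab => by simpa using hab)
  refine fun x => (this x).subset fun m hm => ?_
  simpa [show j + m + (k - j) = k + m by ring] using hm

omit h in
theorem rho_eq (k j : ℤ) : rho ψ ψd (k - j) = opSum fun m : ℤ => ψd (k + m) * ψ (j + m) := by
  unfold rho
  rw [← opSum_reindex _ (Equiv.addLeft j)]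
  refine opSum_congr fun m => ?_
  simp only [Equiv.coe_addLeft]
  rw [show j + m + (k - j) = k + m by ring]

end Chiral

theorem opSum_count (k : ℤ) :
    opSum (fun m : ℕ+ => (((if 0 ≤ k - m then 1 else 0) - (if k + m < 0 then 1 else 0) : ℤ) : ℂ) •
      (1 : Module.End ℂ Fock)) = ((k + if k < 0 then 1 else 0 : ℤ) : ℂ) • 1 := by
  rcases lt_or_ge k 0 with hk | hk
  · rw [opSum_eq_sum (Finset.Ico 1 (-k - 1).toNat.succPNat), Finset.sum_congr rfl
      (g := fun _ => (-1 : ℂ) • (1 : Module.End ℂ Fock))]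
    · rw [Finset.sum_const, card_pnat_Ico, if_pos hk, ← Nat.cast_smul_eq_nsmul ℂ, smul_smul]
      congr 1
      have h3 : (((-k - 1).toNat : ℤ) : ℂ) = ((-k - 1 : ℤ) : ℂ) := by
        rw [Int.toNat_of_nonneg (by omega)]
      push_cast at h3 ⊢
      rw [h3]; ring
    · intro m hm
      rw [mem_pnat_Ico] at hm
      have := m.pos
      rw [if_neg (by omega), if_pos (by omega)]; simp
    · intro m hm
      rw [mem_pnat_Ico] at hm
      have := m.pos
      rw [if_neg (by omega), if_neg (by omega)]; simp
  · rw [opSum_eq_sum (Finset.Ico 1 k.toNat.succPNat), Finset.sum_congr rfl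
      (g := fun _ => (1 : ℂ) • (1 : Module.End ℂ Fock))]
    · rw [Finset.sum_const, card_pnat_Ico, if_neg (by omega), ← Nat.cast_smul_eq_nsmul ℂ,
        smul_smul]
      congr 1
      have h3 : ((k.toNat : ℤ) : ℂ) = k := by rw [Int.toNat_of_nonneg hk]
      push_cast at h3 ⊢
      rw [h3]; ring
    · intro m hm
      rw [mem_pnat_Ico] at hm
      have := m.pos
      rw [if_pos (by omega), if_neg (by omega)]; simp
    · intro m hm
      rw [mem_pnat_Ico] at hm
      have := m.pos
      rw [if_neg (by omega), if_neg (by omega)]; simp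

theorem locFin_count (k : ℤ) : LocFin fun m : ℕ+ =>
    (((if 0 ≤ k - m then 1 else 0) - (if k + m < 0 then 1 else 0) : ℤ) : ℂ) •
      (1 : Module.End ℂ Fock) := by
  refine LocFin.of_finite {m : ℕ+ | (m : ℤ) ≤ |k|} (finite_pnat_le _) fun m hm => ?_
  have h1 : ¬((m : ℤ) ≤ |k|) := hm
  have := le_abs_self k
  have := neg_abs_le k
  rw [if_neg (by omega), if_neg (by omega)]; simp

namespace Chiral

variable {ψ ψd : ℤ → Module.End ℂ Fock} (h : Chiral ψ ψd)
include h

/-- `∑_{m ≥ 1} ϱ(m) ψd(k - m) + ψd(k + m) ϱ(-m) - k ψd(k) + ψd(k) Q`, half the commutator of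
the defect of the Kronig identity with `ψd(k)`. -/
theorem kronig_cr_cr (k j : ℤ) :
    (opSum (fun m : ℕ+ => rho ψ ψd m * ψd (k - m) + ψd (k + m) * rho ψ ψd (-(m : ℤ)))
      - (k : ℂ) • ψd k + ψd k * chg ψ ψd) * ψd j + ψd j *
    (opSum (fun m : ℕ+ => rho ψ ψd m * ψd (k - m) + ψd (k + m) * rho ψ ψd (-(m : ℤ)))
      - (k : ℂ) • ψd k + ψd k * chg ψ ψd) = 0 := by
  have h1 : ∀ m : ℕ+, (rho ψ ψd m * ψd (k - m) + ψd (k + m) * rho ψ ψd (-(m : ℤ))) * ψd j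
      + ψd j * (rho ψ ψd m * ψd (k - m) + ψd (k + m) * rho ψ ψd (-(m : ℤ))) =
      ψd (k + m) * ψd (j - m) + ψd (k + -(m : ℤ)) * ψd (j - -(m : ℤ)) := fun m => by
    rw [add_anticomm_of (anticomm_mul_left (h.cr_cr (k - m) j) (h.rho_cr (pnat_ne m) j))
      (anticomm_mul_right (h.cr_cr (k + m) j) (h.rho_cr (neg_ne_zero.2 (pnat_ne m)) j))]
    refine LinearMap.ext fun x => ?_
    simp only [LinearMap.add_apply, LinearMap.sub_apply, Module.End.mul_apply,
      LinearMap.zero_apply, map_zero]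
    rw [h.cr_cr_apply (j + m), show k + -(m : ℤ) = k - m by ring,
      show j - -(m : ℤ) = j + m by ring, show j + -(m : ℤ) = j - m by ring]
    abel
  have h2 := opSum_anticomm (h.locFin_sug_cr k) h1
  have h3 := opSum_int (h.locFin_cr_cr k j)
  rw [h.opSum_cr_cr] at h3
  have h4 : ((k : ℂ) • ψd k) * ψd j + ψd j * ((k : ℂ) • ψd k) = 0 := by
    rw [smul_mul_assoc, mul_smul_comm, ← smul_add, h.cr_cr, smul_zero]
  have h5 := anticomm_mul_right (h.cr_cr k j) (h.chg_cr j)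
  rw [add_anticomm_of (sub_anticomm_of h2 h4) h5]
  refine LinearMap.ext fun x => ?_
  have h6 := LinearMap.congr_fun h3 x
  simp only [LinearMap.add_apply, LinearMap.sub_apply, Module.End.mul_apply,
    LinearMap.zero_apply, add_zero, sub_zero] at h6 ⊢
  rw [add_comm]
  exact h6.symm

theorem kronig_cr_an (k j : ℤ) :
    (opSum (fun m : ℕ+ => rho ψ ψd m * ψd (k - m) + ψd (k + m) * rho ψ ψd (-(m : ℤ)))
      - (k : ℂ) • ψd k + ψd k * chg ψ ψd) * ψ j + ψ j *
    (opSum (fun m : ℕ+ => rho ψ ψd m * ψd (k - m) + ψd (k + m) * rho ψ ψd (-(m : ℤ)))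
      - (k : ℂ) • ψd k + ψd k * chg ψ ψd) = 0 := by
  have h1 : ∀ m : ℕ+, (rho ψ ψd m * ψd (k - m) + ψd (k + m) * rho ψ ψd (-(m : ℤ))) * ψ j
      + ψ j * (rho ψ ψd m * ψd (k - m) + ψd (k + m) * rho ψ ψd (-(m : ℤ))) =
      (ψ (j - m) * ψd (k - m) - ψd (k + m) * ψ (j + m)) +
        ((if k - m = j then rho ψ ψd m else 0) + if k + m = j then rho ψ ψd (-(m : ℤ)) else 0) :=
    fun m => by
    rw [add_anticomm_of (anticomm_mul_left (h.cr_an (k - m) j) (h.rho_an (pnat_ne m) j))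
      (anticomm_mul_right (h.cr_an (k + m) j) (h.rho_an (neg_ne_zero.2 (pnat_ne m)) j))]
    refine LinearMap.ext fun x => ?_
    rw [show j - -(m : ℤ) = j + m by ring]
    split_ifs <;> simp <;> abel
  have h2 := opSum_anticomm (h.locFin_sug_cr k) h1
  have h4 : ((k : ℂ) • ψd k) * ψ j + ψ j * ((k : ℂ) • ψd k) =
      (k : ℂ) • if k = j then 1 else 0 := by
    rw [smul_mul_assoc, mul_smul_comm, ← smul_add, h.cr_an]
  have h5 := anticomm_mul_right (h.cr_an k j) (h.chg_an j)
  rw [add_anticomm_of (sub_anticomm_of h2 h4) h5]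
  rcases eq_or_ne k j with rfl | hkj
  · have h6 : ∀ m : ℕ+, (ψ (k - m) * ψd (k - m) - ψd (k + m) * ψ (k + m)) +
        ((if k - m = k then rho ψ ψd m else 0) + if k + m = k then rho ψ ψd (-(m : ℤ)) else 0) =
        (((if 0 ≤ k - m then 1 else 0) - (if k + m < 0 then 1 else 0) : ℤ) : ℂ) • 1 -
          (num ψ ψd (m + k) + num ψ ψd (-(m : ℤ) + k)) := fun m => by
      have := m.pos
      rw [if_neg (by omega), if_neg (by omega)]
      refine LinearMap.ext fun x => ?_
      have h7 := LinearMap.congr_fun (h.an_cr (k - m) (k - m)) x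
      simp only [LinearMap.add_apply, Module.End.mul_apply, if_true, Module.End.one_apply] at h7
      have h8 : ψ (k - m) (ψd (k - m) x) = x - ψd (k - m) (ψ (k - m) x) :=
        eq_sub_of_add_eq h7
      simp only [num, LinearMap.add_apply, LinearMap.sub_apply, Module.End.mul_apply,
        LinearMap.smul_apply, Module.End.one_apply, LinearMap.zero_apply, h8]
      rw [show -(m : ℤ) + k = k - m by ring, show (m : ℤ) + k = k + m by ring]
      by_cases h9 : k - m < 0
      · rw [if_pos h9, if_neg (by omega : ¬ 0 ≤ k - (m : ℤ))]
        split_ifs <;> simp <;> abel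
      · rw [if_neg h9, if_pos (by omega : 0 ≤ k - (m : ℤ))]
        split_ifs <;> simp <;> abel
    have h7 : LocFin fun m : ℤ => num ψ ψd (m + k) :=
      h.locFin_num.comp (fun a b hab => by simpa using hab)
    have h8 : chg ψ ψd = opSum fun m : ℤ => num ψ ψd (m + k) :=
      (opSum_reindex (num ψ ψd) (Equiv.addRight k)).symm
    have h9 := opSum_int h7
    rw [← h8] at h9
    have hp : LocFin fun m : ℕ+ => num ψ ψd (m + k) + num ψ ψd (-(m : ℤ) + k) :=
      (h7.comp (f := fun m : ℕ+ => (m : ℤ)) (fun a b hab => by simpa using hab)).add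
        (h7.comp (f := fun m : ℕ+ => -(m : ℤ)) (fun a b hab => by simpa using hab))
    rw [opSum_congr h6, opSum_sub (locFin_count k) hp, opSum_count]
    refine LinearMap.ext fun x => ?_
    have h10 := LinearMap.congr_fun h9 x
    simp only [LinearMap.add_apply, LinearMap.sub_apply, Module.End.mul_apply,
      LinearMap.zero_apply, if_true, LinearMap.smul_apply, Module.End.one_apply, num, zero_add,
      map_neg, LinearMap.neg_apply] at h10 ⊢
    rw [h10]
    split_ifs
    · simp only [Module.End.one_apply]
      push_cast
      module
    · simp only [LinearMap.zero_apply]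
      push_cast
      module
  · have h6 : LocFin fun m : ℕ+ => ψ (j - m) * ψd (k - m) - ψd (k + m) * ψ (j + m) := by
      have h7 := h.locFin_cr_an k j hkj
      have h8 := (h7.comp (f := fun m : ℕ+ => -(m : ℤ)) (fun a b hab => by simpa using hab)).neg
      have h9 := h8.sub (h7.comp (f := fun m : ℕ+ => (m : ℤ)) (fun a b hab => by simpa using hab))
      refine fun x => (h9 x).subset fun m hm => ?_
      rw [Function.mem_support] at hm
      beta_reduce at hm
      rw [h.an_cr_of_ne (show j - (m : ℤ) ≠ k - m by omega)] at hm
      simpa [← sub_eq_add_neg] using hm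
    have h7 : LocFin fun m : ℕ+ => (if k - m = j then rho ψ ψd m else 0) +
        if k + m = j then rho ψ ψd (-(m : ℤ)) else 0 := by
      refine LocFin.of_finite {m : ℕ+ | (m : ℤ) ≤ |k - j|} (finite_pnat_le _) fun m hm => ?_
      have h1 : ¬((m : ℤ) ≤ |k - j|) := hm
      have := le_abs_self (k - j)
      have := neg_abs_le (k - j)
      rw [if_neg (by omega), if_neg (by omega)]; simp
    have h8 : opSum (fun m : ℕ+ => (if k - m = j then rho ψ ψd m else 0) +
        if k + m = j then rho ψ ψd (-(m : ℤ)) else 0) = rho ψ ψd (k - j) := by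
      rcases lt_or_gt_of_ne hkj with hlt | hgt
      · rw [← opSum_single (fun m : ℕ+ => rho ψ ψd (k - j)) ⟨(j - k).toNat, by omega⟩]
        refine opSum_congr fun m => ?_
        have := m.pos
        rw [if_neg (by omega), zero_add]
        by_cases hm : k + m = j
        · rw [if_pos hm, if_pos (by apply PNat.eq; simp; omega)]; congr 1; omega
        · rw [if_neg hm, if_neg]
          intro hm'; rw [hm'] at hm; simp at hm; omega
      · rw [← opSum_single (fun m : ℕ+ => rho ψ ψd (k - j)) ⟨(k - j).toNat, by omega⟩]
        refine opSum_congr fun m => ?_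
        have := m.pos
        rw [if_neg (by omega : ¬ (k + m = j)), add_zero]
        by_cases hm : k - m = j
        · rw [if_pos hm, if_pos (by apply PNat.eq; simp; omega)]; congr 1; omega
        · rw [if_neg hm, if_neg]
          intro hm'; rw [hm'] at hm; simp at hm; omega
    have h9 := opSum_int (h.locFin_cr_an k j hkj)
    rw [← rho_eq] at h9
    have h10 : opSum (fun m : ℕ+ => ψ (j - m) * ψd (k - m) - ψd (k + m) * ψ (j + m)) =
        -opSum (fun m : ℕ+ => ψd (k + m) * ψ (j + m) + ψd (k + -(m : ℤ)) * ψ (j + -(m : ℤ))) := by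
      have h7 := h.locFin_cr_an k j hkj
      rw [← opSum_neg ((h7.comp (f := fun m : ℕ+ => (m : ℤ))
        (fun a b hab => by simpa using hab)).add (h7.comp (f := fun m : ℕ+ => -(m : ℤ))
          (fun a b hab => by simpa using hab)))]
      refine opSum_congr fun m => LinearMap.ext fun x => ?_
      rw [h.an_cr_of_ne (show j - (m : ℤ) ≠ k - m by omega)]
      simp [← sub_eq_add_neg]
    rw [opSum_add h6 h7, h8, h10]
    refine LinearMap.ext fun x => ?_
    have h11 := LinearMap.congr_fun h9 x
    simp only [LinearMap.add_apply, LinearMap.sub_apply, Module.End.mul_apply,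
      LinearMap.zero_apply, LinearMap.neg_apply, if_neg hkj, smul_zero,
      map_neg] at h11 ⊢
    rw [h11]
    simp

end Chiral

/-! ### The Kronig identity -/

namespace Chiral

variable {ψ ψd : ℤ → Module.End ℂ Fock} (h : Chiral ψ ψd) {x : Module.End ℂ Fock}
  (h1 : ∀ i, ψ i * x + x * ψ i = 0) (h2 : ∀ i, ψd i * x + x * ψd i = 0)
include h h1 h2

theorem rho_comm_of_anticomm {m : ℤ} (hm : m ≠ 0) : rho ψ ψd m * x - x * rho ψ ψd m = 0 := by
  unfold rho
  rw [opSum_comm (C := fun _ => 0) (h.locFin_rho hm), opSum_zero]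
  intro k
  rw [comm_mul_of_anticomm (h1 k) (h2 (k + m))]; simp

omit h in
theorem num_comm_of_anticomm (k : ℤ) : num ψ ψd k * x - x * num ψ ψd k = 0 := by
  have h3 : (if k < 0 then 1 else 0 : Module.End ℂ Fock) * x -
      x * (if k < 0 then 1 else 0) = 0 := by split_ifs <;> simp
  rw [num, sub_comm_of (comm_mul_of_anticomm (h1 k) (h2 k)) h3]; simp

theorem chg_comm_of_anticomm : chg ψ ψd * x - x * chg ψ ψd = 0 := by
  unfold chg
  rw [opSum_comm (C := fun _ => 0) h.locFin_num (num_comm_of_anticomm h1 h2), opSum_zero]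

theorem erg_comm_of_anticomm : erg ψ ψd * x - x * erg ψ ψd = 0 := by
  unfold erg
  rw [opSum_comm (C := fun _ => 0) (h.locFin_num.smul _), opSum_zero]
  intro k
  rw [smul_comm_of _ (num_comm_of_anticomm h1 h2 k), smul_zero]

theorem sug_comm_of_anticomm : sug ψ ψd * x - x * sug ψ ψd = 0 := by
  unfold sug
  rw [opSum_comm (C := fun _ => 0) h.locFin_sug, opSum_zero]
  intro m
  rw [comm_mul_of_comm (h.rho_comm_of_anticomm h1 h2 (pnat_ne m))
    (h.rho_comm_of_anticomm h1 h2 (neg_ne_zero.2 (pnat_ne m)))]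
  simp

theorem kronig_cr_of_anticomm (k : ℤ) :
    (opSum (fun m : ℕ+ => rho ψ ψd m * ψd (k - m) + ψd (k + m) * rho ψ ψd (-(m : ℤ)))
      - (k : ℂ) • ψd k + ψd k * chg ψ ψd) * x + x *
    (opSum (fun m : ℕ+ => rho ψ ψd m * ψd (k - m) + ψd (k + m) * rho ψ ψd (-(m : ℤ)))
      - (k : ℂ) • ψd k + ψd k * chg ψ ψd) = 0 := by
  have h3 : ∀ m : ℕ+, (rho ψ ψd m * ψd (k - m) + ψd (k + m) * rho ψ ψd (-(m : ℤ))) * x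
      + x * (rho ψ ψd m * ψd (k - m) + ψd (k + m) * rho ψ ψd (-(m : ℤ))) = 0 := fun m => by
    rw [add_anticomm_of (anticomm_mul_left (h2 (k - m)) (h.rho_comm_of_anticomm h1 h2 (pnat_ne m)))
      (anticomm_mul_right (h2 (k + m))
        (h.rho_comm_of_anticomm h1 h2 (neg_ne_zero.2 (pnat_ne m))))]
    simp
  have h4 : ((k : ℂ) • ψd k) * x + x * ((k : ℂ) • ψd k) = 0 := by
    rw [smul_mul_assoc, mul_smul_comm, ← smul_add, h2, smul_zero]
  rw [add_anticomm_of (sub_anticomm_of (opSum_anticomm (h.locFin_sug_cr k) h3) h4)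
    (anticomm_mul_right (h2 k) (h.chg_comm_of_anticomm h1 h2)), opSum_zero]
  simp

omit h1 h2 in
theorem rho_comm_of_comm {m : ℤ} (hm : m ≠ 0) (h3 : ∀ i, ψ i * x - x * ψ i = 0)
    (h4 : ∀ i, ψd i * x - x * ψd i = 0) : rho ψ ψd m * x - x * rho ψ ψd m = 0 := by
  unfold rho
  rw [opSum_comm (C := fun _ => 0) (h.locFin_rho hm), opSum_zero]
  intro k
  rw [comm_mul_of_comm (h4 (k + m)) (h3 k)]; simp

end Chiral

namespace FieldPair

variable {ψ ψd φ φd : ℤ → Module.End ℂ Fock} (h : FieldPair ψ ψd φ φd)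
include h

theorem kronig_cr (k : ℤ) :
    opSum (fun m : ℕ+ => rho ψ ψd m * ψd (k - m) + ψd (k + m) * rho ψ ψd (-(m : ℤ)))
      - (k : ℂ) • ψd k + ψd k * chg ψ ψd = 0 := by
  have ha : ∀ j, _ := fun j => h.fst.kronig_cr_an k j
  have hc : ∀ j, _ := fun j => h.fst.kronig_cr_cr k j
  have ha' : ∀ j, _ := fun j =>
    h.fst.kronig_cr_of_anticomm (fun i => h.an_an i j) (fun i => h.cr_an i j) k
  have hc' : ∀ j, _ := fun j =>
    h.fst.kronig_cr_of_anticomm (fun i => h.an_cr i j) (fun i => h.cr_cr i j) k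
  have hch : HasCharge 1
      (opSum (fun m : ℕ+ => rho ψ ψd m * ψd (k - m) + ψd (k + m) * rho ψ ψd (-(m : ℤ)))
        - (k : ℂ) • ψd k + ψd k * chg ψ ψd) := by
    refine ((HasCharge.opSum (h.fst.locFin_sug_cr k) fun m => ?_).sub
      ((h.fst.charge_cr k).smul _)).add (h.fst.charge_chg.mul' (h.fst.charge_cr k) (by norm_num))
    exact ((h.fst.charge_cr _).mul' (h.fst.charge_rho (pnat_ne m)) (by norm_num)).add
      ((h.fst.charge_rho (neg_ne_zero.2 (pnat_ne m))).mul' (h.fst.charge_cr _) (by norm_num))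
  set D := opSum (fun m : ℕ+ => rho ψ ψd m * ψd (k - m) + ψd (k + m) * rho ψ ψd (-(m : ℤ)))
      - (k : ℂ) • ψd k + ψd k * chg ψ ψd with hD
  have key : ∀ X : Module.End ℂ Fock, D * X + X * D = 0 → X vac = 0 → X (D vac) = 0 := by
    intro X hX h0
    have := LinearMap.congr_fun hX vac
    simpa [Module.End.mul_apply, h0] using this
  refine h.irr_odd D ha hc ha' hc' ?_
  have h1 := h.vac_unique (D vac) (fun j hj => key _ (ha j) (h.fst.vac_an j hj))
    (fun j hj => key _ (hc j) (h.fst.vac_cr j hj)) (fun j hj => key _ (ha' j) (h.snd.vac_an j hj))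
    (fun j hj => key _ (hc' j) (h.snd.vac_cr j hj))
  have h2 : (D vac) (∅, ∅) = 0 := by
    by_contra hne
    have := hch 0 vac vac_mem_chargeSub (Finsupp.mem_support_iff.2 hne)
    simp at this
  rw [h1, h2, zero_smul]

/-- The Kronig identity `∑_{m ≥ 1} ϱ(m) ϱ(-m) = E - Q (Q - 1) / 2`. -/
theorem kronig : (2 : ℂ) • sug ψ ψd - (2 : ℂ) • erg ψ ψd + chg ψ ψd * chg ψ ψd - chg ψ ψd = 0 := by
  have hcr : ∀ k, ((2 : ℂ) • sug ψ ψd - (2 : ℂ) • erg ψ ψd + chg ψ ψd * chg ψ ψd - chg ψ ψd) * ψd k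
      - ψd k * ((2 : ℂ) • sug ψ ψd - (2 : ℂ) • erg ψ ψd + chg ψ ψd * chg ψ ψd - chg ψ ψd) = 0 := by
    intro k
    have h1 := h.kronig_cr k
    rw [← h.fst.sug_cr] at h1
    refine LinearMap.ext fun x => ?_
    have h2 : ∀ x, chg ψ ψd (ψd k x) = ψd k (chg ψ ψd x) + ψd k x := fun x => by
      have := LinearMap.congr_fun (h.fst.chg_cr k) x
      simp only [LinearMap.sub_apply, Module.End.mul_apply] at this
      rw [add_comm]
      exact eq_add_of_sub_eq this
    have h3 : erg ψ ψd (ψd k x) = ψd k (erg ψ ψd x) + (k : ℂ) • ψd k x := by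
      have := LinearMap.congr_fun (h.fst.erg_cr k) x
      simp only [LinearMap.sub_apply, Module.End.mul_apply, LinearMap.smul_apply] at this
      rw [add_comm]
      exact eq_add_of_sub_eq this
    have h4 := LinearMap.congr_fun h1 x
    simp only [LinearMap.add_apply, LinearMap.sub_apply, Module.End.mul_apply,
      LinearMap.zero_apply, LinearMap.smul_apply, map_add, map_sub, map_smul, h2, h3] at h4 ⊢
    linear_combination (norm := module) (2 : ℂ) • h4
  have hself : IsAdj
      ((2 : ℂ) • sug ψ ψd - (2 : ℂ) • erg ψ ψd + chg ψ ψd * chg ψ ψd - chg ψ ψd)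
      ((2 : ℂ) • sug ψ ψd - (2 : ℂ) • erg ψ ψd + chg ψ ψd * chg ψ ψd - chg ψ ψd) := by
    have h1 := ((h.fst.adj_sug.smul 2).sub (h.fst.adj_erg.smul 2)).add
      (h.fst.adj_chg.mul h.fst.adj_chg) |>.sub h.fst.adj_chg
    simpa using h1
  have hcomm : ∀ x : Module.End ℂ Fock, (∀ i, ψ i * x + x * ψ i = 0) →
      (∀ i, ψd i * x + x * ψd i = 0) →
      ((2 : ℂ) • sug ψ ψd - (2 : ℂ) • erg ψ ψd + chg ψ ψd * chg ψ ψd - chg ψ ψd) * x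
      - x * ((2 : ℂ) • sug ψ ψd - (2 : ℂ) • erg ψ ψd + chg ψ ψd * chg ψ ψd - chg ψ ψd) = 0 := by
    intro x h1 h2
    have h3 := h.fst.chg_comm_of_anticomm h1 h2
    rw [sub_comm_of (add_comm_of (sub_comm_of
      (smul_comm_of 2 (h.fst.sug_comm_of_anticomm h1 h2))
      (smul_comm_of 2 (h.fst.erg_comm_of_anticomm h1 h2))) (comm_mul_of_comm h3 h3)) h3]
    simp
  refine h.irr_even _ ?_ hcr (fun j => hcomm _ (fun i => h.an_an i j) (fun i => h.cr_an i j))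
    (fun j => hcomm _ (fun i => h.an_cr i j) (fun i => h.cr_cr i j)) ?_
  · intro k
    have h1 := ((hself.mul (h.fst.adj k)).sub ((h.fst.adj k).mul hself)).eq_zero (hcr k)
    refine LinearMap.ext fun x => ?_
    have h2 := LinearMap.congr_fun h1 x
    rw [LinearMap.sub_apply] at h2 ⊢
    rw [LinearMap.zero_apply] at h2 ⊢
    rw [← neg_sub, h2, neg_zero]
  · simp [h.fst.sug_vac, h.fst.erg_vac, h.fst.chg_vac]

end FieldPair

/-! ### The right and left moving fields -/

/-- Annihilation modes of a chiral field built from the fermions `f k`, `k ≥ 0`, and the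
anti-fermions `g k`, `k < 0`. -/
def fieldAn (f g : ℤ → ℤ) (k : ℤ) : Module.End ℂ Fock := if 0 ≤ k then bAn (f k) else cCr (g k)

/-- Creation modes of a chiral field built from the fermions `f k`, `k ≥ 0`, and the
anti-fermions `g k`, `k < 0`. -/
def fieldCr (f g : ℤ → ℤ) (k : ℤ) : Module.End ℂ Fock := if 0 ≤ k then bCr (f k) else cAn (g k)

theorem finite_of_basis (A : ℤ → Module.End ℂ Fock)
    (h : ∀ s, {n | A n (basisVec s) ≠ 0}.Finite) (x : Fock) : {n | A n x ≠ 0}.Finite := by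
  induction x using Finsupp.induction_linear with
  | zero => simp
  | add x y hx hy =>
    refine (hx.union hy).subset fun n hn => ?_
    by_contra hc
    simp only [mem_union, Set.mem_ofPred_eq, not_or, not_not] at hc
    exact hn (by simp [hc.1, hc.2])
  | single s a =>
    refine (h s).subset fun n hn => ?_
    have : Finsupp.single s a = a • basisVec s := by simp [basisVec]
    intro hc
    exact hn (by rw [this, map_smul, hc, smul_zero])

theorem finite_bAn (x : Fock) : {n | bAn n x ≠ 0}.Finite :=
  finite_of_basis _ (fun s => s.1.finite_toSet.subset fun n hn => by
    by_contra hc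
    exact hn (by rw [bAn_basis, if_neg (by simpa using hc)])) x

theorem finite_cAn (x : Fock) : {n | cAn n x ≠ 0}.Finite :=
  finite_of_basis _ (fun s => s.2.finite_toSet.subset fun n hn => by
    by_contra hc
    exact hn (by rw [cAn_basis, if_neg (by simpa using hc)])) x

theorem bAn_vac (k : ℤ) : bAn k vac = 0 := by simp [vac, bAn_basis]

theorem cAn_vac (k : ℤ) : cAn k vac = 0 := by simp [vac, cAn_basis]

theorem chiral_field {f g : ℤ → ℤ} (hf : Function.Injective f) (hg : Function.Injective g) :
    Chiral (fieldAn f g) (fieldCr f g) where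
  an_an i j := by
    unfold fieldAn
    split_ifs
    · exact bAn_bAn _ _
    · exact bAn_cCr _ _
    · rw [add_comm]; exact bAn_cCr _ _
    · exact cCr_cCr _ _
  cr_cr i j := by
    unfold fieldCr
    split_ifs
    · exact bCr_bCr _ _
    · exact bCr_cAn _ _
    · rw [add_comm]; exact bCr_cAn _ _
    · exact cAn_cAn _ _
  an_cr i j := by
    unfold fieldCr fieldAn
    by_cases hi : 0 ≤ i <;> by_cases hj : 0 ≤ j <;> simp only [hi, hj, if_true, if_false]
    · rw [bAn_bCr]; simp only [hf.eq_iff]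
    · rw [bAn_cAn, if_neg (by omega)]
    · rw [add_comm, bCr_cCr, if_neg (by omega)]
    · rw [add_comm, cAn_cCr]; simp only [hg.eq_iff, eq_comm]
  adj i := by
    unfold fieldCr fieldAn
    split_ifs
    · exact isAdj_b _
    · exact (isAdj_c _).symm
  charge i := by
    unfold fieldAn
    split_ifs
    · exact hasCharge_bAn _
    · exact hasCharge_cCr _
  charge_cr i := by
    unfold fieldCr
    split_ifs
    · exact hasCharge_bCr _
    · exact hasCharge_cAn _
  fin x := by
    obtain ⟨K, hK⟩ := ((finite_bAn x).preimage hf.injOn).bddAbove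
    refine ⟨max K 0, fun k hk => ?_⟩
    rw [fieldAn, if_pos (by have := le_max_right K 0; omega)]
    by_contra hc
    have : k ≤ K := hK hc
    have := le_max_left K 0
    omega
  fin_cr x := by
    obtain ⟨K, hK⟩ := ((finite_cAn x).preimage hg.injOn).bddBelow
    refine ⟨min K 0, fun k hk => ?_⟩
    rw [fieldCr, if_neg (by have := min_le_right K 0; omega)]
    by_contra hc
    have : K ≤ k := hK hc
    have := min_le_left K 0
    omega
  vac_an k hk := by rw [fieldAn, if_pos hk, bAn_vac]
  vac_cr k hk := by rw [fieldCr, if_neg (by omega), cAn_vac]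

theorem fieldPair {f g f' g' : ℤ → ℤ} (hf : Function.Injective f) (hg : Function.Injective g)
    (hf' : Function.Injective f') (hg' : Function.Injective g')
    (hff : ∀ i j, 0 ≤ i → 0 ≤ j → f i ≠ f' j) (hgg : ∀ i j, i < 0 → j < 0 → g i ≠ g' j)
    (hfs : ∀ n, ∃ k, 0 ≤ k ∧ (f k = n ∨ f' k = n))
    (hgs : ∀ n, ∃ k, k < 0 ∧ (g k = n ∨ g' k = n)) :
    FieldPair (fieldAn f g) (fieldCr f g) (fieldAn f' g') (fieldCr f' g') where
  fst := chiral_field hf hg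
  snd := chiral_field hf' hg'
  an_an i j := by
    unfold fieldAn
    split_ifs
    · exact bAn_bAn _ _
    · exact bAn_cCr _ _
    · rw [add_comm]; exact bAn_cCr _ _
    · exact cCr_cCr _ _
  cr_cr i j := by
    unfold fieldCr
    split_ifs
    · exact bCr_bCr _ _
    · exact bCr_cAn _ _
    · rw [add_comm]; exact bCr_cAn _ _
    · exact cAn_cAn _ _
  an_cr i j := by
    unfold fieldCr fieldAn
    by_cases hi : 0 ≤ i <;> by_cases hj : 0 ≤ j <;> simp only [hi, hj, if_true, if_false]
    · rw [bAn_bCr, if_neg (hff i j hi hj)]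
    · rw [bAn_cAn]
    · rw [add_comm, bCr_cCr]
    · rw [add_comm, cAn_cCr, if_neg (hgg i j (by omega) (by omega)).symm]
  cr_an i j := by
    unfold fieldCr fieldAn
    by_cases hi : 0 ≤ i <;> by_cases hj : 0 ≤ j <;> simp only [hi, hj, if_true, if_false]
    · rw [add_comm, bAn_bCr, if_neg (hff i j hi hj).symm]
    · rw [bCr_cCr]
    · rw [add_comm, bAn_cAn]
    · rw [cAn_cCr, if_neg (hgg i j (by omega) (by omega))]
  irr_even X h1 h2 h3 h4 h0 := by
    refine eq_zero_of_intertwine X bCr cCr (fun n x => ?_) (fun n x => ?_) h0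
    · obtain ⟨k, hk, rfl | rfl⟩ := hfs n
      · have := LinearMap.congr_fun (h2 k) x
        rw [fieldCr, if_pos hk] at this
        exact sub_eq_zero.1 this
      · have := LinearMap.congr_fun (h4 k) x
        rw [fieldCr, if_pos hk] at this
        exact sub_eq_zero.1 this
    · obtain ⟨k, hk, rfl | rfl⟩ := hgs n
      · have := LinearMap.congr_fun (h1 k) x
        rw [fieldAn, if_neg (by omega)] at this
        exact sub_eq_zero.1 this
      · have := LinearMap.congr_fun (h3 k) x
        rw [fieldAn, if_neg (by omega)] at this
        exact sub_eq_zero.1 this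
  irr_odd X h1 h2 h3 h4 h0 := by
    refine eq_zero_of_intertwine X (fun n => -bCr n) (fun n => -cCr n) (fun n x => ?_)
      (fun n x => ?_) h0
    · obtain ⟨k, hk, rfl | rfl⟩ := hfs n
      · have := LinearMap.congr_fun (h2 k) x
        rw [fieldCr, if_pos hk] at this
        exact eq_neg_of_add_eq_zero_left this
      · have := LinearMap.congr_fun (h4 k) x
        rw [fieldCr, if_pos hk] at this
        exact eq_neg_of_add_eq_zero_left this
    · obtain ⟨k, hk, rfl | rfl⟩ := hgs n
      · have := LinearMap.congr_fun (h1 k) x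
        rw [fieldAn, if_neg (by omega)] at this
        exact eq_neg_of_add_eq_zero_left this
      · have := LinearMap.congr_fun (h3 k) x
        rw [fieldAn, if_neg (by omega)] at this
        exact eq_neg_of_add_eq_zero_left this
  vac_unique v h1 h2 h3 h4 := by
    refine eq_smul_vac v (fun n => ?_) (fun n => ?_)
    · obtain ⟨k, hk, rfl | rfl⟩ := hfs n
      · simpa [fieldAn, hk] using h1 k hk
      · simpa [fieldAn, hk] using h3 k hk
    · obtain ⟨k, hk, rfl | rfl⟩ := hgs n
      · simpa [fieldCr, hk.not_ge] using h2 k hk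
      · simpa [fieldCr, hk.not_ge] using h4 k hk

/-- The right moving field: `b_k` for `k ≥ 0` and `c†_{-k}` for `k < 0`. -/
def rAn : ℤ → Module.End ℂ Fock := fieldAn id Neg.neg

/-- The adjoint of the right moving field. -/
def rCr : ℤ → Module.End ℂ Fock := fieldCr id Neg.neg

/-- The left moving field, with reversed momenta: `b_{-1-k}` for `k ≥ 0` and `c†_{k+1}` for
`k < 0`. -/
def lAn : ℤ → Module.End ℂ Fock := fieldAn (fun k => -1 - k) (fun k => k + 1)

/-- The adjoint of the left moving field. -/
def lCr : ℤ → Module.End ℂ Fock := fieldCr (fun k => -1 - k) (fun k => k + 1)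

theorem pairRL : FieldPair rAn rCr lAn lCr := by
  refine fieldPair Function.injective_id neg_injective (fun a b h => by simpa using h)
    (fun a b h => by simpa using h) ?_ ?_ ?_ ?_
  · intro i j hi hj; simp only [id]; omega
  · intro i j hi hj; omega
  · intro n
    rcases le_or_gt 0 n with hn | hn
    · exact ⟨n, hn, Or.inl rfl⟩
    · exact ⟨-1 - n, by omega, Or.inr (by ring)⟩
  · intro n
    rcases lt_or_ge 0 n with hn | hn
    · exact ⟨-n, by omega, Or.inl (by ring)⟩
    · exact ⟨n - 1, by omega, Or.inr (by ring)⟩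

theorem pairLR : FieldPair lAn lCr rAn rCr := by
  refine fieldPair (fun a b h => by simpa using h)
    (fun a b h => by simpa using h) Function.injective_id neg_injective ?_ ?_ ?_ ?_
  · intro i j hi hj; simp only [id]; omega
  · intro i j hi hj; omega
  · intro n
    obtain ⟨k, hk, h⟩ := (show ∃ k : ℤ, 0 ≤ k ∧ (k = n ∨ -1 - k = n) by
      rcases le_or_gt 0 n with hn | hn
      · exact ⟨n, hn, Or.inl rfl⟩
      · exact ⟨-1 - n, by omega, Or.inr (by ring)⟩)
    exact ⟨k, hk, h.symm⟩
  · intro n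
    rcases lt_or_ge 0 n with hn | hn
    · exact ⟨-n, by omega, Or.inr (by ring)⟩
    · exact ⟨n - 1, by omega, Or.inl (by ring)⟩

/-! ### The operators of the model in terms of the chiral fields -/

theorem locFin_bAn : LocFin bAn := finite_bAn

theorem locFin_cAn : LocFin cAn := finite_cAn

theorem opSum_three {f A₁ A₂ A₃ : ℤ → Module.End ℂ Fock} (h₁ : LocFin A₁) (h₂ : LocFin A₂)
    (h₃ : LocFin A₃) (e₁ e₂ e₃ : ℤ ≃ ℤ) {j₁ j₂ j₃ : ℤ → ℤ} (hj₁ : ∀ k, e₁ k = j₁ k)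
    (hj₂ : ∀ k, e₂ k = j₂ k) (hj₃ : ∀ k, e₃ k = j₃ k)
    (h : ∀ k, f k = A₁ (j₁ k) + A₂ (j₂ k) + A₃ (j₃ k)) :
    opSum f = opSum A₁ + opSum A₂ + opSum A₃ := by
  simp only [← hj₁, ← hj₂, ← hj₃] at h
  rw [opSum_congr h, opSum_add ((h₁.comp e₁.injective).add (h₂.comp e₂.injective))
    (h₃.comp e₃.injective), opSum_add (h₁.comp e₁.injective) (h₂.comp e₂.injective),
    opSum_reindex, opSum_reindex, opSum_reindex]

theorem opSum_finset (S : Finset ℤ) (A : ℤ → Module.End ℂ Fock) :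
    ∑ k ∈ S, A k = opSum fun k => if k ∈ S then A k else 0 := by
  rw [opSum_eq_sum S fun k hk => if_neg hk]
  exact Finset.sum_congr rfl fun k hk => (if_pos hk).symm

theorem locFin_finset (S : Finset ℤ) (A : ℤ → Module.End ℂ Fock) :
    LocFin fun k => if k ∈ S then A k else 0 :=
  LocFin.of_finite S S.finite_toSet fun _ hk => if_neg (by simpa using hk)

theorem cAn_mul_cCr {i j : ℤ} (hij : i ≠ j) : cAn i * cCr j = -(cCr j * cAn i) := by
  have h := cAn_cCr i j
  rw [if_neg hij] at h
  refine LinearMap.ext fun x => ?_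
  exact eq_neg_of_add_eq_zero_left (LinearMap.congr_fun h x)

theorem rhoR_eq {m : ℤ} (hm : m ≠ 0) : rhoR m = rho rAn rCr m := by
  unfold rhoR rho
  have hb : ∀ d : ℤ, LocFin fun k => bAn (k - d) := fun d =>
    locFin_bAn.comp (sub_left_injective)
  have hc : ∀ d : ℤ, LocFin fun k => cAn (k - d) := fun d =>
    locFin_cAn.comp (sub_left_injective)
  split_ifs with h
  · rw [opSum_finset, ← opSum_neg (((hc m).mul_left _).ite _)]
    refine (opSum_three (((hc m).mul_left _).ite _).neg (locFin_finset _ _)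
      ((locFin_bAn.mul_left _).ite _) (Equiv.neg ℤ) (Equiv.neg ℤ) (Equiv.refl ℤ)
      (j₁ := fun k => -k) (j₂ := fun k => -k) (j₃ := fun k => k) (fun _ => rfl) (fun _ => rfl) (fun _ => rfl) fun k => ?_).symm
    simp only [rCr, rAn, fieldAn, fieldCr, id, Finset.mem_Ioc]
    rcases lt_or_ge k (-m) with h1 | h1
    · rw [if_neg (by omega), if_neg (by omega), if_pos (by omega), if_neg (by omega),
        if_neg (by omega), cAn_mul_cCr (by omega), show -(k + m) = -k - m by ring]
      simp
    · rcases lt_or_ge k 0 with h2 | h2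
      · rw [if_pos (by omega), if_neg (by omega), if_neg (by omega), if_pos (by omega),
          if_neg (by omega)]
        simp
      · rw [if_pos (by omega), if_pos (by omega), if_neg (by omega), if_neg (by omega),
          if_pos (by omega)]
        simp
  · rw [opSum_finset, ← opSum_neg ((locFin_cAn.mul_left _).ite _)]
    refine (opSum_three ((locFin_cAn.mul_left _).ite _).neg (locFin_finset _ _)
      (((hb m).mul_left _).ite _) (Equiv.subLeft (-m)) (Equiv.subLeft (-m)) (Equiv.addRight m)
      (j₁ := fun k => -m - k) (j₂ := fun k => -m - k) (j₃ := fun k => k + m) (fun _ => rfl) (fun _ => rfl) (fun _ => rfl)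
      fun k => ?_).symm
    simp only [rCr, rAn, fieldAn, fieldCr, id,
      Finset.mem_Ioc]
    rcases lt_or_ge k 0 with h1 | h1
    · rw [if_neg (by omega), if_neg (by omega), if_pos (by omega), if_neg (by omega),
        if_neg (by omega), cAn_mul_cCr (by omega), show -(k + m) = -m - k by ring,
        show -m - k + m = -k by ring]
      simp
    · rcases lt_or_ge k (-m) with h2 | h2
      · rw [if_neg (by omega), if_pos (by omega), if_neg (by omega), if_pos (by omega),
          if_neg (by omega), show -(k + m) = -m - k by ring, show -(-m - k) - m = k by ring]
        simp
      · rw [if_pos (by omega), if_pos (by omega), if_neg (by omega), if_neg (by omega),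
          if_pos (by omega), show k + m - m = k by ring]
        simp

theorem rhoL_eq {m : ℤ} (hm : m ≠ 0) : rhoL m = rho lAn lCr (-m) := by
  unfold rhoL rho
  have hb : ∀ d : ℤ, LocFin fun k => bAn (k - d) := fun d =>
    locFin_bAn.comp (sub_left_injective)
  have hc : ∀ d : ℤ, LocFin fun k => cAn (k - d) := fun d =>
    locFin_cAn.comp (sub_left_injective)
  have hsub : ∀ A B : Module.End ℂ Fock, A - B = A + -B := fun A B =>
    LinearMap.ext fun x => by simp [sub_eq_add_neg]
  split_ifs with h
  · rw [opSum_finset, hsub, ← opSum_neg (((hc m).mul_left _).ite _)]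
    refine (opSum_three ((locFin_bAn.mul_left _).ite _) (locFin_finset _ _)
      (((hc m).mul_left _).ite _).neg (Equiv.subLeft (-1)) (Equiv.subLeft (-1)) (Equiv.addRight 1)
      (j₁ := fun k => -1 - k) (j₂ := fun k => -1 - k) (j₃ := fun k => k + 1) (fun _ => rfl) (fun _ => rfl) (fun _ => rfl)
      fun k => ?_).symm
    simp only [lCr, lAn, fieldAn, fieldCr,
      Finset.mem_Ico]
    rcases lt_or_ge k 0 with h1 | h1
    · rw [if_neg (by omega), if_neg (by omega), if_neg (by omega), if_neg (by omega),
        if_pos (by omega), cAn_mul_cCr (by omega), show k + -m + 1 = k + 1 - m by ring]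
      simp
    · rcases lt_or_ge k m with h2 | h2
      · rw [if_neg (by omega), if_pos (by omega), if_neg (by omega), if_pos (by omega),
          if_neg (by omega), show -(-1 - k) - m = k + -m + 1 by ring]
        simp
      · rw [if_pos (by omega), if_pos (by omega), if_pos (by omega), if_neg (by omega),
          if_neg (by omega), show -1 - (k + -m) = -1 - k + m by ring]
        simp
  · rw [opSum_finset, hsub, ← opSum_neg ((locFin_cAn.mul_left _).ite _)]
    refine (opSum_three (((hb m).mul_left _).ite _) (locFin_finset _ _)
      ((locFin_cAn.mul_left _).ite _).neg (Equiv.subLeft (m - 1)) (Equiv.subLeft (m - 1))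
      (Equiv.addRight (1 - m)) (j₁ := fun k => m - 1 - k) (j₂ := fun k => m - 1 - k)
      (j₃ := fun k => k + (1 - m)) (fun _ => rfl) (fun _ => rfl) (fun _ => rfl) fun k => ?_).symm
    simp only [lCr, lAn, fieldAn, fieldCr,
      Finset.mem_Ico]
    rcases lt_or_ge k m with h1 | h1
    · rw [if_neg (by omega), if_neg (by omega), if_neg (by omega), if_neg (by omega),
        if_pos (by omega), cAn_mul_cCr (by omega), show k + -m + 1 = k + (1 - m) by ring,
        show k + (1 - m) + m = k + 1 by ring]
      simp
    · rcases lt_or_ge k 0 with h2 | h2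
      · rw [if_pos (by omega), if_neg (by omega), if_neg (by omega), if_pos (by omega),
          if_neg (by omega), show -1 - (k + -m) = m - 1 - k by ring,
          show -(m - 1 - k) + m = k + 1 by ring]
        simp
      · rw [if_pos (by omega), if_pos (by omega), if_pos (by omega), if_neg (by omega),
          if_neg (by omega), show -1 - (k + -m) = m - 1 - k by ring,
          show m - 1 - k - m = -1 - k by ring]
        simp

theorem num_r (k : ℤ) : num rAn rCr k =
    (if 0 ≤ k then bCr k * bAn k else 0) + if 0 < -k then -(cCr (-k) * cAn (-k)) else 0 := by
  unfold num rAn rCr fieldAn fieldCr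
  rcases lt_or_ge k 0 with h | h
  · rw [if_neg (by omega), if_neg (by omega), if_pos h, if_neg (by omega), if_pos (by omega)]
    refine LinearMap.ext fun x => ?_
    have := LinearMap.congr_fun (cAn_cCr (-k) (-k)) x
    simp only [if_true, LinearMap.add_apply, Module.End.mul_apply, Module.End.one_apply] at this
    simp only [LinearMap.sub_apply, LinearMap.add_apply, Module.End.mul_apply,
      Module.End.one_apply, LinearMap.neg_apply, LinearMap.zero_apply]
    linear_combination (norm := module) (1 : ℂ) • this
  · rw [if_pos h, if_pos h, if_neg (by omega), if_pos h, if_neg (by omega)]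
    simp

theorem num_l (k : ℤ) : num lAn lCr k =
    (if -1 - k < 0 then bCr (-1 - k) * bAn (-1 - k) else 0) +
      if k + 1 ≤ 0 then -(cCr (k + 1) * cAn (k + 1)) else 0 := by
  unfold num lAn lCr fieldAn fieldCr
  rcases lt_or_ge k 0 with h | h
  · rw [if_neg (by omega), if_neg (by omega), if_pos h, if_neg (by omega), if_pos (by omega)]
    refine LinearMap.ext fun x => ?_
    have := LinearMap.congr_fun (cAn_cCr (k + 1) (k + 1)) x
    simp only [if_true, LinearMap.add_apply, Module.End.mul_apply, Module.End.one_apply] at this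
    simp only [LinearMap.sub_apply, LinearMap.add_apply, Module.End.mul_apply,
      Module.End.one_apply, LinearMap.neg_apply, LinearMap.zero_apply]
    linear_combination (norm := module) (1 : ℂ) • this
  · rw [if_pos h, if_pos h, if_neg (by omega), if_pos (by omega), if_neg (by omega)]
    simp

theorem opSum_two {f A₁ A₂ : ℤ → Module.End ℂ Fock} (h₁ : LocFin A₁) (h₂ : LocFin A₂)
    (e₁ e₂ : ℤ ≃ ℤ) {j₁ j₂ : ℤ → ℤ} (hj₁ : ∀ k, e₁ k = j₁ k)
    (hj₂ : ∀ k, e₂ k = j₂ k) (h : ∀ k, f k = A₁ (j₁ k) + A₂ (j₂ k)) :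
    opSum f = opSum fun k => A₁ k + A₂ k := by
  simp only [← hj₁, ← hj₂] at h
  rw [opSum_congr h, opSum_add (h₁.comp e₁.injective) (h₂.comp e₂.injective),
    opSum_reindex, opSum_reindex, opSum_add h₁ h₂]

theorem locFin_nb : LocFin fun k => bCr k * bAn k := locFin_bAn.mul_left _

theorem locFin_nc : LocFin fun k => cCr k * cAn k := locFin_cAn.mul_left _

theorem chg_r : chg rAn rCr = opSum fun n : ℤ =>
    (if 0 ≤ n then bCr n * bAn n else 0) + if 0 < n then -(cCr n * cAn n) else 0 :=
  opSum_two (locFin_nb.ite _) (locFin_nc.neg.ite _) (Equiv.refl ℤ) (Equiv.neg ℤ)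
    (j₁ := fun k => k) (j₂ := fun k => -k) (fun _ => rfl) (fun _ => rfl) num_r

theorem chg_l : chg lAn lCr = opSum fun n : ℤ =>
    (if n < 0 then bCr n * bAn n else 0) + if n ≤ 0 then -(cCr n * cAn n) else 0 :=
  opSum_two (locFin_nb.ite _) (locFin_nc.neg.ite _) (Equiv.subLeft (-1)) (Equiv.addRight 1)
    (j₁ := fun k => -1 - k) (j₂ := fun k => k + 1) (fun _ => rfl) (fun _ => rfl) num_l

theorem erg_r : erg rAn rCr = opSum fun n : ℤ =>
    (n : ℂ) • (if 0 ≤ n then bCr n * bAn n else 0) +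
      (-n : ℂ) • if 0 < n then -(cCr n * cAn n) else 0 :=
  opSum_two ((locFin_nb.ite _).smul _) ((locFin_nc.neg.ite _).smul _) (Equiv.refl ℤ)
    (Equiv.neg ℤ) (j₁ := fun k => k) (j₂ := fun k => -k) (fun _ => rfl) (fun _ => rfl)
    fun k => by rw [num_r, smul_add]; simp

theorem erg_l : erg lAn lCr = opSum fun n : ℤ =>
    (-1 - n : ℂ) • (if n < 0 then bCr n * bAn n else 0) +
      (n - 1 : ℂ) • if n ≤ 0 then -(cCr n * cAn n) else 0 :=
  opSum_two ((locFin_nb.ite _).smul _) ((locFin_nc.neg.ite _).smul _) (Equiv.subLeft (-1))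
    (Equiv.addRight 1) (j₁ := fun k => -1 - k) (j₂ := fun k => k + 1) (fun _ => rfl)
    (fun _ => rfl) fun k => by rw [num_l, smul_add]; simp

theorem axial_eq : axial = chg rAn rCr - chg lAn lCr := by
  rw [chg_r, chg_l, ← opSum_sub ((locFin_nb.ite _).add (locFin_nc.neg.ite _))
    ((locFin_nb.ite _).add (locFin_nc.neg.ite _))]
  refine opSum_congr fun n => LinearMap.ext fun x => ?_
  rcases lt_trichotomy n 0 with h | h | h
  · simp [h, h.le, h.not_ge, h.not_gt]
    abel
  · simp [h]
  · simp [h, h.le, h.not_ge, h.not_gt]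

theorem diracH_eq (L : ℝ) (hL : 0 < L) : diracH L = ((2 * Real.pi / L : ℝ) : ℂ) •
    (erg rAn rCr + (erg lAn lCr + chg lAn lCr)) := by
  have h1 := ((locFin_nb.ite fun n : ℤ => n < 0).add (locFin_nc.neg.ite fun n : ℤ => n ≤ 0))
  have h2 := (((locFin_nb.ite fun n : ℤ => n < 0).smul fun n => (-1 - n : ℂ)).add
    ((locFin_nc.neg.ite fun n : ℤ => n ≤ 0).smul fun n => (n - 1 : ℂ)))
  have h3 := (((locFin_nb.ite fun n : ℤ => 0 ≤ n).smul fun n => (n : ℂ)).add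
    ((locFin_nc.neg.ite fun n : ℤ => 0 < n).smul fun n => (-n : ℂ)))
  rw [erg_r, erg_l, chg_l, ← opSum_add h2 h1, ← opSum_add h3 (h2.add h1),
    ← opSum_smul (h3.add (h2.add h1))]
  refine opSum_congr fun n => LinearMap.ext fun x => ?_
  have h4 : |mom L n| = 2 * Real.pi / L * |(n : ℝ)| := by
    unfold mom
    rw [mul_div_right_comm, abs_mul, abs_of_pos (by positivity)]
  rw [h4]
  rcases lt_trichotomy n 0 with h | h | h
  · rw [abs_of_neg (by exact_mod_cast h)]
    simp [h, h.le, h.not_ge, h.not_gt]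
    module
  · simp [h]
  · rw [abs_of_pos (by exact_mod_cast h)]
    simp [h, h.le, h.not_ge, h.not_gt]
    module

/-! ### Diagonal operators on basis vectors -/

theorem nb_basis (k : ℤ) (s : Cfg) :
    bCr k (bAn k (basisVec s)) = if k ∈ s.1 then basisVec s else 0 := by
  rw [bAn_basis]
  split_ifs with h
  · rw [map_smul, bCr_basis, if_neg (by simp), passSign_erase h, smul_smul]
    simp [Finset.insert_erase h, passSign_mul_self]
  · simp

theorem nc_basis (k : ℤ) (s : Cfg) :
    cCr k (cAn k (basisVec s)) = if k ∈ s.2 then basisVec s else 0 := by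
  rw [cAn_basis]
  split_ifs with h
  · have h3 : (-1 : ℂ) ^ s.1.card * passSign s.2 k * ((-1) ^ s.1.card * passSign s.2 k) = 1 := by
      linear_combination (passSign s.2 k * passSign s.2 k) * neg_one_pow_mul_self s.1.card +
        passSign_mul_self s.2 k
    rw [map_smul, cCr_basis, if_neg (by simp), passSign_erase h, smul_smul]
    simp [Finset.insert_erase h, h3]
  · simp

theorem opSum_diag_basis (u v : ℤ → ℂ) (s : Cfg) :
    opSum (fun n : ℤ => u n • (bCr n * bAn n) + v n • (cCr n * cAn n)) (basisVec s) =
      (∑ n ∈ s.1, u n + ∑ n ∈ s.2, v n) • basisVec s := by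
  rw [opSum_add (locFin_nb.smul u) (locFin_nc.smul v), LinearMap.add_apply,
    opSum_apply_eq_sum (locFin_nb.smul u) (basisVec s) (S := s.1)
      (fun i hi => by simp [nb_basis, hi]),
    opSum_apply_eq_sum (locFin_nc.smul v) (basisVec s) (S := s.2)
      (fun i hi => by simp [nc_basis, hi]), add_smul, Finset.sum_smul, Finset.sum_smul]
  congr 1
  · exact Finset.sum_congr rfl fun i hi => by simp [nb_basis, hi]
  · exact Finset.sum_congr rfl fun i hi => by simp [nc_basis, hi]

/-- The energy `∑ |k|` of a configuration. -/
def cfgErg (s : Cfg) : ℝ := ∑ k ∈ s.1, |(k : ℝ)| + ∑ k ∈ s.2, |(k : ℝ)|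

/-- The axial charge of a configuration. -/
def cfgAx (s : Cfg) : ℝ :=
  ∑ k ∈ s.1, (if 0 ≤ k then 1 else -1) + ∑ k ∈ s.2, (if 0 < k then -1 else 1)

theorem axial_basis (s : Cfg) : axial (basisVec s) = (cfgAx s : ℂ) • basisVec s := by
  unfold axial
  rw [opSum_diag_basis]
  congr 1
  simp only [cfgAx]
  push_cast
  congr 1 <;> exact Finset.sum_congr rfl fun i _ => by split_ifs <;> simp

theorem diracH_basis (L : ℝ) (hL : 0 < L) (s : Cfg) : diracH L (basisVec s) =
    ((2 * Real.pi / L * cfgErg s : ℝ) : ℂ) • basisVec s := by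
  have : diracH L = opSum fun n : ℤ => ((|mom L n| : ℝ) : ℂ) • (bCr n * bAn n) +
      ((|mom L n| : ℝ) : ℂ) • (cCr n * cAn n) := opSum_congr fun n => by rw [smul_add]
  rw [this, opSum_diag_basis]
  congr 1
  have h4 : ∀ n, |mom L n| = 2 * Real.pi / L * |(n : ℝ)| := fun n => by
    unfold mom
    rw [mul_div_right_comm, abs_mul, abs_of_pos (by positivity)]
  simp only [cfgErg, h4, mul_add, Finset.mul_sum]
  push_cast
  rfl

theorem chg_add_basis (s : Cfg) : (chg rAn rCr + chg lAn lCr) (basisVec s) =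
    ((s.1.card : ℂ) - s.2.card) • basisVec s := by
  rw [chg_r, chg_l, ← opSum_add ((locFin_nb.ite _).add (locFin_nc.neg.ite _))
    ((locFin_nb.ite _).add (locFin_nc.neg.ite _))]
  rw [opSum_congr (B := fun n : ℤ => (1 : ℂ) • (bCr n * bAn n) + (-1 : ℂ) • (cCr n * cAn n)),
    opSum_diag_basis]
  · simp [sub_eq_add_neg]
  · intro n
    refine LinearMap.ext fun x => ?_
    rcases lt_trichotomy n 0 with h | h | h
    · simp [h, h.le, h.not_ge, h.not_gt]
    · simp [h]
    · simp [h, h.le, h.not_ge, h.not_gt]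

theorem chg_r_basis {s : Cfg} (hs : s.1.card = s.2.card) :
    chg rAn rCr (basisVec s) = ((cfgAx s / 2 : ℝ) : ℂ) • basisVec s := by
  have h1 := chg_add_basis s
  have h2 := axial_basis s
  rw [axial_eq] at h2
  rw [hs, sub_self, zero_smul] at h1
  simp only [LinearMap.add_apply, LinearMap.sub_apply] at h1 h2
  have h3 : (2 : ℂ) • chg rAn rCr (basisVec s) = (cfgAx s : ℂ) • basisVec s := by
    rw [two_smul, ← h2]
    nth_rewrite 2 [← sub_add_cancel (chg rAn rCr (basisVec s)) (chg lAn lCr (basisVec s))]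
    linear_combination (norm := module) (1 : ℂ) • h1
  have h4 := congrArg (fun v => (2⁻¹ : ℂ) • v) h3
  simp only [smul_smul] at h4
  rw [inv_mul_cancel₀ two_ne_zero, one_smul] at h4
  rw [h4]
  congr 1
  push_cast
  ring

theorem chg_l_basis {s : Cfg} (hs : s.1.card = s.2.card) :
    chg lAn lCr (basisVec s) = (-(cfgAx s / 2 : ℝ) : ℂ) • basisVec s := by
  have h1 := chg_add_basis s
  rw [hs, sub_self, zero_smul, LinearMap.add_apply, chg_r_basis hs] at h1
  rw [neg_smul]
  exact eq_neg_of_add_eq_zero_right h1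

/-- The Kronig identity on the zero charge basis vectors. -/
theorem sug_basis {s : Cfg} (hs : s.1.card = s.2.card) :
    sug rAn rCr (basisVec s) + sug lAn lCr (basisVec s) =
      ((cfgErg s - cfgAx s ^ 2 / 4 + cfgAx s / 2 : ℝ) : ℂ) • basisVec s := by
  have hr := LinearMap.congr_fun pairRL.kronig (basisVec s)
  have hl := LinearMap.congr_fun pairLR.kronig (basisVec s)
  have hd := LinearMap.congr_fun (diracH_eq 1 one_pos) (basisVec s)
  rw [diracH_basis 1 one_pos] at hd
  have hpi : (Real.pi : ℂ) ≠ 0 := by exact_mod_cast Real.pi_ne_zero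
  simp only [LinearMap.add_apply, LinearMap.sub_apply, LinearMap.smul_apply,
    Module.End.mul_apply, chg_r_basis hs, chg_l_basis hs, map_smul, LinearMap.zero_apply]
    at hr hl hd
  push_cast at hd
  have hd' := congrArg (fun v => ((2 * Real.pi / 1 : ℂ)⁻¹) • v) hd
  simp only [smul_smul] at hd'
  rw [← mul_assoc, inv_mul_cancel₀ (by simp [hpi]), one_smul, one_mul] at hd'
  push_cast at hr hl hd' ⊢
  linear_combination (norm := module) (1 / 2 : ℂ) • hr + (1 / 2 : ℂ) • hl - (1 : ℂ) • hd'

/-! ### Restriction to the zero charge sector -/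

/-- The inclusion `𝓕₀ → 𝓕`. -/
def inc : Fock0 →ₗ[ℂ] Fock := Finsupp.lmapDomain ℂ ℂ (Subtype.val : Cfg0 → Cfg)

theorem inc_basis (s : Cfg0) : inc (basisVec0 s) = basisVec s.1 := by
  simp [inc, basisVec0, basisVec]

theorem inc_apply (x : Fock0) (s : Cfg0) : inc x s.1 = x s :=
  Finsupp.mapDomain_apply Subtype.val_injective x s

theorem inc_injective : Function.Injective inc := Finsupp.mapDomain_injective Subtype.val_injective

theorem fock0_ext {M : Type*} [AddCommMonoid M] [Module ℂ M] {A B : Fock0 →ₗ[ℂ] M}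
    (h : ∀ s, A (basisVec0 s) = B (basisVec0 s)) : A = B :=
  Finsupp.lhom_ext' fun s => LinearMap.ext_ring (h s)

theorem inc_mem (x : Fock0) : inc x ∈ chargeSub 0 := by
  induction x using Finsupp.induction_linear with
  | zero => simp
  | add x y hx hy => rw [map_add]; exact Submodule.add_mem _ hx hy
  | single s a =>
    have : Finsupp.single s a = a • basisVec0 s := by simp [basisVec0]
    rw [this, map_smul, inc_basis]
    refine Submodule.smul_mem _ _ ?_
    convert basis_mem_chargeSub s.1
    rw [s.2, sub_self]

theorem restrict0_apply (A : Module.End ℂ Fock) (x : Fock0) (s : Cfg0) :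
    restrict0 A x s = A (inc x) s.1 := rfl

theorem inc_restrict0 {A : Module.End ℂ Fock} (hA : HasCharge 0 A) (x : Fock0) :
    inc (restrict0 A x) = A (inc x) := by
  refine Finsupp.ext fun s => ?_
  by_cases hs : s.1.card = s.2.card
  · exact (inc_apply _ ⟨s, hs⟩).trans (restrict0_apply A x ⟨s, hs⟩)
  · have h1 : ∀ y ∈ chargeSub 0, y s = 0 := fun y hy => by
      by_contra hc
      have : (s.1.card : ℤ) - s.2.card = 0 := hy (Finsupp.mem_support_iff.2 hc)
      omega
    rw [h1 _ (inc_mem _), h1 _ (by simpa using hA 0 _ (inc_mem x))]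

theorem restrict0_add (A B : Module.End ℂ Fock) : restrict0 (A + B) = restrict0 A + restrict0 B :=
  LinearMap.ext fun _ => Finsupp.ext fun _ => rfl

theorem restrict0_smul (c : ℂ) (A : Module.End ℂ Fock) : restrict0 (c • A) = c • restrict0 A :=
  LinearMap.ext fun _ => Finsupp.ext fun _ => rfl

theorem restrict0_mul {A B : Module.End ℂ Fock} (hB : HasCharge 0 B) (x : Fock0) :
    restrict0 (A * B) x = restrict0 A (restrict0 B x) := Finsupp.ext fun s => by
  rw [restrict0_apply, restrict0_apply, inc_restrict0 hB]; rfl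

theorem restrict0_basis {A : Module.End ℂ Fock} {w : Cfg → ℝ}
    (h : ∀ s : Cfg, A (basisVec s) = (w s : ℂ) • basisVec s) (s : Cfg0) :
    restrict0 A (basisVec0 s) = (w s.1 : ℂ) • basisVec0 s := by
  apply Finsupp.ext
  intro t
  rw [restrict0_apply, inc_basis, h, ← inc_basis]
  simp only [Finsupp.smul_apply, inc_apply]

theorem inner_emb (x y : Fock0) : inner ℂ (emb x) (emb y) = ip (inc x) (inc y) := by
  induction y using Finsupp.induction_linear with
  | zero => simp
  | add y z hy hz => rw [map_add, inner_add_right, hy, hz, map_add, map_add]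
  | single s a =>
    have h1 : Finsupp.single s a = a • basisVec0 s := by simp [basisVec0]
    have h2 : emb (basisVec0 s) = lp.single 2 s (1 : ℂ) := by simp [emb, basisVec0]
    rw [h1, map_smul, inner_smul_right, h2, map_smul, map_smul, inc_basis, ip_basis_right]
    rw [lp.inner_single_right, inc_apply, emb_apply]
    simp

theorem inner_emb_of_adj {A B : Module.End ℂ Fock} (h : IsAdj A B) (hA : HasCharge 0 A)
    (hB : HasCharge 0 B) (x y : Fock0) :
    inner ℂ (emb (restrict0 A x)) (emb y) = inner ℂ (emb x) (emb (restrict0 B y)) := by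
  rw [inner_emb, inner_emb, inc_restrict0 hA, inc_restrict0 hB, h]

/-! ### The bosonic operators -/

/-- The right moving boson annihilation operators `ϱᴿ(-m)`. -/
def alpha (m : ℕ+) : Module.End ℂ Fock0 := restrict0 (rhoR (-(m : ℤ)))

/-- The right moving boson creation operators `ϱᴿ(m)`. -/
def alphaD (m : ℕ+) : Module.End ℂ Fock0 := restrict0 (rhoR (m : ℤ))

/-- The left moving boson annihilation operators `ϱᴸ(m)`. -/
def beta (m : ℕ+) : Module.End ℂ Fock0 := restrict0 (rhoL (m : ℤ))

/-- The left moving boson creation operators `ϱᴸ(-m)`. -/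
def betaD (m : ℕ+) : Module.End ℂ Fock0 := restrict0 (rhoL (-(m : ℤ)))

theorem alpha_eq (m : ℕ+) : alpha m = restrict0 (rho rAn rCr (-(m : ℤ))) := by
  rw [alpha, rhoR_eq (neg_ne_zero.2 (pnat_ne m))]

theorem alphaD_eq (m : ℕ+) : alphaD m = restrict0 (rho rAn rCr (m : ℤ)) := by
  rw [alphaD, rhoR_eq (pnat_ne m)]

theorem beta_eq (m : ℕ+) : beta m = restrict0 (rho lAn lCr (-(m : ℤ))) := by
  rw [beta, rhoL_eq (pnat_ne m)]

theorem betaD_eq (m : ℕ+) : betaD m = restrict0 (rho lAn lCr (m : ℤ)) := by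
  rw [betaD, rhoL_eq (neg_ne_zero.2 (pnat_ne m)), neg_neg]

theorem charge_rhoR {m : ℤ} (hm : m ≠ 0) : HasCharge 0 (rhoR m) := by
  rw [rhoR_eq hm]; exact pairRL.fst.charge_rho hm

theorem charge_rhoL {m : ℤ} (hm : m ≠ 0) : HasCharge 0 (rhoL m) := by
  rw [rhoL_eq hm]; exact pairRL.snd.charge_rho (neg_ne_zero.2 hm)

theorem restrict_comm {A B : Module.End ℂ Fock} (hA : HasCharge 0 A) (hB : HasCharge 0 B)
    (h : A * B - B * A = 0) (x : Fock0) :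
    restrict0 A (restrict0 B x) = restrict0 B (restrict0 A x) := by
  rw [← restrict0_mul hB, ← restrict0_mul hA]
  refine Finsupp.ext fun s => ?_
  rw [restrict0_apply, restrict0_apply]
  have := LinearMap.congr_fun h (inc x)
  rw [sub_eq_zero.1 this]

theorem rho_r_l {m n : ℤ} (hm : m ≠ 0) (hn : n ≠ 0) :
    rho rAn rCr m * rho lAn lCr n - rho lAn lCr n * rho rAn rCr m = 0 := by
  refine pairRL.fst.rho_comm_of_comm hm (fun i => ?_) (fun i => ?_)
  · have := comm_swap (pairRL.snd.rho_comm_of_anticomm (x := rAn i) (fun j => ?_) (fun j => ?_) hn)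
    · rw [this, end_neg_zero]
    · rw [add_comm]; exact pairRL.an_an i j
    · rw [add_comm]; exact pairRL.an_cr i j
  · have := comm_swap (pairRL.snd.rho_comm_of_anticomm (x := rCr i) (fun j => ?_) (fun j => ?_) hn)
    · rw [this, end_neg_zero]
    · rw [add_comm]; exact pairRL.cr_an i j
    · rw [add_comm]; exact pairRL.cr_cr i j

section Modes

variable (m n : ℕ+) (x y : Fock0)

theorem alpha_alpha : alpha m (alpha n x) = alpha n (alpha m x) := by
  rw [alpha_eq, alpha_eq]
  have h1 := pnat_pos m; have h2 := pnat_pos n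
  exact restrict_comm (pairRL.fst.charge_rho (by omega)) (pairRL.fst.charge_rho (by omega))
    (pairRL.fst.rho_rho (by omega) (by omega) (by omega)) x

theorem alphaD_alphaD : alphaD m (alphaD n x) = alphaD n (alphaD m x) := by
  rw [alphaD_eq, alphaD_eq]
  have h1 := pnat_pos m; have h2 := pnat_pos n
  exact restrict_comm (pairRL.fst.charge_rho (by omega)) (pairRL.fst.charge_rho (by omega))
    (pairRL.fst.rho_rho (by omega) (by omega) (by omega)) x

theorem beta_beta : beta m (beta n x) = beta n (beta m x) := by
  rw [beta_eq, beta_eq]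
  have h1 := pnat_pos m; have h2 := pnat_pos n
  exact restrict_comm (pairRL.snd.charge_rho (by omega)) (pairRL.snd.charge_rho (by omega))
    (pairRL.snd.rho_rho (by omega) (by omega) (by omega)) x

theorem betaD_betaD : betaD m (betaD n x) = betaD n (betaD m x) := by
  rw [betaD_eq, betaD_eq]
  have h1 := pnat_pos m; have h2 := pnat_pos n
  exact restrict_comm (pairRL.snd.charge_rho (by omega)) (pairRL.snd.charge_rho (by omega))
    (pairRL.snd.rho_rho (by omega) (by omega) (by omega)) x

theorem alpha_beta : alpha m (beta n x) = beta n (alpha m x) := by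
  rw [alpha_eq, beta_eq]
  have h1 := pnat_pos m; have h2 := pnat_pos n
  exact restrict_comm (pairRL.fst.charge_rho (by omega)) (pairRL.snd.charge_rho (by omega))
    (rho_r_l (by omega) (by omega)) x

theorem alpha_betaD : alpha m (betaD n x) = betaD n (alpha m x) := by
  rw [alpha_eq, betaD_eq]
  have h1 := pnat_pos m; have h2 := pnat_pos n
  exact restrict_comm (pairRL.fst.charge_rho (by omega)) (pairRL.snd.charge_rho (by omega))
    (rho_r_l (by omega) (by omega)) x

theorem alphaD_beta : alphaD m (beta n x) = beta n (alphaD m x) := by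
  rw [alphaD_eq, beta_eq]
  have h1 := pnat_pos m; have h2 := pnat_pos n
  exact restrict_comm (pairRL.fst.charge_rho (by omega)) (pairRL.snd.charge_rho (by omega))
    (rho_r_l (by omega) (by omega)) x

theorem alphaD_betaD : alphaD m (betaD n x) = betaD n (alphaD m x) := by
  rw [alphaD_eq, betaD_eq]
  have h1 := pnat_pos m; have h2 := pnat_pos n
  exact restrict_comm (pairRL.fst.charge_rho (by omega)) (pairRL.snd.charge_rho (by omega))
    (rho_r_l (by omega) (by omega)) x

theorem restrict_ccr {ψ ψd : ℤ → Module.End ℂ Fock} (h : Chiral ψ ψd) :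
    restrict0 (rho ψ ψd (-(m : ℤ))) (restrict0 (rho ψ ψd (n : ℤ)) x) =
      restrict0 (rho ψ ψd (n : ℤ)) (restrict0 (rho ψ ψd (-(m : ℤ))) x) +
        if m = n then (m : ℂ) • x else 0 := by
  have h1 := pnat_pos m; have h2 := pnat_pos n
  split_ifs with hmn
  · subst hmn
    rw [← restrict0_mul (h.charge_rho (by omega)), ← restrict0_mul (h.charge_rho (by omega))]
    refine Finsupp.ext fun s => ?_
    have h3 := LinearMap.congr_fun (h.rho_rho_neg h1) (inc x)
    rw [LinearMap.sub_apply] at h3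
    have h4 := congrArg (fun v : Fock => v s.1) (sub_eq_iff_eq_add.1 h3)
    simp only [Finsupp.add_apply, LinearMap.smul_apply, Module.End.one_apply,
      Finsupp.smul_apply, inc_apply, restrict0_apply] at h4 ⊢
    rw [h4, add_comm]
    push_cast
    rfl
  · rw [add_zero]
    have h3 : (m : ℤ) ≠ n := fun hc => hmn (by exact_mod_cast hc)
    exact restrict_comm (h.charge_rho (by omega)) (h.charge_rho (by omega))
      (h.rho_rho (by omega) (by omega) (by omega)) x

theorem alpha_alphaD : alpha m (alphaD n x) =
    alphaD n (alpha m x) + if m = n then (m : ℂ) • x else 0 := by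
  rw [alpha_eq, alphaD_eq]
  exact restrict_ccr m n x pairRL.fst

theorem beta_betaD : beta m (betaD n x) =
    betaD n (beta m x) + if m = n then (m : ℂ) • x else 0 := by
  rw [beta_eq, betaD_eq]
  exact restrict_ccr m n x pairRL.snd

theorem inner_alphaD : inner ℂ (emb (alphaD m x)) (emb y) = inner ℂ (emb x) (emb (alpha m y)) := by
  rw [alpha_eq, alphaD_eq]
  have h1 := pnat_ne m
  exact inner_emb_of_adj (pairRL.fst.adj_rho h1) (pairRL.fst.charge_rho h1)
    (pairRL.fst.charge_rho (by omega)) x y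

theorem inner_betaD : inner ℂ (emb (betaD m x)) (emb y) = inner ℂ (emb x) (emb (beta m y)) := by
  rw [beta_eq, betaD_eq]
  have h1 := pnat_ne m
  exact inner_emb_of_adj (pairRL.snd.adj_rho h1) (pairRL.snd.charge_rho h1)
    (pairRL.snd.charge_rho (by omega)) x y

end Modes

theorem inner_alpha (m : ℕ+) (x y : Fock0) :
    inner ℂ (emb (alpha m x)) (emb y) = inner ℂ (emb x) (emb (alphaD m y)) := by
  rw [← inner_conj_symm, ← inner_alphaD, inner_conj_symm]

theorem inner_beta (m : ℕ+) (x y : Fock0) :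
    inner ℂ (emb (beta m x)) (emb y) = inner ℂ (emb x) (emb (betaD m y)) := by
  rw [← inner_conj_symm, ← inner_betaD, inner_conj_symm]

theorem finite_alpha (x : Fock0) : {m : ℕ+ | alpha m x ≠ 0 ∨ beta m x ≠ 0}.Finite := by
  refine ((pairRL.fst.locFin_rho_neg (inc x)).union
    (pairRL.snd.locFin_rho_neg (inc x))).subset fun m hm => ?_
  by_contra hc
  simp only [mem_union, Function.mem_support, not_or, not_not] at hc
  rcases hm with hm | hm
  · refine hm (Finsupp.ext fun s => ?_)
    rw [alpha_eq, restrict0_apply, hc.1]; rfl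
  · refine hm (Finsupp.ext fun s => ?_)
    rw [beta_eq, restrict0_apply, hc.2]; rfl

/-- The modes which do not annihilate `x`. -/
def modes (x : Fock0) : Finset ℕ+ := (finite_alpha x).toFinset

theorem alpha_of_notMem {x : Fock0} {m : ℕ+} (h : m ∉ modes x) : alpha m x = 0 := by
  by_contra hc
  exact h (by simp [modes, hc])

theorem beta_of_notMem {x : Fock0} {m : ℕ+} (h : m ∉ modes x) : beta m x = 0 := by
  by_contra hc
  exact h (by simp [modes, hc])

/-- The excitation number `∑ m (A†_m A_m + A†_{-m} A_{-m})` of a configuration. -/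
def lev (s : Cfg0) : ℝ := cfgErg s.1 - cfgAx s.1 ^ 2 / 4 + cfgAx s.1 / 2

/-- The diagonal operator with given eigenvalues. -/
def dg (w : Cfg0 → ℝ) : Module.End ℂ Fock0 :=
  Finsupp.linearCombination ℂ fun s => (w s : ℂ) • basisVec0 s

theorem dg_basis (w : Cfg0 → ℝ) (s : Cfg0) : dg w (basisVec0 s) = (w s : ℂ) • basisVec0 s := by
  simp [dg, basisVec0]

theorem dg_apply (w : Cfg0 → ℝ) (x : Fock0) (s : Cfg0) : dg w x s = w s * x s := by
  have : Finsupp.lapply s ∘ₗ dg w = (w s : ℂ) • Finsupp.lapply s := fock0_ext fun t => by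
    rw [LinearMap.comp_apply, dg_basis]
    simp only [LinearMap.smul_apply, map_smul, Finsupp.lapply_apply, smul_eq_mul, basisVec0,
      Finsupp.single_apply]
    split_ifs with h
    · rw [h]
    · simp
  exact LinearMap.congr_fun this x

theorem restrict0_axial : restrict0 axial = dg fun s => cfgAx s.1 := fock0_ext fun s => by
  rw [restrict0_basis axial_basis, dg_basis]

theorem restrict0_diracH (L : ℝ) (hL : 0 < L) :
    restrict0 (diracH L) = dg fun s => 2 * Real.pi / L * cfgErg s.1 := fock0_ext fun s => by
  rw [restrict0_basis (diracH_basis L hL), dg_basis]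

/-- The Kronig identity on `𝓕₀`. -/
theorem sum_modes (x : Fock0) {S : Finset ℕ+} (hS : modes x ⊆ S) :
    ∑ m ∈ S, (alphaD m (alpha m x) + betaD m (beta m x)) = dg lev x := by
  have h1 : ∀ x : Fock0, inc (dg lev x) = sug rAn rCr (inc x) + sug lAn lCr (inc x) := by
    intro x
    have : inc ∘ₗ dg lev = (sug rAn rCr + sug lAn lCr) ∘ₗ inc := fock0_ext fun s => by
      rw [LinearMap.comp_apply, dg_basis, LinearMap.comp_apply, inc_basis, map_smul, inc_basis,
        LinearMap.add_apply, sug_basis s.2]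
      rfl
    exact LinearMap.congr_fun this x
  apply inc_injective
  rw [h1, map_sum, sug, sug, opSum_apply_eq_sum pairRL.fst.locFin_sug (inc x) (S := S),
    opSum_apply_eq_sum pairRL.snd.locFin_sug (inc x) (S := S), ← Finset.sum_add_distrib]
  · refine Finset.sum_congr rfl fun m _ => ?_
    have h2 := pnat_ne m
    rw [alphaD_eq, alpha_eq, betaD_eq, beta_eq, map_add,
      inc_restrict0 (pairRL.fst.charge_rho h2), inc_restrict0 (pairRL.fst.charge_rho (by omega)),
      inc_restrict0 (pairRL.snd.charge_rho h2), inc_restrict0 (pairRL.snd.charge_rho (by omega))]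
    rfl
  · intro m hm
    have h2 := beta_of_notMem fun hc => hm (hS hc)
    rw [Module.End.mul_apply, ← inc_restrict0 (pairRL.snd.charge_rho
      (neg_ne_zero.2 (pnat_ne m))), ← beta_eq, h2, map_zero, map_zero]
  · intro m hm
    have h2 := alpha_of_notMem fun hc => hm (hS hc)
    rw [Module.End.mul_apply, ← inc_restrict0 (pairRL.fst.charge_rho
      (neg_ne_zero.2 (pnat_ne m))), ← alpha_eq, h2, map_zero, map_zero]

/-- The bosonic operators commute with the axial charge. -/
theorem axial_comm_rho :
    (∀ m : ℤ, m ≠ 0 → rhoR m * axial - axial * rhoR m = 0) ∧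
    (∀ m : ℤ, m ≠ 0 → rhoL m * axial - axial * rhoL m = 0) := by
  constructor
  · intro m hm
    rw [rhoR_eq hm, axial_eq]
    have h1 := pairRL.fst.rho_chg hm
    have h2 := pairRL.fst.rho_comm_of_comm (x := chg lAn lCr) hm
      (fun i => ?_) (fun i => ?_)
    · have := sub_comm_of (comm_swap h1) (comm_swap h2)
      have h3 := comm_swap this
      simpa using h3
    · have := comm_swap (pairRL.snd.chg_comm_of_anticomm (x := rAn i)
        (fun j => by rw [add_comm]; exact pairRL.an_an i j)
        (fun j => by rw [add_comm]; exact pairRL.an_cr i j))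
      rw [this, end_neg_zero]
    · have := comm_swap (pairRL.snd.chg_comm_of_anticomm (x := rCr i)
        (fun j => by rw [add_comm]; exact pairRL.cr_an i j)
        (fun j => by rw [add_comm]; exact pairRL.cr_cr i j))
      rw [this, end_neg_zero]
  · intro m hm
    rw [rhoL_eq hm, axial_eq]
    have h1 := pairLR.fst.rho_chg (neg_ne_zero.2 hm)
    have h2 := pairLR.fst.rho_comm_of_comm (x := chg rAn rCr) (neg_ne_zero.2 hm)
      (fun i => ?_) (fun i => ?_)
    · have := sub_comm_of (comm_swap h2) (comm_swap h1)
      have h3 := comm_swap this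
      simpa using h3
    · have := comm_swap (pairLR.snd.chg_comm_of_anticomm (x := lAn i)
        (fun j => by rw [add_comm]; exact pairLR.an_an i j)
        (fun j => by rw [add_comm]; exact pairLR.an_cr i j))
      rw [this, end_neg_zero]
    · have := comm_swap (pairLR.snd.chg_comm_of_anticomm (x := lCr i)
        (fun j => by rw [add_comm]; exact pairLR.cr_an i j)
        (fun j => by rw [add_comm]; exact pairLR.cr_cr i j))
      rw [this, end_neg_zero]

/-- The axial charge as an operator on `𝓕₀`. -/
def ax : Module.End ℂ Fock0 := dg fun s => cfgAx s.1

theorem charge_axial : HasCharge 0 axial := by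
  rw [axial_eq]
  exact pairRL.fst.charge_chg.sub pairRL.snd.charge_chg

theorem ax_alpha (m : ℕ+) (x : Fock0) : alpha m (ax x) = ax (alpha m x) := by
  rw [ax, ← restrict0_axial]
  have h := neg_ne_zero.2 (pnat_ne m)
  exact restrict_comm (charge_rhoR h) charge_axial (axial_comm_rho.1 _ h) x

theorem ax_alphaD (m : ℕ+) (x : Fock0) : alphaD m (ax x) = ax (alphaD m x) := by
  rw [ax, ← restrict0_axial]
  have h := pnat_ne m
  exact restrict_comm (charge_rhoR h) charge_axial (axial_comm_rho.1 _ h) x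

theorem ax_beta (m : ℕ+) (x : Fock0) : beta m (ax x) = ax (beta m x) := by
  rw [ax, ← restrict0_axial]
  have h := pnat_ne m
  exact restrict_comm (charge_rhoL h) charge_axial (axial_comm_rho.2 _ h) x

theorem ax_betaD (m : ℕ+) (x : Fock0) : betaD m (ax x) = ax (betaD m x) := by
  rw [ax, ← restrict0_axial]
  have h := neg_ne_zero.2 (pnat_ne m)
  exact restrict_comm (charge_rhoL h) charge_axial (axial_comm_rho.2 _ h) x

theorem lev_nonneg (s : Cfg0) : 0 ≤ lev s := by
  have h1 := sum_modes (basisVec0 s) subset_rfl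
  have h2 : emb (basisVec0 s) = lp.single 2 s (1 : ℂ) := by simp [emb, basisVec0]
  have h3 : inner ℂ (emb (basisVec0 s)) (emb (dg lev (basisVec0 s))) = (lev s : ℂ) := by
    rw [dg_basis, map_smul, inner_smul_right, h2, lp.inner_single_left]
    simp
  rw [← h1, map_sum, inner_sum] at h3
  have h4 : ∀ m, inner ℂ (emb (basisVec0 s)) (emb (alphaD m (alpha m (basisVec0 s)) +
      betaD m (beta m (basisVec0 s)))) =
      ((‖emb (alpha m (basisVec0 s))‖ ^ 2 + ‖emb (beta m (basisVec0 s))‖ ^ 2 : ℝ) : ℂ) := by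
    intro m
    rw [map_add, inner_add_right, ← inner_alpha, ← inner_beta, inner_self_eq_norm_sq_to_K,
      inner_self_eq_norm_sq_to_K]
    push_cast
    rfl
  rw [Finset.sum_congr rfl fun m _ => h4 m] at h3
  have h5 : (∑ m ∈ modes (basisVec0 s), (‖emb (alpha m (basisVec0 s))‖ ^ 2 +
      ‖emb (beta m (basisVec0 s))‖ ^ 2) : ℝ) = lev s := by exact_mod_cast h3
  rw [← h5]
  exact Finset.sum_nonneg fun m _ => by positivity

/-- Only finitely many configurations of given axial charge have bounded excitation number. -/
theorem finite_lev (q M : ℝ) : {s : Cfg0 | lev s ≤ M ∧ cfgAx s.1 = q}.Finite := by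
  set K : ℤ := ⌈|M + q ^ 2 / 4 - q / 2|⌉ with hK
  have h1 : (((Finset.Icc (-K) K).powerset ×ˢ (Finset.Icc (-K) K).powerset : Finset Cfg) :
      Set Cfg).Finite := Finset.finite_toSet _
  refine (h1.preimage (f := (Subtype.val : Cfg0 → Cfg)) Subtype.val_injective.injOn).subset
    fun s hs => ?_
  obtain ⟨h2, h3⟩ := hs
  have h4 : cfgErg s.1 ≤ K := by
    have : cfgErg s.1 ≤ M + q ^ 2 / 4 - q / 2 := by rw [lev, h3] at h2; linarith
    exact (this.trans (le_abs_self _)).trans (Int.le_ceil _)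
  have hb : ∀ k ∈ s.1.1, |(k : ℝ)| ≤ K := fun k hk => by
    have := Finset.single_le_sum (f := fun k : ℤ => |(k : ℝ)|) (fun i _ => abs_nonneg _) hk
    have h5 : 0 ≤ ∑ k ∈ s.1.2, |(k : ℝ)| := Finset.sum_nonneg fun i _ => abs_nonneg _
    have h6 : cfgErg s.1 = ∑ k ∈ s.1.1, |(k : ℝ)| + ∑ k ∈ s.1.2, |(k : ℝ)| := rfl
    linarith
  have hc : ∀ k ∈ s.1.2, |(k : ℝ)| ≤ K := fun k hk => by
    have := Finset.single_le_sum (f := fun k : ℤ => |(k : ℝ)|) (fun i _ => abs_nonneg _) hk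
    have h5 : 0 ≤ ∑ k ∈ s.1.1, |(k : ℝ)| := Finset.sum_nonneg fun i _ => abs_nonneg _
    have h6 : cfgErg s.1 = ∑ k ∈ s.1.1, |(k : ℝ)| + ∑ k ∈ s.1.2, |(k : ℝ)| := rfl
    linarith
  simp only [mem_preimage, Finset.mem_coe, Finset.mem_product, Finset.mem_powerset]
  constructor
  · intro k hk
    have h7 := abs_le.1 (hb k hk)
    rw [Finset.mem_Icc]
    exact ⟨by exact_mod_cast h7.1, by exact_mod_cast h7.2⟩
  · intro k hk
    have h7 := abs_le.1 (hc k hk)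
    rw [Finset.mem_Icc]
    exact ⟨by exact_mod_cast h7.1, by exact_mod_cast h7.2⟩

/-! ### The large gauge transformation -/

section OrderedProducts

variable {M : Type*} [AddCommGroup M] [Module ℂ M]

/-- The ordered product of a family of operators over a finite set of indices. -/
def ordProd (f : ℤ → Module.End ℂ M) (m : Finset ℤ) : Module.End ℂ M :=
  ((m.sort (· ≤ ·)).map f).prod

theorem ordProd_insert_min (f : ℤ → Module.End ℂ M) {a : ℤ} {m : Finset ℤ} (h : ∀ x ∈ m, a < x)
    (x : M) : ordProd f (insert a m) x = f a (ordProd f m x) := by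
  unfold ordProd
  rw [Finset.sort_insert _ (fun b hb => (h b hb).le) (fun hc => lt_irrefl _ (h a hc))]
  simp

theorem apply_ordProd {f : ℤ → Module.End ℂ M} (hf : ∀ i j x, f i (f j x) = -f j (f i x))
    (k : ℤ) (m : Finset ℤ) (x : M) : f k (ordProd f m x) =
      if k ∈ m then 0 else passSign m k • ordProd f (insert k m) x := by
  have hsq : ∀ i x, f i (f i x) = 0 := fun i x => by
    have h1 := hf i i x
    have h2 : (2 : ℂ) • f i (f i x) = 0 := by
      rw [two_smul]; nth_rewrite 1 [h1]; exact neg_add_cancel _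
    exact (smul_eq_zero.1 h2).resolve_left two_ne_zero
  induction m using Finset.induction_on_min with
  | empty =>
    simp only [Finset.notMem_empty, if_false]
    rw [ordProd_insert_min f (by simp)]
    simp [passSign]
  | insert a m ha ih =>
    have ham : a ∉ m := fun hc => lt_irrefl _ (ha a hc)
    rw [ordProd_insert_min f ha]
    rcases lt_trichotomy k a with h | rfl | h
    · have hk : ∀ y ∈ insert a m, k < y := by
        intro y hy
        rcases Finset.mem_insert.1 hy with rfl | hy
        · exact h
        · exact h.trans (ha y hy)
      rw [if_neg (fun hc => lt_irrefl _ (hk k hc)), ordProd_insert_min f hk,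
        ordProd_insert_min f ha]
      have : (insert a m).filter (· < k) = ∅ := Finset.filter_eq_empty_iff.2
        fun y hy => (hk y hy).not_gt
      simp [passSign, this]
    · simp [hsq]
    · rw [hf, ih]
      have hne : k ≠ a := h.ne'
      by_cases hk : k ∈ m
      · simp [hk]
      · have hmin : ∀ y ∈ insert k m, a < y := by
          intro y hy
          rcases Finset.mem_insert.1 hy with rfl | hy
          · exact h
          · exact ha y hy
        rw [if_neg hk, if_neg (by simp [hk, hne]), passSign_insert ham, if_pos h,
          Finset.insert_comm, ordProd_insert_min f hmin, map_smul]
        module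

theorem anticomm_ordProd {f : ℤ → Module.End ℂ M} {g : Module.End ℂ M}
    (hf : ∀ i x, g (f i x) = -f i (g x)) (m : Finset ℤ) (x : M) :
    g (ordProd f m x) = (-1 : ℂ) ^ m.card • ordProd f m (g x) := by
  induction m using Finset.induction_on_min with
  | empty => simp [ordProd]
  | insert a m ha ih =>
    have ham : a ∉ m := fun hc => lt_irrefl _ (ha a hc)
    rw [ordProd_insert_min f ha, ordProd_insert_min f ha, hf, ih, neg_one_pow_insert ham, map_smul]
    module

end OrderedProducts

/-- `𝚪 b_n 𝚪⁻¹`. -/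
def gaugeB' (n : ℤ) : Module.End ℂ Fock := if n = 0 then cCr 1 else bAn (n - 1)

/-- `𝚪 c_n 𝚪⁻¹`. -/
def gaugeC' (n : ℤ) : Module.End ℂ Fock := if n = 0 then bCr (-1) else cAn (n + 1)

theorem gaugeB_gaugeB (i j : ℤ) : gaugeB i * gaugeB j + gaugeB j * gaugeB i = 0 := by
  unfold gaugeB
  split_ifs
  · exact cAn_cAn _ _
  · rw [add_comm]; exact bCr_cAn _ _
  · exact bCr_cAn _ _
  · exact bCr_bCr _ _

theorem gaugeC_gaugeC (i j : ℤ) : gaugeC i * gaugeC j + gaugeC j * gaugeC i = 0 := by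
  unfold gaugeC
  split_ifs
  · exact bAn_bAn _ _
  · exact bAn_cCr _ _
  · rw [add_comm]; exact bAn_cCr _ _
  · exact cCr_cCr _ _

theorem gaugeC_gaugeB (i j : ℤ) : gaugeC i * gaugeB j + gaugeB j * gaugeC i = 0 := by
  unfold gaugeB gaugeC
  by_cases hi : i = 0 <;> by_cases hj : j = 0 <;> simp only [hi, hj, if_true, if_false]
  · exact bAn_cAn _ _
  · rw [bAn_bCr, if_neg (by omega)]
  · rw [add_comm, cAn_cCr, if_neg (by omega)]
  · rw [add_comm]; exact bCr_cCr _ _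

theorem gaugeB'_gaugeB (i j : ℤ) :
    gaugeB' i * gaugeB j + gaugeB j * gaugeB' i = if i = j then 1 else 0 := by
  unfold gaugeB gaugeB'
  by_cases hi : i = 0 <;> by_cases hj : j = 0 <;> simp only [hi, hj, if_true, if_false]
  · rw [add_comm, cAn_cCr, if_pos rfl]
  · rw [add_comm, bCr_cCr, if_neg (by omega)]
  · exact bAn_cAn _ _
  · rw [bAn_bCr]; congr 1; simp

theorem gaugeB'_gaugeC (i j : ℤ) : gaugeB' i * gaugeC j + gaugeC j * gaugeB' i = 0 := by
  unfold gaugeC gaugeB'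
  by_cases hi : i = 0 <;> by_cases hj : j = 0 <;> simp only [hi, hj, if_true, if_false]
  · rw [add_comm]; exact bAn_cCr _ _
  · exact cCr_cCr _ _
  · exact bAn_bAn _ _
  · exact bAn_cCr _ _

theorem gaugeC'_gaugeC (i j : ℤ) :
    gaugeC' i * gaugeC j + gaugeC j * gaugeC' i = if i = j then 1 else 0 := by
  unfold gaugeC gaugeC'
  by_cases hi : i = 0 <;> by_cases hj : j = 0 <;> simp only [hi, hj, if_true, if_false]
  · rw [add_comm, bAn_bCr, if_pos rfl]
  · rw [bCr_cCr, if_neg (by omega)]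
  · rw [add_comm]; exact bAn_cAn _ _
  · rw [cAn_cCr]; congr 1; simp

theorem gaugeC'_gaugeB (i j : ℤ) : gaugeC' i * gaugeB j + gaugeB j * gaugeC' i = 0 := by
  unfold gaugeB gaugeC'
  by_cases hi : i = 0 <;> by_cases hj : j = 0 <;> simp only [hi, hj, if_true, if_false]
  · exact bCr_cAn _ _
  · exact bCr_bCr _ _
  · exact cAn_cAn _ _
  · rw [add_comm]; exact bCr_cAn _ _

theorem anticomm_apply {A B : Module.End ℂ Fock} (h : A * B + B * A = 0) (x : Fock) :
    A (B x) = -B (A x) :=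
  eq_neg_of_add_eq_zero_left (LinearMap.congr_fun h x)

/-- The transformed vacuum `b†₋₁ c†₁ Ω₀`. -/
def gaugeVac : Fock := bCr (-1) (cCr 1 vac)

theorem gauge_basis (s : Cfg) :
    gauge (basisVec s) = ordProd gaugeB s.1 (ordProd gaugeC s.2 gaugeVac) := by
  simp [gauge, basisVec, ordProd, gaugeVac, vac]

theorem gauge_vac : gauge vac = gaugeVac := by
  rw [vac, gauge_basis]; simp [ordProd]

theorem gauge_bCr (k : ℤ) (x : Fock) : gauge (bCr k x) = gaugeB k (gauge x) := by
  have : gauge ∘ₗ bCr k = gaugeB k ∘ₗ gauge := end_ext fun s => by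
    rw [LinearMap.comp_apply, LinearMap.comp_apply, gauge_basis,
      apply_ordProd (fun i j => anticomm_apply (gaugeB_gaugeB i j)), bCr_basis]
    split_ifs
    · simp
    · rw [map_smul, gauge_basis]
  exact LinearMap.congr_fun this x

theorem gauge_cCr (k : ℤ) (x : Fock) : gauge (cCr k x) = gaugeC k (gauge x) := by
  have : gauge ∘ₗ cCr k = gaugeC k ∘ₗ gauge := end_ext fun s => by
    rw [LinearMap.comp_apply, LinearMap.comp_apply, gauge_basis,
      anticomm_ordProd (fun i => anticomm_apply (gaugeC_gaugeB k i)),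
      apply_ordProd (fun i j => anticomm_apply (gaugeC_gaugeC i j)), cCr_basis]
    split_ifs
    · simp
    · rw [map_smul, gauge_basis, map_smul, smul_smul]
  exact LinearMap.congr_fun this x

theorem gaugeB'_gaugeVac (n : ℤ) : gaugeB' n gaugeVac = 0 := by
  unfold gaugeB' gaugeVac vac
  split_ifs with h
  · simp [cCr_basis, bCr_basis]
  · have : ¬ n - 1 = -1 := by omega
    simp [cCr_basis, bCr_basis, bAn_basis, this]

theorem gaugeC'_gaugeVac (n : ℤ) : gaugeC' n gaugeVac = 0 := by
  unfold gaugeC' gaugeVac vac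
  split_ifs with h
  · simp [cCr_basis, bCr_basis]
  · simp [cCr_basis, bCr_basis, cAn_basis, h]

theorem gauge_bAn (k : ℤ) (x : Fock) : gauge (bAn k x) = gaugeB' k (gauge x) := by
  have : gauge ∘ₗ bAn k - gaugeB' k ∘ₗ gauge = 0 := by
    refine eq_zero_of_intertwine _ (fun i => -gaugeB i) (fun i => -gaugeC i) (fun i x => ?_)
      (fun i x => ?_) ?_
    · have h1 := LinearMap.congr_fun (bAn_bCr k i) x
      have h2 := LinearMap.congr_fun (gaugeB'_gaugeB k i) (gauge x)
      simp only [LinearMap.add_apply, Module.End.mul_apply] at h1 h2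
      simp only [LinearMap.sub_apply, LinearMap.comp_apply, LinearMap.neg_apply, map_sub,
        gauge_bCr]
      rw [eq_sub_of_add_eq h1, eq_sub_of_add_eq h2, map_sub, gauge_bCr]
      split_ifs
      · simp only [Module.End.one_apply]; abel
      · simp only [LinearMap.zero_apply, map_zero]; abel
    · simp only [LinearMap.sub_apply, LinearMap.comp_apply, LinearMap.neg_apply, map_sub,
        gauge_cCr]
      rw [anticomm_apply (bAn_cCr k i), anticomm_apply (gaugeB'_gaugeC k i), map_neg, gauge_cCr]
    · simp only [LinearMap.sub_apply, LinearMap.comp_apply, bAn_vac, map_zero, gauge_vac,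
        gaugeB'_gaugeVac, sub_zero]
  exact sub_eq_zero.1 (LinearMap.congr_fun this x)

theorem gauge_cAn (k : ℤ) (x : Fock) : gauge (cAn k x) = gaugeC' k (gauge x) := by
  have : gauge ∘ₗ cAn k - gaugeC' k ∘ₗ gauge = 0 := by
    refine eq_zero_of_intertwine _ (fun i => -gaugeB i) (fun i => -gaugeC i) (fun i x => ?_)
      (fun i x => ?_) ?_
    · simp only [LinearMap.sub_apply, LinearMap.comp_apply, LinearMap.neg_apply, map_sub,
        gauge_bCr]
      rw [anticomm_apply ((add_comm _ _).trans (bCr_cAn i k)),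
        anticomm_apply (gaugeC'_gaugeB k i), map_neg, gauge_bCr]
    · have h1 := LinearMap.congr_fun (cAn_cCr k i) x
      have h2 := LinearMap.congr_fun (gaugeC'_gaugeC k i) (gauge x)
      simp only [LinearMap.add_apply, Module.End.mul_apply] at h1 h2
      simp only [LinearMap.sub_apply, LinearMap.comp_apply, LinearMap.neg_apply, map_sub,
        gauge_cCr]
      rw [eq_sub_of_add_eq h1, eq_sub_of_add_eq h2, map_sub, gauge_cCr]
      split_ifs
      · simp only [Module.End.one_apply]; abel
      · simp only [LinearMap.zero_apply, map_zero]; abel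
    · simp only [LinearMap.sub_apply, LinearMap.comp_apply, cAn_vac, map_zero, gauge_vac,
        gaugeC'_gaugeVac, sub_zero]
  exact sub_eq_zero.1 (LinearMap.congr_fun this x)

theorem gauge_rAn (k : ℤ) (x : Fock) : gauge (rAn k x) = rAn (k - 1) (gauge x) := by
  unfold rAn fieldAn
  rcases lt_trichotomy k 0 with h | rfl | h
  · rw [if_neg (by omega), if_neg (by omega), gauge_cCr, gaugeC, if_neg (by omega)]
    congr 2; ring
  · rw [if_pos le_rfl, if_neg (by omega), gauge_bAn]; simp [gaugeB']
  · rw [if_pos (by omega), if_pos (by omega), gauge_bAn, gaugeB', if_neg (by simpa using h.ne')]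
    rfl

theorem gauge_rCr (k : ℤ) (x : Fock) : gauge (rCr k x) = rCr (k - 1) (gauge x) := by
  unfold rCr fieldCr
  rcases lt_trichotomy k 0 with h | rfl | h
  · rw [if_neg (by omega), if_neg (by omega), gauge_cAn, gaugeC', if_neg (by omega)]
    congr 2; ring
  · rw [if_pos le_rfl, if_neg (by omega), gauge_bCr]; simp [gaugeB]
  · rw [if_pos (by omega), if_pos (by omega), gauge_bCr, gaugeB, if_neg (by simpa using h.ne')]
    rfl

theorem gauge_lAn (k : ℤ) (x : Fock) : gauge (lAn k x) = lAn (k + 1) (gauge x) := by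
  simp only [lAn, fieldAn]
  rcases lt_trichotomy k (-1) with h | rfl | h
  · rw [if_neg (by omega), if_neg (by omega), gauge_cCr, gaugeC, if_neg (by omega)]
  · rw [if_neg (by omega), if_pos (by omega), gauge_cCr]; simp [gaugeC]
  · rw [if_pos (by omega), if_pos (by omega), gauge_bAn, gaugeB', if_neg (by omega)]
    congr 2; ring

theorem gauge_lCr (k : ℤ) (x : Fock) : gauge (lCr k x) = lCr (k + 1) (gauge x) := by
  simp only [lCr, fieldCr]
  rcases lt_trichotomy k (-1) with h | rfl | h
  · rw [if_neg (by omega), if_neg (by omega), gauge_cAn, gaugeC', if_neg (by omega)]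
  · rw [if_neg (by omega), if_pos (by omega), gauge_cAn]; simp [gaugeC']
  · rw [if_pos (by omega), if_pos (by omega), gauge_bCr, gaugeB, if_neg (by omega)]
    congr 2; ring

theorem gauge_rhoR {m : ℤ} (hm : m ≠ 0) (x : Fock) : gauge (rhoR m x) = rhoR m (gauge x) := by
  rw [rhoR_eq hm]
  have h := pairRL.fst.locFin_rho hm
  have e1 : opSum (fun k : ℤ => rCr (k - 1 + m) * rAn (k - 1)) = rho rAn rCr m :=
    opSum_reindex (fun k : ℤ => rCr (k + m) * rAn k) (Equiv.subRight 1)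
  have e2 : gauge (rho rAn rCr m x) = ∑ᶠ k : ℤ, rCr (k - 1 + m) (rAn (k - 1) (gauge x)) := by
    rw [rho, opSum_apply h, map_finsum gauge (h x)]
    refine finsum_congr fun k => ?_
    rw [Module.End.mul_apply, gauge_rCr, gauge_rAn]
    congr 2; ring
  rw [e2, ← e1]
  exact (opSum_apply (h.comp (Equiv.subRight (1 : ℤ)).injective) _).symm

theorem gauge_rhoL {m : ℤ} (hm : m ≠ 0) (x : Fock) : gauge (rhoL m x) = rhoL m (gauge x) := by
  rw [rhoL_eq hm]
  have h := pairRL.snd.locFin_rho (neg_ne_zero.2 hm)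
  have e1 : opSum (fun k : ℤ => lCr (k + 1 + -m) * lAn (k + 1)) = rho lAn lCr (-m) :=
    opSum_reindex (fun k : ℤ => lCr (k + -m) * lAn k) (Equiv.addRight 1)
  have e2 : gauge (rho lAn lCr (-m) x) =
      ∑ᶠ k : ℤ, lCr (k + 1 + -m) (lAn (k + 1) (gauge x)) := by
    rw [rho, opSum_apply h, map_finsum gauge (h x)]
    refine finsum_congr fun k => ?_
    rw [Module.End.mul_apply, gauge_lCr, gauge_lAn]
    congr 2; ring
  rw [e2, ← e1]
  exact (opSum_apply (h.comp (Equiv.addRight (1 : ℤ)).injective) _).symm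

theorem comm_apply {A B C : Module.End ℂ Fock} (h : A * B - B * A = C) (x : Fock) :
    A (B x) = B (A x) + C x := by
  have := LinearMap.congr_fun h x
  rw [← this]
  simp only [LinearMap.sub_apply, Module.End.mul_apply]
  abel

theorem axial_rCr (k : ℤ) (x : Fock) : axial (rCr k x) = rCr k (axial x) + rCr k x := by
  have h2 := pairRL.snd.chg_comm_of_anticomm (x := rCr k)
    (fun j => by rw [add_comm]; exact pairRL.cr_an k j)
    (fun j => by rw [add_comm]; exact pairRL.cr_cr k j)
  rw [axial_eq, LinearMap.sub_apply, comm_apply (pairRL.fst.chg_cr k), comm_apply h2,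
    LinearMap.sub_apply, map_sub, LinearMap.zero_apply]
  abel

theorem axial_rAn (k : ℤ) (x : Fock) : axial (rAn k x) = rAn k (axial x) - rAn k x := by
  have h2 := pairRL.snd.chg_comm_of_anticomm (x := rAn k)
    (fun j => by rw [add_comm]; exact pairRL.an_an k j)
    (fun j => by rw [add_comm]; exact pairRL.an_cr k j)
  rw [axial_eq, LinearMap.sub_apply, comm_apply (pairRL.fst.chg_an k), comm_apply h2,
    LinearMap.sub_apply, map_sub, LinearMap.zero_apply, LinearMap.neg_apply]
  abel

theorem axial_lCr (k : ℤ) (x : Fock) : axial (lCr k x) = lCr k (axial x) - lCr k x := by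
  have h2 := pairRL.fst.chg_comm_of_anticomm (x := lCr k)
    (fun j => pairRL.an_cr j k) (fun j => pairRL.cr_cr j k)
  rw [axial_eq, LinearMap.sub_apply, comm_apply (pairRL.snd.chg_cr k), comm_apply h2,
    LinearMap.sub_apply, map_sub, LinearMap.zero_apply]
  abel

theorem axial_lAn (k : ℤ) (x : Fock) : axial (lAn k x) = lAn k (axial x) + lAn k x := by
  have h2 := pairRL.fst.chg_comm_of_anticomm (x := lAn k)
    (fun j => pairRL.an_an j k) (fun j => pairRL.cr_an j k)
  rw [axial_eq, LinearMap.sub_apply, comm_apply (pairRL.snd.chg_an k), comm_apply h2,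
    LinearMap.sub_apply, map_sub, LinearMap.zero_apply, LinearMap.neg_apply]
  abel

theorem axial_gauge (x : Fock) : axial (gauge x) = gauge (axial x) - (2 : ℂ) • gauge x := by
  have hb1 : ∀ k : ℤ, 0 ≤ k → bCr k = rCr k := fun k hk => by simp [rCr, fieldCr, hk]
  have hb2 : ∀ k : ℤ, k < 0 → bCr k = lCr (-1 - k) := fun k hk => by
    simp [lCr, fieldCr, show k ≤ -1 by omega]
  have hc1 : ∀ k : ℤ, 0 < k → cCr k = rAn (-k) := fun k hk => by simp [rAn, fieldAn, hk.not_ge]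
  have hc2 : ∀ k : ℤ, k ≤ 0 → cCr k = lAn (k - 1) := fun k hk => by
    simp [lAn, fieldAn, show ¬ 1 ≤ k by omega]
  have : axial ∘ₗ gauge - gauge ∘ₗ axial + (2 : ℂ) • gauge = 0 := by
    refine eq_zero_of_intertwine _ (fun k => if 0 ≤ k then rCr (k - 1) else lCr (-1 - k + 1))
      (fun k => if 0 < k then rAn (-k - 1) else lAn (k - 1 + 1)) (fun k x => ?_)
      (fun k x => ?_) ?_
    · simp only [LinearMap.add_apply, LinearMap.sub_apply, LinearMap.comp_apply,
        LinearMap.smul_apply]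
      split_ifs with hk
      · rw [hb1 k hk, gauge_rCr, axial_rCr, axial_rCr, map_add gauge, gauge_rCr, gauge_rCr, map_add,
          map_sub, map_smul]
        abel
      · rw [hb2 k (by omega), gauge_lCr, axial_lCr, axial_lCr, map_sub gauge, gauge_lCr, gauge_lCr,
          map_add, map_sub, map_smul]
        abel
    · simp only [LinearMap.add_apply, LinearMap.sub_apply, LinearMap.comp_apply,
        LinearMap.smul_apply]
      split_ifs with hk
      · rw [hc1 k hk, gauge_rAn, axial_rAn, axial_rAn, map_sub gauge, gauge_rAn, gauge_rAn, map_add,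
          map_sub, map_smul]
        abel
      · rw [hc2 k (by omega), gauge_lAn, axial_lAn, axial_lAn, map_add gauge, gauge_lAn, gauge_lAn,
          map_add, map_sub, map_smul]
        abel
    · have h0 : axial vac = 0 := by rw [vac, axial_basis]; simp [cfgAx]
      have h1 : axial gaugeVac = -(2 : ℂ) • gaugeVac := by
        rw [gaugeVac, hb2 _ (by norm_num), hc1 _ (by norm_num), axial_lCr, axial_rAn, h0, map_zero,
          zero_sub, map_neg]
        module
      simp only [LinearMap.add_apply, LinearMap.sub_apply, LinearMap.comp_apply,
        LinearMap.smul_apply]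
      rw [gauge_vac, h0, h1, map_zero]
      module
  have h := LinearMap.congr_fun this x
  simp only [LinearMap.add_apply, LinearMap.sub_apply, LinearMap.comp_apply,
        LinearMap.smul_apply, LinearMap.zero_apply] at h
  linear_combination (norm := module) h

theorem isAdj_gaugeB (k : ℤ) : IsAdj (gaugeB k) (gaugeB' k) := by
  unfold gaugeB gaugeB'
  split_ifs
  · exact (isAdj_c 1).symm
  · exact isAdj_b _

theorem isAdj_gaugeC (k : ℤ) : IsAdj (gaugeC k) (gaugeC' k) := by
  unfold gaugeC gaugeC'
  split_ifs
  · exact (isAdj_b _).symm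
  · exact isAdj_c _

theorem ip_gauge (x y : Fock) : ip (gauge x) (gauge y) = ip x y := by
  have h0 : ∀ s, ip (gauge vac) (gauge (basisVec s)) = ip vac (basisVec s) := by
    refine basis_induction ?_ (fun k n hk _ => ?_) (fun k m n hk _ => ?_)
    · have : ip gaugeVac gaugeVac = ip vac vac := by
        have h1 : gaugeVac = basisVec ({-1}, {1}) := by
          simp [gaugeVac, vac, bCr_basis, cCr_basis, passSign]
        rw [h1, vac, ip_basis_left, ip_basis_left]
        simp [basisVec]
      rw [← vac, gauge_vac, this]
    · rw [basis_insert_c hk, map_smul, map_smul, map_smul, gauge_cCr, ← (isAdj_gaugeC k).symm,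
        gauge_vac, gaugeC'_gaugeVac, ← (isAdj_c k).symm, cAn_vac]
      simp [ip_zero_left]
    · rw [basis_insert_b hk, map_smul, map_smul, map_smul, gauge_bCr, ← (isAdj_gaugeB k).symm,
        gauge_vac, gaugeB'_gaugeVac, ← (isAdj_b k).symm, bAn_vac]
      simp [ip_zero_left]
  have h1 : ∀ s, ip (gauge (basisVec s)) ∘ₗ gauge = ip (basisVec s) := by
    refine basis_induction (end_ext h0) (fun k n hk ih => ?_) (fun k m n hk ih => ?_)
    · refine LinearMap.ext fun y => ?_
      rw [LinearMap.comp_apply, basis_insert_c hk, map_smul, ip_smul_left, ip_smul_left,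
        gauge_cCr, isAdj_gaugeC, isAdj_c, ← gauge_cAn]
      exact congrArg _ (LinearMap.congr_fun ih _)
    · refine LinearMap.ext fun y => ?_
      rw [LinearMap.comp_apply, basis_insert_b hk, map_smul, ip_smul_left, ip_smul_left,
        gauge_bCr, isAdj_gaugeB, isAdj_b, ← gauge_bAn]
      exact congrArg _ (LinearMap.congr_fun ih _)
  induction x using Finsupp.induction_linear with
  | zero => simp [ip_zero_left]
  | add x z hx hz => rw [map_add, ip_add_left, hx, hz, ip_add_left]
  | single s a =>
    have h2 : Finsupp.single s a = a • basisVec s := by simp [basisVec]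
    rw [h2, map_smul, ip_smul_left, ip_smul_left]
    exact congrArg _ (LinearMap.congr_fun (h1 s) y)

theorem hasCharge_gaugeB (k : ℤ) : HasCharge 1 (gaugeB k) := by
  unfold gaugeB
  split_ifs
  · exact hasCharge_cAn _
  · exact hasCharge_bCr _

theorem hasCharge_gaugeC (k : ℤ) : HasCharge (-1) (gaugeC k) := by
  unfold gaugeC
  split_ifs
  · exact hasCharge_bAn _
  · exact hasCharge_cCr _

theorem charge_gauge : HasCharge 0 gauge := by
  refine .of_basis fun s => ?_
  refine basis_induction (p := fun s => gauge (basisVec s) ∈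
    chargeSub ((s.1.card : ℤ) - s.2.card + 0)) ?_ (fun k n hk ih => ?_) (fun k m n hk ih => ?_) s
  · rw [← vac, gauge_vac]
    have := hasCharge_bCr (-1) _ _ (hasCharge_cCr 1 _ _ vac_mem_chargeSub)
    simpa [gaugeVac] using this
  · rw [basis_insert_c hk, map_smul, gauge_cCr]
    refine Submodule.smul_mem _ _ ?_
    convert hasCharge_gaugeC k _ _ ih using 2
    rw [Finset.card_insert_of_notMem hk]
    push_cast; ring
  · rw [basis_insert_b hk, map_smul, gauge_bCr]
    refine Submodule.smul_mem _ _ ?_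
    convert hasCharge_gaugeB k _ _ ih using 2
    rw [Finset.card_insert_of_notMem hk]
    push_cast; ring

theorem exists_gauge_eq (s : Cfg) :
    ∃ y ∈ chargeSub ((s.1.card : ℤ) - s.2.card), gauge y = basisVec s := by
  refine basis_induction (p := fun s => ∃ y ∈ chargeSub ((s.1.card : ℤ) - s.2.card),
    gauge y = basisVec s) ?_ (fun k n hk ih => ?_) (fun k m n hk ih => ?_) s
  · refine ⟨bCr 0 (cCr 0 vac), ?_, ?_⟩
    · have := hasCharge_bCr 0 _ _ (hasCharge_cCr 0 _ _ vac_mem_chargeSub)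
      simpa using this
    · rw [gauge_bCr, gauge_cCr, gauge_vac]
      simp [gaugeB, gaugeC, gaugeVac, vac, bCr_basis, cCr_basis, bAn_basis, cAn_basis, passSign,
        Finset.filter_singleton]
  · obtain ⟨y, hy, hyk⟩ := ih
    rw [basis_insert_c hk, ← hyk]
    have hcard : (((∅ : Finset ℤ), insert k n).1.card : ℤ) - (((∅ : Finset ℤ), insert k n).2.card : ℤ)
        = ((∅ : Finset ℤ), n).1.card - ((∅ : Finset ℤ), n).2.card + -1 := by
      simp only [Finset.card_insert_of_notMem hk]; push_cast; ring
    rw [hcard]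
    by_cases hk1 : k = 1
    · refine ⟨_, Submodule.smul_mem _ ((-1 : ℂ) ^ (∅ : Finset ℤ).card * passSign n k) (hasCharge_bAn 0 _ _ hy), ?_⟩
      rw [map_smul, gauge_bAn, gaugeB', if_pos rfl, hk1]
    · refine ⟨_, Submodule.smul_mem _ ((-1 : ℂ) ^ (∅ : Finset ℤ).card * passSign n k) (hasCharge_cCr (k - 1) _ _ hy), ?_⟩
      rw [map_smul, gauge_cCr, gaugeC, if_neg (by omega), sub_add_cancel]
  · obtain ⟨y, hy, hyk⟩ := ih
    rw [basis_insert_b hk, ← hyk]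
    have hcard : ((insert k m, n).1.card : ℤ) - ((insert k m, n).2.card : ℤ)
        = (m, n).1.card - (m, n).2.card + 1 := by
      simp only [Finset.card_insert_of_notMem hk]; push_cast; ring
    rw [hcard]
    by_cases hk1 : k = -1
    · refine ⟨_, Submodule.smul_mem _ (passSign m k) (hasCharge_cAn 0 _ _ hy), ?_⟩
      rw [map_smul, gauge_cAn, gaugeC', if_pos rfl, hk1]
    · refine ⟨_, Submodule.smul_mem _ (passSign m k) (hasCharge_bCr (k + 1) _ _ hy), ?_⟩
      rw [map_smul, gauge_bCr, gaugeB, if_neg (by omega), add_sub_cancel_right]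

/-- `𝚪` on `𝓕₀`. -/
def gam : Module.End ℂ Fock0 := restrict0 gauge

theorem inner_gam (x y : Fock0) :
    inner ℂ (emb (gam x)) (emb (gam y)) = inner ℂ (emb x) (emb y) := by
  rw [inner_emb, inner_emb, gam, inc_restrict0 charge_gauge, inc_restrict0 charge_gauge, ip_gauge]

theorem norm_gam (x : Fock0) : ‖emb (gam x)‖ = ‖emb x‖ := by
  rw [@norm_eq_sqrt_re_inner ℂ, @norm_eq_sqrt_re_inner ℂ, inner_gam]

theorem gam_injective : Function.Injective gam := by
  refine (injective_iff_map_eq_zero gam).2 fun x hx => ?_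
  have h := norm_gam x
  rw [hx, map_zero, norm_zero, eq_comm, norm_eq_zero] at h
  exact LinearMap.ker_eq_bot'.1 ker_emb x h

theorem exists_inc_eq {y : Fock} (hy : y ∈ chargeSub 0) : ∃ z : Fock0, inc z = y := by
  refine ⟨Finsupp.lsubtypeDomain (R := ℂ) {s : Cfg | s.1.card = s.2.card} y, Finsupp.ext fun s => ?_⟩
  by_cases hs : s.1.card = s.2.card
  · exact inc_apply _ ⟨s, hs⟩
  · have h1 : ∀ y ∈ chargeSub 0, y s = 0 := fun y hy => by
      by_contra hc
      have : (s.1.card : ℤ) - s.2.card = 0 := hy (Finsupp.mem_support_iff.2 hc)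
      omega
    rw [h1 _ (inc_mem _), h1 _ hy]

theorem gam_surjective : Function.Surjective gam := by
  intro x
  induction x using Finsupp.induction_linear with
  | zero => exact ⟨0, map_zero _⟩
  | add x y hx hy =>
    obtain ⟨⟨u, rfl⟩, ⟨v, rfl⟩⟩ := And.intro hx hy
    exact ⟨u + v, map_add _ _ _⟩
  | single s a =>
    obtain ⟨y, hy, hys⟩ := exists_gauge_eq s.1
    rw [s.2, sub_self] at hy
    obtain ⟨z, rfl⟩ := exists_inc_eq hy
    refine ⟨a • z, inc_injective ?_⟩
    rw [map_smul, map_smul, gam, inc_restrict0 charge_gauge, hys, ← inc_basis, ← map_smul]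
    simp [basisVec0]

/-- `𝚪` as a linear automorphism of `𝓕₀`. -/
def gamE : Fock0 ≃ₗ[ℂ] Fock0 := LinearEquiv.ofBijective gam ⟨gam_injective, gam_surjective⟩

theorem gamE_apply (x : Fock0) : gamE x = gam x := rfl

theorem emb_basis (s : Cfg0) : emb (basisVec0 s) = lp.single 2 s (1 : ℂ) := by
  simp [emb, basisVec0]

theorem dense_emb : DenseRange emb := by
  intro x
  have h := lp.hasSum_single (E := fun _ : Cfg0 => ℂ) (p := 2) (by simp) x
  refine mem_closure_of_tendsto h (Eventually.of_forall fun S => ⟨∑ s ∈ S, x s • basisVec0 s, ?_⟩)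
  rw [map_sum]
  refine Finset.sum_congr rfl fun s _ => ?_
  rw [map_smul, emb_basis, ← lp.single_smul]
  simp

/-- `𝚪` on `𝓗₀`. -/
def gamH : Hilb0 ≃ₗᵢ[ℂ] Hilb0 :=
  gamE.extendOfIsometry emb emb dense_emb dense_emb norm_gam

theorem gamH_emb (x : Fock0) : gamH (emb x) = emb (gam x) :=
  gamE.extendOfIsometry_eq emb emb dense_emb dense_emb norm_gam x

theorem gam_alpha (m : ℕ+) (x : Fock0) : gam (alpha m x) = alpha m (gam x) := by
  have h := neg_ne_zero.2 (pnat_ne m)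
  apply inc_injective
  rw [gam, alpha, inc_restrict0 charge_gauge, inc_restrict0 (charge_rhoR h),
    inc_restrict0 (charge_rhoR h), inc_restrict0 charge_gauge, gauge_rhoR h]

theorem gam_alphaD (m : ℕ+) (x : Fock0) : gam (alphaD m x) = alphaD m (gam x) := by
  have h := pnat_ne m
  apply inc_injective
  rw [gam, alphaD, inc_restrict0 charge_gauge, inc_restrict0 (charge_rhoR h),
    inc_restrict0 (charge_rhoR h), inc_restrict0 charge_gauge, gauge_rhoR h]

theorem gam_beta (m : ℕ+) (x : Fock0) : gam (beta m x) = beta m (gam x) := by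
  have h := pnat_ne m
  apply inc_injective
  rw [gam, beta, inc_restrict0 charge_gauge, inc_restrict0 (charge_rhoL h),
    inc_restrict0 (charge_rhoL h), inc_restrict0 charge_gauge, gauge_rhoL h]

theorem gam_betaD (m : ℕ+) (x : Fock0) : gam (betaD m x) = betaD m (gam x) := by
  have h := neg_ne_zero.2 (pnat_ne m)
  apply inc_injective
  rw [gam, betaD, inc_restrict0 charge_gauge, inc_restrict0 (charge_rhoL h),
    inc_restrict0 (charge_rhoL h), inc_restrict0 charge_gauge, gauge_rhoL h]

theorem ax_gam (x : Fock0) : ax (gam x) = gam (ax x) - (2 : ℂ) • gam x := by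
  apply inc_injective
  rw [ax, ← restrict0_axial, gam, map_sub, inc_restrict0 charge_axial, inc_restrict0 charge_gauge,
    inc_restrict0 charge_gauge, inc_restrict0 charge_axial, axial_gauge, map_smul,
    inc_restrict0 charge_gauge]

/-! ### The unexcited states -/

theorem inc_unexcited_succ {P : ℤ} (hP : 0 ≤ P) :
    inc (unexcited (P + 1)) = bCr P (cCr (-P) (inc (unexcited P))) := by
  have h1 : Finset.Ico 0 (P + 1) ∪ Finset.Ico (P + 1) 0 =
      insert P (Finset.Ico 0 P ∪ Finset.Ico P 0) := by
    ext k; simp only [Finset.mem_union, Finset.mem_Ico, Finset.mem_insert]; omega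
  have h2 : Finset.Ioc (-(P + 1)) 0 ∪ Finset.Ioc 0 (-(P + 1)) =
      insert (-P) (Finset.Ioc (-P) 0 ∪ Finset.Ioc 0 (-P)) := by
    ext k; simp only [Finset.mem_union, Finset.mem_Ioc, Finset.mem_insert]; omega
  have n1 : P ∉ Finset.Ico 0 P ∪ Finset.Ico P 0 := by
    simp only [Finset.mem_union, Finset.mem_Ico]; omega
  have n2 : -P ∉ Finset.Ioc (-P) 0 ∪ Finset.Ioc 0 (-P) := by
    simp only [Finset.mem_union, Finset.mem_Ioc]; omega
  rw [unexcited, unexcited, inc_basis, inc_basis]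
  simp only [h1, h2]
  rw [basis_insert_b n1, basis_insert_c n2, map_smul, smul_smul]
  have s1 : (Finset.Ico 0 P ∪ Finset.Ico P 0).filter (· < P) =
      Finset.Ico 0 P ∪ Finset.Ico P 0 := by
    ext k; simp only [Finset.mem_filter, Finset.mem_union, Finset.mem_Ico]; omega
  have s2 : (Finset.Ioc (-P) 0 ∪ Finset.Ioc 0 (-P)).filter (· < -P) = ∅ := by
    refine Finset.filter_eq_empty_iff.2 fun k hk => ?_
    simp only [Finset.mem_union, Finset.mem_Ioc] at hk
    omega
  rw [passSign, passSign, s1, s2, Finset.card_empty, pow_zero, mul_one, neg_one_pow_mul_self,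
    one_smul]

theorem inc_unexcited_pred {P : ℤ} (hP : P ≤ 0) :
    inc (unexcited (P - 1)) = bCr (P - 1) (cCr (1 - P) (inc (unexcited P))) := by
  have h1 : Finset.Ico 0 (P - 1) ∪ Finset.Ico (P - 1) 0 =
      insert (P - 1) (Finset.Ico 0 P ∪ Finset.Ico P 0) := by
    ext k; simp only [Finset.mem_union, Finset.mem_Ico, Finset.mem_insert]; omega
  have h2 : Finset.Ioc (-(P - 1)) 0 ∪ Finset.Ioc 0 (-(P - 1)) =
      insert (1 - P) (Finset.Ioc (-P) 0 ∪ Finset.Ioc 0 (-P)) := by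
    ext k; simp only [Finset.mem_union, Finset.mem_Ioc, Finset.mem_insert]; omega
  have n1 : P - 1 ∉ Finset.Ico 0 P ∪ Finset.Ico P 0 := by
    simp only [Finset.mem_union, Finset.mem_Ico]; omega
  have n2 : 1 - P ∉ Finset.Ioc (-P) 0 ∪ Finset.Ioc 0 (-P) := by
    simp only [Finset.mem_union, Finset.mem_Ioc]; omega
  rw [unexcited, unexcited, inc_basis, inc_basis]
  simp only [h1, h2]
  rw [basis_insert_b n1, basis_insert_c n2, map_smul, smul_smul]
  have s1 : (Finset.Ico 0 P ∪ Finset.Ico P 0).filter (· < P - 1) = ∅ := by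
    refine Finset.filter_eq_empty_iff.2 fun k hk => ?_
    simp only [Finset.mem_union, Finset.mem_Ico] at hk
    omega
  have s2 : (Finset.Ioc (-P) 0 ∪ Finset.Ioc 0 (-P)).filter (· < 1 - P) =
      Finset.Ioc (-P) 0 ∪ Finset.Ioc 0 (-P) := by
    ext k; simp only [Finset.mem_filter, Finset.mem_union, Finset.mem_Ioc]
    omega
  rw [passSign, passSign, s1, s2, Finset.card_empty, pow_zero, one_mul, unexcited_card,
    neg_one_pow_mul_self, one_smul]

theorem inc_unexcited_zero : inc (unexcited 0) = vac := by
  rw [unexcited, inc_basis]; simp [vac]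

theorem gam_unexcited (P : ℤ) : gam (unexcited (P + 1)) = unexcited P := by
  have hpos : ∀ n : ℕ, gauge (inc (unexcited (n + 1))) = inc (unexcited n) := by
    intro n
    induction n with
    | zero =>
      have := inc_unexcited_succ (P := 0) le_rfl
      simp only [Nat.cast_zero]
      rw [this, neg_zero, inc_unexcited_zero, gauge_bCr, gauge_cCr, gauge_vac]
      simp [gaugeB, gaugeC, gaugeVac, vac, bCr_basis, cCr_basis, bAn_basis, cAn_basis, passSign,
        Finset.filter_singleton]
    | succ n ih =>
      push_cast
      rw [inc_unexcited_succ (P := n + 1) (by omega), gauge_bCr, gauge_cCr, ih,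
        inc_unexcited_succ (P := n) (by omega), gaugeB, if_neg (by omega), gaugeC,
        if_neg (by omega)]
      congr 3 <;> ring_nf
  have hneg : ∀ n : ℕ, gauge (inc (unexcited (-n))) = inc (unexcited (-n - 1)) := by
    intro n
    induction n with
    | zero =>
      have := inc_unexcited_pred (P := 0) le_rfl
      simp only [Nat.cast_zero, neg_zero]
      rw [this, inc_unexcited_zero, gauge_vac]
      rfl
    | succ n ih =>
      push_cast
      rw [neg_add', inc_unexcited_pred (P := -n) (by omega), gauge_bCr, gauge_cCr, ih,
        inc_unexcited_pred (P := -n - 1) (by omega), gaugeB, if_neg (by omega), gaugeC,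
        if_neg (by omega)]
      congr 3; ring_nf
  apply inc_injective
  rw [gam, inc_restrict0 charge_gauge]
  rcases le_or_gt 0 P with h | h
  · obtain ⟨n, rfl⟩ := Int.eq_ofNat_of_zero_le h
    exact hpos n
  · obtain ⟨n, hn⟩ := Int.eq_ofNat_of_zero_le (show 0 ≤ -P - 1 by omega)
    have h1 : P + 1 = -(n : ℤ) := by omega
    have h2 : P = -(n : ℤ) - 1 := by omega
    rw [h1, hneg n, ← h2]

theorem unexcited_induction {p : Fock0 → Prop} (h0 : p (unexcited 0))
    (h : ∀ x, p (gam x) ↔ p x) (P : ℤ) : p (unexcited P) := by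
  induction P using Int.induction_on with
  | zero => exact h0
  | succ n ih => rwa [← h, gam_unexcited]
  | pred n ih => rwa [← gam_unexcited, sub_add_cancel, h]

theorem alpha_unexcited (m : ℕ+) (P : ℤ) : alpha m (unexcited P) = 0 := by
  refine unexcited_induction (p := fun x => alpha m x = 0) ?_ (fun x => ?_) P
  · apply inc_injective
    have h := pairRL.fst.charge_rho (neg_ne_zero.2 (pnat_ne m))
    rw [alpha_eq, inc_restrict0 h, inc_unexcited_zero, pairRL.fst.rho_vac (pnat_pos m), map_zero]
  · rw [← gam_alpha]; exact map_eq_zero_iff gam gam_injective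

theorem beta_unexcited (m : ℕ+) (P : ℤ) : beta m (unexcited P) = 0 := by
  refine unexcited_induction (p := fun x => beta m x = 0) ?_ (fun x => ?_) P
  · apply inc_injective
    have h := pairRL.snd.charge_rho (neg_ne_zero.2 (pnat_ne m))
    rw [beta_eq, inc_restrict0 h, inc_unexcited_zero, pairRL.snd.rho_vac (pnat_pos m), map_zero]
  · rw [← gam_beta]; exact map_eq_zero_iff gam gam_injective

theorem ax_unexcited (P : ℤ) : ax (unexcited P) = ((2 * P : ℝ) : ℂ) • unexcited P := by
  have hs : ∀ Q : ℤ, ax (unexcited (Q + 1)) = ((2 * (Q + 1) : ℝ) : ℂ) • unexcited (Q + 1) ↔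
      ax (unexcited Q) = ((2 * Q : ℝ) : ℂ) • unexcited Q := fun Q => by
    rw [← gam_injective.eq_iff, map_smul, gam_unexcited]
    have h1 := ax_gam (unexcited (Q + 1))
    rw [gam_unexcited] at h1
    rw [h1]
    constructor <;> intro h
    · rw [h]; push_cast; module
    · rw [sub_eq_iff_eq_add.1 h]; push_cast; module
  induction P using Int.induction_on with
  | zero =>
    rw [unexcited, ax, dg_basis]
    simp [cfgAx]
  | succ n ih => have := (hs n).2 ih; exact_mod_cast this
  | pred n ih =>
    refine (hs (-n - 1)).1 ?_
    rw [sub_add_cancel]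
    convert ih using 3
    push_cast; ring

/-! ### The commutator theorem -/

section Commutator

variable {H : Type*} [NormedAddCommGroup H] [InnerProductSpace ℂ H]

/-- The inverse `R` of a positive self-adjoint operator `N ≥ 1`, with its spectral projections `P k`
onto `N ≤ k + 1` and the bounded operators `N k = N P k`. -/
structure Cutoff (H : Type*) [NormedAddCommGroup H] [InnerProductSpace ℂ H] where
  /-- The inverse of `N`. -/
  R : H →L[ℂ] H
  /-- The spectral projections. -/
  P : ℕ → H →L[ℂ] H
  /-- The truncations of `N`. -/
  N : ℕ → H →L[ℂ] H
  R_sa : ∀ x y, (inner ℂ (R x) y) = (inner ℂ x (R y))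
  P_sa : ∀ k x y, (inner ℂ (P k x) y) = (inner ℂ x (P k y))
  N_sa : ∀ k x y, (inner ℂ (N k x) y) = (inner ℂ x (N k y))
  N_R : ∀ k x, N k (R x) = P k x
  R_N : ∀ k x, R (N k x) = P k x
  P_N : ∀ {j k}, j ≤ k → ∀ x, P j (N k x) = N j x
  P_N' : ∀ {j k}, j ≤ k → ∀ x, P k (N j x) = N j x
  P_norm : ∀ k x, ‖P k x‖ ≤ ‖x‖
  tail : ∀ k x, ‖R x - P k (R x)‖ ≤ ‖x‖ / (k + 1)
  P_tendsto : ∀ x, Tendsto (fun k => P k x) atTop (𝓝 x)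
  dense : DenseRange R
  mem_dom : ∀ v C, (∀ j, ‖N j v‖ ≤ C) → ∃ η, R η = v ∧ ‖η‖ ≤ C

/-- `T` is `Z R` for a symmetric operator `Z`, and `T'` is `[Z, N] R` up to sign. -/
structure Commutes (c : Cutoff H) (T T' : H →L[ℂ] H) : Prop where
  sym : ∀ x y, (inner ℂ (T x) (c.R y)) = (inner ℂ (c.R x) (T y))
  comm : ∀ x y, (inner ℂ (T x) y) - (inner ℂ x (T y)) = (inner ℂ (c.R x) (T' y))

namespace Cutoff

variable (c : Cutoff H)

theorem eq_zero_of_inner {u : H} (h : ∀ x, (inner ℂ u (c.R x)) = 0) : u = 0 := by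
  have h1 : (fun x => (inner ℂ u x)) = fun _ => 0 :=
    c.dense.equalizer (by fun_prop) (by fun_prop) (funext h)
  exact inner_self_eq_zero.1 (congrFun h1 u)

theorem R_injective : Function.Injective c.R := by
  refine (injective_iff_map_eq_zero c.R).2 fun x hx => c.eq_zero_of_inner fun y => ?_
  rw [← c.R_sa, hx, inner_zero_left]

/-- The generator of the truncated dynamics. -/
def gen (T : H →L[ℂ] H) (k : ℕ) : H →L[ℂ] H := Complex.I • (c.P k ∘L T ∘L c.N k)

theorem gen_apply (T : H →L[ℂ] H) (k : ℕ) (x : H) :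
    c.gen T k x = Complex.I • c.P k (T (c.N k x)) := rfl

variable {c} {T T' : H →L[ℂ] H}

theorem gen_skew (h : Commutes c T T') (k : ℕ) (x y : H) :
    (inner ℂ (c.gen T k x) y) = -(inner ℂ x (c.gen T k y)) := by
  rw [gen_apply, gen_apply, inner_smul_left, inner_smul_right, c.P_sa, ← c.R_N, h.sym, c.R_N,
    c.P_sa]
  simp

/-- The truncated dynamics. -/
def dyn (c : Cutoff H) (T : H →L[ℂ] H) (k : ℕ) (t : ℝ) : H →L[ℂ] H :=
  NormedSpace.exp (t • c.gen T k)

theorem dyn_zero (k : ℕ) (x : H) : c.dyn T k 0 x = x := by simp [dyn]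

theorem hasDerivAt_clm {E F : Type*} [NormedAddCommGroup E] [NormedSpace ℂ E]
    [NormedAddCommGroup F] [NormedSpace ℂ F] (B : E →L[ℂ] F) {f : ℝ → E} {f' : E} {t : ℝ}
    (hf : HasDerivAt f f' t) : HasDerivAt (fun t => B (f t)) (B f') t :=
  (B.restrictScalars ℝ).hasFDerivAt.comp_hasDerivAt t hf

theorem hasDerivAt_norm_sq {f : ℝ → H} {f' : H} {t : ℝ} (hf : HasDerivAt f f' t) :
    HasDerivAt (fun t => ‖f t‖ ^ 2) (2 * ((inner ℂ (f t) f')).re) t := by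
  have h1 := Complex.reCLM.hasFDerivAt.comp_hasDerivAt t (hf.inner ℂ hf)
  have e1 : (fun t => ‖f t‖ ^ 2) = Complex.reCLM ∘ fun t => (inner ℂ (f t) (f t)) := by
    funext t
    rw [Function.comp_apply, Complex.reCLM_apply, inner_self_eq_norm_sq_to_K]
    norm_cast
  have e2 : 2 * ((inner ℂ (f t) f')).re = Complex.reCLM ((inner ℂ (f t) f') + (inner ℂ f' (f t))) := by
    rw [Complex.reCLM_apply, Complex.add_re, ← inner_conj_symm f', Complex.conj_re]
    ring
  rw [e1, e2]
  exact h1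

theorem P_P {j k : ℕ} (hjk : j ≤ k) (x : H) : c.P j (c.P k x) = c.P j x := by
  rw [← c.N_R k, c.P_N hjk, c.N_R]

variable [CompleteSpace H]

theorem hasDerivAt_dyn (k : ℕ) (t : ℝ) (x : H) :
    HasDerivAt (fun t => c.dyn T k t x) (c.gen T k (c.dyn T k t x)) t := by
  exact hasDerivAt_clm (ContinuousLinearMap.apply ℂ H x)
    (hasDerivAt_exp_smul_const' (𝕂 := ℝ) (c.gen T k) t)

theorem hasDerivAt_dyn' (k : ℕ) (t : ℝ) (x : H) :
    HasDerivAt (fun t => c.dyn T k t x) (c.dyn T k t (c.gen T k x)) t := by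
  exact hasDerivAt_clm (ContinuousLinearMap.apply ℂ H x)
    (hasDerivAt_exp_smul_const (𝕂 := ℝ) (c.gen T k) t)

theorem dyn_add (k : ℕ) (s t : ℝ) (x : H) : c.dyn T k (s + t) x = c.dyn T k s (c.dyn T k t x) := by
  unfold dyn
  let _ : NormedAlgebra ℚ (H →L[ℂ] H) := NormedAlgebra.restrictScalars ℚ ℝ _
  rw [add_smul, NormedSpace.exp_add_of_commute]
  · rfl
  · exact ((Commute.refl _).smul_left s).smul_right t

theorem norm_dyn (h : Commutes c T T') (k : ℕ) (t : ℝ) (x : H) : ‖c.dyn T k t x‖ = ‖x‖ := by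
  have h1 : ∀ t, HasDerivAt (fun t => ‖c.dyn T k t x‖ ^ 2) 0 t := fun t => by
    convert hasDerivAt_norm_sq (hasDerivAt_dyn (c := c) (T := T) k t x) using 1
    have h2 := gen_skew h k (c.dyn T k t x) (c.dyn T k t x)
    have h3 := congrArg Complex.re h2
    rw [← inner_conj_symm, Complex.conj_re, Complex.neg_re] at h3
    linarith
  have h2 := is_const_of_deriv_eq_zero (fun t => (h1 t).differentiableAt)
    (fun t => (h1 t).deriv) t 0
  simp only [dyn_zero] at h2
  exact (sq_eq_sq₀ (norm_nonneg _) (norm_nonneg _)).1 h2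

theorem le_exp_of_deriv_le {g g' : ℝ → ℝ} {K : ℝ} (hg : ∀ t, HasDerivAt g (g' t) t)
    (hb : ∀ t, |g' t| ≤ K * g t) (t : ℝ) : g t ≤ Real.exp (K * |t|) * g 0 := by
  have he : ∀ K t : ℝ, HasDerivAt (fun t => Real.exp (K * t)) (K * Real.exp (K * t)) t :=
    fun K t => by
      have := ((hasDerivAt_id t).const_mul K).exp
      simpa [mul_comm] using this
  rcases le_total 0 t with h | h
  · have h1 : ∀ t, HasDerivAt (fun t => Real.exp (-K * t) * g t)
        (-K * Real.exp (-K * t) * g t + Real.exp (-K * t) * g' t) t := fun t =>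
      (he (-K) t).mul (hg t)
    have h2 : Antitone fun t => Real.exp (-K * t) * g t :=
      antitone_of_deriv_nonpos (fun t => (h1 t).differentiableAt) fun t => by
        rw [(h1 t).deriv]
        have := (abs_le.1 (hb t)).2
        have h3 := (Real.exp_pos (-K * t)).le
        nlinarith
    have h3 := h2 h
    simp only [mul_zero, Real.exp_zero, one_mul] at h3
    rw [abs_of_nonneg h]
    calc g t = Real.exp (K * t) * (Real.exp (-K * t) * g t) := by
          rw [← mul_assoc, ← Real.exp_add]; simp
      _ ≤ _ := mul_le_mul_of_nonneg_left h3 (Real.exp_pos _).le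
  · have h1 : ∀ t, HasDerivAt (fun t => Real.exp (K * t) * g t)
        (K * Real.exp (K * t) * g t + Real.exp (K * t) * g' t) t := fun t =>
      (he K t).mul (hg t)
    have h2 : Monotone fun t => Real.exp (K * t) * g t :=
      monotone_of_deriv_nonneg (fun t => (h1 t).differentiableAt) fun t => by
        rw [(h1 t).deriv]
        have := (abs_le.1 (hb t)).1
        have h3 := (Real.exp_pos (K * t)).le
        nlinarith
    have h3 := h2 h
    simp only [mul_zero, Real.exp_zero, one_mul] at h3
    rw [abs_of_nonpos h]
    calc g t = Real.exp (K * -t) * (Real.exp (K * t) * g t) := by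
          rw [← mul_assoc, ← Real.exp_add]; simp
      _ ≤ _ := mul_le_mul_of_nonneg_left h3 (Real.exp_pos _).le

theorem norm_N_dyn (h : Commutes c T T') (k : ℕ) (t : ℝ) (x : H) :
    ‖c.N k (c.dyn T k t x)‖ ≤ Real.exp (‖T'‖ * |t|) * ‖c.N k x‖ := by
  have h1 : ∀ t, HasDerivAt (fun t => ‖c.N k (c.dyn T k t x)‖ ^ 2)
      (2 * ((inner ℂ (c.N k (c.dyn T k t x)) (c.N k (c.gen T k (c.dyn T k t x))))).re) t := fun t =>
    hasDerivAt_norm_sq (hasDerivAt_clm (c.N k) (hasDerivAt_dyn (c := c) (T := T) k t x))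
  have h2 : ∀ t, |2 * ((inner ℂ (c.N k (c.dyn T k t x)) (c.N k (c.gen T k (c.dyn T k t x))))).re| ≤
      2 * ‖T'‖ * ‖c.N k (c.dyn T k t x)‖ ^ 2 := fun t => by
    generalize c.dyn T k t x = v
    set η := c.N k v with hη
    set ξ := c.N k η with hξ
    have e1 : c.R ξ = η := by rw [hξ, c.R_N, hη, c.P_N le_rfl]
    have e2 : (inner ℂ η (c.N k (c.gen T k v))) = Complex.I * (inner ℂ ξ (T η)) := by
      rw [gen_apply, map_smul, inner_smul_right, ← c.N_sa, ← c.P_sa, ← hξ, ← hη, hξ, c.P_N le_rfl]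
    have e3 := h.comm η ξ
    have e4 := h.sym ξ ξ
    have e5 := h.comm ξ η
    rw [e1] at e4 e5
    have e6 := congrArg (starRingEnd ℂ) e5
    have e7 := congrArg (starRingEnd ℂ) e3
    simp only [map_sub, inner_conj_symm] at e6 e7
    have e8 : ((inner ℂ ξ (T η))).im = -((inner ℂ η (T' η))).im := by
      have i1 := congrArg Complex.im e5
      have i2 := congrArg Complex.im e7
      have i3 := congrArg Complex.im e4
      have i4 := congrArg Complex.im e6
      have s1 : ((inner ℂ (T η) ξ)).im = -((inner ℂ ξ (T η))).im := by
        rw [← inner_conj_symm, Complex.conj_im]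
      have s2 : ((inner ℂ η (T ξ))).im = -((inner ℂ (T ξ) η)).im := by
        rw [← inner_conj_symm, Complex.conj_im]
      simp only [Complex.sub_im] at i1 i2 i3 i4
      linarith
    rw [e2]
    have e9 : (Complex.I * (inner ℂ ξ (T η))).re = ((inner ℂ η (T' η))).im := by
      rw [Complex.I_mul_re, e8, neg_neg]
    rw [e9, abs_mul, abs_two, mul_assoc]
    refine mul_le_mul_of_nonneg_left ?_ zero_le_two
    calc |((inner ℂ η (T' η))).im| ≤ ‖(inner ℂ η (T' η))‖ := Complex.abs_im_le_norm _
      _ ≤ ‖η‖ * ‖T' η‖ := norm_inner_le_norm _ _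
      _ ≤ ‖η‖ * (‖T'‖ * ‖η‖) := by gcongr; exact T'.le_opNorm η
      _ = _ := by ring
  have h3 := le_exp_of_deriv_le h1 h2 t
  simp only [dyn_zero] at h3
  refine (sq_le_sq₀ (norm_nonneg _) (by positivity)).1 (h3.trans (le_of_eq ?_))
  rw [mul_pow, ← Real.exp_nat_mul]
  push_cast
  ring_nf

theorem norm_N_dyn_R (h : Commutes c T T') (k : ℕ) (t : ℝ) (x : H) :
    ‖c.N k (c.dyn T k t (c.R x))‖ ≤ Real.exp (‖T'‖ * |t|) * ‖x‖ := by
  refine (norm_N_dyn h k t _).trans ?_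
  rw [c.N_R]
  exact mul_le_mul_of_nonneg_left (c.P_norm k x) (Real.exp_pos _).le

theorem norm_sub_le_of_hasDerivAt {E : Type*} [NormedAddCommGroup E] [NormedSpace ℝ E]
    {f f' : ℝ → E} {t C : ℝ} (hf : ∀ s, HasDerivAt f (f' s) s)
    (hb : ∀ s, |s| ≤ |t| → ‖f' s‖ ≤ C) : ‖f t - f 0‖ ≤ C * |t| := by
  have := (convex_Icc (-|t|) |t|).norm_image_sub_le_of_norm_hasDerivWithin_le
    (f := f) (f' := f') (C := C) (fun s _ => (hf s).hasDerivWithinAt)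
    (fun s hs => hb s (abs_le.2 hs)) (x := 0) (y := t)
    ⟨by simp, abs_nonneg t⟩ ⟨neg_abs_le t, le_abs_self t⟩
  simpa using this

theorem dyn_sub_P (j : ℕ) (t : ℝ) (x : H) :
    c.dyn T j t x - c.P j (c.dyn T j t x) = x - c.P j x := by
  have h1 : ∀ t, HasDerivAt (fun t => c.dyn T j t x - c.P j (c.dyn T j t x)) 0 t := fun t => by
    have h2 := hasDerivAt_dyn (c := c) (T := T) j t x
    have h3 := h2.sub (hasDerivAt_clm (c.P j) h2)
    rwa [gen_apply, map_smul, P_P le_rfl, sub_self] at h3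
  have h2 := is_const_of_deriv_eq_zero (fun t => (h1 t).differentiableAt)
    (fun t => (h1 t).deriv) t 0
  simpa only [dyn_zero] using h2

theorem norm_dyn_sub_dyn (h : Commutes c T T') {j k : ℕ} (hjk : j ≤ k) (t : ℝ) (x : H) :
    ‖c.dyn T k t (c.R x) - c.dyn T j t (c.R x)‖ ^ 2 ≤
      4 * ‖T‖ * Real.exp (‖T'‖ * |t|) ^ 2 * ‖x‖ ^ 2 * |t| / (j + 1) := by
  set E := Real.exp (‖T'‖ * |t|) with hE
  have hE1 : 1 ≤ E := Real.one_le_exp (by positivity)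
  set F : ℝ → ℂ := fun t => (inner ℂ (c.dyn T k t (c.R x)) (c.dyn T j t (c.R x))) with hF
  have hd : ∀ s, HasDerivAt F ((inner ℂ (c.dyn T k s (c.R x)) (c.gen T j (c.dyn T j s (c.R x)))) +
      (inner ℂ (c.gen T k (c.dyn T k s (c.R x))) (c.dyn T j s (c.R x)))) s := fun s =>
    (hasDerivAt_dyn k s _).inner ℂ (hasDerivAt_dyn j s _)
  have hb : ∀ s, |s| ≤ |t| → ‖(inner ℂ (c.dyn T k s (c.R x)) (c.gen T j (c.dyn T j s (c.R x)))) +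
      (inner ℂ (c.gen T k (c.dyn T k s (c.R x))) (c.dyn T j s (c.R x)))‖ ≤
      2 * ‖T‖ * E ^ 2 * ‖x‖ ^ 2 / (j + 1) := by
    intro s hs
    have hle : Real.exp (‖T'‖ * |s|) ≤ E := Real.exp_le_exp.2 (by gcongr)
    have b1 : ‖c.N k (c.dyn T k s (c.R x))‖ ≤ E * ‖x‖ :=
      (norm_N_dyn_R h k s x).trans (by gcongr)
    have b2 : ‖c.N j (c.dyn T j s (c.R x))‖ ≤ E * ‖x‖ :=
      (norm_N_dyn_R h j s x).trans (by gcongr)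
    have e0 := dyn_sub_P (c := c) (T := T) j s (c.R x)
    generalize c.dyn T k s (c.R x) = v at *
    generalize c.dyn T j s (c.R x) = w at *
    set η := c.N k v with hη
    set ξ := c.N j w with hξ
    have e1 : c.P k w = c.R ξ + c.P k (c.R x - c.P j (c.R x)) := by
      rw [← e0, map_sub, hξ, c.R_N, ← c.N_R j w, c.P_N' hjk]; abel
    have e2 : c.P j v = c.P j (c.R η) := by rw [hη, c.R_N, P_P hjk]
    have e3 : (inner ℂ v (c.gen T j w)) + (inner ℂ (c.gen T k v) w) =
        -Complex.I * ((inner ℂ (T η) (c.P k (c.R x - c.P j (c.R x)))) +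
          (inner ℂ (c.R η - c.P j (c.R η)) (T ξ))) := by
      rw [gen_apply, gen_apply, inner_smul_left, inner_smul_right, c.P_sa, ← c.P_sa, e1, e2,
        inner_add_right, h.sym, inner_sub_left, Complex.conj_I]
      ring
    rw [e3, norm_mul, norm_neg, Complex.norm_I, one_mul]
    have j0 : (0 : ℝ) < j + 1 := by positivity
    calc _ ≤ ‖(inner ℂ (T η) (c.P k (c.R x - c.P j (c.R x))))‖ + ‖(inner ℂ (c.R η - c.P j (c.R η)) (T ξ))‖ :=
          norm_add_le _ _
      _ ≤ ‖T η‖ * ‖c.P k (c.R x - c.P j (c.R x))‖ + ‖c.R η - c.P j (c.R η)‖ * ‖T ξ‖ :=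
          add_le_add (norm_inner_le_norm _ _) (norm_inner_le_norm _ _)
      _ ≤ (‖T‖ * (E * ‖x‖)) * (‖x‖ / (j + 1)) + (E * ‖x‖ / (j + 1)) * (‖T‖ * (E * ‖x‖)) := by
          gcongr
          · exact (T.le_opNorm _).trans (by gcongr)
          · exact (c.P_norm _ _).trans (c.tail j x)
          · exact (c.tail j η).trans (by gcongr)
          · exact (T.le_opNorm _).trans (by gcongr)
      _ ≤ _ := by
          have : E ≤ E ^ 2 := by nlinarith
          have h5 : ‖T‖ * E * ‖x‖ ^ 2 ≤ ‖T‖ * E ^ 2 * ‖x‖ ^ 2 := by gcongr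
          calc _ = (‖T‖ * E * ‖x‖ ^ 2 + ‖T‖ * E ^ 2 * ‖x‖ ^ 2) / (j + 1) := by ring
            _ ≤ (‖T‖ * E ^ 2 * ‖x‖ ^ 2 + ‖T‖ * E ^ 2 * ‖x‖ ^ 2) / (j + 1) := by gcongr
            _ = _ := by ring
  have h1 := norm_sub_le_of_hasDerivAt hd hb
  have h2 : ‖c.dyn T k t (c.R x) - c.dyn T j t (c.R x)‖ ^ 2 = 2 * (F 0 - F t).re := by
    rw [@norm_sub_sq ℂ, norm_dyn h, norm_dyn h]
    simp only [hF, dyn_zero, Complex.sub_re]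
    have : ((inner ℂ (c.R x) (c.R x))).re = ‖c.R x‖ ^ 2 := by
      rw [inner_self_eq_norm_sq_to_K]; norm_cast
    rw [this, RCLike.re_to_complex]
    ring
  rw [h2]
  have h3 : (F 0 - F t).re ≤ ‖F t - F 0‖ := by
    rw [norm_sub_rev]; exact (Complex.re_le_norm _)
  calc _ ≤ 2 * (2 * ‖T‖ * E ^ 2 * ‖x‖ ^ 2 / (j + 1) * |t|) := by linarith
    _ = _ := by ring

theorem cauchySeq_dyn (h : Commutes c T T') (t : ℝ) (x : H) :
    CauchySeq fun k => c.dyn T k t x := by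
  rw [Metric.cauchySeq_iff']
  intro ε hε
  obtain ⟨_, hy, ⟨y, rfl⟩⟩ := Metric.dense_iff.1 c.dense x (ε / 3) (by positivity)
  rw [Metric.mem_ball, dist_eq_norm] at hy
  set K := 4 * ‖T‖ * Real.exp (‖T'‖ * |t|) ^ 2 * ‖y‖ ^ 2 * |t| with hK
  have hlim : Tendsto (fun j : ℕ => K / ((j : ℝ) + 1)) atTop (𝓝 0) :=
    tendsto_const_div_atTop_nhds_zero_nat K |>.comp (tendsto_add_atTop_nat 1) |>.congr
      fun j => by simp
  obtain ⟨j, hj⟩ := (hlim.eventually_lt_const (show (0 : ℝ) < (ε / 3) ^ 2 by positivity)).exists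
  refine ⟨j, fun k hk => ?_⟩
  have h1 : ‖c.dyn T k t (c.R y) - c.dyn T j t (c.R y)‖ < ε / 3 :=
    lt_of_pow_lt_pow_left₀ 2 (by positivity) ((norm_dyn_sub_dyn h hk t y).trans_lt hj)
  rw [dist_eq_norm]
  have h2 : ∀ i, ‖c.dyn T i t x - c.dyn T i t (c.R y)‖ < ε / 3 := fun i => by
    rw [← map_sub, norm_dyn h, norm_sub_rev]; exact hy
  calc _ = ‖(c.dyn T k t x - c.dyn T k t (c.R y)) + (c.dyn T k t (c.R y) - c.dyn T j t (c.R y)) -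
        (c.dyn T j t x - c.dyn T j t (c.R y))‖ := by congr 1; abel
    _ ≤ ‖c.dyn T k t x - c.dyn T k t (c.R y)‖ + ‖c.dyn T k t (c.R y) - c.dyn T j t (c.R y)‖ +
        ‖c.dyn T j t x - c.dyn T j t (c.R y)‖ := (norm_sub_le _ _).trans (by gcongr; exact norm_add_le _ _)
    _ < ε := by linarith [h2 k, h2 j]

/-- The limiting dynamics. -/
def limDyn (c : Cutoff H) (T : H →L[ℂ] H) (t : ℝ) (x : H) : H :=
  limUnder atTop fun k => c.dyn T k t x

theorem tendsto_dyn (h : Commutes c T T') (t : ℝ) (x : H) :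
    Tendsto (fun k => c.dyn T k t x) atTop (𝓝 (c.limDyn T t x)) :=
  (cauchySeq_tendsto_of_complete (cauchySeq_dyn h t x)).elim fun _ ha => tendsto_nhds_limUnder ⟨_, ha⟩

theorem norm_limDyn (h : Commutes c T T') (t : ℝ) (x : H) : ‖c.limDyn T t x‖ = ‖x‖ := by
  refine tendsto_nhds_unique (tendsto_dyn h t x).norm ?_
  simp only [norm_dyn h]
  exact tendsto_const_nhds

theorem limDyn_zero (h : Commutes c T T') (x : H) : c.limDyn T 0 x = x := by
  refine tendsto_nhds_unique (tendsto_dyn h 0 x) ?_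
  simp only [dyn_zero]
  exact tendsto_const_nhds

theorem limDyn_add (h : Commutes c T T') (s t : ℝ) (x : H) :
    c.limDyn T (s + t) x = c.limDyn T s (c.limDyn T t x) := by
  refine tendsto_nhds_unique (tendsto_dyn h (s + t) x) ?_
  have h1 : Tendsto (fun k => c.dyn T k s (c.dyn T k t x - c.limDyn T t x)) atTop (𝓝 0) := by
    refine squeeze_zero_norm (fun k => (norm_dyn h k s _).le) ?_
    exact tendsto_iff_norm_sub_tendsto_zero.1 (tendsto_dyn h t x)
  have h2 := h1.add (tendsto_dyn h s (c.limDyn T t x))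
  rw [zero_add] at h2
  refine h2.congr fun k => ?_
  rw [map_sub, sub_add_cancel, dyn_add]

/-- The unitary group generated by `Z`. -/
def grp (h : Commutes c T T') (t : ℝ) : H ≃ₗᵢ[ℂ] H where
  toFun := c.limDyn T t
  invFun := c.limDyn T (-t)
  map_add' x y := tendsto_nhds_unique (tendsto_dyn h t (x + y)) (by
    simpa only [map_add] using (tendsto_dyn h t x).add (tendsto_dyn h t y))
  map_smul' a x := tendsto_nhds_unique (tendsto_dyn h t (a • x)) (by
    simpa only [map_smul, RingHom.id_apply] using (tendsto_dyn h t x).const_smul a)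
  left_inv x := by rw [← limDyn_add h, neg_add_cancel, limDyn_zero h]
  right_inv x := by rw [← limDyn_add h, add_neg_cancel, limDyn_zero h]
  norm_map' := norm_limDyn h t

theorem tendsto_grp (h : Commutes c T T') (t : ℝ) (x : H) :
    Tendsto (fun k => c.dyn T k t x) atTop (𝓝 (grp h t x)) := tendsto_dyn h t x

theorem grp_zero (h : Commutes c T T') (x : H) : grp h 0 x = x := limDyn_zero h x

theorem grp_add (h : Commutes c T T') (s t : ℝ) (x : H) :
    grp h (s + t) x = grp h s (grp h t x) := limDyn_add h s t x

end Cutoff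

end Commutator

namespace Cutoff

variable {H : Type*} [NormedAddCommGroup H] [InnerProductSpace ℂ H] [CompleteSpace H]
variable {c : Cutoff H} {T T' : H →L[ℂ] H} (h : Commutes c T T')

include h

theorem norm_dyn_sub (k : ℕ) (t : ℝ) (x : H) :
    ‖c.dyn T k t (c.R x) - c.R x‖ ≤ ‖T‖ * (Real.exp (‖T'‖ * |t|) * ‖x‖) * |t| := by
  have h1 := norm_sub_le_of_hasDerivAt (f := fun t => c.dyn T k t (c.R x)) (t := t)
    (C := ‖T‖ * (Real.exp (‖T'‖ * |t|) * ‖x‖)) (fun s => hasDerivAt_dyn k s _) fun s hs => by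
      rw [gen_apply, norm_smul, Complex.norm_I, one_mul]
      refine (c.P_norm _ _).trans ((T.le_opNorm _).trans ?_)
      gcongr
      exact (norm_N_dyn_R h k s x).trans (by gcongr)
  simpa only [dyn_zero] using h1

theorem norm_grp_sub (t : ℝ) (x : H) :
    ‖grp h t (c.R x) - c.R x‖ ≤ ‖T‖ * (Real.exp (‖T'‖ * |t|) * ‖x‖) * |t| :=
  le_of_tendsto ((tendsto_grp h t (c.R x)).sub_const _).norm
    (Eventually.of_forall fun k => norm_dyn_sub h k t x)

theorem continuous_grp (x : H) : Continuous fun t => grp h t x := by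
  have h0 : ∀ x, Tendsto (fun t => grp h t x) (𝓝 0) (𝓝 x) := by
    intro x
    rw [Metric.tendsto_nhds]
    intro ε hε
    obtain ⟨_, hy, ⟨y, rfl⟩⟩ := Metric.dense_iff.1 c.dense x (ε / 3) (by positivity)
    rw [Metric.mem_ball, dist_eq_norm] at hy
    have h1 : Tendsto (fun t : ℝ => ‖T‖ * (Real.exp (‖T'‖ * |t|) * ‖y‖) * |t|) (𝓝 0) (𝓝 0) := by
      have : Continuous fun t : ℝ => ‖T‖ * (Real.exp (‖T'‖ * |t|) * ‖y‖) * |t| := by fun_prop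
      simpa using this.tendsto 0
    filter_upwards [h1.eventually_lt_const (show (0 : ℝ) < ε / 3 by positivity)] with t ht
    rw [dist_eq_norm]
    have h2 := (norm_grp_sub h t y).trans_lt ht
    have h3 : ‖grp h t (x - c.R y)‖ < ε / 3 := by
      rw [LinearIsometryEquiv.norm_map, norm_sub_rev]; exact hy
    calc _ = ‖grp h t (x - c.R y) + (grp h t (c.R y) - c.R y) + (c.R y - x)‖ := by
          rw [map_sub]; congr 1; abel
      _ ≤ ‖grp h t (x - c.R y)‖ + ‖grp h t (c.R y) - c.R y‖ + ‖c.R y - x‖ := norm_add₃_le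
      _ < ε := by linarith
  refine continuous_iff_continuousAt.2 fun t => ?_
  have h1 : Tendsto (fun s => grp h t (grp h (s - t) x)) (𝓝 t) (𝓝 (grp h t x)) := by
    refine ((grp h t).continuous.tendsto x).comp ((h0 x).comp ?_)
    have : Continuous fun s : ℝ => s - t := by fun_prop
    simpa using this.tendsto t
  refine h1.congr fun s => ?_
  rw [← grp_add, add_sub_cancel]

/-- `y = Z x`, for the generator `iZ` of the unitary group. -/
def IsGen (x y : H) : Prop := HasDerivAt (fun t => grp h t x) (Complex.I • y) 0

omit h in
theorem hasDerivAt_zero_of_bound {f : ℝ → H} {y : H}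
    (hb : ∀ ε > 0, ∃ δ > 0, ∀ t : ℝ, |t| < δ → ‖f t - f 0 - t • y‖ ≤ ε * |t|) :
    HasDerivAt f y 0 := by
  rw [hasDerivAt_iff_isLittleO_nhds_zero, Asymptotics.isLittleO_iff]
  intro ε hε
  obtain ⟨δ, hδ, hb⟩ := hb ε hε
  filter_upwards [Metric.ball_mem_nhds (0 : ℝ) hδ] with t ht
  rw [Metric.mem_ball, dist_zero_right, Real.norm_eq_abs] at ht
  simpa using hb t ht

theorem isGen_R (x : H) : IsGen h (c.R x) (T x) := by
  refine hasDerivAt_zero_of_bound fun ε hε => ?_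
  obtain ⟨_, hy, ⟨y, rfl⟩⟩ := Metric.dense_iff.1 c.dense (T x) (ε / 4) (by positivity)
  rw [Metric.mem_ball, dist_eq_norm, norm_sub_rev] at hy
  set L := ‖T‖ * (Real.exp ‖T'‖ * ‖y‖) with hL
  have hL0 : 0 ≤ L := by positivity
  refine ⟨min 1 (ε / (2 * (L + 1))), by positivity, fun t ht => ?_⟩
  have ht1 : |t| ≤ 1 := (ht.trans_le (min_le_left _ _)).le
  have ht2 : L * |t| ≤ ε / 2 := by
    have : |t| ≤ ε / (2 * (L + 1)) := (ht.trans_le (min_le_right _ _)).le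
    calc L * |t| ≤ (L + 1) * (ε / (2 * (L + 1))) := by gcongr; linarith
      _ = ε / 2 := by field_simp
  set y' : ℕ → H := fun k => c.gen T k (c.R x) with hy'
  have hlim : Tendsto y' atTop (𝓝 (Complex.I • T x)) := by
    have h1 : Tendsto (fun k => c.P k (T (c.P k x) - T x)) atTop (𝓝 0) := by
      refine squeeze_zero_norm (fun k => c.P_norm k _) ?_
      exact tendsto_iff_norm_sub_tendsto_zero.1 ((T.continuous.tendsto x).comp (c.P_tendsto x))
    have h2 := (h1.add (c.P_tendsto (T x))).const_smul Complex.I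
    rw [zero_add] at h2
    refine h2.congr fun k => ?_
    rw [hy']
    simp only
    rw [gen_apply, c.N_R, map_sub, sub_add_cancel]
  have hk : ∀ k, ‖c.dyn T k t (c.R x) - c.R x - t • y' k‖ ≤
      (2 * ‖y' k - Complex.I • c.R y‖ + L * |t|) * |t| := fun k => by
    have h1 := norm_sub_le_of_hasDerivAt (f := fun s => c.dyn T k s (c.R x) - s • y' k) (t := t)
      (C := 2 * ‖y' k - Complex.I • c.R y‖ + L * |t|)
      (fun s => (hasDerivAt_dyn' k s _).sub ((hasDerivAt_id s).smul_const (y' k))) fun s hs => by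
        have h2 : ‖c.dyn T k s (c.R y) - c.R y‖ ≤ L * |t| := by
          refine (norm_dyn_sub h k s y).trans ?_
          have : ‖T'‖ * |s| ≤ ‖T'‖ := mul_le_of_le_one_right (norm_nonneg _) (hs.trans ht1)
          rw [hL]
          gcongr
        rw [one_smul]
        change ‖c.dyn T k s (y' k) - y' k‖ ≤ _
        calc _ = ‖c.dyn T k s (y' k - Complex.I • c.R y) - (y' k - Complex.I • c.R y) +
              Complex.I • (c.dyn T k s (c.R y) - c.R y)‖ := by
              rw [map_sub, map_smul, smul_sub]; congr 1; abel
          _ ≤ ‖c.dyn T k s (y' k - Complex.I • c.R y)‖ + ‖y' k - Complex.I • c.R y‖ +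
              ‖Complex.I • (c.dyn T k s (c.R y) - c.R y)‖ :=
              (norm_add_le _ _).trans (by gcongr; exact norm_sub_le _ _)
          _ ≤ _ := by
              rw [norm_dyn h, norm_smul, Complex.norm_I, one_mul]
              linarith
    simp only [dyn_zero, zero_smul, sub_zero] at h1
    rwa [sub_right_comm]
  have h3 := le_of_tendsto_of_tendsto'
    (((tendsto_grp h t (c.R x)).sub_const (c.R x)).sub (hlim.const_smul t)).norm
    ((((hlim.sub_const (Complex.I • c.R y)).norm.const_mul 2).add_const (L * |t|)).mul_const |t|) hk
  rw [grp_zero]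
  refine h3.trans ?_
  rw [← smul_sub, norm_smul, Complex.norm_I, one_mul]
  gcongr
  linarith

variable {h}

theorem IsGen.hasDerivAt {x y : H} (hx : IsGen h x y) (t : ℝ) :
    HasDerivAt (fun t => grp h t x) (grp h t (Complex.I • y)) t := by
  have h1 : HasDerivAt (fun s => grp h (s - t) x) (Complex.I • y) t := by
    have : HasDerivAt (fun t => grp h t x) (Complex.I • y) (t - t) := by rwa [sub_self]
    exact this.comp_sub_const t t
  have h2 := hasDerivAt_clm (grp h t).toContinuousLinearEquiv.toContinuousLinearMap h1
  refine h2.congr_of_eventuallyEq (Eventually.of_forall fun s => ?_)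
  change _ = grp h t (grp h (s - t) x)
  rw [← grp_add, add_sub_cancel]

theorem IsGen.bound {x y : H} (hx : IsGen h x y) {t C : ℝ}
    (hC : ∀ s, |s| ≤ |t| → ‖grp h s y - y‖ ≤ C) :
    ‖grp h t x - x - t • Complex.I • y‖ ≤ C * |t| := by
  have h1 := norm_sub_le_of_hasDerivAt (f := fun s => grp h s x - s • Complex.I • y) (t := t)
      (C := C) (fun s => (hx.hasDerivAt s).sub ((hasDerivAt_id s).smul_const _)) fun s hs => by
        rw [one_smul, map_smul, ← smul_sub, norm_smul, Complex.norm_I, one_mul]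
        exact hC s hs
  simp only [grp_zero, zero_smul, sub_zero] at h1
  rwa [sub_right_comm]

theorem isGen_of_mem_closure {x y : H}
    (hx : (x, y) ∈ closure {p : H × H | IsGen h p.1 p.2}) : IsGen h x y := by
  obtain ⟨p, hp, hlim⟩ := mem_closure_iff_seq_limit.1 hx
  have l1 := (continuous_fst.tendsto _).comp hlim
  have l2 := (continuous_snd.tendsto _).comp hlim
  refine hasDerivAt_zero_of_bound fun ε hε => ?_
  have hc := (continuous_grp h y).tendsto 0
  rw [grp_zero, Metric.tendsto_nhds] at hc
  obtain ⟨δ, hδ, hb⟩ := Metric.eventually_nhds_iff.1 (hc ε hε)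
  refine ⟨δ, hδ, fun t ht => ?_⟩
  have hk : ∀ k, ‖grp h t (p k).1 - (p k).1 - t • Complex.I • (p k).2‖ ≤
      (2 * ‖(p k).2 - y‖ + ε) * |t| := fun k => by
    refine IsGen.bound (hp k) fun s hs => ?_
    have h2 : ‖grp h s y - y‖ ≤ ε := by
      have := hb (y := s) (by rw [Real.dist_eq, sub_zero]; exact hs.trans_lt ht)
      rw [dist_eq_norm] at this
      exact this.le
    calc _ = ‖grp h s ((p k).2 - y) - ((p k).2 - y) + (grp h s y - y)‖ := by
          rw [map_sub]; congr 1; abel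
      _ ≤ ‖grp h s ((p k).2 - y)‖ + ‖(p k).2 - y‖ + ‖grp h s y - y‖ :=
          (norm_add_le _ _).trans (by gcongr; exact norm_sub_le _ _)
      _ ≤ _ := by
          rw [LinearIsometryEquiv.norm_map]
          linarith
  have h3 := le_of_tendsto_of_tendsto'
    (((((grp h t).continuous.tendsto x).comp l1).sub l1).sub
      ((l2.const_smul Complex.I).const_smul t)).norm
    ((((l2.sub_const y).norm.const_mul 2).add_const ε).mul_const |t|) hk
  rw [grp_zero]
  simpa using h3

theorem IsGen.sub {x y x' y' : H} (hx : IsGen h x y) (hx' : IsGen h x' y') :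
    IsGen h (x - x') (y - y') := by
  have := HasDerivAt.sub hx hx'
  rw [← smul_sub] at this
  unfold IsGen
  simp only [map_sub]
  exact this

theorem IsGen.norm_sq {x y : H} (hx : IsGen h x y) :
    ‖y + Complex.I • x‖ ^ 2 = ‖y‖ ^ 2 + ‖x‖ ^ 2 := by
  have h1 := hasDerivAt_norm_sq hx
  simp only [LinearIsometryEquiv.norm_map, grp_zero] at h1
  have h2 := h1.unique (hasDerivAt_const _ _)
  rw [inner_smul_right, Complex.I_mul_re] at h2
  rw [@norm_add_sq ℂ, inner_smul_right, RCLike.re_to_complex, Complex.I_mul_re, norm_smul,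
    Complex.norm_I, one_mul, ← inner_conj_symm, Complex.conj_im]
  linarith

theorem isGen_unique {y : H} (hx : IsGen h 0 y) : y = 0 := by
  have h1 : HasDerivAt (fun t => grp h t 0) 0 0 := by simpa using hasDerivAt_const (0 : ℝ) (0 : H)
  have := HasDerivAt.unique hx h1
  simpa using this

variable (h)

theorem exists_dom (t : ℝ) (x : H) :
    ∃ η, c.R η = grp h t (c.R x) ∧ ‖η‖ ≤ Real.exp (‖T'‖ * |t|) * ‖x‖ := by
  refine c.mem_dom _ _ fun j => ?_
  refine le_of_tendsto (((c.N j).continuous.tendsto _).comp (tendsto_grp h t (c.R x))).norm ?_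
  filter_upwards [eventually_ge_atTop j] with k hk
  rw [Function.comp_apply, ← c.P_N hk]
  exact (c.P_norm _ _).trans (norm_N_dyn_R h k t x)

/-- The action `N V(t) N⁻¹` of the group on the domain of `N`. -/
def dom (t : ℝ) (x : H) : H := (exists_dom h t x).choose

theorem R_dom (t : ℝ) (x : H) : c.R (dom h t x) = grp h t (c.R x) := (exists_dom h t x).choose_spec.1

theorem norm_dom (t : ℝ) (x : H) : ‖dom h t x‖ ≤ Real.exp (‖T'‖ * |t|) * ‖x‖ :=
  (exists_dom h t x).choose_spec.2

theorem dom_add (s t : ℝ) (x : H) : dom h (s + t) x = dom h s (dom h t x) := by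
  apply c.R_injective
  rw [R_dom, R_dom, R_dom, grp_add]

theorem dom_zero (x : H) : dom h 0 x = x := c.R_injective (by rw [R_dom, grp_zero])

theorem hasDerivAt_grp_R (t : ℝ) (x : H) :
    HasDerivAt (fun t => grp h t (c.R x)) (Complex.I • T (dom h t x)) t := by
  have h1 := isGen_R h (dom h t x)
  have h2 : HasDerivAt (fun s => grp h s (c.R (dom h t x))) (Complex.I • T (dom h t x)) (t - t) := by
    rw [sub_self]; exact h1
  refine (h2.comp_sub_const t t).congr_of_eventuallyEq (Eventually.of_forall fun s => ?_)
  change _ = grp h (s - t) (c.R (dom h t x))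
  rw [R_dom, ← grp_add, sub_add_cancel]

theorem denseRange_add_I : DenseRange (T + Complex.I • c.R : H →L[ℂ] H) := by
  have h0 : (LinearMap.range (T + Complex.I • c.R : H →L[ℂ] H).toLinearMap).topologicalClosure = ⊤ := by
    rw [Submodule.topologicalClosure_eq_top_iff, Submodule.eq_bot_iff]
    intro u hu
    have hu' : ∀ x, (inner ℂ u (T x)) = -Complex.I * (inner ℂ u (c.R x)) := fun x => by
      have := (Submodule.mem_orthogonal' _ u).1 hu _ ⟨x, rfl⟩
      simp only [ContinuousLinearMap.coe_coe, add_apply,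
        smul_apply, inner_add_right, inner_smul_right] at this
      linear_combination this
    refine c.eq_zero_of_inner fun x => ?_
    by_contra hne
    set g : ℝ → ℂ := fun t => (inner ℂ u (grp h t (c.R x))) with hg
    have hd : ∀ t, HasDerivAt g (g t) t := fun t => by
      have h1 := (hasDerivAt_const t u).inner ℂ (hasDerivAt_grp_R h t x)
      rw [inner_zero_left, add_zero, inner_smul_right, hu', ← mul_assoc, mul_neg, Complex.I_mul_I,
        neg_neg, one_mul, R_dom] at h1
      exact h1
    have hd2 : ∀ t : ℝ, HasDerivAt (fun t : ℝ => Real.exp (-t) • g t) 0 t := fun t => by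
      have h1 : HasDerivAt (fun t : ℝ => Real.exp (-t)) (Real.exp (-t) * -1) t :=
        (hasDerivAt_neg t).exp
      have h2 := h1.smul (hd t)
      rw [mul_neg_one, neg_smul, add_neg_cancel] at h2
      exact h2
    have hc : ∀ t, g t = Real.exp t • g 0 := fun t => by
      have h1 := is_const_of_deriv_eq_zero (fun t => (hd2 t).differentiableAt)
        (fun t => (hd2 t).deriv) t 0
      simp only [neg_zero, Real.exp_zero, one_smul] at h1
      rw [← h1, smul_smul, ← Real.exp_add, add_neg_cancel, Real.exp_zero, one_smul]
    have hg0 : g 0 ≠ 0 := by rw [hg]; simpa [grp_zero] using hne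
    have hb : ∀ t, ‖g t‖ ≤ ‖u‖ * ‖c.R x‖ := fun t => by
      have := norm_inner_le_norm (𝕜 := ℂ) u (grp h t (c.R x))
      rwa [LinearIsometryEquiv.norm_map] at this
    have hpos : 0 < ‖g 0‖ := norm_pos_iff.2 hg0
    have h1 := hb (‖u‖ * ‖c.R x‖ / ‖g 0‖)
    rw [hc, norm_smul, Real.norm_eq_abs, abs_of_pos (Real.exp_pos _)] at h1
    have h2 := Real.add_one_le_exp (‖u‖ * ‖c.R x‖ / ‖g 0‖)
    have h3 : (‖u‖ * ‖c.R x‖ / ‖g 0‖ + 1) * ‖g 0‖ ≤ ‖u‖ * ‖c.R x‖ :=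
      (mul_le_mul_of_nonneg_right h2 hpos.le).trans h1
    rw [add_mul, div_mul_cancel₀ _ hpos.ne'] at h3
    linarith
  exact Submodule.dense_iff_topologicalClosure_eq_top.2 h0

/-- The generator of the group is the closure of `Z`. -/
theorem isGen_iff (x y : H) :
    IsGen h x y ↔ (x, y) ∈ closure (Set.range fun ξ => (c.R ξ, T ξ)) := by
  constructor
  · intro hx
    refine Metric.mem_closure_iff.2 fun ε hε => ?_
    obtain ⟨_, hξ, ⟨ξ, rfl⟩⟩ := Metric.dense_iff.1 (denseRange_add_I h) (y + Complex.I • x) ε hε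
    refine ⟨_, ⟨ξ, rfl⟩, ?_⟩
    have h1 := (hx.sub (isGen_R h ξ)).norm_sq
    have h2 : ‖y - T ξ + Complex.I • (x - c.R ξ)‖ < ε := by
      rw [Metric.mem_ball, dist_comm, dist_eq_norm] at hξ
      refine lt_of_eq_of_lt (congrArg _ ?_) hξ
      change _ = y + Complex.I • x - (T ξ + Complex.I • c.R ξ)
      module
    have h3 : ‖y - T ξ + Complex.I • (x - c.R ξ)‖ ^ 2 < ε ^ 2 := by gcongr
    rw [Prod.dist_eq, max_lt_iff, dist_eq_norm, dist_eq_norm]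
    constructor
    · exact lt_of_pow_lt_pow_left₀ 2 hε.le (by nlinarith [sq_nonneg ‖y - T ξ‖])
    · exact lt_of_pow_lt_pow_left₀ 2 hε.le (by nlinarith [sq_nonneg ‖x - c.R ξ‖])
  · intro hx
    refine isGen_of_mem_closure (closure_mono ?_ hx)
    rintro _ ⟨ξ, rfl⟩
    exact isGen_R h ξ

theorem tendsto_inner_dom (u x : H) : Tendsto (fun t => (inner ℂ u (dom h t x))) (𝓝 0) (𝓝 (inner ℂ u x)) := by
  rw [Metric.tendsto_nhds]
  intro ε hε
  set K := (Real.exp ‖T'‖ + 1) * ‖x‖ + 1 with hK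
  have hK0 : 0 < K := by positivity
  obtain ⟨_, hy, ⟨y, rfl⟩⟩ := Metric.dense_iff.1 c.dense u (ε / (2 * K)) (by positivity)
  rw [Metric.mem_ball, dist_comm, dist_eq_norm] at hy
  have hc : Tendsto (fun t => (inner ℂ y (grp h t (c.R x)))) (𝓝 0) (𝓝 (inner ℂ y (c.R x))) := by
    have h1 := (continuous_grp h (c.R x)).tendsto 0
    rw [grp_zero] at h1
    exact tendsto_const_nhds.inner h1
  have h1 : ∀ᶠ t : ℝ in 𝓝 0, |t| < 1 := by
    have : Tendsto (fun t : ℝ => |t|) (𝓝 0) (𝓝 0) := by simpa using continuous_abs.tendsto (0 : ℝ)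
    exact this.eventually_lt_const one_pos
  filter_upwards [h1, (Metric.tendsto_nhds.1 hc) (ε / 2) (by positivity)] with t ht1 ht2
  rw [dist_eq_norm, ← inner_sub_right] at ht2 ⊢
  have e1 : (inner ℂ y (grp h t (c.R x) - c.R x)) = (inner ℂ (c.R y) (dom h t x - x)) := by
    rw [c.R_sa, map_sub, R_dom]
  have e2 : ‖dom h t x - x‖ ≤ K := by
    refine (norm_sub_le _ _).trans ?_
    have h3 := norm_dom h t x
    have h4 : Real.exp (‖T'‖ * |t|) ≤ Real.exp ‖T'‖ :=
      Real.exp_le_exp.2 (mul_le_of_le_one_right (norm_nonneg _) ht1.le)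
    have h5 := mul_le_mul_of_nonneg_right h4 (norm_nonneg x)
    rw [hK]
    linarith
  calc ‖(inner ℂ u (dom h t x - x))‖ = ‖(inner ℂ (u - c.R y) (dom h t x - x)) + (inner ℂ (c.R y) (dom h t x - x))‖ := by
        rw [← inner_add_left, sub_add_cancel]
    _ ≤ ‖u - c.R y‖ * ‖dom h t x - x‖ + ‖(inner ℂ (c.R y) (dom h t x - x))‖ :=
        (norm_add_le _ _).trans (by gcongr; exact norm_inner_le_norm _ _)
    _ < ε := by
        rw [← e1]
        have h6 : ‖u - c.R y‖ * ‖dom h t x - x‖ ≤ ε / (2 * K) * K := by gcongr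
        have h7 : ε / (2 * K) * K = ε / 2 := by field_simp
        linarith

/-- An operator `S` with `[iZ, S] = a S` is scaled by the group. -/
theorem grp_intertwine {S : H →L[ℂ] H} {a : ℝ} (hs : ∀ x y, (inner ℂ (S x) (c.R y)) = (inner ℂ (c.R x) (S y)))
    (hc : ∀ x y, Complex.I * (inner ℂ (S x) (T y)) - Complex.I * (inner ℂ (T x) (S y)) = -(a : ℂ) * (inner ℂ (c.R x) (S y)))
    (t : ℝ) (x : H) : grp h t (S x) = Real.exp (a * t) • S (dom h t x) := by
  have h0 : ∀ y x, HasDerivAt (fun t => (inner ℂ (grp h t (c.R y)) (S (dom h t x))))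
      (-(a : ℂ) * (inner ℂ (c.R y) (S x))) 0 := by
    intro y x
    have d1 : HasDerivAt (fun t => grp h t (c.R y)) (Complex.I • T y) 0 := isGen_R h y
    have d2 : HasDerivAt (fun t => grp h t (c.R x)) (Complex.I • T x) 0 := isGen_R h x
    rw [hasDerivAt_iff_tendsto_slope] at d1 d2 ⊢
    have l0 : Tendsto (fun t : ℝ => t) (𝓝[≠] 0) (𝓝 0) := tendsto_nhdsWithin_of_tendsto_nhds tendsto_id
    have l1 : Tendsto (fun t => (inner ℂ (slope (fun t => grp h t (c.R y)) 0 t - Complex.I • T y) (S (dom h t x)))) (𝓝[≠] 0) (𝓝 0) := by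
      have b1 : Tendsto (fun t => ‖slope (fun t => grp h t (c.R y)) 0 t - Complex.I • T y‖ *
          (‖S‖ * (Real.exp (‖T'‖ * |t|) * ‖x‖))) (𝓝[≠] 0) (𝓝 0) := by
        have b2 : Continuous fun t : ℝ => ‖S‖ * (Real.exp (‖T'‖ * |t|) * ‖x‖) := by fun_prop
        have b3 := (tendsto_iff_norm_sub_tendsto_zero.1 d1).mul ((b2.tendsto 0).comp l0)
        simpa using b3
      refine squeeze_zero_norm (fun t => ?_) b1
      refine (norm_inner_le_norm _ _).trans ?_
      gcongr
      exact (S.le_opNorm _).trans (by gcongr; exact norm_dom h t x)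
    have l2 : Tendsto (fun t => (inner ℂ (Complex.I • T y) (S (dom h t x)))) (𝓝[≠] 0)
        (𝓝 (inner ℂ (Complex.I • T y) (S x))) := by
      have := (tendsto_inner_dom h (S.adjoint (Complex.I • T y)) x).comp l0
      simp only [ContinuousLinearMap.adjoint_inner_left] at this
      exact this
    have l3 : Tendsto (fun t => (inner ℂ (S y) (slope (fun t => grp h t (c.R x)) 0 t))) (𝓝[≠] 0)
        (𝓝 (inner ℂ (S y) (Complex.I • T x))) := tendsto_const_nhds.inner d2
    have l4 := (l1.add l2).add l3
    have e1 : 0 + (inner ℂ (Complex.I • T y) (S x)) + (inner ℂ (S y) (Complex.I • T x)) = -(a : ℂ) * (inner ℂ (c.R y) (S x)) := by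
      rw [inner_smul_left, inner_smul_right, Complex.conj_I, ← hc]
      ring
    rw [e1] at l4
    refine l4.congr fun t => ?_
    rw [← inner_add_left, sub_add_cancel]
    simp only [slope_def_module, sub_zero, grp_zero, dom_zero]
    have hr : ∀ (v w : H) (r : ℝ), (inner ℂ (r • v) w) = r • (inner ℂ v w) := fun v w r => by
      rw [RCLike.real_smul_eq_coe_smul (K := ℂ), inner_smul_left]
      simp
    have hr' : ∀ (v w : H) (r : ℝ), (inner ℂ v (r • w)) = r • (inner ℂ v w) := fun v w r => by
      rw [RCLike.real_smul_eq_coe_smul (K := ℂ), inner_smul_right]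
      simp
    rw [hr, hr', ← smul_add]
    congr 1
    rw [inner_sub_left, inner_sub_right, ← R_dom h t x, hs, hs]
    ring
  have h1 : ∀ y t, HasDerivAt (fun t => (inner ℂ (grp h t (c.R y)) (S (dom h t x))))
      (-(a : ℂ) * (inner ℂ (grp h t (c.R y)) (S (dom h t x)))) t := by
    intro y t
    have := h0 (dom h t y) (dom h t x)
    rw [← sub_self t] at this
    have h2 := this.comp_sub_const t t
    rw [R_dom] at h2
    refine h2.congr_of_eventuallyEq (Eventually.of_forall fun s => ?_)
    simp only
    rw [← grp_add, ← dom_add, sub_add_cancel]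
  have h2 : ∀ y, (inner ℂ (grp h t (c.R y)) (Real.exp (a * t) • S (dom h t x))) = (inner ℂ (c.R y) (S x)) := by
    intro y
    have hd : ∀ t, HasDerivAt (fun t : ℝ => Real.exp (a * t) •
        (inner ℂ (grp h t (c.R y)) (S (dom h t x)))) 0 t := fun t => by
      have e1 : HasDerivAt (fun t : ℝ => Real.exp (a * t)) (Real.exp (a * t) * (a * 1)) t :=
        ((hasDerivAt_id t).const_mul a).exp
      have e2 := e1.smul (h1 y t)
      have e3 : Real.exp (a * t) • (-(a : ℂ) * (inner ℂ (grp h t (c.R y)) (S (dom h t x)))) +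
          (Real.exp (a * t) * (a * 1)) • (inner ℂ (grp h t (c.R y)) (S (dom h t x))) = 0 := by
        simp only [Complex.real_smul]
        push_cast
        ring
      rw [e3] at e2
      exact e2
    have := is_const_of_deriv_eq_zero (fun t => (hd t).differentiableAt)
      (fun t => (hd t).deriv) t 0
    simp only [mul_zero, Real.exp_zero, one_smul, grp_zero, dom_zero] at this
    rw [← this, RCLike.real_smul_eq_coe_smul (K := ℂ), inner_smul_right]
    simp
  have h3 : grp h t (S x) - Real.exp (a * t) • S (dom h t x) = 0 := by
    have h4 : (grp h t).symm (grp h t (S x) - Real.exp (a * t) • S (dom h t x)) = 0 := by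
      refine c.eq_zero_of_inner fun y => ?_
      rw [← LinearIsometryEquiv.inner_map_map (grp h t), LinearIsometryEquiv.apply_symm_apply,
        ← inner_conj_symm, inner_sub_right, h2, LinearIsometryEquiv.inner_map_map, sub_self,
        map_zero]
    exact (map_eq_zero_iff _ (grp h t).symm.injective).1 h4
  exact sub_eq_zero.1 h3

theorem grp_commute {X : H →L[ℂ] H} (hP : ∀ k x, X (c.P k x) = c.P k (X x))
    (hN : ∀ k x, X (c.N k x) = c.N k (X x)) (hT : ∀ x, X (T x) = T (X x)) (t : ℝ) (x : H) :
    grp h t (X x) = X (grp h t x) := by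
  refine tendsto_nhds_unique (tendsto_grp h t (X x)) ?_
  refine ((X.continuous.tendsto _).comp (tendsto_grp h t x)).congr fun k => ?_
  let _ : NormedAlgebra ℚ (H →L[ℂ] H) := NormedAlgebra.restrictScalars ℚ ℝ _
  have h1 : Commute X (t • c.gen T k) := by
    refine Commute.smul_right (ContinuousLinearMap.ext fun y => ?_) t
    change X (c.gen T k y) = c.gen T k (X y)
    rw [gen_apply, gen_apply, map_smul, hP, hT, hN]
  have h2 : Commute X (c.dyn T k t) := h1.exp_right
  exact DFunLike.congr_fun h2.eq x

end Cutoff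

/-! ### Diagonal operators on `𝓗₀` -/

theorem norm_le_of_coord {f g : Hilb0} {C : ℝ} (hC : 0 ≤ C) (h : ∀ s, ‖f s‖ ≤ C * ‖g s‖) :
    ‖f‖ ≤ C * ‖g‖ := by
  have h1 : ‖f‖ ≤ ‖(C : ℂ) • g‖ := lp.norm_mono (by simp) fun s => by
    rw [lp.coeFn_smul, Pi.smul_apply, norm_smul, Complex.norm_real, Real.norm_of_nonneg hC]
    exact h s
  rwa [norm_smul, Complex.norm_real, Real.norm_of_nonneg hC] at h1

theorem memℓp_of_coord {f : Cfg0 → ℂ} {g : Hilb0} {C : ℝ} (h : ∀ s, ‖f s‖ ≤ C * ‖g s‖) :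
    Memℓp f 2 := by
  refine Memℓp.mono' ((lp.memℓp g).const_smul (C : ℂ)) fun s => ?_
  rw [Pi.smul_apply, norm_smul, Complex.norm_real, Real.norm_eq_abs]
  exact (h s).trans (mul_le_mul_of_nonneg_right (le_abs_self C) (norm_nonneg _))

/-- The bounded diagonal operator with given eigenvalues. -/
def diag (w : Cfg0 → ℝ) (C : ℝ) (hw : ∀ s, |w s| ≤ C) : Hilb0 →L[ℂ] Hilb0 :=
  have hb : ∀ (f : Hilb0) (s : Cfg0), ‖(w s : ℂ) * f s‖ ≤ C * ‖f s‖ := fun f s => by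
    rw [norm_mul, Complex.norm_real, Real.norm_eq_abs]
    exact mul_le_mul_of_nonneg_right (hw s) (norm_nonneg _)
  LinearMap.mkContinuousOfExistsBound
    { toFun := fun f => ⟨fun s => (w s : ℂ) * f s, memℓp_of_coord (hb f)⟩
      map_add' := fun f g => lp.ext (funext fun s => mul_add _ _ _)
      map_smul' := fun a f => lp.ext (funext fun s => mul_left_comm _ _ _) }
    ⟨|C|, fun f => norm_le_of_coord (abs_nonneg C) fun s =>
      (hb f s).trans (mul_le_mul_of_nonneg_right (le_abs_self C) (norm_nonneg _))⟩

theorem diag_apply {w : Cfg0 → ℝ} {C : ℝ} (hw : ∀ s, |w s| ≤ C) (f : Hilb0) (s : Cfg0) :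
    diag w C hw f s = (w s : ℂ) * f s := rfl

theorem diag_emb {w : Cfg0 → ℝ} {C : ℝ} (hw : ∀ s, |w s| ≤ C) (x : Fock0) :
    diag w C hw (emb x) = emb (dg w x) := lp.ext (funext fun s => by
  rw [diag_apply, emb_apply, emb_apply, dg_apply])

theorem diag_sa {w : Cfg0 → ℝ} {C : ℝ} (hw : ∀ s, |w s| ≤ C) (f g : Hilb0) :
    inner ℂ (diag w C hw f) g = inner ℂ f (diag w C hw g) := by
  rw [lp.inner_eq_tsum, lp.inner_eq_tsum]
  refine tsum_congr fun s => ?_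
  rw [diag_apply, diag_apply]
  simp only [RCLike.inner_apply, map_mul, Complex.conj_ofReal]
  ring

/-- The eigenvalues of `N = ∑ (α†α + β†β) + 1`. -/
def wt (s : Cfg0) : ℝ := lev s + 1

theorem one_le_wt (s : Cfg0) : 1 ≤ wt s := by have := lev_nonneg s; unfold wt; linarith

theorem wt_pos (s : Cfg0) : 0 < wt s := one_pos.trans_le (one_le_wt s)

theorem inv_wt_le (s : Cfg0) : |(wt s)⁻¹| ≤ 1 := by
  rw [abs_inv, abs_of_pos (wt_pos s)]
  exact inv_le_one_of_one_le₀ (one_le_wt s)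

theorem cut_le (k : ℕ) (s : Cfg0) : |if wt s ≤ k + 1 then (1 : ℝ) else 0| ≤ 1 := by
  split_ifs <;> simp

theorem wt_cut_le (k : ℕ) (s : Cfg0) : |if wt s ≤ k + 1 then wt s else 0| ≤ k + 1 := by
  split_ifs with h
  · rwa [abs_of_pos (wt_pos s)]
  · rw [abs_zero]; positivity

/-- `N⁻¹`. -/
def invN : Hilb0 →L[ℂ] Hilb0 := diag (fun s => (wt s)⁻¹) 1 inv_wt_le

/-- The spectral projections of `N`. -/
def cutP (k : ℕ) : Hilb0 →L[ℂ] Hilb0 := diag _ 1 (cut_le k)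

/-- The truncations of `N`. -/
def cutN (k : ℕ) : Hilb0 →L[ℂ] Hilb0 := diag _ _ (wt_cut_le k)

theorem invN_apply (f : Hilb0) (s : Cfg0) : invN f s = ((wt s)⁻¹ : ℝ) * f s := rfl

theorem cutP_apply (k : ℕ) (f : Hilb0) (s : Cfg0) :
    cutP k f s = if wt s ≤ k + 1 then f s else 0 := by
  rw [cutP, diag_apply]; split_ifs <;> simp

theorem cutN_apply (k : ℕ) (f : Hilb0) (s : Cfg0) :
    cutN k f s = if wt s ≤ k + 1 then (wt s : ℂ) * f s else 0 := by
  rw [cutN, diag_apply]; split_ifs <;> simp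

/-- `N` on `𝓕₀`. -/
def opN : Module.End ℂ Fock0 := dg wt

theorem opN_apply (x : Fock0) : opN x = dg lev x + x := Finsupp.ext fun s => by
  rw [opN, dg_apply, Finsupp.add_apply, dg_apply, wt]; push_cast; ring

theorem invN_opN (x : Fock0) : invN (emb (opN x)) = emb x := lp.ext (funext fun s => by
  rw [invN_apply, emb_apply, opN, dg_apply, emb_apply, ← mul_assoc, ← Complex.ofReal_mul,
    inv_mul_cancel₀ (wt_pos s).ne', Complex.ofReal_one, one_mul])

theorem opN_surjective : Function.Surjective opN := fun x => ⟨dg (fun s => (wt s)⁻¹) x,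
  Finsupp.ext fun s => by
    rw [opN, dg_apply, dg_apply, ← mul_assoc, ← Complex.ofReal_mul,
      mul_inv_cancel₀ (wt_pos s).ne', Complex.ofReal_one, one_mul]⟩

theorem dense_opN : DenseRange fun x => emb (opN x) :=
  dense_emb.mono (by
    rintro _ ⟨x, rfl⟩
    obtain ⟨y, rfl⟩ := opN_surjective x
    exact ⟨y, rfl⟩)

theorem wt_le_natCeil (S : Finset Cfg0) : ∃ k : ℕ, ∀ s ∈ S, wt s ≤ k + 1 := by
  obtain ⟨k, hk⟩ := exists_nat_ge (∑ s ∈ S, wt s)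
  refine ⟨k, fun s hs => ?_⟩
  have := Finset.single_le_sum (f := wt) (fun s _ => (wt_pos s).le) hs
  linarith

theorem cutP_tendsto (f : Hilb0) : Tendsto (fun k => cutP k f) atTop (𝓝 f) := by
  have hn : ∀ k g, ‖cutP k g‖ ≤ ‖g‖ := fun k g => by
    rw [← one_mul ‖g‖]
    refine norm_le_of_coord zero_le_one fun s => ?_
    rw [cutP_apply]; split_ifs <;> simp
  rw [Metric.tendsto_atTop]
  intro ε hε
  obtain ⟨_, hy, ⟨y, rfl⟩⟩ := Metric.dense_iff.1 dense_emb f (ε / 2) (by positivity)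
  rw [Metric.mem_ball, dist_comm, dist_eq_norm] at hy
  obtain ⟨k, hk⟩ := wt_le_natCeil y.support
  refine ⟨k, fun j hj => ?_⟩
  have e : cutP j (emb y) = emb y := lp.ext (funext fun s => by
    rw [cutP_apply, emb_apply]
    split_ifs with h
    · rfl
    · by_contra hc
      refine h ((hk s (Finsupp.mem_support_iff.2 (Ne.symm hc))).trans ?_)
      have : (k : ℝ) ≤ j := by exact_mod_cast hj
      linarith)
  rw [dist_eq_norm]
  calc _ = ‖cutP j (f - emb y) - (f - emb y)‖ := by rw [map_sub, e]; congr 1; abel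
    _ ≤ ‖f - emb y‖ + ‖f - emb y‖ := (norm_sub_le _ _).trans (by gcongr; exact hn _ _)
    _ < ε := by linarith

/-- The cutoff system of `N`. -/
def cutoff : Cutoff Hilb0 where
  R := invN
  P := cutP
  N := cutN
  R_sa := diag_sa _
  P_sa k := diag_sa _
  N_sa k := diag_sa _
  N_R k x := lp.ext (funext fun s => by
    rw [cutN_apply, cutP_apply, invN_apply, ← mul_assoc, ← Complex.ofReal_mul,
      mul_inv_cancel₀ (wt_pos s).ne', Complex.ofReal_one, one_mul])
  R_N k x := lp.ext (funext fun s => by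
    rw [invN_apply, cutN_apply, cutP_apply]
    split_ifs
    · rw [← mul_assoc, ← Complex.ofReal_mul, inv_mul_cancel₀ (wt_pos s).ne', Complex.ofReal_one,
        one_mul]
    · rw [mul_zero])
  P_N {j k} hjk x := lp.ext (funext fun s => by
    have : (j : ℝ) ≤ k := by exact_mod_cast hjk
    rw [cutP_apply, cutN_apply, cutN_apply]
    split_ifs <;> first | rfl | (exfalso; linarith))
  P_N' {j k} hjk x := lp.ext (funext fun s => by
    have : (j : ℝ) ≤ k := by exact_mod_cast hjk
    rw [cutP_apply, cutN_apply]
    split_ifs <;> first | rfl | (exfalso; linarith))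
  P_norm k x := by
    rw [← one_mul ‖x‖]
    refine norm_le_of_coord zero_le_one fun s => ?_
    rw [cutP_apply]; split_ifs <;> simp
  tail k x := by
    rw [div_eq_inv_mul]
    refine norm_le_of_coord (by positivity) fun s => ?_
    rw [lp.coeFn_sub, Pi.sub_apply, cutP_apply]
    split_ifs with h
    · rw [sub_self, norm_zero]; positivity
    · rw [sub_zero, invN_apply, norm_mul, Complex.norm_real, Real.norm_of_nonneg
        (inv_nonneg.2 (wt_pos s).le)]
      gcongr
      exact (not_le.1 h).le
  P_tendsto := cutP_tendsto
  dense := by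
    refine dense_emb.mono ?_
    rintro _ ⟨x, rfl⟩
    exact ⟨_, invN_opN x⟩
  mem_dom v C h := by
    have hC : 0 ≤ C := (norm_nonneg _).trans (h 0)
    have hs : ∀ S : Finset Cfg0, ∑ s ∈ S, ‖(wt s : ℂ) * v s‖ ^ (2 : ENNReal).toReal ≤
        C ^ (2 : ENNReal).toReal := fun S => by
      obtain ⟨k, hk⟩ := wt_le_natCeil S
      refine le_trans (le_of_eq (Finset.sum_congr rfl fun s hs => ?_))
        ((lp.sum_rpow_le_norm_rpow (by simp) (cutN k v) S).trans
          (Real.rpow_le_rpow (norm_nonneg _) (h k) (by simp)))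
      rw [cutN_apply, if_pos (hk s hs)]
    refine ⟨⟨fun s => (wt s : ℂ) * v s, memℓp_gen' hs⟩, lp.ext (funext fun s => ?_),
      lp.norm_le_of_forall_sum_le (by simp) hC hs⟩
    rw [invN_apply]
    change _ * ((wt s : ℂ) * v s) = _
    rw [← mul_assoc, ← Complex.ofReal_mul, inv_mul_cancel₀ (wt_pos s).ne', Complex.ofReal_one,
      one_mul]

/-! ### `N`-bounded operators -/

/-- `‖B x‖ ≤ C ‖N x‖`. -/
def NBdd (B : Fock0 →ₗ[ℂ] Hilb0) (C : ℝ) : Prop := ∀ x, ‖B x‖ ≤ C * ‖emb (opN x)‖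

/-- The bounded operator `B N⁻¹`. -/
def hat (B : Fock0 →ₗ[ℂ] Hilb0) : Hilb0 →L[ℂ] Hilb0 := B.extendOfNorm (emb ∘ₗ opN)

theorem hat_opN {B : Fock0 →ₗ[ℂ] Hilb0} {C : ℝ} (hB : NBdd B C) (x : Fock0) :
    hat B (emb (opN x)) = B x :=
  B.extendOfNorm_eq (e := emb ∘ₗ opN) dense_opN ⟨C, hB⟩ x

theorem norm_hat {B : Fock0 →ₗ[ℂ] Hilb0} {C : ℝ} (hB : NBdd B C) (x : Hilb0) :
    ‖hat B x‖ ≤ C * ‖x‖ :=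
  B.norm_extendOfNorm_apply_le (e := emb ∘ₗ opN) dense_opN C hB x

/-- Continuous functions of two vectors are determined on `𝓕₀`. -/
theorem eq_of_dense₂ {F G : Hilb0 → Hilb0 → ℂ} (hF : Continuous fun p : Hilb0 × Hilb0 => F p.1 p.2)
    (hG : Continuous fun p : Hilb0 × Hilb0 => G p.1 p.2)
    (h : ∀ x y : Fock0, F (emb (opN x)) (emb (opN y)) = G (emb (opN x)) (emb (opN y)))
    (x y : Hilb0) : F x y = G x y := by
  have hd : DenseRange (Prod.map (fun x => emb (opN x)) (fun x => emb (opN x))) :=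
    dense_opN.prodMap dense_opN
  exact congrFun (hd.equalizer hF hG (funext fun p => h p.1 p.2)) (x, y)

/-! ### Quadratic boson operators -/

/-- The pair creation operator `α†_m β†_m`. -/
def pc (m : ℕ+) : Module.End ℂ Fock0 := alphaD m ∘ₗ betaD m

/-- The pair annihilation operator `α_m β_m`. -/
def pa (m : ℕ+) : Module.End ℂ Fock0 := alpha m ∘ₗ beta m

/-- `α†_m α_m + β†_m β_m`. -/
def nm (m : ℕ+) : Module.End ℂ Fock0 := alphaD m ∘ₗ alpha m + betaD m ∘ₗ beta m

theorem pc_apply (m : ℕ+) (x : Fock0) : pc m x = alphaD m (betaD m x) := rfl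

theorem pa_apply (m : ℕ+) (x : Fock0) : pa m x = alpha m (beta m x) := rfl

theorem nm_apply (m : ℕ+) (x : Fock0) :
    nm m x = alphaD m (alpha m x) + betaD m (beta m x) := rfl

theorem inner_pc (m : ℕ+) (x y : Fock0) :
    inner ℂ (emb (pc m x)) (emb y) = inner ℂ (emb x) (emb (pa m y)) := by
  rw [pc_apply, pa_apply, inner_alphaD, inner_betaD, alpha_beta]

theorem inner_pa (m : ℕ+) (x y : Fock0) :
    inner ℂ (emb (pa m x)) (emb y) = inner ℂ (emb x) (emb (pc m y)) := by
  rw [← inner_conj_symm, ← inner_pc, inner_conj_symm]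

theorem inner_nm (m : ℕ+) (x y : Fock0) :
    inner ℂ (emb (nm m x)) (emb y) = inner ℂ (emb x) (emb (nm m y)) := by
  rw [nm_apply, nm_apply, map_add, map_add, inner_add_left, inner_add_right, inner_alphaD,
    inner_betaD, inner_alpha, inner_beta]

theorem inner_self_emb (x : Fock0) : inner ℂ (emb x) (emb x) = ((‖emb x‖ ^ 2 : ℝ) : ℂ) := by
  rw [inner_self_eq_norm_sq_to_K]; norm_cast

theorem inner_nm_self (m : ℕ+) (x : Fock0) : inner ℂ (emb x) (emb (nm m x)) =
    ((‖emb (alpha m x)‖ ^ 2 + ‖emb (beta m x)‖ ^ 2 : ℝ) : ℂ) := by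
  rw [nm_apply, map_add, inner_add_right, ← inner_alpha, ← inner_beta, inner_self_emb,
    inner_self_emb]
  push_cast; rfl

theorem inner_cross (m p : ℕ+) (x : Fock0) :
    inner ℂ (emb (alphaD m (alpha m x))) (emb (betaD p (beta p x))) =
      ((‖emb (alpha m (beta p x))‖ ^ 2 : ℝ) : ℂ) := by
  rw [inner_alphaD, alpha_betaD, ← inner_beta, ← alpha_beta, inner_self_emb]

theorem re_inner_nm_nm (m p : ℕ+) (x : Fock0) :
    0 ≤ (inner ℂ (emb (nm m x)) (emb (nm p x))).re := by
  have h1 : 0 ≤ (inner ℂ (emb (alphaD m (alpha m x))) (emb (alphaD p (alpha p x)))).re := by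
    by_cases h : m = p
    · subst h; rw [inner_self_emb, Complex.ofReal_re]; positivity
    · rw [inner_alphaD, alpha_alphaD, if_neg h, add_zero, ← inner_alpha, alpha_alpha,
        inner_self_emb, Complex.ofReal_re]
      positivity
  have h2 : 0 ≤ (inner ℂ (emb (betaD m (beta m x))) (emb (betaD p (beta p x)))).re := by
    by_cases h : m = p
    · subst h; rw [inner_self_emb, Complex.ofReal_re]; positivity
    · rw [inner_betaD, beta_betaD, if_neg h, add_zero, ← inner_beta, beta_beta,
        inner_self_emb, Complex.ofReal_re]
      positivity
  have h3 : 0 ≤ (inner ℂ (emb (alphaD m (alpha m x))) (emb (betaD p (beta p x)))).re := by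
    rw [inner_cross, Complex.ofReal_re]; positivity
  have h4 : 0 ≤ (inner ℂ (emb (betaD m (beta m x))) (emb (alphaD p (alpha p x)))).re := by
    rw [← inner_conj_symm, Complex.conj_re, inner_cross, Complex.ofReal_re]; positivity
  rw [nm_apply, nm_apply, map_add, map_add, inner_add_left, inner_add_right, inner_add_right]
  simp only [Complex.add_re]
  linarith

theorem norm_pa_sq_le (m : ℕ+) (x : Fock0) : ‖emb (pa m x)‖ ^ 2 ≤ ‖emb (nm m x)‖ ^ 2 := by
  rw [nm_apply, map_add, @norm_add_sq ℂ, inner_cross, RCLike.re_to_complex, Complex.ofReal_re,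
    pa_apply]
  nlinarith [sq_nonneg ‖emb (alphaD m (alpha m x))‖, sq_nonneg ‖emb (betaD m (beta m x))‖,
    sq_nonneg ‖emb (alpha m (beta m x))‖]

theorem norm_sum_sq {ι : Type*} (S : Finset ι) (f : ι → Hilb0) :
    ‖∑ i ∈ S, f i‖ ^ 2 = ∑ i ∈ S, ∑ j ∈ S, (inner ℂ (f i) (f j)).re := by
  have : ‖∑ i ∈ S, f i‖ ^ 2 = (inner ℂ (∑ i ∈ S, f i) (∑ i ∈ S, f i)).re := by
    rw [inner_self_eq_norm_sq_to_K]; norm_cast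
  rw [this, sum_inner, Complex.re_sum]
  refine Finset.sum_congr rfl fun i _ => ?_
  rw [inner_sum, Complex.re_sum]

theorem sum_nm (x : Fock0) {S : Finset ℕ+} (hS : modes x ⊆ S) : ∑ m ∈ S, nm m x = dg lev x :=
  sum_modes x hS

theorem norm_sum_nm_le (S : Finset ℕ+) {w : ℕ+ → ℝ} {W : ℝ} (hw : ∀ m, |w m| ≤ W) (x : Fock0) :
    ‖emb (∑ m ∈ S, (w m : ℂ) • nm m x)‖ ≤ W * ‖emb (dg lev x)‖ := by
  classical
  have hW : 0 ≤ W := (abs_nonneg _).trans (hw 1)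
  refine (sq_le_sq₀ (norm_nonneg _) (by positivity)).1 ?_
  set S' := S ∪ modes x
  have h1 : ∑ m ∈ S, (w m : ℂ) • nm m x = ∑ m ∈ S', ((if m ∈ S then w m else 0 : ℝ) : ℂ) • nm m x := by
    rw [← Finset.sum_subset (Finset.subset_union_left (s₁ := S) (s₂ := modes x))]
    · exact Finset.sum_congr rfl fun m hm => by rw [if_pos hm]
    · intro m _ hm; rw [if_neg hm]; simp
  rw [h1, ← sum_nm x (S := S') Finset.subset_union_right, mul_pow, map_sum, map_sum, norm_sum_sq,
    norm_sum_sq, Finset.mul_sum]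
  refine Finset.sum_le_sum fun i _ => ?_
  rw [Finset.mul_sum]
  refine Finset.sum_le_sum fun j _ => ?_
  rw [map_smul, map_smul, inner_smul_left, inner_smul_right, Complex.conj_ofReal, ← mul_assoc,
    ← Complex.ofReal_mul, Complex.re_ofReal_mul]
  refine mul_le_mul_of_nonneg_right ?_ (re_inner_nm_nm i j x)
  have hw' : ∀ m, |(if m ∈ S then w m else 0 : ℝ)| ≤ W := fun m => by
    split_ifs
    · exact hw m
    · simpa using hW
  calc _ ≤ |(if i ∈ S then w i else 0 : ℝ) * (if j ∈ S then w j else 0 : ℝ)| := le_abs_self _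
    _ ≤ W * W := by rw [abs_mul]; exact mul_le_mul (hw' i) (hw' j) (abs_nonneg _) hW
    _ = W ^ 2 := (sq W).symm

theorem sum_norm_pa_sq (S : Finset ℕ+) (x : Fock0) :
    ∑ m ∈ S, ‖emb (pa m x)‖ ^ 2 ≤ ‖emb (dg lev x)‖ ^ 2 := by
  classical
  rw [← sum_nm x (S := S ∪ modes x) Finset.subset_union_right, map_sum, norm_sum_sq]
  calc _ ≤ ∑ m ∈ S ∪ modes x, ‖emb (pa m x)‖ ^ 2 :=
        Finset.sum_le_sum_of_subset_of_nonneg Finset.subset_union_left fun _ _ _ => by positivity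
    _ ≤ _ := Finset.sum_le_sum fun m hm => ?_
  refine (norm_pa_sq_le m x).trans ?_
  have h1 := Finset.single_le_sum (f := fun p => (inner ℂ (emb (nm m x)) (emb (nm p x))).re)
    (fun p _ => re_inner_nm_nm m p x) hm
  rwa [inner_self_emb, Complex.ofReal_re] at h1

theorem sum_norm_alpha_sq (S : Finset ℕ+) (x : Fock0) :
    ∑ m ∈ S, (‖emb (alpha m x)‖ ^ 2 + ‖emb (beta m x)‖ ^ 2) ≤
      (inner ℂ (emb x) (emb (dg lev x))).re := by
  classical
  rw [← sum_nm x (S := S ∪ modes x) Finset.subset_union_right, map_sum, inner_sum, Complex.re_sum]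
  calc _ ≤ ∑ m ∈ S ∪ modes x, (‖emb (alpha m x)‖ ^ 2 + ‖emb (beta m x)‖ ^ 2) :=
        Finset.sum_le_sum_of_subset_of_nonneg Finset.subset_union_left fun _ _ _ => by positivity
    _ = _ := Finset.sum_congr rfl fun m _ => by rw [inner_nm_self, Complex.ofReal_re]

theorem norm_opN_sq (x : Fock0) : ‖emb (opN x)‖ ^ 2 =
    ‖emb (dg lev x)‖ ^ 2 + 2 * (inner ℂ (emb x) (emb (dg lev x))).re + ‖emb x‖ ^ 2 := by
  rw [opN_apply, map_add, @norm_add_sq ℂ, RCLike.re_to_complex, ← inner_conj_symm, Complex.conj_re]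

theorem norm_sum_pa_sq (S : Finset ℕ+) (v : ℕ+ → ℝ) (x : Fock0) :
    ‖emb (∑ m ∈ S, (v m : ℂ) • pa m x)‖ ^ 2 ≤
      (∑ m ∈ S, (v m * m) ^ 2) * ‖emb (dg lev x)‖ ^ 2 := by
  rw [map_sum]
  have h1 : ‖∑ m ∈ S, emb ((v m : ℂ) • pa m x)‖ ≤ ∑ m ∈ S, |v m| * ‖emb (pa m x)‖ :=
    (norm_sum_le _ _).trans (Finset.sum_le_sum fun m _ => by
      rw [map_smul, norm_smul, Complex.norm_real, Real.norm_eq_abs])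
  calc _ ≤ (∑ m ∈ S, |v m| * ‖emb (pa m x)‖) ^ 2 := by gcongr
    _ ≤ (∑ m ∈ S, |v m| ^ 2) * ∑ m ∈ S, ‖emb (pa m x)‖ ^ 2 := Finset.sum_mul_sq_le_sq_mul_sq _ _ _
    _ ≤ _ := by
      refine mul_le_mul (Finset.sum_le_sum fun m _ => ?_) (sum_norm_pa_sq S x) (by positivity)
        (by positivity)
      have : (1 : ℝ) ≤ m := by exact_mod_cast Nat.succ_le_of_lt m.pos
      rw [sq_abs, mul_pow]
      exact le_mul_of_one_le_right (sq_nonneg _) (one_le_pow₀ this)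

theorem pa_pc (m p : ℕ+) (x : Fock0) : pa m (pc p x) =
    pc p (pa m x) + if m = p then (m : ℂ) • nm m x + ((m : ℂ) * m) • x else 0 := by
  rw [pa_apply, pc_apply, ← alphaD_beta, alpha_alphaD, beta_betaD, pc_apply, pa_apply, nm_apply]
  split_ifs with h
  · subst h
    rw [map_add, map_smul, ← alpha_betaD, map_add, map_smul]
    module
  · rw [add_zero, add_zero, add_zero, alpha_betaD]

theorem norm_sum_pc_sq (S : Finset ℕ+) (u : ℕ+ → ℝ) (x : Fock0) :
    ‖emb (∑ m ∈ S, (u m : ℂ) • pc m x)‖ ^ 2 ≤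
      (∑ m ∈ S, (u m * m) ^ 2) * ‖emb (opN x)‖ ^ 2 := by
  have h1 : ‖emb (∑ m ∈ S, (u m : ℂ) • pc m x)‖ ^ 2 = ‖emb (∑ m ∈ S, (u m : ℂ) • pa m x)‖ ^ 2 +
      ∑ m ∈ S, u m ^ 2 * (m * (‖emb (alpha m x)‖ ^ 2 + ‖emb (beta m x)‖ ^ 2) +
        m ^ 2 * ‖emb x‖ ^ 2) := by
    rw [map_sum, map_sum, norm_sum_sq, norm_sum_sq, Finset.sum_comm, ← Finset.sum_add_distrib]
    refine Finset.sum_congr rfl fun i hi => ?_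
    have h2 : ∀ j ∈ S, (inner ℂ (emb ((u j : ℂ) • pc j x)) (emb ((u i : ℂ) • pc i x))).re =
        (inner ℂ (emb ((u i : ℂ) • pa i x)) (emb ((u j : ℂ) • pa j x))).re +
          if j = i then u i ^ 2 * (i * (‖emb (alpha i x)‖ ^ 2 + ‖emb (beta i x)‖ ^ 2) +
            i ^ 2 * ‖emb x‖ ^ 2) else 0 := by
      intro j _
      simp only [map_smul, inner_smul_left, inner_smul_right, Complex.conj_ofReal,
        Complex.re_ofReal_mul]
      rw [inner_pc, pa_pc, map_add, inner_add_right, ← inner_pa, Complex.add_re]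
      split_ifs with h
      · subst h
        rw [map_add, map_smul, map_smul, inner_add_right, inner_smul_right, inner_smul_right,
          inner_nm_self, inner_self_emb x]
        have e : ∀ (m : ℕ+) (a b : ℝ), (m : ℂ) * (a : ℂ) + ((m : ℂ) * m) * (b : ℂ) =
            ((m * a + m ^ 2 * b : ℝ) : ℂ) := fun m a b => by push_cast; ring
        rw [e, Complex.ofReal_re]
        ring
      · simp only [map_zero, inner_zero_right, Complex.zero_re, add_zero]
        ring
    rw [Finset.sum_congr rfl h2, Finset.sum_add_distrib, Finset.sum_ite_eq' S i, if_pos hi]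
  rw [h1, norm_opN_sq]
  set K := ∑ m ∈ S, (u m * m) ^ 2 with hK
  have hK0 : 0 ≤ K := by positivity
  have h3 := norm_sum_pa_sq S u x
  have h4 : ∑ m ∈ S, u m ^ 2 * (m * (‖emb (alpha m x)‖ ^ 2 + ‖emb (beta m x)‖ ^ 2) +
        m ^ 2 * ‖emb x‖ ^ 2) ≤ K * (inner ℂ (emb x) (emb (dg lev x))).re + K * ‖emb x‖ ^ 2 := by
    calc _ ≤ ∑ m ∈ S, (K * (‖emb (alpha m x)‖ ^ 2 + ‖emb (beta m x)‖ ^ 2) +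
          (u m * m) ^ 2 * ‖emb x‖ ^ 2) := Finset.sum_le_sum fun m hm => by
            have hm1 : (1 : ℝ) ≤ m := by exact_mod_cast Nat.succ_le_of_lt m.pos
            have : u m ^ 2 * m ≤ K := by
              refine le_trans ?_ (Finset.single_le_sum (f := fun m : ℕ+ => (u m * m) ^ 2)
                (fun _ _ => by positivity) hm)
              simp only [mul_pow]
              gcongr
              nlinarith
            rw [mul_add, ← mul_assoc, ← mul_assoc, ← mul_pow]
            gcongr
      _ = K * ∑ m ∈ S, (‖emb (alpha m x)‖ ^ 2 + ‖emb (beta m x)‖ ^ 2) + K * ‖emb x‖ ^ 2 := by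
          rw [Finset.sum_add_distrib, ← Finset.mul_sum, ← Finset.sum_mul]
      _ ≤ _ := by gcongr; exact sum_norm_alpha_sq S x
  have h5 : 0 ≤ (inner ℂ (emb x) (emb (dg lev x))).re := by
    have := sum_norm_alpha_sq ∅ x
    simpa using this
  have h6 := mul_nonneg hK0 h5
  calc _ ≤ K * ‖emb (dg lev x)‖ ^ 2 +
        (K * (inner ℂ (emb x) (emb (dg lev x))).re + K * ‖emb x‖ ^ 2) := add_le_add h3 h4
    _ ≤ _ := by nlinarith

/-! ### Commutators of the quadratic operators -/

theorem nm_alphaD (p m : ℕ+) (x : Fock0) : nm p (alphaD m x) =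
    alphaD m (nm p x) + if p = m then (m : ℂ) • alphaD m x else 0 := by
  rw [nm_apply, nm_apply, alpha_alphaD, ← alphaD_beta, ← alphaD_betaD, map_add, map_add,
    alphaD_alphaD]
  split_ifs with h
  · subst h; rw [map_smul]; abel
  · rw [map_zero]; abel

theorem nm_betaD (p m : ℕ+) (x : Fock0) : nm p (betaD m x) =
    betaD m (nm p x) + if p = m then (m : ℂ) • betaD m x else 0 := by
  rw [nm_apply, nm_apply, beta_betaD, alpha_betaD, alphaD_betaD, map_add, map_add,
    betaD_betaD]
  split_ifs with h
  · subst h; rw [map_smul]; abel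
  · rw [map_zero]; abel

theorem nm_alpha (p m : ℕ+) (x : Fock0) : nm p (alpha m x) =
    alpha m (nm p x) - if p = m then (m : ℂ) • alpha m x else 0 := by
  have h1 := alpha_alphaD m p (alpha p x)
  rw [nm_apply, nm_apply, ← alpha_beta, ← alpha_betaD, map_add, h1, alpha_alpha p m]
  split_ifs with h h' h'
  · subst h; abel
  · exact absurd h.symm h'
  · exact absurd h'.symm h
  · abel

theorem nm_beta (p m : ℕ+) (x : Fock0) : nm p (beta m x) =
    beta m (nm p x) - if p = m then (m : ℂ) • beta m x else 0 := by
  have h1 := beta_betaD m p (beta p x)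
  rw [nm_apply, nm_apply, alpha_beta, alphaD_beta, map_add, h1, beta_beta p m]
  split_ifs with h h' h'
  · subst h; abel
  · exact absurd h.symm h'
  · exact absurd h'.symm h
  · abel

theorem nm_pc (p m : ℕ+) (x : Fock0) : nm p (pc m x) =
    pc m (nm p x) + if p = m then (2 * m : ℂ) • pc m x else 0 := by
  rw [pc_apply, pc_apply, nm_alphaD, nm_betaD, map_add]
  split_ifs with h
  · rw [map_smul]; module
  · rw [map_zero]; abel

theorem nm_pa (p m : ℕ+) (x : Fock0) : nm p (pa m x) =
    pa m (nm p x) - if p = m then (2 * m : ℂ) • pa m x else 0 := by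
  rw [pa_apply, pa_apply, nm_alpha, nm_beta, map_sub]
  split_ifs with h
  · rw [map_smul]; module
  · rw [map_zero]; abel

theorem pc_pc (p m : ℕ+) (x : Fock0) : pc p (pc m x) = pc m (pc p x) := by
  simp only [pc_apply]
  rw [← alphaD_betaD, betaD_betaD, alphaD_alphaD, alphaD_betaD p m]

theorem pa_pa (p m : ℕ+) (x : Fock0) : pa p (pa m x) = pa m (pa p x) := by
  simp only [pa_apply]
  rw [← alpha_beta, beta_beta, alpha_alpha, alpha_beta p m]

theorem opN_eq_sum (x : Fock0) {S : Finset ℕ+} (hS : modes x ⊆ S) :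
    opN x = ∑ m ∈ S, nm m x + x := by rw [opN_apply, sum_nm x hS]

theorem opN_pc (m : ℕ+) (x : Fock0) : opN (pc m x) = pc m (opN x) + (2 * m : ℂ) • pc m x := by
  classical
  rw [opN_eq_sum (pc m x) (S := modes x ∪ (modes (pc m x) ∪ {m})) (by grind),
    opN_eq_sum x (S := modes x ∪ (modes (pc m x) ∪ {m})) (by grind), map_add, map_sum]
  simp only [nm_pc]
  rw [Finset.sum_add_distrib, Finset.sum_ite_eq', if_pos (by grind)]
  abel

theorem opN_pa (m : ℕ+) (x : Fock0) : opN (pa m x) = pa m (opN x) - (2 * m : ℂ) • pa m x := by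
  classical
  rw [opN_eq_sum (pa m x) (S := modes x ∪ (modes (pa m x) ∪ {m})) (by grind),
    opN_eq_sum x (S := modes x ∪ (modes (pa m x) ∪ {m})) (by grind), map_add, map_sum]
  simp only [nm_pa]
  rw [Finset.sum_sub_distrib, Finset.sum_ite_eq', if_pos (by grind)]
  abel

theorem inner_opN (x y : Fock0) :
    inner ℂ (emb (opN x)) (emb y) = inner ℂ (emb x) (emb (opN y)) := by
  conv_lhs => rw [← invN_opN y]
  conv_rhs => rw [← invN_opN x]
  exact (diag_sa _ _ _).symm

/-! ### Sums of quadratic operators -/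

/-- Coefficients of a sum `∑ u_m α†_m β†_m + v_m α_m β_m + w_m (α†_m α_m + β†_m β_m)`. -/
structure Coef where
  /-- The coefficients of pair creation. -/
  u : ℕ+ → ℝ
  /-- The coefficients of pair annihilation. -/
  v : ℕ+ → ℝ
  /-- The coefficients of the number operators. -/
  w : ℕ+ → ℝ
  hu : Summable fun m => (u m * m) ^ 2
  hv : Summable fun m => (v m * m) ^ 2
  hw : ∃ W, ∀ m, |w m| ≤ W

namespace Coef

variable (q : Coef)

/-- The contribution of a single mode. -/
def qm (m : ℕ+) : Module.End ℂ Fock0 :=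
  (q.u m : ℂ) • pc m + (q.v m : ℂ) • pa m + (q.w m : ℂ) • nm m

theorem qm_apply (m : ℕ+) (x : Fock0) :
    q.qm m x = (q.u m : ℂ) • pc m x + (q.v m : ℂ) • pa m x + (q.w m : ℂ) • nm m x := rfl

theorem exists_bound : ∃ C, ∀ (S : Finset ℕ+) (x : Fock0),
    ‖emb (∑ m ∈ S, q.qm m x)‖ ≤ C * ‖emb (opN x)‖ := by
  obtain ⟨W, hW⟩ := q.hw
  have hW0 : 0 ≤ W := (abs_nonneg _).trans (hW 1)
  refine ⟨√(∑' m, (q.u m * m) ^ 2) + √(∑' m, (q.v m * m) ^ 2) + W, fun S x => ?_⟩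
  have hN : ‖emb (dg lev x)‖ ^ 2 ≤ ‖emb (opN x)‖ ^ 2 := by
    rw [norm_opN_sq]
    have := sum_norm_alpha_sq ∅ x
    rw [Finset.sum_empty] at this
    nlinarith [sq_nonneg ‖emb x‖]
  have hN' : ‖emb (dg lev x)‖ ≤ ‖emb (opN x)‖ :=
    (sq_le_sq₀ (norm_nonneg _) (norm_nonneg _)).1 hN
  have h1 : ‖emb (∑ m ∈ S, (q.u m : ℂ) • pc m x)‖ ≤
      √(∑' m, (q.u m * m) ^ 2) * ‖emb (opN x)‖ := by
    refine (sq_le_sq₀ (norm_nonneg _) (by positivity)).1 ((norm_sum_pc_sq S q.u x).trans ?_)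
    rw [mul_pow, Real.sq_sqrt (tsum_nonneg fun m => sq_nonneg _)]
    exact mul_le_mul_of_nonneg_right (q.hu.sum_le_tsum S fun m _ => sq_nonneg _) (sq_nonneg _)
  have h2 : ‖emb (∑ m ∈ S, (q.v m : ℂ) • pa m x)‖ ≤
      √(∑' m, (q.v m * m) ^ 2) * ‖emb (opN x)‖ := by
    refine (sq_le_sq₀ (norm_nonneg _) (by positivity)).1 ((norm_sum_pa_sq S q.v x).trans ?_)
    rw [mul_pow, Real.sq_sqrt (tsum_nonneg fun m => sq_nonneg _)]
    exact mul_le_mul (q.hv.sum_le_tsum S fun m _ => sq_nonneg _) hN (sq_nonneg _)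
      (tsum_nonneg fun m => sq_nonneg _)
  have h3 := (norm_sum_nm_le S hW x).trans (mul_le_mul_of_nonneg_left hN' hW0)
  simp only [qm_apply, Finset.sum_add_distrib, map_add]
  refine (norm_add₃_le).trans ?_
  linarith

/-- A bound for the partial sums relative to `N`. -/
def bd : ℝ := q.exists_bound.choose

theorem norm_sum_le (S : Finset ℕ+) (x : Fock0) :
    ‖emb (∑ m ∈ S, q.qm m x)‖ ≤ q.bd * ‖emb (opN x)‖ := q.exists_bound.choose_spec S x

theorem summable_pc {u : ℕ+ → ℝ} (hu : Summable fun m => (u m * m) ^ 2) (x : Fock0) :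
    Summable fun m => emb ((u m : ℂ) • pc m x) := by
  rw [summable_iff_vanishing_norm]
  intro ε hε
  set B := ‖emb (opN x)‖ ^ 2 + 1 with hB
  have hB0 : 0 < B := by positivity
  obtain ⟨S, hS⟩ := summable_iff_vanishing_norm.1 hu (ε ^ 2 / B) (by positivity)
  refine ⟨S, fun T hT => ?_⟩
  have h1 := hS T hT
  rw [Real.norm_of_nonneg (by positivity), lt_div_iff₀ hB0] at h1
  rw [← map_sum]
  refine lt_of_pow_lt_pow_left₀ 2 hε.le ((norm_sum_pc_sq T u x).trans_lt (lt_of_le_of_lt ?_ h1))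
  gcongr
  rw [hB]; linarith

theorem summable_qm (x : Fock0) : Summable fun m => emb (q.qm m x) := by
  have h2 : Summable fun m => emb ((q.v m : ℂ) • pa m x) :=
    summable_of_ne_finset_zero (s := modes x) fun m hm => by
      rw [pa_apply, beta_of_notMem hm, map_zero, smul_zero, map_zero]
  have h3 : Summable fun m => emb ((q.w m : ℂ) • nm m x) :=
    summable_of_ne_finset_zero (s := modes x) fun m hm => by
      rw [nm_apply, beta_of_notMem hm, alpha_of_notMem hm, map_zero, map_zero, add_zero, smul_zero,
        map_zero]
  simpa only [qm_apply, map_add] using ((summable_pc q.hu x).add h2).add h3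

/-- The sum of the contributions of all modes. -/
def op : Fock0 →ₗ[ℂ] Hilb0 where
  toFun x := ∑' m, emb (q.qm m x)
  map_add' x y := by
    simp only [map_add]
    exact (q.summable_qm x).tsum_add (q.summable_qm y)
  map_smul' a x := by
    simp only [map_smul, RingHom.id_apply]
    exact (q.summable_qm x).tsum_const_smul a

theorem hasSum_op (x : Fock0) : HasSum (fun m => emb (q.qm m x)) (q.op x) := (q.summable_qm x).hasSum

/-- The partial sums. -/
def part (S : Finset ℕ+) : Fock0 →ₗ[ℂ] Hilb0 := emb ∘ₗ ∑ m ∈ S, q.qm m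

theorem part_apply (S : Finset ℕ+) (x : Fock0) : q.part S x = emb (∑ m ∈ S, q.qm m x) := by
  rw [part, LinearMap.comp_apply, LinearMap.sum_apply]

theorem nBdd_part (S : Finset ℕ+) : NBdd (q.part S) q.bd := fun x => by
  rw [part_apply]; exact q.norm_sum_le S x

theorem tendsto_part (x : Fock0) : Tendsto (fun S => q.part S x) atTop (𝓝 (q.op x)) := by
  refine (q.hasSum_op x).congr fun S => ?_
  rw [part_apply, map_sum]

theorem nBdd_op : NBdd q.op q.bd := fun x =>
  le_of_tendsto (q.tendsto_part x).norm (Eventually.of_forall fun S => q.nBdd_part S x)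

/-- The coefficients of the formal adjoint. -/
def adj : Coef := ⟨q.v, q.u, q.w, q.hv, q.hu, q.hw⟩

theorem inner_qm (m : ℕ+) (x y : Fock0) :
    inner ℂ (emb (q.qm m x)) (emb y) = inner ℂ (emb x) (emb (q.adj.qm m y)) := by
  simp only [qm_apply, adj, map_add, map_smul, inner_add_left, inner_add_right, inner_smul_left,
    inner_smul_right, inner_pc, inner_pa, inner_nm, Complex.conj_ofReal]
  ring

theorem hasSum_inner (z : Hilb0) (x : Fock0) :
    HasSum (fun m => inner ℂ z (emb (q.qm m x))) (inner ℂ z (q.op x)) :=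
  (innerSL ℂ z).hasSum (q.hasSum_op x)

theorem hasSum_inner_left (z : Hilb0) (x : Fock0) :
    HasSum (fun m => inner ℂ (emb (q.qm m x)) z) (inner ℂ (q.op x) z) := by
  have := (q.hasSum_inner z x).star
  simpa only [RCLike.star_def, inner_conj_symm] using this

theorem inner_op (x y : Fock0) : inner ℂ (q.op x) (emb y) = inner ℂ (emb x) (q.adj.op y) := by
  refine (q.hasSum_inner_left (emb y) x).unique ?_
  simp only [inner_qm]
  exact q.adj.hasSum_inner (emb x) y

end Coef

theorem tendsto_hat {ι : Type*} {l : Filter ι} {B : ι → Fock0 →ₗ[ℂ] Hilb0} {A : Fock0 →ₗ[ℂ] Hilb0}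
    {C : ℝ} (hB : ∀ i, NBdd (B i) C) (hA : NBdd A C)
    (hlim : ∀ x, Tendsto (fun i => B i x) l (𝓝 (A x))) (z : Hilb0) :
    Tendsto (fun i => hat (B i) z) l (𝓝 (hat A z)) := by
  rw [Metric.tendsto_nhds]
  intro ε hε
  set K := |C| + 1 with hK
  have hK0 : 0 < K := by positivity
  obtain ⟨_, hy, ⟨y, rfl⟩⟩ := Metric.dense_iff.1 dense_opN z (ε / (3 * K)) (by positivity)
  rw [Metric.mem_ball, dist_comm, dist_eq_norm] at hy
  filter_upwards [Metric.tendsto_nhds.1 (hlim y) (ε / 3) (by positivity)] with i hi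
  rw [dist_eq_norm] at hi ⊢
  have h1 : ∀ {D : Fock0 →ₗ[ℂ] Hilb0}, NBdd D C → ‖hat D (z - emb (opN y))‖ < ε / 3 := by
    intro D hD
    refine (norm_hat hD _).trans_lt ?_
    calc C * ‖z - emb (opN y)‖ ≤ K * ‖z - emb (opN y)‖ := by
          gcongr; rw [hK]; linarith [le_abs_self C]
      _ < K * (ε / (3 * K)) := by gcongr
      _ = ε / 3 := by field_simp
  have h2 := h1 (hB i)
  have h3 := h1 hA
  calc _ = ‖hat (B i) (z - emb (opN y)) + (B i y - A y) - hat A (z - emb (opN y))‖ := by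
        rw [map_sub, map_sub, hat_opN (hB i), hat_opN hA]; congr 1; abel
    _ ≤ ‖hat (B i) (z - emb (opN y))‖ + ‖B i y - A y‖ + ‖hat A (z - emb (opN y))‖ :=
        (norm_sub_le _ _).trans (by gcongr; exact norm_add_le _ _)
    _ < ε := by linarith

theorem hat_unique {B : Fock0 →ₗ[ℂ] Hilb0} {C : ℝ} (hB : NBdd B C) {A : Hilb0 →L[ℂ] Hilb0}
    (h : ∀ x, A (emb (opN x)) = B x) : hat B = A := by
  refine ContinuousLinearMap.ext fun z => ?_
  refine congrFun (dense_opN.equalizer (hat B).continuous A.continuous (funext fun x => ?_)) z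
  simp only [Function.comp_apply]
  rw [hat_opN hB, h]

theorem nBdd_emb : NBdd emb 1 := fun x => by
  rw [one_mul]
  refine (sq_le_sq₀ (norm_nonneg _) (norm_nonneg _)).1 ?_
  rw [norm_opN_sq]
  have := sum_norm_alpha_sq ∅ x
  rw [Finset.sum_empty] at this
  nlinarith [sq_nonneg ‖emb (dg lev x)‖]

theorem hat_emb : hat emb = invN := hat_unique nBdd_emb invN_opN

theorem NBdd.add {A B : Fock0 →ₗ[ℂ] Hilb0} {C D : ℝ} (hA : NBdd A C) (hB : NBdd B D) :
    NBdd (A + B) (C + D) := fun x => by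
  rw [LinearMap.add_apply, add_mul]
  exact (norm_add_le _ _).trans (add_le_add (hA x) (hB x))

theorem NBdd.smul {A : Fock0 →ₗ[ℂ] Hilb0} {C : ℝ} (hA : NBdd A C) (a : ℂ) :
    NBdd (a • A) (‖a‖ * C) := fun x => by
  rw [LinearMap.smul_apply, norm_smul, mul_assoc]
  exact mul_le_mul_of_nonneg_left (hA x) (norm_nonneg a)

theorem hat_add {A B : Fock0 →ₗ[ℂ] Hilb0} {C D : ℝ} (hA : NBdd A C) (hB : NBdd B D) :
    hat (A + B) = hat A + hat B := hat_unique (hA.add hB) fun x => by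
  rw [add_apply, hat_opN hA, hat_opN hB, LinearMap.add_apply]

theorem hat_smul {A : Fock0 →ₗ[ℂ] Hilb0} {C : ℝ} (hA : NBdd A C) (a : ℂ) :
    hat (a • A) = a • hat A := hat_unique (hA.smul a) fun x => by
  rw [smul_apply, hat_opN hA, LinearMap.smul_apply]

/-! ### The Bogoliubov group -/

/-- Square summable rotation parameters. -/
structure Rot where
  /-- The parameter of each mode. -/
  z : ℕ+ → ℝ
  hz : Summable fun m => (z m * m) ^ 2

namespace Rot

variable (r : Rot)

theorem summable_sq : Summable fun m => r.z m ^ 2 :=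
  Summable.of_nonneg_of_le (fun m => sq_nonneg _) (fun m => by
    have : 1 ≤ (m : ℝ) := by exact_mod_cast Nat.succ_le_of_lt m.pos
    rw [mul_pow]; exact le_mul_of_one_le_right (sq_nonneg _) (one_le_pow₀ this)) r.hz

/-- The coefficients of `-i Z`. -/
def coef : Coef where
  u m := r.z m / m
  v m := -(r.z m / m)
  w _ := 0
  hu := by
    refine r.summable_sq.congr fun m => ?_
    have : (m : ℝ) ≠ 0 := by exact_mod_cast m.pos.ne'
    field_simp
  hv := by
    refine r.summable_sq.congr fun m => ?_
    have : (m : ℝ) ≠ 0 := by exact_mod_cast m.pos.ne'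
    field_simp
  hw := ⟨0, by simp⟩

/-- The coefficients of the commutator of `Z` with `N`. -/
def comCoef : Coef where
  u := r.z
  v := r.z
  w _ := 0
  hu := r.hz
  hv := r.hz
  hw := ⟨0, by simp⟩

theorem coef_qm (m : ℕ+) (x : Fock0) :
    r.coef.qm m x = ((r.z m / m : ℝ) : ℂ) • (pc m x - pa m x) := by
  simp only [Coef.qm_apply, coef]; push_cast; module

theorem comCoef_qm (m : ℕ+) (x : Fock0) :
    r.comCoef.qm m x = (r.z m : ℂ) • (pc m x + pa m x) := by
  simp only [Coef.qm_apply, comCoef]; push_cast; module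

theorem inner_coef_qm (m : ℕ+) (x y : Fock0) :
    inner ℂ (emb (r.coef.qm m x)) (emb y) = -inner ℂ (emb x) (emb (r.coef.qm m y)) := by
  rw [coef_qm, coef_qm, map_smul, map_smul, inner_smul_left, inner_smul_right, map_sub, map_sub,
    inner_sub_left, inner_sub_right, inner_pc, inner_pa, Complex.conj_ofReal]
  ring

theorem inner_coef_op (x y : Fock0) :
    inner ℂ (r.coef.op x) (emb y) = -inner ℂ (emb x) (r.coef.op y) := by
  refine (r.coef.hasSum_inner_left (emb y) x).unique ?_
  simp only [inner_coef_qm]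
  exact (r.coef.hasSum_inner (emb x) y).neg

theorem opN_coef_qm (m : ℕ+) (x : Fock0) :
    opN (r.coef.qm m x) = r.coef.qm m (opN x) + (2 : ℂ) • r.comCoef.qm m x := by
  have hm : (m : ℂ) ≠ 0 := by exact_mod_cast m.pos.ne'
  rw [coef_qm, coef_qm, comCoef_qm, map_smul, map_sub, opN_pc, opN_pa]
  have : (((r.z m / m : ℝ) : ℂ)) * (2 * m) = 2 * r.z m := by push_cast; field_simp
  linear_combination (norm := module) this • (pc m x + pa m x)

/-- `Z N⁻¹`. -/
def T : Hilb0 →L[ℂ] Hilb0 := Complex.I • hat r.coef.op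

/-- `[Z, N] N⁻¹`, up to sign. -/
def T' : Hilb0 →L[ℂ] Hilb0 := (-2 * Complex.I) • hat r.comCoef.op

theorem T_opN (x : Fock0) : r.T (emb (opN x)) = Complex.I • r.coef.op x := by
  rw [T, smul_apply, hat_opN r.coef.nBdd_op]

theorem T'_opN (x : Fock0) : r.T' (emb (opN x)) = (-2 * Complex.I) • r.comCoef.op x := by
  rw [T', smul_apply, hat_opN r.comCoef.nBdd_op]

theorem commutes : Commutes cutoff r.T r.T' where
  sym x y := by
    refine eq_of_dense₂ (F := fun x y => inner ℂ (r.T x) (cutoff.R y))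
      (G := fun x y => inner ℂ (cutoff.R x) (r.T y)) (by fun_prop) (by fun_prop) (fun x y => ?_) x y
    simp only [T_opN]
    rw [show cutoff.R = invN from rfl, invN_opN, invN_opN, inner_smul_left, inner_smul_right,
      inner_coef_op, Complex.conj_I]
    ring
  comm x y := by
    refine eq_of_dense₂ (F := fun x y => inner ℂ (r.T x) y - inner ℂ x (r.T y))
      (G := fun x y => inner ℂ (cutoff.R x) (r.T' y)) (by fun_prop) (by fun_prop) (fun x y => ?_) x y
    simp only [T_opN, T'_opN]
    rw [show cutoff.R = invN from rfl, invN_opN, inner_smul_left, inner_smul_right,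
      inner_smul_right, Complex.conj_I]
    have h1 := ((r.coef.hasSum_inner_left (emb (opN y)) x).mul_left (-Complex.I)).sub
      ((r.coef.hasSum_inner (emb (opN x)) y).mul_left Complex.I)
    refine h1.unique ?_
    have h2 := (r.comCoef.hasSum_inner (emb x) y).mul_left (-2 * Complex.I)
    refine h2.congr_fun fun m => ?_
    rw [inner_coef_qm, inner_opN, opN_coef_qm, map_add, inner_add_right, map_smul, inner_smul_right]
    ring

/-! ### Conjugation of single modes -/

/-- The coefficients of `nm + ε (pc + pa)` for the single mode `m`. -/
def single (m : ℕ+) (ε : ℝ) : Coef where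
  u p := if p = m then ε else 0
  v p := if p = m then ε else 0
  w p := if p = m then 1 else 0
  hu := summable_of_ne_finset_zero (s := {m}) fun p hp => by
    rw [if_neg (by simpa using hp)]; simp
  hv := summable_of_ne_finset_zero (s := {m}) fun p hp => by
    rw [if_neg (by simpa using hp)]; simp
  hw := ⟨1, fun p => by split_ifs <;> simp⟩

/-- `S = nm + m + ε (pc + pa)`. -/
def ladder (m : ℕ+) (ε : ℝ) : Module.End ℂ Fock0 :=
  nm m + (m : ℂ) • LinearMap.id + (ε : ℂ) • (pc m + pa m)

theorem ladder_apply (m : ℕ+) (ε : ℝ) (x : Fock0) :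
    ladder m ε x = nm m x + (m : ℂ) • x + (ε : ℂ) • (pc m x + pa m x) := rfl

theorem nBdd_ladder (m : ℕ+) (ε : ℝ) : ∃ C, NBdd (emb ∘ₗ ladder m ε) C := by
  have h := ((single m ε).nBdd_part {m}).add (nBdd_emb.smul (m : ℂ))
  refine ⟨_, fun x => (?_ : _ ≤ ((single m ε).bd + ‖(m : ℂ)‖ * 1) * _)⟩
  have := h x
  rw [LinearMap.add_apply, Coef.part_apply, Finset.sum_singleton, LinearMap.smul_apply,
    Coef.qm_apply] at this
  simp only [single, if_true] at this
  rw [LinearMap.comp_apply, ladder_apply]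
  refine le_trans (le_of_eq ?_) this
  simp only [map_add, map_smul]
  congr 1
  push_cast
  module

theorem inner_ladder (m : ℕ+) (ε : ℝ) (x y : Fock0) :
    inner ℂ (emb (ladder m ε x)) (emb y) = inner ℂ (emb x) (emb (ladder m ε y)) := by
  simp only [ladder_apply, map_add, map_smul, inner_add_left, inner_add_right, inner_smul_left,
    inner_smul_right, inner_pc, inner_pa, inner_nm, Complex.conj_ofReal, Complex.conj_natCast]
  ring

theorem coef_qm_ladder (p m : ℕ+) {ε : ℝ} (hε : ε * ε = 1) (x : Fock0) :
    r.coef.qm p (ladder m ε x) = ladder m ε (r.coef.qm p x) -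
      if p = m then ((2 * r.z m * ε : ℝ) : ℂ) • ladder m ε x else 0 := by
  have hε' : (ε : ℂ) * ε = 1 := by exact_mod_cast hε
  rw [coef_qm, coef_qm, ladder_apply, ladder_apply]
  simp only [map_smul, map_sub, map_add]
  have a1 := nm_pc m p x
  have a2 := nm_pa m p x
  have a3 := pa_pc m p x
  have a4 := pa_pc p m x
  have a5 := pc_pc p m x
  have a6 := pa_pa p m x
  by_cases h : p = m
  · subst h
    have hm : (p : ℂ) ≠ 0 := by exact_mod_cast p.pos.ne'
    rw [if_pos rfl] at a1 a2 a3 a4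
    rw [if_pos rfl, a1, a2, a3]
    push_cast
    have e1 : (r.z p / p : ℂ) * p = r.z p := by field_simp
    linear_combination (norm := module) ((2 * r.z p : ℂ) * hε') • (pc p x + pa p x) +
      (-2 * e1) • (pc p x + pa p x) + (-2 * ε * e1) • (nm p x + (p : ℂ) • x)
  · rw [if_neg (Ne.symm h)] at a1 a2 a3
    rw [if_neg h] at a4
    rw [if_neg h, a1, a2, a3, a4, a5, a6]
    module

/-- The unitary group generated by `Z`. -/
def V (t : ℝ) : Hilb0 ≃ₗᵢ[ℂ] Hilb0 := Cutoff.grp r.commutes t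

/-- The action of `V t` on the domain of `N`, in terms of the values of `N`. -/
def W (t : ℝ) (ξ : Hilb0) : Hilb0 := Cutoff.dom r.commutes t ξ

theorem invN_W (t : ℝ) (ξ : Hilb0) : invN (r.W t ξ) = r.V t (invN ξ) := Cutoff.R_dom r.commutes t ξ

theorem V_ladder (m : ℕ+) {ε : ℝ} (hε : ε * ε = 1) (t : ℝ) (ξ : Hilb0) :
    r.V t (hat (emb ∘ₗ ladder m ε) ξ) =
      (Real.exp (2 * r.z m * ε * t) : ℂ) • hat (emb ∘ₗ ladder m ε) (r.W t ξ) := by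
  obtain ⟨C, hC⟩ := nBdd_ladder m ε
  refine (Cutoff.grp_intertwine r.commutes (S := hat (emb ∘ₗ ladder m ε)) (a := 2 * r.z m * ε)
    (fun x y => ?_) (fun x y => ?_) t ξ).trans (Complex.coe_smul _ _).symm
  · refine eq_of_dense₂ (F := fun x y => inner ℂ (hat (emb ∘ₗ ladder m ε) x) (cutoff.R y))
      (G := fun x y => inner ℂ (cutoff.R x) (hat (emb ∘ₗ ladder m ε) y)) (by fun_prop) (by fun_prop)
      (fun x y => ?_) x y
    simp only [hat_opN hC]
    rw [show cutoff.R = invN from rfl, invN_opN, invN_opN]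
    exact inner_ladder m ε x y
  · refine eq_of_dense₂ (F := fun x y => Complex.I * inner ℂ (hat (emb ∘ₗ ladder m ε) x) (r.T y) -
        Complex.I * inner ℂ (r.T x) (hat (emb ∘ₗ ladder m ε) y))
      (G := fun x y => -((2 * r.z m * ε : ℝ) : ℂ) *
        inner ℂ (cutoff.R x) (hat (emb ∘ₗ ladder m ε) y))
      (by fun_prop) (by fun_prop) (fun x y => ?_) x y
    simp only [hat_opN hC, T_opN, LinearMap.comp_apply]
    rw [show cutoff.R = invN from rfl, invN_opN, inner_smul_left, inner_smul_right, Complex.conj_I,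
      inner_coef_op]
    have h1 := (r.coef.hasSum_inner (emb x) (ladder m ε y)).sub
      (r.coef.hasSum_inner (emb (ladder m ε x)) y)
    have h2 : ∀ p, inner ℂ (emb x) (emb (r.coef.qm p (ladder m ε y))) -
        inner ℂ (emb (ladder m ε x)) (emb (r.coef.qm p y)) =
        if p = m then -((2 * r.z m * ε : ℝ) : ℂ) * inner ℂ (emb x) (emb (ladder m ε y)) else 0 := by
      intro p
      rw [coef_qm_ladder r p m hε, inner_ladder, map_sub, inner_sub_right]
      split_ifs with h
      · rw [map_smul, inner_smul_right]; ring
      · simp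
    have h3 := h1.unique ((hasSum_ite_eq m _).congr_fun h2)
    rw [← h3, ← mul_assoc, ← mul_assoc]
    linear_combination (inner ℂ (emb (ladder m ε x)) (r.coef.op y) -
      inner ℂ (emb x) (r.coef.op (ladder m ε y))) * Complex.I_mul_I

theorem V_pair (m : ℕ+) {p q p' : ℝ} {t : ℝ} (hplus : (p + q) * Real.exp (2 * r.z m * t) = p')
    (hminus : (p - q) * Real.exp (-(2 * r.z m * t)) = p') {A B : Fock0 →ₗ[ℂ] Hilb0} {C D : ℝ}
    (hA : NBdd A C) (hB : NBdd B D)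
    (hA' : ∀ x, A x = emb ((q : ℂ) • (pc m x + pa m x) + (p : ℂ) • nm m x))
    (hB' : ∀ x, B x = emb ((p' : ℂ) • nm m x)) (ξ : Hilb0) :
    r.V t (hat A ξ) = hat B (r.W t ξ) + ((m * (p' - p) : ℝ) : ℂ) • invN (r.W t ξ) := by
  obtain ⟨C₁, hC₁⟩ := nBdd_ladder m 1
  obtain ⟨C₂, hC₂⟩ := nBdd_ladder m (-1)
  have e1 : hat A = ((p + q : ℝ) / 2 : ℂ) • hat (emb ∘ₗ ladder m 1) +
      ((p - q : ℝ) / 2 : ℂ) • hat (emb ∘ₗ ladder m (-1)) - ((m * p : ℝ) : ℂ) • invN := by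
    refine hat_unique hA fun x => ?_
    rw [sub_apply, add_apply, smul_apply, smul_apply, smul_apply, hat_opN hC₁, hat_opN hC₂,
      invN_opN, hA']
    simp only [LinearMap.comp_apply, ladder_apply, map_smul, map_add]
    push_cast
    module
  have e2 : hat B = ((p' : ℝ) / 2 : ℂ) • hat (emb ∘ₗ ladder m 1) +
      ((p' : ℝ) / 2 : ℂ) • hat (emb ∘ₗ ladder m (-1)) - ((m * p' : ℝ) : ℂ) • invN := by
    refine hat_unique hB fun x => ?_
    rw [sub_apply, add_apply, smul_apply, smul_apply, smul_apply, hat_opN hC₁, hat_opN hC₂,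
      invN_opN, hB']
    simp only [LinearMap.comp_apply, ladder_apply, map_smul, map_add]
    push_cast
    module
  have f1 := r.V_ladder m (ε := 1) (by norm_num) t ξ
  have f2 := r.V_ladder m (ε := -1) (by norm_num) t ξ
  rw [show 2 * r.z m * 1 * t = 2 * r.z m * t by ring] at f1
  rw [show 2 * r.z m * -1 * t = -(2 * r.z m * t) by ring] at f2
  rw [e1, e2]
  simp only [sub_apply, add_apply, smul_apply, map_sub, map_add, map_smul]
  rw [f1, f2, ← invN_W]
  have g1 : ((p + q : ℝ) : ℂ) * (Real.exp (2 * r.z m * t) : ℂ) = p' := by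
    rw [← hplus]; push_cast; ring
  have g2 : ((p - q : ℝ) : ℂ) * (Real.exp (-(2 * r.z m * t)) : ℂ) = p' := by
    rw [← hminus]; push_cast; ring
  push_cast at g1 g2 ⊢
  linear_combination (norm := module) (g1 / 2) • hat (emb ∘ₗ ladder m 1) (r.W t ξ) +
    (g2 / 2) • hat (emb ∘ₗ ladder m (-1)) (r.W t ξ)

/-- The Bogoliubov transformation diagonalizes the quadratic Hamiltonian. -/
theorem V_op {a b : Coef} {t σ : ℝ} (hab : ∀ m, a.u m = a.v m) (hbu : ∀ m, b.u m = 0)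
    (hbv : ∀ m, b.v m = 0) (hplus : ∀ m, (a.w m + a.u m) * Real.exp (2 * r.z m * t) = b.w m)
    (hminus : ∀ m, (a.w m - a.u m) * Real.exp (-(2 * r.z m * t)) = b.w m)
    (hσ : HasSum (fun m : ℕ+ => m * (b.w m - a.w m)) σ) (ξ : Hilb0) :
    r.V t (hat a.op ξ) = hat b.op (r.W t ξ) + (σ : ℂ) • invN (r.W t ξ) := by
  have hsum : ∀ (c : Coef) (S : Finset ℕ+) (η : Hilb0),
      hat (c.part S) η = ∑ m ∈ S, hat (c.part {m}) η := by
    intro c S η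
    have : hat (c.part S) = ∑ m ∈ S, hat (c.part {m}) := by
      refine hat_unique (c.nBdd_part S) fun x => ?_
      rw [_root_.sum_apply, c.part_apply, map_sum]
      refine Finset.sum_congr rfl fun m _ => ?_
      rw [hat_opN (c.nBdd_part {m}), c.part_apply, Finset.sum_singleton]
    rw [this, _root_.sum_apply]
  have h1 : ∀ S : Finset ℕ+, r.V t (hat (a.part S) ξ) = hat (b.part S) (r.W t ξ) +
      ((∑ m ∈ S, m * (b.w m - a.w m) : ℝ) : ℂ) • invN (r.W t ξ) := by
    intro S
    rw [hsum, hsum, map_sum, Complex.ofReal_sum, Finset.sum_smul, ← Finset.sum_add_distrib]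
    refine Finset.sum_congr rfl fun m _ => ?_
    refine r.V_pair m (hplus m) (hminus m) (a.nBdd_part {m}) (b.nBdd_part {m}) (fun x => ?_)
      (fun x => ?_) ξ
    · rw [Coef.part_apply, Finset.sum_singleton, Coef.qm_apply, ← hab m]
      congr 1
      module
    · rw [Coef.part_apply, Finset.sum_singleton, Coef.qm_apply, hbu, hbv]
      congr 1
      push_cast
      module
  have l1 := ((r.V t).continuous.tendsto _).comp
    (tendsto_hat a.nBdd_part a.nBdd_op a.tendsto_part ξ)
  have l2 := (tendsto_hat b.nBdd_part b.nBdd_op b.tendsto_part (r.W t ξ)).add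
    (((Complex.continuous_ofReal.tendsto _).comp hσ).smul_const (invN (r.W t ξ)))
  refine tendsto_nhds_unique l1 (l2.congr fun S => ?_)
  simp only [Function.comp_apply]
  exact (h1 S).symm

end Rot

/-! ### The coupling constants -/

theorem hasSum_nonzero {E : Type*} [AddCommGroup E] [TopologicalSpace E] [IsTopologicalAddGroup E]
    {f : {m : ℤ // m ≠ 0} → E} {a b : E}
    (ha : HasSum (fun p : ℕ+ => f ⟨p, pnat_ne p⟩) a)
    (hb : HasSum (fun p : ℕ+ => f ⟨-p, neg_ne_zero.2 (pnat_ne p)⟩) b) : HasSum f (a + b) := by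
  classical
  set F : ℤ → E := fun m => if h : m ≠ 0 then f ⟨m, h⟩ else 0 with hF
  have h1 : HasSum (fun n : ℕ => F n) a := by
    have : HasSum (fun p : ℕ+ => F ((p : ℕ) : ℤ)) a := ha.congr_fun fun p => by
      rw [hF]; exact dif_pos (pnat_ne p)
    simpa [hF] using (hasSum_pnat_iff (f := fun n : ℕ => F n)).1 this
  have h2 : HasSum (fun n : ℕ => F (-n)) b := by
    have : HasSum (fun p : ℕ+ => F (-((p : ℕ) : ℤ))) b := hb.congr_fun fun p => by
      rw [hF]; exact dif_pos (neg_ne_zero.2 (pnat_ne p))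
    simpa [hF] using (hasSum_pnat_iff (f := fun n : ℕ => F (-(n : ℤ)))).1 this
  have h3 := HasSum.of_nat_of_neg h1 h2
  have h4 : F 0 = 0 := by simp [hF]
  rw [h4, sub_zero] at h3
  refine ((hasSum_subtype_iff_of_support_subset (f := F) (s := {m | m ≠ 0}) fun m hm => ?_).2
    h3).congr_fun fun m => ?_
  · by_contra h
    simp only [Set.mem_ofPred_eq, not_not] at h
    exact hm (by rw [h, h4])
  · simp only [Function.comp_apply, hF]
    rw [dif_pos (show m.1 ≠ 0 from m.2)]
    exact congrArg f rfl

section Constants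

variable (e L : ℝ)

/-- `λV_m/π`. -/
def ratio (m : ℕ+) : ℝ := e ^ 2 * L ^ 2 / (8 * Real.pi ^ 3) / m ^ 2

variable {e L}

theorem pnat_cast_pos (m : ℕ+) : (0 : ℝ) < m := by exact_mod_cast m.pos

theorem one_le_pnat_cast (m : ℕ+) : (1 : ℝ) ≤ m := by exact_mod_cast Nat.succ_le_of_lt m.pos

theorem lamV_eq (hL : 0 < L) (m : ℕ+) : lamV e L m = Real.pi * ratio e L m := by
  have := pnat_cast_pos m
  have := Real.pi_pos
  rw [lamV, mom, ratio]
  push_cast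
  field_simp
  ring

theorem lamV_neg (m : ℤ) : lamV e L (-m) = lamV e L m := by
  rw [lamV, lamV, mom, mom]; push_cast; ring_nf

theorem zeta_neg (m : ℤ) : zeta e L (-m) = zeta e L m := by rw [zeta, zeta, lamV_neg]

theorem ratio_pos (he : 0 < e) (hL : 0 < L) (m : ℕ+) : 0 < ratio e L m := by
  have := pnat_cast_pos m
  have := Real.pi_pos
  rw [ratio]; positivity

theorem exp_zeta (he : 0 < e) (hL : 0 < L) (m : ℕ+) :
    Real.exp (-(2 * zeta e L m)) = √(1 + 2 * ratio e L m) := by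
  have h0 := ratio_pos he hL m
  have hpi := Real.pi_pos
  have hx : lamV e L m / (lamV e L m + Real.pi) = ratio e L m / (ratio e L m + 1) := by
    rw [lamV_eq hL]; field_simp
  rw [zeta, hx, show -(2 * (-Real.artanh (ratio e L m / (ratio e L m + 1)) / 2)) =
    Real.artanh (ratio e L m / (ratio e L m + 1)) by ring, Real.exp_artanh]
  · congr 1
    field_simp
    ring
  · constructor
    · have : 0 < ratio e L m / (ratio e L m + 1) := by positivity
      linarith
    · rw [div_lt_one (by positivity)]; linarith

theorem zeta_sq_le (he : 0 < e) (hL : 0 < L) (m : ℕ+) :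
    zeta e L m ^ 2 ≤ ratio e L m ^ 2 := by
  have h0 := ratio_pos he hL m
  have h1 := exp_zeta he hL m
  have h2 : 1 ≤ √(1 + 2 * ratio e L m) := by rw [Real.one_le_sqrt]; linarith
  have h3 : √(1 + 2 * ratio e L m) ≤ 1 + ratio e L m := by
    rw [Real.sqrt_le_left (by linarith)]; nlinarith
  rw [← h1] at h2 h3
  have h4 := Real.one_le_exp_iff.1 h2
  have h5 := Real.add_one_le_exp (-(2 * zeta e L m))
  exact sq_le_sq' (by linarith) (by linarith)

theorem summable_ratio_sq : Summable fun m : ℕ+ => (ratio e L m * m) ^ 2 := by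
  have h1 : Summable fun n : ℕ => 1 / (n : ℝ) ^ 2 := Real.summable_one_div_nat_pow.2 (by norm_num)
  have h2 : Summable fun m : ℕ+ => 1 / ((m : ℕ) : ℝ) ^ 2 := h1.comp_injective PNat.coe_injective
  refine (h2.mul_left ((e ^ 2 * L ^ 2 / (8 * Real.pi ^ 3)) ^ 2)).congr fun m => ?_
  have := pnat_cast_pos m
  rw [ratio]
  field_simp

variable (e L)

/-- The dispersion factor `(2π/L) √(1 + 2λV_m/π)`. -/
def freq (m : ℕ+) : ℝ := 2 * Real.pi / L * √(1 + 2 * ratio e L m)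

variable {e L}

theorem shiftTerm_eq (hL : 0 < L) (m : ℕ+) : shiftTerm e L m =
    m * (freq e L m - (2 * Real.pi / L + 2 * Real.pi / L * ratio e L m)) := by
  have := Real.pi_pos
  rw [shiftTerm, freq, lamV_eq hL, mul_div_assoc 2 (Real.pi * _), mul_div_cancel_left₀ _ Real.pi_ne_zero]
  ring

theorem shiftTerm_bounds (he : 0 < e) (hL : 0 < L) (m : ℕ+) :
    shiftTerm e L m < 0 ∧ |shiftTerm e L m| ≤ 2 * Real.pi / L * (ratio e L m * m) ^ 2 := by
  have h0 := ratio_pos he hL m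
  have hm := one_le_pnat_cast m
  have hpi : 0 < 2 * Real.pi / L := by have := Real.pi_pos; positivity
  set ν := ratio e L m with hν
  have h1 : √(1 + 2 * ν) < 1 + ν := by
    rw [Real.sqrt_lt' (by linarith)]; nlinarith
  have h2 : 1 + ν - ν ^ 2 ≤ √(1 + 2 * ν) := by
    rcases le_or_gt (1 + ν - ν ^ 2) 0 with h | h
    · exact h.trans (Real.sqrt_nonneg _)
    · rw [Real.le_sqrt' h]
      have : 0 < ν ^ 2 := by positivity
      nlinarith [mul_pos h0 h0]
  have h3 : shiftTerm e L m = 2 * Real.pi / L * m * (√(1 + 2 * ν) - (1 + ν)) := by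
    rw [shiftTerm_eq hL, freq, ← hν]; ring
  have h4 : shiftTerm e L m < 0 := by
    rw [h3]; exact mul_neg_of_pos_of_neg (by positivity) (by linarith)
  refine ⟨h4, ?_⟩
  rw [abs_of_neg h4, h3, mul_pow]
  have h5 : (m : ℝ) * ((1 + ν) - √(1 + 2 * ν)) ≤ ν ^ 2 * m ^ 2 := by
    have : (m : ℝ) * ((1 + ν) - √(1 + 2 * ν)) ≤ m * ν ^ 2 := by gcongr; linarith
    nlinarith [sq_nonneg ν, mul_nonneg (sq_nonneg ν) (by linarith : (0 : ℝ) ≤ m)]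
  nlinarith

theorem summable_shift (he : 0 < e) (hL : 0 < L) : Summable (shiftTerm e L) :=
  Summable.of_norm_bounded (summable_ratio_sq.mul_left _) fun m => (shiftTerm_bounds he hL m).2

theorem shift_neg (he : 0 < e) (hL : 0 < L) : shift e L < 0 := by
  have h := (summable_shift he hL).neg.tsum_pos (fun m => ?_) 1 ?_
  · rw [tsum_neg] at h; unfold shift; linarith
  · have := (shiftTerm_bounds he hL m).1; linarith
  · have := (shiftTerm_bounds he hL 1).1; linarith

theorem omega_eq (hL : 0 < L) (m : ℕ+) : omega e L m = m * freq e L m := by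
  have hm := pnat_cast_pos m
  have hpi := Real.pi_pos
  rw [omega, freq, show (m : ℝ) * (2 * Real.pi / L * √(1 + 2 * ratio e L m)) =
    (2 * Real.pi * m / L) * √(1 + 2 * ratio e L m) by ring]
  rw [← Real.sqrt_sq (show 0 ≤ 2 * Real.pi * m / L by positivity), ← Real.sqrt_mul (sq_nonneg _),
    mom, mass, ratio, div_pow e, Real.sq_sqrt hpi.le]
  congr 1
  push_cast
  field_simp
  ring

end Constants

/-! ### The quadratic Hamiltonians -/

variable {e L : ℝ}

/-- The parameters of the Bogoliubov transformation. -/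
def rot (he : 0 < e) (hL : 0 < L) : Rot where
  z m := zeta e L m
  hz := Summable.of_nonneg_of_le (fun m => sq_nonneg _) (fun m => by
    rw [mul_pow, mul_pow]
    exact mul_le_mul_of_nonneg_right (zeta_sq_le he hL m) (sq_nonneg _)) summable_ratio_sq

theorem summable_coupling (c : ℝ) : Summable fun m : ℕ+ => (c * ratio e L m * m) ^ 2 :=
  (summable_ratio_sq.mul_left (c ^ 2)).congr fun m => by ring

theorem ratio_bdd (c d : ℝ) : ∃ W, ∀ m : ℕ+, |d + c * ratio e L m| ≤ W := by
  refine ⟨|d| + |c| * |e ^ 2 * L ^ 2 / (8 * Real.pi ^ 3)|, fun m => (abs_add_le _ _).trans ?_⟩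
  rw [abs_mul, ratio, abs_div, abs_of_nonneg (sq_nonneg (m : ℝ))]
  gcongr
  exact div_le_self (abs_nonneg _) (one_le_pow₀ (one_le_pnat_cast m))

variable (e L)

/-- The coefficients of the Coulomb energy. -/
def coulCoef : Coef where
  u m := 2 * Real.pi / L * ratio e L m
  v m := 2 * Real.pi / L * ratio e L m
  w m := 2 * Real.pi / L * ratio e L m
  hu := summable_coupling _
  hv := summable_coupling _
  hw := by simpa using ratio_bdd (e := e) (L := L) (2 * Real.pi / L) 0

/-- The coefficients of the undressed Hamiltonian. -/
def hamCoef : Coef where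
  u m := 2 * Real.pi / L * ratio e L m
  v m := 2 * Real.pi / L * ratio e L m
  w m := 2 * Real.pi / L + 2 * Real.pi / L * ratio e L m
  hu := summable_coupling _
  hv := summable_coupling _
  hw := ratio_bdd _ _

variable {e L}

/-- The coefficients of the dressed Hamiltonian. -/
def freeCoef (he : 0 < e) (hL : 0 < L) : Coef where
  u _ := 0
  v _ := 0
  w m := freq e L m
  hu := by simp
  hv := by simp
  hw := by
    obtain ⟨W, hW⟩ := ratio_bdd (e := e) (L := L) (2 * Real.pi / L) (2 * Real.pi / L)
    refine ⟨W, fun m => le_trans ?_ (hW m)⟩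
    have h0 := ratio_pos he hL m
    have hpi : 0 < 2 * Real.pi / L := by have := Real.pi_pos; positivity
    have h3 : √(1 + 2 * ratio e L m) ≤ 1 + ratio e L m := by
      rw [Real.sqrt_le_left (by linarith)]; nlinarith
    rw [freq, abs_of_nonneg (by positivity), abs_of_nonneg (by positivity)]
    nlinarith

theorem mom_pnat (m : ℕ+) : mom L m = 2 * Real.pi / L * m := by rw [mom]; push_cast; ring

theorem bogoliubovTerm_pos (hL : 0 < L) (s : Cfg0) (p : ℕ+) :
    bogoliubovTerm e L s ⟨p, pnat_ne p⟩ =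
      Complex.I • emb (((zeta e L p / p : ℝ) : ℂ) • pc p (basisVec0 s)) := by
  have := pnat_cast_pos p
  have := Real.pi_pos
  rw [bogoliubovTerm, restrict0_mul (charge_rhoL (neg_ne_zero.2 (pnat_ne p))), map_smul, smul_smul,
    mom_pnat, show 2 * Real.pi / L * (zeta e L p / (2 * Real.pi / L * p)) = zeta e L p / p by
      field_simp]
  rfl

theorem bogoliubovTerm_neg (hL : 0 < L) (s : Cfg0) (p : ℕ+) :
    bogoliubovTerm e L s ⟨-p, neg_ne_zero.2 (pnat_ne p)⟩ =
      Complex.I • emb (((-(zeta e L p / p) : ℝ) : ℂ) • pa p (basisVec0 s)) := by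
  have := pnat_cast_pos p
  have := Real.pi_pos
  rw [bogoliubovTerm]
  simp only [neg_neg]
  rw [restrict0_mul (charge_rhoL (pnat_ne p)), map_smul, smul_smul, zeta_neg,
    show mom L (-p) = - mom L p by rw [mom, mom]; push_cast; ring,
    mom_pnat, show 2 * Real.pi / L * (zeta e L p / -(2 * Real.pi / L * p)) = -(zeta e L p / p) by
      field_simp]
  rfl

theorem summable_of_modes {B : ℕ+ → Module.End ℂ Fock0} (x : Fock0) (w : ℕ+ → ℂ)
    (hB : ∀ m ∉ modes x, B m x = 0) : Summable fun m => emb (w m • B m x) :=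
  summable_of_ne_finset_zero (s := modes x) fun m hm => by rw [hB m hm, smul_zero, map_zero]

theorem pa_of_notMem {x : Fock0} {m : ℕ+} (h : m ∉ modes x) : pa m x = 0 := by
  rw [pa_apply, beta_of_notMem h, map_zero]

theorem nm_of_notMem {x : Fock0} {m : ℕ+} (h : m ∉ modes x) : nm m x = 0 := by
  rw [nm_apply, beta_of_notMem h, alpha_of_notMem h, map_zero, map_zero, add_zero]

theorem hasSum_bogoliubovTerm (he : 0 < e) (hL : 0 < L) (s : Cfg0) :
    HasSum (bogoliubovTerm e L s) (Complex.I • (rot he hL).coef.op (basisVec0 s)) := by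
  have h1 := ((Coef.summable_pc (rot he hL).coef.hu (basisVec0 s)).const_smul Complex.I).hasSum
  have h2 := ((summable_of_modes (B := pa) (basisVec0 s)
    (fun m => (((rot he hL).coef.v m : ℝ) : ℂ)) fun m => pa_of_notMem).const_smul
      Complex.I).hasSum
  have h3 := hasSum_nonzero (f := bogoliubovTerm e L s)
    (h1.congr_fun fun p => bogoliubovTerm_pos hL s p)
    (h2.congr_fun fun p => bogoliubovTerm_neg hL s p)
  have h4 := h1.add h2
  have h5 := ((rot he hL).coef.hasSum_op (basisVec0 s)).const_smul Complex.I
  rwa [h4.unique (h5.congr_fun fun p => ?_)] at h3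
  rw [← smul_add, ← map_add, Coef.qm_apply]
  congr 2
  simp [Rot.coef]

theorem restrict0_current (p : ℕ+) (m : {m : ℤ // m ≠ 0}) (hm : m.1 = p ∨ m.1 = -p) (x : Fock0) :
    restrict0 (currentSq L m) x = ((1 / L ^ 2 : ℝ) : ℂ) • (pc p x + pa p x + nm p x) := by
  have c1 := charge_rhoR (pnat_ne p)
  have c2 := charge_rhoR (neg_ne_zero.2 (pnat_ne p))
  have c3 := charge_rhoL (pnat_ne p)
  have c4 := charge_rhoL (neg_ne_zero.2 (pnat_ne p))
  have habs : |m.1| = (p : ℤ) := by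
    have : (0 : ℤ) < p := by exact_mod_cast p.pos
    rcases hm with h | h <;> rw [h] <;> simp
  rw [currentSq, restrict0_smul, LinearMap.smul_apply, habs, restrict0_add, restrict0_add,
    restrict0_add, LinearMap.add_apply, LinearMap.add_apply, LinearMap.add_apply]
  congr 1
  have e1 : restrict0 (rhoR p * rhoR (-p)) x = alphaD p (alpha p x) := restrict0_mul c2 x
  have e2 : restrict0 (rhoL (-p) * rhoL p) x = betaD p (beta p x) := restrict0_mul c3 x
  have e3 : restrict0 (rhoL p * rhoR (-p)) x = beta p (alpha p x) := restrict0_mul c2 x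
  have e4 : restrict0 (rhoR p * rhoL (-p)) x = alphaD p (betaD p x) := restrict0_mul c4 x
  have e5 : restrict0 (rhoL (-p) * rhoR p) x = betaD p (alphaD p x) := restrict0_mul c1 x
  have e6 : restrict0 (rhoR (-p) * rhoL p) x = alpha p (beta p x) := restrict0_mul c3 x
  rw [pc_apply, pa_apply, nm_apply, e1, e2]
  rcases hm with h | h <;> rw [h]
  · rw [e3, e4, ← alpha_beta]; abel
  · rw [neg_neg, e5, e6, ← alphaD_betaD]; abel

theorem coulombTerm_eq (hL : 0 < L) (s : Cfg0) (p : ℕ+) (m : {m : ℤ // m ≠ 0})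
    (hm : m.1 = p ∨ m.1 = -p) : coulombTerm e L s m =
      ((1 / 2 : ℝ) : ℂ) • emb ((coulCoef e L).qm p (basisVec0 s)) := by
  have hp := pnat_cast_pos p
  have hpi := Real.pi_pos
  have hmom : mom L m.1 ^ 2 = mom L p ^ 2 := by
    rcases hm with h | h <;> rw [h]
    rw [mom, mom]; push_cast; ring
  rw [coulombTerm, restrict0_current p m hm, hmom, Coef.qm_apply, mom_pnat]
  have hc : e ^ 2 * L / 2 * (1 / (2 * Real.pi / L * p) ^ 2) * (1 / L ^ 2) =
      1 / 2 * (2 * Real.pi / L * ratio e L p) := by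
    rw [ratio]; field_simp; ring
  simp only [coulCoef]
  rw [← smul_add, ← smul_add, map_smul, map_smul, smul_smul, smul_smul, ← Complex.ofReal_mul,
    ← Complex.ofReal_mul, hc]

theorem hasSum_coulombTerm (hL : 0 < L) (s : Cfg0) :
    HasSum (coulombTerm e L s) ((coulCoef e L).op (basisVec0 s)) := by
  have h1 := ((coulCoef e L).hasSum_op (basisVec0 s)).const_smul ((1 / 2 : ℝ) : ℂ)
  have h3 := hasSum_nonzero (f := coulombTerm e L s)
    (h1.congr_fun fun p => coulombTerm_eq hL s p _ (Or.inl rfl))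
    (h1.congr_fun fun p => coulombTerm_eq hL s p _ (Or.inr rfl))
  rwa [← add_smul, ← Complex.ofReal_add, show (1 / 2 + 1 / 2 : ℝ) = 1 by norm_num,
    Complex.ofReal_one, one_smul] at h3

theorem coulomb_eq (hL : 0 < L) : coulomb e L = (coulCoef e L).op := fock0_ext fun s => by
  rw [coulomb]
  simp [basisVec0]
  exact (hasSum_coulombTerm hL s).tsum_eq

theorem scalarTerm (hL : 0 < L) (m : ℕ+) (x : Fock0) :
    (omega e L (m : ℤ) : ℂ) • (aCr (m : ℤ) * aAn (m : ℤ) + aCr (-(m : ℤ)) * aAn (-(m : ℤ))) (inc x)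
      = inc ((freq e L m : ℂ) • nm m x) := by
  have hp := pnat_cast_pos m
  have hm : 0 < (m : ℤ) := by exact_mod_cast m.pos
  have c1 := charge_rhoR (pnat_ne m)
  have c2 := charge_rhoR (neg_ne_zero.2 (pnat_ne m))
  have c3 := charge_rhoL (pnat_ne m)
  have c4 := charge_rhoL (neg_ne_zero.2 (pnat_ne m))
  have hs : ((1 / √(m : ℝ) : ℝ) : ℂ) * ((1 / √(m : ℝ) : ℝ) : ℂ) = ((1 / m : ℝ) : ℂ) := by
    rw [← Complex.ofReal_mul, div_mul_div_comm, one_mul, Real.mul_self_sqrt hp.le]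
  have hc : (m : ℝ) * freq e L m * (1 / m) = freq e L m := by field_simp
  have e1 : (aCr (m : ℤ) * aAn (m : ℤ)) (inc x) =
      ((1 / m : ℝ) : ℂ) • inc (alphaD m (alpha m x)) := by
    rw [Module.End.mul_apply, aCr, aAn, if_pos hm, if_pos hm, LinearMap.smul_apply,
      LinearMap.smul_apply, map_smul, smul_smul, alphaD, alpha, inc_restrict0 c1, inc_restrict0 c2]
    congr 1
    rw [← hs]
    push_cast
    linear_combination (-((1 / √(m : ℝ) : ℂ)) * (1 / √(m : ℝ) : ℂ)) * Complex.I_mul_I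
  have e2 : (aCr (-(m : ℤ)) * aAn (-(m : ℤ))) (inc x) =
      ((1 / m : ℝ) : ℂ) • inc (betaD m (beta m x)) := by
    rw [Module.End.mul_apply, aCr, aAn, if_neg (by omega), if_neg (by omega), LinearMap.smul_apply,
      LinearMap.smul_apply, map_smul, smul_smul, betaD, beta, inc_restrict0 c4, inc_restrict0 c3,
      neg_neg]
    congr 1
    rw [← hs]
    push_cast
    simp only [neg_neg]
    linear_combination (-((1 / √(m : ℝ) : ℂ)) * (1 / √(m : ℝ) : ℂ)) * Complex.I_mul_I
  rw [LinearMap.add_apply, e1, e2, omega_eq hL, map_smul, nm_apply, map_add, ← smul_add, smul_smul,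
    ← Complex.ofReal_mul, hc]

theorem restrict0_scalarH (he : 0 < e) (hL : 0 < L) (x : Fock0) :
    emb (restrict0 (scalarH e L) x) = (freeCoef he hL).op x := by
  refine LinearMap.congr_fun (f := emb ∘ₗ restrict0 (scalarH e L)) (g := (freeCoef he hL).op)
    (fock0_ext fun s => ?_) x
  set x := basisVec0 s
  have hx : inc x = basisVec s.1 := inc_basis s
  have h1 : scalarH e L (inc x) = inc (∑ m ∈ modes x, (freq e L m : ℂ) • nm m x) := by
    rw [hx, scalarH, opSum]
    simp only [basisVec, Finsupp.linearCombination_single, one_smul]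
    rw [map_sum, finsum_eq_sum_of_support_subset (s := modes x)]
    · refine Finset.sum_congr rfl fun m _ => ?_
      rw [← scalarTerm hL, hx]; rfl
    · intro m hm
      by_contra h
      refine hm ?_
      have := scalarTerm (e := e) hL m x
      rw [nm_of_notMem h, smul_zero, map_zero, hx] at this
      exact this
  have h2 : restrict0 (scalarH e L) x = ∑ m ∈ modes x, (freq e L m : ℂ) • nm m x := by
    refine Finsupp.ext fun t => ?_
    rw [restrict0_apply, h1, inc_apply]
  rw [LinearMap.comp_apply, h2, map_sum]
  refine HasSum.unique (hasSum_sum_of_ne_finset_zero fun m hm => ?_)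
    (((freeCoef he hL).hasSum_op x).congr_fun fun m => ?_)
  · rw [nm_of_notMem hm, smul_zero, map_zero]
  · rw [Coef.qm_apply]; simp [freeCoef]

/-- The zero-mode potential `(π/2L) (Q⁵ʳᵉᵍ)²` plus an operator which does not depend on `a`. -/
def fib (L : ℝ) (A : Fock0 →ₗ[ℂ] Hilb0) (a : ℝ) : Fock0 →ₗ[ℂ] Hilb0 :=
  emb ∘ₗ dg (fun s => Real.pi / (2 * L) * (cfgAx s.1 - (a * L / Real.pi + 1)) ^ 2) + A

theorem fib_basis (A : Fock0 →ₗ[ℂ] Hilb0) (a : ℝ) (s : Cfg0) : fib L A a (basisVec0 s) =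
    ((Real.pi / (2 * L) * (cfgAx s.1 - (a * L / Real.pi + 1)) ^ 2 : ℝ) : ℂ) • emb (basisVec0 s) +
      A (basisVec0 s) := by
  rw [fib, LinearMap.add_apply, LinearMap.comp_apply, dg_basis, map_smul]

theorem fib_continuous (A : Fock0 →ₗ[ℂ] Hilb0) (s : Cfg0) :
    Continuous fun a => fib L A a (basisVec0 s) := by
  simp only [fib_basis]
  fun_prop

theorem schrOp_congr {B B' : ℝ → Fock0 →ₗ[ℂ] Hilb0} (h : B = B')
    (hB : ∀ s, Continuous fun a => B a (basisVec0 s))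
    (hB' : ∀ s, Continuous fun a => B' a (basisVec0 s)) : schrOp e L B hB = schrOp e L B' hB' := by
  subst h; rfl

theorem axialReg_basis (a : ℝ) (s : Cfg0) : axialReg L a (basisVec0 s) =
    ((cfgAx s.1 - (a * L / Real.pi + 1) : ℝ) : ℂ) • basisVec0 s := by
  rw [axialReg, LinearMap.sub_apply, restrict0_axial, dg_basis, LinearMap.smul_apply,
    Module.End.one_apply, ← sub_smul, ← Complex.ofReal_sub]

theorem hamFiber_eq (hL : 0 < L) : hamFiber e L = fib L (hamCoef e L).op := by
  funext a
  refine fock0_ext fun s => ?_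
  have hpi := Real.pi_pos
  have h1 : (hamCoef e L).op (basisVec0 s) =
      ((2 * Real.pi / L * lev s : ℝ) : ℂ) • emb (basisVec0 s) + (coulCoef e L).op (basisVec0 s) := by
    refine ((hamCoef e L).hasSum_op _).unique (HasSum.congr_fun (HasSum.add (f := fun m => emb
      (((2 * Real.pi / L : ℝ) : ℂ) • nm m (basisVec0 s))) ?_
      ((coulCoef e L).hasSum_op (basisVec0 s))) fun m => ?_)
    · have h2 := sum_nm (basisVec0 s) subset_rfl
      rw [dg_basis] at h2
      rw [Complex.ofReal_mul, mul_smul, ← map_smul, ← map_smul, ← h2, Finset.smul_sum, map_sum]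
      exact hasSum_sum_of_ne_finset_zero fun m hm => by rw [nm_of_notMem hm, smul_zero, map_zero]
    · rw [Coef.qm_apply, Coef.qm_apply, ← map_add]
      congr 1
      simp only [hamCoef, coulCoef]
      push_cast
      module
  rw [hamFiber, fib_basis, h1, LinearMap.add_apply, coulomb_eq hL, LinearMap.comp_apply,
    ← add_assoc]
  congr 1
  rw [LinearMap.add_apply, LinearMap.sub_apply, LinearMap.sub_apply, LinearMap.smul_apply,
    LinearMap.smul_apply, LinearMap.smul_apply, axialReg_basis, restrict0_diracH L hL, dg_basis,
    Module.End.one_apply, smul_smul, ← sub_smul, ← sub_smul, ← add_smul, map_smul, ← add_smul]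
  congr 1
  rw [lev]
  push_cast
  have : (Real.pi : ℂ) ≠ 0 := by exact_mod_cast hpi.ne'
  have : (L : ℂ) ≠ 0 := by exact_mod_cast hL.ne'
  field_simp
  ring

theorem ham_eq (hL : 0 < L) :
    ham e L = schrOp e L (fib L (hamCoef e L).op) (fib_continuous _) :=
  schrOp_congr (hamFiber_eq hL) _ _

/-- The dressed Hamiltonian without zero modes. -/
def dressedOp (he : 0 < e) (hL : 0 < L) : Fock0 →ₗ[ℂ] Hilb0 :=
  (freeCoef he hL).op + (shift e L : ℂ) • emb

theorem dressedFiber_eq (he : 0 < e) (hL : 0 < L) :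
    dressedFiber e L = fib L (dressedOp he hL) := by
  funext a
  refine fock0_ext fun s => ?_
  rw [dressedFiber, fib_basis, dressedOp, LinearMap.comp_apply, LinearMap.add_apply,
    LinearMap.add_apply, LinearMap.smul_apply, Module.End.mul_apply, axialReg_basis, map_smul,
    axialReg_basis, LinearMap.smul_apply, Module.End.one_apply, map_add, map_add,
    restrict0_scalarH he hL, LinearMap.add_apply, LinearMap.smul_apply, ← add_assoc, smul_smul,
    smul_smul, map_smul, map_smul, ← Complex.ofReal_mul, ← Complex.ofReal_mul]
  congr 4
  ring

theorem dressedHam_eq (he : 0 < e) (hL : 0 < L) :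
    dressedHam e L = schrOp e L (fib L (dressedOp he hL)) (fib_continuous _) :=
  schrOp_congr (dressedFiber_eq he hL) _ _

/-! ### Dressing -/

theorem nBdd_dressedOp (he : 0 < e) (hL : 0 < L) :
    NBdd (dressedOp he hL) ((freeCoef he hL).bd + ‖(shift e L : ℂ)‖ * 1) :=
  (freeCoef he hL).nBdd_op.add (nBdd_emb.smul _)

theorem hat_dressedOp (he : 0 < e) (hL : 0 < L) (ξ : Hilb0) :
    hat (dressedOp he hL) ξ = hat (freeCoef he hL).op ξ + (shift e L : ℂ) • invN ξ := by
  rw [dressedOp, hat_add (freeCoef he hL).nBdd_op (nBdd_emb.smul _), hat_smul nBdd_emb, hat_emb]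
  rfl

theorem V_ham (he : 0 < e) (hL : 0 < L) (ξ : Hilb0) :
    (rot he hL).V 1 (hat (hamCoef e L).op ξ) = hat (dressedOp he hL) ((rot he hL).W 1 ξ) := by
  rw [hat_dressedOp]
  refine (rot he hL).V_op (fun _ => rfl) (fun _ => rfl) (fun _ => rfl) (fun m => ?_) (fun m => ?_)
    ((summable_shift he hL).hasSum.congr_fun fun m => (shiftTerm_eq hL m).symm) ξ
  · have h0 := ratio_pos he hL m
    have h1 := exp_zeta he hL m
    have h2 : Real.exp (2 * zeta e L m) * √(1 + 2 * ratio e L m) = 1 := by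
      rw [← h1, ← Real.exp_add, add_neg_cancel, Real.exp_zero]
    have h3 := Real.mul_self_sqrt (show 0 ≤ 1 + 2 * ratio e L m by linarith)
    simp only [rot, mul_one, hamCoef, freeCoef, freq]
    linear_combination (-2 * Real.pi / L * Real.exp (2 * zeta e L m)) * h3 +
      (2 * Real.pi / L * √(1 + 2 * ratio e L m)) * h2
  · simp only [rot, mul_one, hamCoef, freeCoef, freq]
    rw [exp_zeta he hL m]
    ring

/-! ### Operators commuting with the bosons -/

theorem dg_comm {w : Cfg0 → ℝ} {X : Module.End ℂ Fock0} (h : ∀ x, X (dg w x) = dg w (X x))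
    (φ : ℝ → ℝ) (x : Fock0) : X (dg (fun s => φ (w s)) x) = dg (fun s => φ (w s)) (X x) := by
  refine LinearMap.congr_fun (f := X ∘ₗ dg fun s => φ (w s)) (g := dg (fun s => φ (w s)) ∘ₗ X)
    (fock0_ext fun s => Finsupp.ext fun t => ?_) x
  have h1 := DFunLike.congr_fun (h (basisVec0 s)) t
  rw [dg_basis, map_smul, dg_apply, Finsupp.smul_apply, smul_eq_mul] at h1
  rw [LinearMap.comp_apply, LinearMap.comp_apply, dg_basis, map_smul, dg_apply, Finsupp.smul_apply,
    smul_eq_mul]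
  by_cases h0 : X (basisVec0 s) t = 0
  · rw [h0]; simp
  · have := mul_right_cancel₀ h0 h1
    rw [Complex.ofReal_injective this]

/-- `X` commutes with the bosons and extends to the bounded operator `Y`. -/
structure Neutral (X : Module.End ℂ Fock0) (Y : Hilb0 →L[ℂ] Hilb0) : Prop where
  ext : ∀ x, Y (emb x) = emb (X x)
  a : ∀ m x, X (alpha m x) = alpha m (X x)
  aD : ∀ m x, X (alphaD m x) = alphaD m (X x)
  b : ∀ m x, X (beta m x) = beta m (X x)
  bD : ∀ m x, X (betaD m x) = betaD m (X x)

namespace Neutral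

variable {X : Module.End ℂ Fock0} {Y : Hilb0 →L[ℂ] Hilb0} (h : Neutral X Y)
include h

theorem pc (m : ℕ+) (x : Fock0) : X (pc m x) = Schwinger.pc m (X x) := by
  rw [pc_apply, pc_apply, h.aD, h.bD]

theorem pa (m : ℕ+) (x : Fock0) : X (pa m x) = Schwinger.pa m (X x) := by
  rw [pa_apply, pa_apply, h.a, h.b]

theorem nm (m : ℕ+) (x : Fock0) : X (nm m x) = Schwinger.nm m (X x) := by
  rw [nm_apply, nm_apply, map_add, h.aD, h.a, h.bD, h.b]

theorem qm (q : Coef) (m : ℕ+) (x : Fock0) : X (q.qm m x) = q.qm m (X x) := by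
  rw [Coef.qm_apply, Coef.qm_apply, map_add, map_add, map_smul, map_smul, map_smul, h.pc, h.pa,
    h.nm]

theorem op (q : Coef) (x : Fock0) : Y (q.op x) = q.op (X x) := by
  refine (Y.hasSum (q.hasSum_op x)).unique ((q.hasSum_op (X x)).congr_fun fun m => ?_)
  rw [h.ext, h.qm]

theorem level (x : Fock0) : X (dg lev x) = dg lev (X x) := by
  classical
  rw [← sum_nm x (S := modes x ∪ modes (X x)) Finset.subset_union_left,
    ← sum_nm (X x) (S := modes x ∪ modes (X x)) Finset.subset_union_right, map_sum]
  exact Finset.sum_congr rfl fun m _ => h.nm m x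

theorem opN (x : Fock0) : X (opN x) = Schwinger.opN (X x) := by
  rw [opN_apply, opN_apply, map_add, h.level]

theorem hat {B : Fock0 →ₗ[ℂ] Hilb0} {C : ℝ} (hB : NBdd B C) (hX : ∀ x, Y (B x) = B (X x))
    (ξ : Hilb0) : Y (hat B ξ) = Schwinger.hat B (Y ξ) := by
  refine congrFun (dense_opN.equalizer (by fun_prop : Continuous fun ξ => Y (Schwinger.hat B ξ))
    (by fun_prop : Continuous fun ξ => Schwinger.hat B (Y ξ)) (funext fun x => ?_)) ξ
  simp only [Function.comp_apply]
  rw [hat_opN hB, h.ext, h.opN, hat_opN hB, hX]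

theorem diag {w : Cfg0 → ℝ} {C : ℝ} (hw : ∀ s, |w s| ≤ C) {φ : ℝ → ℝ} (hφ : ∀ s, w s = φ (lev s))
    (ξ : Hilb0) : Y (diag w C hw ξ) = Schwinger.diag w C hw (Y ξ) := by
  refine congrFun (dense_emb.equalizer
    (by fun_prop : Continuous fun ξ => Y (Schwinger.diag w C hw ξ))
    (by fun_prop : Continuous fun ξ => Schwinger.diag w C hw (Y ξ)) (funext fun x => ?_)) ξ
  simp only [Function.comp_apply]
  obtain rfl : w = fun s => φ (lev s) := funext hφ
  rw [diag_emb, h.ext, h.ext, diag_emb, dg_comm h.level]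

theorem cutP (k : ℕ) (ξ : Hilb0) : Y (cutP k ξ) = Schwinger.cutP k (Y ξ) :=
  h.diag _ (φ := fun l => if l + 1 ≤ k + 1 then 1 else 0) (fun _ => rfl) ξ

theorem cutN (k : ℕ) (ξ : Hilb0) : Y (cutN k ξ) = Schwinger.cutN k (Y ξ) :=
  h.diag _ (φ := fun l => if l + 1 ≤ k + 1 then l + 1 else 0) (fun _ => rfl) ξ

theorem V (r : Rot) (t : ℝ) (ξ : Hilb0) : r.V t (Y ξ) = Y (r.V t ξ) := by
  refine Cutoff.grp_commute r.commutes h.cutP h.cutN (fun x => ?_) t ξ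
  rw [Rot.T, smul_apply, smul_apply, map_smul, h.hat r.coef.nBdd_op (h.op r.coef)]

end Neutral

theorem neutral_gam : Neutral gam (gamH.toContinuousLinearEquiv : Hilb0 →L[ℂ] Hilb0) :=
  ⟨gamH_emb, gam_alpha, gam_alphaD, gam_beta, gam_betaD⟩

/-- The indicator function of a charge. -/
def ind (q c : ℝ) : ℝ := if c = q then 1 else 0

/-- The projection onto axial charge `q`. -/
def sector (q : ℝ) : Hilb0 →L[ℂ] Hilb0 :=
  diag (fun s => ind q (cfgAx s.1)) 1 fun s => by rw [ind]; split_ifs <;> simp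

theorem neutral_sector (q : ℝ) : Neutral (dg fun s => ind q (cfgAx s.1)) (sector q) where
  ext x := diag_emb _ x
  a m x := (dg_comm (w := fun s => cfgAx s.1) (ax_alpha m) (ind q) x).symm
  aD m x := (dg_comm (w := fun s => cfgAx s.1) (ax_alphaD m) (ind q) x).symm
  b m x := (dg_comm (w := fun s => cfgAx s.1) (ax_beta m) (ind q) x).symm
  bD m x := (dg_comm (w := fun s => cfgAx s.1) (ax_betaD m) (ind q) x).symm

namespace Rot

variable (r : Rot)

theorem V_gamH (t : ℝ) (ξ : Hilb0) : r.V t (gamH ξ) = gamH (r.V t ξ) := neutral_gam.V r t ξ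

theorem V_basis_apply (t : ℝ) (s u : Cfg0) (h : cfgAx u.1 ≠ cfgAx s.1) :
    r.V t (emb (basisVec0 s)) u = 0 := by
  have h1 : sector (cfgAx s.1) (emb (basisVec0 s)) = emb (basisVec0 s) := by
    rw [(neutral_sector _).ext, dg_basis, ind, if_pos rfl, Complex.ofReal_one, one_smul]
  have h2 := (neutral_sector (cfgAx s.1)).V r t (emb (basisVec0 s))
  rw [h1] at h2
  rw [h2, sector, diag_apply, ind, if_neg h, Complex.ofReal_zero, zero_mul]

theorem exists_app (t : ℝ) (k : ℕ) (x : Fock0) : ∃ y, emb y = cutP k (r.V t (emb x)) := by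
  induction x using Finsupp.induction_linear with
  | zero => exact ⟨0, by simp⟩
  | add x y hx hy =>
    obtain ⟨u, hu⟩ := hx
    obtain ⟨v, hv⟩ := hy
    exact ⟨u + v, by simp only [map_add, hu, hv]⟩
  | single s c =>
    have hs : Finsupp.single s c = c • basisVec0 s := by simp [basisVec0]
    set f := cutP k (r.V t (emb (basisVec0 s))) with hf
    have hfin : (Function.support fun u => f u).Finite := by
      refine (finite_lev (cfgAx s.1) k).subset fun u hu => ?_
      have hu' : f u ≠ 0 := hu
      rw [hf, cutP_apply] at hu'
      split_ifs at hu' with h1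
      · refine ⟨?_, ?_⟩
        · rw [wt] at h1; linarith
        · by_contra h2
          exact hu' (r.V_basis_apply t s u h2)
      · exact absurd rfl hu'
    refine ⟨c • Finsupp.ofSupportFinite (fun u => f u) hfin, ?_⟩
    rw [hs, map_smul, map_smul, map_smul, map_smul]
    congr 1
    exact lp.ext (funext fun u => by rw [emb_apply]; rfl)

/-- The values of the truncations of `V t`. -/
def appFun (t : ℝ) (k : ℕ) (x : Fock0) : Fock0 := (r.exists_app t k x).choose

theorem emb_appFun (t : ℝ) (k : ℕ) (x : Fock0) : emb (r.appFun t k x) = cutP k (r.V t (emb x)) :=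
  (r.exists_app t k x).choose_spec

/-- The truncations of `V t`, which map `𝓕₀` into itself. -/
def app (t : ℝ) (k : ℕ) : Fock0 →ₗ[ℂ] Fock0 where
  toFun := r.appFun t k
  map_add' x y := by
    apply LinearMap.ker_eq_bot.1 ker_emb
    simp only [emb_appFun, map_add]
  map_smul' c x := by
    apply LinearMap.ker_eq_bot.1 ker_emb
    simp only [emb_appFun, map_smul, RingHom.id_apply]

theorem emb_app (t : ℝ) (k : ℕ) (x : Fock0) : emb (r.app t k x) = cutP k (r.V t (emb x)) :=
  r.emb_appFun t k x

theorem gam_app (t : ℝ) (k : ℕ) (x : Fock0) : gam (r.app t k x) = r.app t k (gam x) := by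
  apply LinearMap.ker_eq_bot.1 ker_emb
  rw [← gamH_emb, emb_app, emb_app, ← gamH_emb, V_gamH]
  exact neutral_gam.cutP k _

theorem dg_app (t : ℝ) (k : ℕ) (φ : ℝ → ℝ) (x : Fock0) :
    dg (fun s => φ (cfgAx s.1)) (r.app t k x) = r.app t k (dg (fun s => φ (cfgAx s.1)) x) := by
  refine (dg_comm (w := fun s => cfgAx s.1) (fun x => ?_) φ x).symm
  refine LinearMap.congr_fun (f := r.app t k ∘ₗ dg fun s => cfgAx s.1)
    (g := dg (fun s => cfgAx s.1) ∘ₗ r.app t k) (fock0_ext fun s => Finsupp.ext fun u => ?_) x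
  rw [LinearMap.comp_apply, LinearMap.comp_apply, dg_basis, map_smul, dg_apply, Finsupp.smul_apply,
    smul_eq_mul]
  by_cases h : cfgAx u.1 = cfgAx s.1
  · rw [h]
  · rw [← emb_apply, emb_app, cutP_apply, V_basis_apply r t s u h, ite_self, mul_zero, mul_zero]

theorem tendsto_app (t : ℝ) (x : Fock0) :
    Tendsto (fun k => emb (r.app t k x)) atTop (𝓝 (r.V t (emb x))) := by
  simp only [emb_app]
  exact cutP_tendsto _

theorem opN_app (t : ℝ) (k : ℕ) (x : Fock0) :
    emb (opN (r.app t k x)) = cutP k (r.W t (emb (opN x))) := by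
  apply cutoff.R_injective
  change invN _ = invN _
  rw [invN_opN, emb_app, ← invN_opN x, ← invN_W]
  refine lp.ext (funext fun s => ?_)
  rw [cutP_apply, invN_apply, invN_apply, cutP_apply]
  split_ifs <;> simp

theorem V_zero (ξ : Hilb0) : r.V 0 ξ = ξ := Cutoff.grp_zero r.commutes ξ

theorem V_add (s t : ℝ) (ξ : Hilb0) : r.V (s + t) ξ = r.V s (r.V t ξ) :=
  Cutoff.grp_add r.commutes s t ξ

theorem V_neg (t : ℝ) (ξ : Hilb0) : r.V (-t) ξ = (r.V t).symm ξ := by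
  rw [LinearIsometryEquiv.eq_symm_apply, ← V_add, add_neg_cancel, V_zero]

theorem V_symm_intertwine {t : ℝ} {A B : Fock0 →ₗ[ℂ] Hilb0}
    (hAB : ∀ ξ, r.V t (hat A ξ) = hat B (r.W t ξ)) (ξ : Hilb0) :
    r.V (-t) (hat B ξ) = hat A (r.W (-t) ξ) := by
  have h1 : r.W t (r.W (-t) ξ) = ξ := by
    apply cutoff.R_injective
    change invN _ = invN _
    rw [invN_W, invN_W, ← V_add, add_neg_cancel, V_zero]
  rw [← h1, ← hAB, ← V_add, neg_add_cancel, V_zero, h1]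

end Rot

/-! ### Closures -/

section Closure

variable {D E : Type*} [AddCommGroup D] [Module ℂ D] [NormedAddCommGroup E] [InnerProductSpace ℂ E]

theorem mkOp_apply (j B : D →ₗ[ℂ] E) (h : LinearMap.ker j ≤ LinearMap.ker B) (x : D) :
    mkOp j B h ⟨j x, ⟨x, rfl⟩⟩ = B x := by
  change (LinearMap.ker j).liftQ B h (j.quotKerEquivRange.symm ⟨j x, ⟨x, rfl⟩⟩) = B x
  have : j.quotKerEquivRange.symm ⟨j x, ⟨x, rfl⟩⟩ = (LinearMap.ker j).mkQ x := by
    rw [LinearEquiv.symm_apply_eq]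
    exact Subtype.ext rfl
  rw [this, Submodule.mkQ_apply, Submodule.liftQ_apply]

theorem graph_mkOp (j B : D →ₗ[ℂ] E) (h : LinearMap.ker j ≤ LinearMap.ker B) :
    ((mkOp j B h).graph : Set (E × E)) = Set.range fun x => (j x, B x) := by
  ext ⟨u, v⟩
  rw [SetLike.mem_coe, LinearPMap.mem_graph_iff]
  constructor
  · rintro ⟨⟨_, ⟨x, rfl⟩⟩, h1, h2⟩
    exact ⟨x, Prod.ext h1 ((mkOp_apply j B h x).symm.trans h2)⟩
  · rintro ⟨x, hx⟩
    obtain ⟨rfl, rfl⟩ := Prod.mk.inj hx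
    exact ⟨⟨j x, ⟨x, rfl⟩⟩, rfl, mkOp_apply j B h x⟩

theorem isClosable_of_closure {f : E →ₗ.[ℂ] E}
    (h : ∀ y, ((0 : E), y) ∈ closure (f.graph : Set (E × E)) → y = 0) : f.IsClosable := by
  refine ⟨f.graph.topologicalClosure.toLinearPMap, ?_⟩
  rw [Submodule.toLinearPMap_graph_eq]
  rintro ⟨u, v⟩ hx hu
  dsimp at hu
  subst hu
  exact h v hx

theorem mem_closure_graph {f : E →ₗ.[ℂ] E} (hf : f.IsClosable) (u v : E) :
    (u, v) ∈ f.closure.graph ↔ (u, v) ∈ closure (f.graph : Set (E × E)) := by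
  rw [← hf.graph_closure_eq_closure_graph]; rfl

end Closure

variable {e L : ℝ}

theorem bogoliubov_graph (he : 0 < e) (hL : 0 < L) (u v : Hilb0) :
    (u, v) ∈ closure ((bogoliubov e L).graph : Set (Hilb0 × Hilb0)) ↔
      Cutoff.IsGen (rot he hL).commutes u v := by
  rw [Cutoff.isGen_iff, bogoliubov, graph_mkOp]
  have h1 : ∀ x, Finsupp.linearCombination ℂ (fun s : Cfg0 => ∑' m, bogoliubovTerm e L s m) x =
      (rot he hL).T (emb (opN x)) := fun x => by
    rw [Rot.T_opN]
    refine LinearMap.congr_fun (g := Complex.I • (rot he hL).coef.op) (fock0_ext fun s => ?_) x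
    rw [LinearMap.smul_apply, ← (hasSum_bogoliubovTerm he hL s).tsum_eq]
    simp [basisVec0]
  have h2 : (Set.range fun x => (emb x, Finsupp.linearCombination ℂ
      (fun s : Cfg0 => ∑' m, bogoliubovTerm e L s m) x)) =
      (fun ξ => (cutoff.R ξ, (rot he hL).T ξ)) '' Set.range fun x => emb (opN x) := by
    rw [← Set.range_comp]
    congr 1
    funext x
    simp only [Function.comp_apply, h1]
    rw [show cutoff.R = invN from rfl, invN_opN]
  rw [h2]
  have hc : Continuous fun ξ => (cutoff.R ξ, (rot he hL).T ξ) := by fun_prop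
  have h3 : closure ((fun ξ => (cutoff.R ξ, (rot he hL).T ξ)) '' Set.range fun x => emb (opN x)) =
      closure (Set.range fun ξ => (cutoff.R ξ, (rot he hL).T ξ)) := by
    refine subset_antisymm (closure_mono (Set.image_subset_range _ _)) ?_
    refine closure_minimal ?_ isClosed_closure
    have := image_closure_subset_closure_image hc (s := Set.range fun x => emb (opN x))
    rwa [dense_opN.closure_range, Set.image_univ] at this
  rw [h3]

theorem bogoliubov_isClosable (he : 0 < e) (hL : 0 < L) : (bogoliubov e L).IsClosable :=
  isClosable_of_closure fun _ hy => Cutoff.isGen_unique ((bogoliubov_graph he hL _ _).1 hy)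

theorem isExpI_bogoliubov (he : 0 < e) (hL : 0 < L) :
    IsExpI (bogoliubov e L).closure ((rot he hL).V 1) := by
  refine ⟨(rot he hL).V, (rot he hL).V_zero, (rot he hL).V_add,
    Cutoff.continuous_grp (rot he hL).commutes, fun x y => ?_, rfl⟩
  rw [mem_closure_graph (bogoliubov_isClosable he hL), bogoliubov_graph he hL]
  rfl

/-! ### Calculus on the domain -/

section Calculus

variable {L : ℝ}

/-- The period `2π/L`. -/
def per (L : ℝ) : ℝ := 2 * Real.pi / L

theorem per_pos (hL : 0 < L) : 0 < per L := by have := Real.pi_pos; unfold per; positivity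

/-- The first derivative of an element of the domain. -/
def d1 (Ψ : ℝ → Fock0) : ℝ → Hilb0 := deriv fun a => emb (Ψ a)

/-- The second derivative of an element of the domain. -/
def d2 (Ψ : ℝ → Fock0) : ℝ → Hilb0 := iteratedDeriv 2 fun a => emb (Ψ a)

theorem hasDerivAt_d1 {Ψ : ℝ → Fock0} (h : ContDiff ℝ ∞ fun a => emb (Ψ a)) (a : ℝ) :
    HasDerivAt (fun a => emb (Ψ a)) (d1 Ψ a) a :=
  ((h.differentiable (by simp)) a).hasDerivAt

theorem hasDerivAt_d2 {Ψ : ℝ → Fock0} (h : ContDiff ℝ ∞ fun a => emb (Ψ a)) (a : ℝ) :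
    HasDerivAt (d1 Ψ) (d2 Ψ a) a := by
  have h1 : ContDiff ℝ 1 (d1 Ψ) :=
    ((contDiff_succ_iff_deriv (n := 1)).1 (h.of_le two_le_infty)).2.2
  have h2 := ((h1.differentiable (by simp)) a).hasDerivAt
  have h3 : d2 Ψ a = deriv (d1 Ψ) a := by rw [d2, iteratedDeriv_succ, iteratedDeriv_one]; rfl
  rwa [← h3] at h2

theorem continuous_d1 {Ψ : ℝ → Fock0} (h : ContDiff ℝ ∞ fun a => emb (Ψ a)) : Continuous (d1 Ψ) :=
  continuous_iff_continuousAt.2 fun a => (hasDerivAt_d2 h a).continuousAt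

theorem continuous_d2 {Ψ : ℝ → Fock0} (h : ContDiff ℝ ∞ fun a => emb (Ψ a)) : Continuous (d2 Ψ) :=
  h.continuous_iteratedDeriv 2 two_le_infty

theorem eq_d2 {Ψ : ℝ → Fock0} {f g : ℝ → Hilb0} (h1 : ∀ a, HasDerivAt (fun a => emb (Ψ a)) (f a) a)
    (h2 : ∀ a, HasDerivAt f (g a) a) : d2 Ψ = g := by
  rw [d2, iteratedDeriv_succ, iteratedDeriv_one, show deriv (fun a => emb (Ψ a)) = f from
    funext fun a => (h1 a).deriv]
  exact funext fun a => (h2 a).deriv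

theorem real_smul_eq (c : ℝ) (f : Hilb0) : c • f = (c : ℂ) • f := rfl

theorem clm_hasDerivAt (B : Hilb0 →L[ℂ] Hilb0) {f : ℝ → Hilb0} {f' : Hilb0} {t : ℝ}
    (hf : HasDerivAt f f' t) : HasDerivAt (fun t => B (f t)) (B f') t :=
  Cutoff.hasDerivAt_clm B hf

theorem gamH_per (Ψ : smoothDom L) (a : ℝ) :
    gamH (emb (Ψ.1 (a + per L))) = emb (Ψ.1 a) := by
  rw [gamH_emb]; exact congrArg emb (Ψ.2.2.2 a)

theorem gamH_d1 (Ψ : smoothDom L) (a : ℝ) : gamH (d1 Ψ.1 (a + per L)) = d1 Ψ.1 a := by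
  have h1 := (hasDerivAt_d1 Ψ.2.1 (a + per L)).comp_add_const a (per L)
  have h2 := clm_hasDerivAt (gamH.toContinuousLinearEquiv : Hilb0 →L[ℂ] Hilb0) h1
  have h3 : (fun t => (gamH.toContinuousLinearEquiv : Hilb0 →L[ℂ] Hilb0) (emb (Ψ.1 (t + per L)))) =
      fun t => emb (Ψ.1 t) := funext fun t => gamH_per Ψ t
  rw [h3] at h2
  exact h2.unique (hasDerivAt_d1 Ψ.2.1 a)

theorem inner_hasDerivAt {f g : ℝ → Hilb0} {f' g' : Hilb0} {t : ℝ} (hf : HasDerivAt f f' t)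
    (hg : HasDerivAt g g' t) :
    HasDerivAt (fun t => inner ℂ (f t) (g t)) (inner ℂ (f t) g' + inner ℂ f' (g t)) t :=
  hf.inner ℂ hg

/-- Integration by parts; the boundary terms cancel by the twisted periodicity. -/
theorem integral_parts (Ψ Φ : smoothDom L) :
    ∫ a in (0)..(per L), inner ℂ (emb (Ψ.1 a)) (d2 Φ.1 a) =
      -∫ a in (0)..(per L), inner ℂ (d1 Ψ.1 a) (d1 Φ.1 a) := by
  have c0 := Ψ.2.1.continuous
  have c1 := continuous_d1 Ψ.2.1
  have c2 := continuous_d1 Φ.2.1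
  have c3 := continuous_d2 Φ.2.1
  have i1 : Continuous fun a => inner ℂ (emb (Ψ.1 a)) (d2 Φ.1 a) := c0.inner c3
  have i2 : Continuous fun a => inner ℂ (d1 Ψ.1 a) (d1 Φ.1 a) := c1.inner c2
  have h1 := intervalIntegral.integral_eq_sub_of_hasDerivAt (a := 0) (b := per L)
    (fun a _ => inner_hasDerivAt (hasDerivAt_d1 Ψ.2.1 a) (hasDerivAt_d2 Φ.2.1 a))
    ((i1.add i2).intervalIntegrable 0 (per L))
  have h2 := gamH_per Ψ 0
  have h3 := gamH_d1 Φ 0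
  rw [zero_add] at h2 h3
  rw [← h2, ← h3, LinearIsometryEquiv.inner_map_map, sub_self, intervalIntegral.integral_add
    (i1.intervalIntegrable _ _) (i2.intervalIntegrable _ _)] at h1
  exact eq_neg_of_add_eq_zero_left h1

theorem integral_meas (hL : 0 < L) {E : Type*} [NormedAddCommGroup E] [NormedSpace ℝ E]
    (f : ℝ → E) : ∫ a, f a ∂(meas L) = ∫ a in (0)..(per L), f a := by
  rw [intervalIntegral.integral_of_le (per_pos hL).le, meas, integral_Icc_eq_integral_Ioc]
  rfl

theorem inner_toLp {f g : ℝ → Hilb0} (hf : MemLp f 2 (meas L)) (hg : MemLp g 2 (meas L)) :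
    inner ℂ (hf.toLp f : Tot L) (hg.toLp g) = ∫ a, inner ℂ (f a) (g a) ∂(meas L) := by
  rw [L2.inner_def]
  refine integral_congr_ae ?_
  filter_upwards [hf.coeFn_toLp, hg.coeFn_toLp] with a h1 h2
  rw [h1, h2]

theorem norm_toLp_sq {f : ℝ → Hilb0} (hf : MemLp f 2 (meas L)) :
    ‖(hf.toLp f : Tot L)‖ ^ 2 = ∫ a, ‖f a‖ ^ 2 ∂(meas L) := by
  have h1 := inner_toLp hf hf
  simp only [inner_self_eq_norm_sq_to_K] at h1
  exact_mod_cast h1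

theorem ae_meas {p : ℝ → Prop} (h : ∀ a ∈ Icc 0 (per L), p a) : ∀ᵐ a ∂(meas L), p a :=
  (ae_restrict_iff' measurableSet_Icc).2 (Eventually.of_forall h)

/-- Dominated convergence in `𝓚`. -/
theorem tendsto_toLp {F : ℕ → ℝ → Hilb0} {G : ℝ → Hilb0} (hF : ∀ n, MemLp (F n) 2 (meas L))
    (hG : MemLp G 2 (meas L)) {C : ℝ} (hC : ∀ n, ∀ a ∈ Icc 0 (per L), ‖F n a‖ ≤ C)
    (hlim : ∀ a ∈ Icc 0 (per L), Tendsto (fun n => F n a) atTop (𝓝 (G a))) :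
    Tendsto (fun n => (hF n).toLp (F n)) atTop (𝓝 (hG.toLp G)) := by
  have h1 : Tendsto (fun n => ∫ a, ‖F n a - G a‖ ^ 2 ∂(meas L)) atTop (𝓝 (∫ a, 0 ∂(meas L))) := by
    refine tendsto_integral_of_dominated_convergence (fun _ => (C + C) ^ 2) (fun n => ?_)
      (integrable_const _) (fun n => ae_meas fun a ha => ?_) (ae_meas fun a ha => ?_)
    · exact (((hF n).1.sub hG.1).norm).pow 2
    · have hGa : ‖G a‖ ≤ C := le_of_tendsto (hlim a ha).norm (Eventually.of_forall fun n => hC n a ha)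
      rw [Real.norm_of_nonneg (sq_nonneg _)]
      exact pow_le_pow_left₀ (norm_nonneg _)
        ((norm_sub_le _ _).trans (add_le_add (hC n a ha) hGa)) 2
    · have := ((hlim a ha).sub_const (G a)).norm.pow 2
      simpa using this
  rw [integral_zero] at h1
  rw [tendsto_iff_norm_sub_tendsto_zero]
  have h2 : ∀ n, ‖(hF n).toLp (F n) - hG.toLp G‖ = √(∫ a, ‖F n a - G a‖ ^ 2 ∂(meas L)) := by
    intro n
    rw [← MemLp.toLp_sub]
    refine (Real.sqrt_sq (norm_nonneg _)).symm.trans ?_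
    rw [norm_toLp_sq]
    rfl
  simp only [h2]
  have h3 := (Real.continuous_sqrt.tendsto 0).comp h1
  rwa [Real.sqrt_zero] at h3

end Calculus

/-! ### The Schrödinger operators -/

section Schr

variable {e L : ℝ}

/-- The map of `𝓓` defining the Schrödinger operator with potential `fib L A`. -/
def act (e L : ℝ) (A : Fock0 →ₗ[ℂ] Hilb0) : smoothDom L →ₗ[ℂ] Tot L :=
  actMap e L (fib L A) (fib_continuous A)

/-- The Schrödinger operator with potential `fib L A`. -/
def schr (e L : ℝ) (A : Fock0 →ₗ[ℂ] Hilb0) : Tot L →ₗ.[ℂ] Tot L :=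
  schrOp e L (fib L A) (fib_continuous A)

theorem graph_schr (A : Fock0 →ₗ[ℂ] Hilb0) : ((schr e L A).graph : Set (Tot L × Tot L)) =
    Set.range fun Ψ => (domMap L Ψ, act e L A Ψ) := graph_mkOp _ _ _

theorem schr_apply (A : Fock0 →ₗ[ℂ] Hilb0) (Ψ : smoothDom L) :
    schr e L A ⟨domMap L Ψ, ⟨Ψ, rfl⟩⟩ = act e L A Ψ := mkOp_apply _ _ _ _

theorem memLp_d2 (Ψ : smoothDom L) : MemLp (d2 Ψ.1) 2 (meas L) :=
  memLp_of_continuousOn L _ (continuous_d2 Ψ.2.1).continuousOn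

theorem actFun_eq (B : ℝ → Fock0 →ₗ[ℂ] Hilb0) (Ψ : ℝ → Fock0) (a : ℝ) :
    actFun e L B Ψ a = ((-(e ^ 2 / (2 * L)) : ℝ) : ℂ) • d2 Ψ a + B a (Ψ a) := rfl

theorem memLp_fib (A : Fock0 →ₗ[ℂ] Hilb0) (Ψ : smoothDom L) :
    MemLp (fun a => fib L A a (Ψ.1 a)) 2 (meas L) := by
  have h1 := (memLp_act 0 L (fib L A) (fib_continuous A) Ψ)
  refine h1.ae_eq (Eventually.of_forall fun a => ?_)
  simp [actFun_eq]

/-- The energy form. -/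
theorem inner_act (hL : 0 < L) (A : Fock0 →ₗ[ℂ] Hilb0) (Ψ Φ : smoothDom L) :
    inner ℂ (domMap L Ψ) (act e L A Φ) =
      ((e ^ 2 / (2 * L) : ℝ) : ℂ) * (∫ a in (0)..(per L), inner ℂ (d1 Ψ.1 a) (d1 Φ.1 a)) +
        ∫ a, inner ℂ (emb (Ψ.1 a)) (fib L A a (Φ.1 a)) ∂(meas L) := by
  have h0 : act e L A Φ = ((-(e ^ 2 / (2 * L)) : ℝ) : ℂ) • (memLp_d2 Φ).toLp (d2 Φ.1) +
      (memLp_fib A Φ).toLp _ := by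
    rw [← MemLp.toLp_const_smul, ← MemLp.toLp_add]
    rfl
  rw [h0, inner_add_right, inner_smul_right, show domMap L Ψ = (memLp_emb L Ψ).toLp _ from rfl,
    inner_toLp, inner_toLp, integral_meas hL, integral_parts]
  push_cast
  ring

/-- The operator `A` is symmetric. -/
def IsSymm (A : Fock0 →ₗ[ℂ] Hilb0) : Prop :=
  ∀ x y, inner ℂ (A x) (emb y) = inner ℂ (emb x) (A y)

theorem inner_dg (w : Cfg0 → ℝ) (x y : Fock0) :
    inner ℂ (emb (dg w x)) (emb y) = inner ℂ (emb x) (emb (dg w y)) := by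
  rw [lp.inner_eq_tsum, lp.inner_eq_tsum]
  refine tsum_congr fun s => ?_
  rw [emb_apply, emb_apply, emb_apply, emb_apply, dg_apply, dg_apply]
  simp only [RCLike.inner_apply, map_mul, Complex.conj_ofReal]
  ring

theorem IsSymm.fib {A : Fock0 →ₗ[ℂ] Hilb0} (hA : IsSymm A) (a : ℝ) : IsSymm (fib L A a) :=
  fun x y => by
    rw [Schwinger.fib, LinearMap.add_apply, LinearMap.add_apply, inner_add_left, inner_add_right,
      hA, LinearMap.comp_apply, LinearMap.comp_apply, inner_dg]

theorem act_symm (hL : 0 < L) {A : Fock0 →ₗ[ℂ] Hilb0} (hA : IsSymm A) (Ψ Φ : smoothDom L) :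
    inner ℂ (act e L A Ψ) (domMap L Φ) = inner ℂ (domMap L Ψ) (act e L A Φ) := by
  rw [← inner_conj_symm, inner_act hL, inner_act hL, map_add, map_mul, Complex.conj_ofReal,
    ← integral_conj, intervalIntegral.integral_of_le (per_pos hL).le,
    intervalIntegral.integral_of_le (per_pos hL).le, ← integral_conj]
  simp only [inner_conj_symm]
  congr 1
  exact integral_congr_ae (Eventually.of_forall fun a => hA.fib a _ _)

theorem schr_isFormalAdjoint (hL : 0 < L) {A : Fock0 →ₗ[ℂ] Hilb0} (hA : IsSymm A) :
    (schr e L A).IsFormalAdjoint (schr e L A) := by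
  rintro ⟨_, ⟨Ψ, rfl⟩⟩ ⟨_, ⟨Φ, rfl⟩⟩
  rw [schr_apply, schr_apply]
  exact act_symm hL hA Ψ Φ

theorem isClosable_of_symm {E : Type*} [NormedAddCommGroup E] [InnerProductSpace ℂ E]
    [CompleteSpace E] {T : E →ₗ.[ℂ] E} (hd : Dense (T.domain : Set E)) (hT : T.IsFormalAdjoint T) :
    T.IsClosable :=
  (LinearPMap.adjoint_isClosed hd).isClosable.leIsClosable (hT.le_adjoint hd)

end Schr

variable {L : ℝ}

/-! ### Twisted periodization -/

/-- Smooth functions of compact support on the line. -/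
structure Test where
  /-- The function. -/
  f : ℝ → ℝ
  smooth : ContDiff ℝ ∞ f
  /-- The radius of an interval containing the support. -/
  M : ℝ
  zero : ∀ a, M < |a| → f a = 0

namespace Test

variable (g : Test)

/-- The indices of the translates which do not vanish on `[-R, R]`. -/
def idx (L R : ℝ) : Finset ℤ := Finset.Icc (-⌈(R + g.M) / per L⌉) ⌈(R + g.M) / per L⌉

theorem f_eq_zero (hL : 0 < L) {R a : ℝ} (ha : |a| ≤ R) {j : ℤ} (hj : j ∉ g.idx L R) :
    g.f (a - j * per L) = 0 := by
  have hT := per_pos hL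
  refine g.zero _ ?_
  by_contra h
  refine hj ?_
  rw [not_lt] at h
  have h1 : |(j : ℝ)| ≤ (R + g.M) / per L := by
    rw [le_div_iff₀ hT]; nth_rw 1 [← abs_of_pos hT]; rw [← abs_mul]
    have h2 : (j : ℝ) * per L = a - (a - j * per L) := by ring
    rw [h2]
    exact (abs_sub _ _).trans (add_le_add ha h)
  have h2 : |j| ≤ ⌈(R + g.M) / per L⌉ := by
    have : ((|j| : ℤ) : ℝ) ≤ ⌈(R + g.M) / per L⌉ := by
      push_cast; exact h1.trans (Int.le_ceil _)
    exact_mod_cast this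
  rw [idx, Finset.mem_Icc]
  exact abs_le.1 h2

/-- The twisted periodization `∑ⱼ g(a - jT) Γ⁻ʲ x`. -/
def fold (L : ℝ) (x : Fock0) (a : ℝ) : Fock0 :=
  ∑ᶠ j : ℤ, (g.f (a - j * per L) : ℂ) • (gamE ^ (-j)) x

theorem fold_eq_sum (hL : 0 < L) (x : Fock0) {R a : ℝ} (ha : |a| ≤ R) :
    g.fold L x a = ∑ j ∈ g.idx L R, (g.f (a - j * per L) : ℂ) • (gamE ^ (-j)) x := by
  refine finsum_eq_sum_of_support_subset _ fun j hj => ?_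
  by_contra h
  exact hj (by simp only [g.f_eq_zero hL ha h, Complex.ofReal_zero, zero_smul])

theorem emb_fold_eq_sum (hL : 0 < L) (x : Fock0) {R a : ℝ} (ha : |a| ≤ R) :
    emb (g.fold L x a) = ∑ j ∈ g.idx L R, g.f (a - j * per L) • emb ((gamE ^ (-j)) x) := by
  rw [g.fold_eq_sum hL x ha, map_sum]
  exact Finset.sum_congr rfl fun j _ => map_smul _ _ _

theorem eventually_emb_fold (hL : 0 < L) (x : Fock0) (a : ℝ) :
    (fun b => emb (g.fold L x b)) =ᶠ[𝓝 a]
      fun b => ∑ j ∈ g.idx L (|a| + 1), g.f (b - j * per L) • emb ((gamE ^ (-j)) x) := by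
  filter_upwards [Metric.ball_mem_nhds a one_pos] with b hb
  refine g.emb_fold_eq_sum hL x ?_
  rw [Metric.mem_ball, Real.dist_eq] at hb
  linarith [abs_sub_abs_le_abs_sub b a]

theorem fold_mem (hL : 0 < L) (x : Fock0) : g.fold L x ∈ smoothDom L := by
  classical
  refine ⟨?_, ?_, fun a => ?_⟩
  · rw [contDiff_iff_contDiffAt]
    intro a
    refine ContDiffAt.congr_of_eventuallyEq ?_ (g.eventually_emb_fold hL x a)
    refine ContDiff.contDiffAt (ContDiff.sum fun j _ => ?_)
    exact (g.smooth.comp (contDiff_id.sub contDiff_const)).smul contDiff_const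
  · refine ⟨(g.idx L (per L)).biUnion fun j => ((gamE ^ (-j)) x).support, fun a ha => ?_⟩
    rw [g.fold_eq_sum hL x (show |a| ≤ per L by rw [abs_of_nonneg ha.1]; exact ha.2)]
    refine Finsupp.support_finsetSum.trans (Finset.biUnion_mono fun j _ => Finsupp.support_smul)
  · change gam (g.fold L x (a + per L)) = g.fold L x a
    have hfin : (Function.support fun j : ℤ =>
        (g.f (a + per L - j * per L) : ℂ) • (gamE ^ (-j)) x).Finite := by
      refine (g.idx L |a + per L|).finite_toSet.subset fun j hj => ?_
      by_contra h
      exact hj (by simp only [g.f_eq_zero hL le_rfl h, Complex.ofReal_zero, zero_smul])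
    rw [fold, show gam (finsum _) = _ from map_finsum gam hfin, fold]
    rw [← finsum_comp_equiv (Equiv.addRight (1 : ℤ))]
    refine finsum_congr fun j => ?_
    rw [map_smul, ← gamE_apply, ← LinearEquiv.mul_apply, ← zpow_one_add, Equiv.coe_addRight]
    congr 3
    · push_cast; ring
    · ring

/-- The derivative. -/
def der : Test where
  f := deriv g.f
  smooth := ((contDiff_infty_iff_deriv).1 g.smooth).2
  M := g.M
  zero a ha := by
    have : g.f =ᶠ[𝓝 a] fun _ => 0 := by
      filter_upwards [(isOpen_lt continuous_const continuous_abs).mem_nhds ha] with b hb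
      exact g.zero b hb
    rw [this.deriv_eq]; simp

theorem hasDerivAt_fold (hL : 0 < L) (x : Fock0) (a : ℝ) :
    HasDerivAt (fun a => emb (g.fold L x a)) (emb (g.der.fold L x a)) a := by
  refine HasDerivAt.congr_of_eventuallyEq ?_ (g.eventually_emb_fold hL x a)
  rw [g.der.emb_fold_eq_sum hL x (show |a| ≤ |a| + 1 by linarith)]
  refine HasDerivAt.fun_sum fun j _ => ?_
  have h1 : HasDerivAt g.f (g.der.f (a - j * per L)) (a - j * per L) :=
    (g.smooth.differentiable (by simp) _).hasDerivAt
  exact (h1.comp_sub_const a (j * per L)).smul_const _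

theorem d2_fold (hL : 0 < L) (x : Fock0) :
    d2 (g.fold L x) = fun a => emb (g.der.der.fold L x a) :=
  eq_d2 (g.hasDerivAt_fold hL x) (g.der.hasDerivAt_fold hL x)

/-- The element of the domain. -/
def vec (hL : 0 < L) (x : Fock0) : smoothDom L := ⟨g.fold L x, g.fold_mem hL x⟩

theorem fold_of_tsupport (hL : 0 < L) (hg : ∀ a ∉ Ioo 0 (per L), g.f a = 0) (x : Fock0) {a : ℝ}
    (ha : a ∈ Icc 0 (per L)) : g.fold L x a = (g.f a : ℂ) • x := by
  have hT := per_pos hL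
  rw [fold, finsum_eq_single _ 0]
  · simp
  · intro j hj
    rw [hg, Complex.ofReal_zero, zero_smul]
    rintro ⟨h1, h2⟩
    rcases lt_or_gt_of_ne hj with h | h
    · have : (j : ℝ) ≤ -1 := by exact_mod_cast Int.le_sub_one_of_lt h
      nlinarith [ha.1]
    · have : (1 : ℝ) ≤ j := by exact_mod_cast h
      nlinarith [ha.2]

end Test

/-! ### Density of the domain -/

theorem dense_range_domMap (hL : 0 < L) : Dense (LinearMap.range (domMap L) : Set (Tot L)) := by
  rw [Submodule.dense_iff_topologicalClosure_eq_top, Submodule.topologicalClosure_eq_top_iff,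
    Submodule.eq_bot_iff]
  intro u hu
  have hint : Integrable (fun a => u a) (meas L) := (Lp.memLp u).integrable (by norm_num)
  have h1 : ∀ s : Cfg0, ∀ᵐ a ∂volume, a ∈ Ioo 0 (per L) → u a s = 0 := by
    intro s
    have hs : Integrable (fun a => u a s) (meas L) :=
      (lp.evalCLM ℂ (fun _ : Cfg0 => ℂ) 2 s).integrable_comp hint
    refine isOpen_Ioo.ae_eq_zero_of_integral_contDiff_smul_eq_zero ?_ fun g hg hc hsupp => ?_
    · refine IntegrableOn.locallyIntegrableOn ?_
      exact (show IntegrableOn (fun a => u a s) (Icc 0 (per L)) volume from hs).mono_set Ioo_subset_Icc_self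
    · have hz : ∀ a ∉ Ioo 0 (per L), g a = 0 := fun a ha =>
        image_eq_zero_of_notMem_tsupport fun h => ha (hsupp h)
      let G : Test := ⟨g, hg, per L, fun a ha => hz a fun h => by
        rw [abs_of_pos h.1] at ha; linarith [h.2]⟩
      have h2 := (Submodule.mem_orthogonal _ u).1 hu _ ⟨G.vec hL (basisVec0 s), rfl⟩
      have h3 : inner ℂ (domMap L (G.vec hL (basisVec0 s))) u = ∫ a, g a • u a s ∂(meas L) := by
        rw [L2.inner_def]
        refine integral_congr_ae ?_
        filter_upwards [(memLp_emb L (G.vec hL (basisVec0 s))).coeFn_toLp,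
          ae_meas (L := L) (p := fun a => a ∈ Icc 0 (per L)) fun a ha => ha] with a h4 h5
        have h6 : (domMap L (G.vec hL (basisVec0 s)) : ℝ → Hilb0) a =
            (g a : ℂ) • emb (basisVec0 s) := by
          refine h4.trans ?_
          rw [← map_smul]
          exact congrArg emb (G.fold_of_tsupport hL hz _ h5)
        rw [h6, inner_smul_left, Complex.conj_ofReal, emb_basis, lp.inner_single_left]
        simp
      rw [h3] at h2
      rw [← h2]
      change _ = ∫ a in Icc 0 (per L), g a • u a s
      refine (setIntegral_eq_integral_of_forall_compl_eq_zero fun a ha => ?_).symm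
      rw [hz a fun h => ha (Ioo_subset_Icc_self h), zero_smul]
  have h2 : ∀ᵐ a ∂volume, a ∈ Ioo 0 (per L) → u a = 0 := by
    filter_upwards [ae_all_iff.2 h1] with a ha h
    exact lp.ext (funext fun s => ha s h)
  rw [Lp.eq_zero_iff_ae_eq_zero]
  have h3 : meas L = volume.restrict (Ioo 0 (per L)) := restrict_Ioo_eq_restrict_Icc.symm
  change ∀ᵐ a ∂(meas L), u a = 0
  have h4 := (ae_restrict_iff' measurableSet_Ioo).2 h2
  exact (congrArg (fun μ => ∀ᵐ a ∂μ, u a = 0) h3).mpr h4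

theorem dense_schr {e : ℝ} (hL : 0 < L) (A : Fock0 →ₗ[ℂ] Hilb0) :
    Dense ((schr e L A).domain : Set (Tot L)) := dense_range_domMap hL

theorem schr_isClosable {e : ℝ} (hL : 0 < L) {A : Fock0 →ₗ[ℂ] Hilb0} (hA : IsSymm A) :
    (schr e L A).IsClosable := isClosable_of_symm (dense_schr hL A) (schr_isFormalAdjoint hL hA)

variable {e L : ℝ}

/-! ### Transport of the closures -/

theorem eq_sum_basis {x : Fock0} {S : Finset Cfg0} (h : x.support ⊆ S) :
    x = ∑ s ∈ S, x s • basisVec0 s := by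
  conv_lhs => rw [← Finsupp.sum_single x]
  rw [Finsupp.sum_of_support_subset _ h _ (by simp)]
  simp [basisVec0]

theorem continuousOn_fam {B : ℝ → Fock0 →ₗ[ℂ] Hilb0}
    (hB : ∀ s, Continuous fun a => B a (basisVec0 s)) (Ψ : smoothDom L) :
    ContinuousOn (fun a => B a (Ψ.1 a)) (Icc 0 (per L)) := by
  obtain ⟨S, hS⟩ := Ψ.2.2.1
  have hc : ∀ s, Continuous fun a => Ψ.1 a s := fun s => by
    refine ((lp.evalCLM ℂ (fun _ : Cfg0 => ℂ) 2 s).continuous.comp Ψ.2.1.continuous).congr fun a => ?_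
    exact emb_apply _ _
  have h1 : ContinuousOn (fun a => ∑ s ∈ S, Ψ.1 a s • B a (basisVec0 s)) (Icc 0 (per L)) :=
    (continuous_finsetSum _ fun s _ => (hc s).smul (hB s)).continuousOn
  refine h1.congr fun a ha => ?_
  conv_lhs => rw [eq_sum_basis (hS a ha)]
  simp

theorem exists_bound_fam {B : ℝ → Fock0 →ₗ[ℂ] Hilb0}
    (hB : ∀ s, Continuous fun a => B a (basisVec0 s)) (Ψ : smoothDom L) :
    ∃ C, ∀ a ∈ Icc 0 (per L), ‖B a (Ψ.1 a)‖ ≤ C :=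
  isCompact_Icc.exists_bound_of_continuousOn (continuousOn_fam hB Ψ)

theorem liftTot_toLp (U : Hilb0 ≃ₗᵢ[ℂ] Hilb0) {f g : ℝ → Hilb0} (hf : MemLp f 2 (meas L))
    (hg : MemLp g 2 (meas L)) (h : ∀ a, g a = U (f a)) :
    liftTot L U (hf.toLp f) = hg.toLp g := by
  refine Lp.ext ?_
  have h1 := ContinuousLinearMap.coeFn_compLpL (p := 2) (μ := meas L)
    (U.toContinuousLinearEquiv : Hilb0 →L[ℂ] Hilb0) (hf.toLp f)
  filter_upwards [h1, hf.coeFn_toLp, hg.coeFn_toLp] with a h1 h2 h3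
  rw [h3, h a, ← h2]
  exact h1

theorem memLp_comp (U : Hilb0 ≃ₗᵢ[ℂ] Hilb0) {f : ℝ → Hilb0} (hf : MemLp f 2 (meas L)) :
    MemLp (fun a => U (f a)) 2 (meas L) := by
  refine hf.of_le (U.continuous.comp_aestronglyMeasurable hf.1) (Eventually.of_forall fun a => ?_)
  rw [U.norm_map]

theorem norm_cutP (k : ℕ) (ξ : Hilb0) : ‖cutP k ξ‖ ≤ ‖ξ‖ := cutoff.P_norm k ξ

namespace Rot

variable (r : Rot)

theorem app_mem (t : ℝ) (k : ℕ) (Ψ : smoothDom L) :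
    (fun a => r.app t k (Ψ.1 a)) ∈ smoothDom L := by
  classical
  obtain ⟨h1, ⟨S, hS⟩, h3⟩ := Ψ.2
  refine ⟨?_, ⟨S.biUnion fun s => (r.app t k (basisVec0 s)).support, fun a ha => ?_⟩, fun a => ?_⟩
  · simp only [emb_app]
    exact ((cutP k ∘L (r.V t).toContinuousLinearEquiv.toContinuousLinearMap).restrictScalars
      ℝ).contDiff.comp h1
  · dsimp only
    rw [eq_sum_basis (hS a ha), map_sum]
    refine Finsupp.support_finsetSum.trans (Finset.biUnion_mono fun s _ => ?_)
    rw [map_smul]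
    exact Finsupp.support_smul
  · exact (r.gam_app t k _).trans (congrArg _ (h3 a))

/-- The truncated transport of an element of the domain. -/
def appVec (t : ℝ) (k : ℕ) (Ψ : smoothDom L) : smoothDom L := ⟨_, r.app_mem t k Ψ⟩

theorem d2_appVec (t : ℝ) (k : ℕ) (Ψ : smoothDom L) (a : ℝ) :
    d2 (r.appVec t k Ψ).1 a = cutP k (r.V t (d2 Ψ.1 a)) := by
  have h1 : ∀ {f : ℝ → Hilb0} {f' : Hilb0} {a : ℝ}, HasDerivAt f f' a →
      HasDerivAt (fun a => cutP k (r.V t (f a))) (cutP k (r.V t f')) a := fun h =>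
    clm_hasDerivAt (cutP k ∘L (r.V t).toContinuousLinearEquiv.toContinuousLinearMap) h
  refine congrFun (eq_d2 (Ψ := (r.appVec t k Ψ).1) (f := fun a => cutP k (r.V t (d1 Ψ.1 a)))
    (fun a => ?_) fun a => h1 (hasDerivAt_d2 Ψ.2.1 a)) a
  have h2 := h1 (hasDerivAt_d1 Ψ.2.1 a)
  simp only [← emb_app] at h2
  exact h2

theorem norm_W (t : ℝ) : ∃ K, 0 ≤ K ∧ ∀ ξ, ‖r.W t ξ‖ ≤ K * ‖ξ‖ :=
  ⟨_, (Real.exp_pos _).le, Cutoff.norm_dom r.commutes t⟩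

/-- The potential. -/
def pot (L a : ℝ) (q : ℝ) : ℝ := Real.pi / (2 * L) * (q - (a * L / Real.pi + 1)) ^ 2

theorem fib_apply (A : Fock0 →ₗ[ℂ] Hilb0) (a : ℝ) (x : Fock0) :
    fib L A a x = emb (dg (fun s => pot L a (cfgAx s.1)) x) + A x := rfl

theorem closure_transport {t : ℝ} {A B : Fock0 →ₗ[ℂ] Hilb0} {C D : ℝ} (hA : NBdd A C)
    (hB : NBdd B D) (hAB : ∀ ξ, r.V t (hat A ξ) = hat B (r.W t ξ)) {u v : Tot L}
    (h : (u, v) ∈ closure ((schr e L A).graph : Set (Tot L × Tot L))) :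
    (liftTot L (r.V t) u, liftTot L (r.V t) v) ∈
      closure ((schr e L B).graph : Set (Tot L × Tot L)) := by
  have hc : Continuous fun p : Tot L × Tot L => (liftTot L (r.V t) p.1, liftTot L (r.V t) p.2) := by
    fun_prop
  refine closure_minimal (t := (fun p : Tot L × Tot L => (liftTot L (r.V t) p.1,
    liftTot L (r.V t) p.2)) ⁻¹' closure ((schr e L B).graph : Set (Tot L × Tot L))) ?_
    (isClosed_closure.preimage hc) h
  rw [graph_schr, graph_schr]
  rintro _ ⟨Ψ, rfl⟩
  refine mem_closure_of_tendsto (f := fun k => (domMap L (r.appVec t k Ψ), act e L B (r.appVec t k Ψ)))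
    (b := atTop) ?_ (Eventually.of_forall fun k => ⟨_, rfl⟩)
  refine Tendsto.prodMk_nhds ?_ ?_ <;> dsimp only
  · obtain ⟨M, hM⟩ := exists_bound_fam (B := fun _ => emb) (fun s => continuous_const) Ψ
    rw [show domMap L Ψ = (memLp_emb L Ψ).toLp _ from rfl, liftTot_toLp (r.V t) (memLp_emb L Ψ)
      (memLp_comp (r.V t) (memLp_emb L Ψ)) fun a => rfl]
    refine tendsto_toLp (fun k => memLp_emb L (r.appVec t k Ψ)) _ (C := M) (fun k a ha => ?_)
      fun a ha => r.tendsto_app t (Ψ.1 a)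
    change ‖emb (r.app t k (Ψ.1 a))‖ ≤ M
    rw [emb_app]
    exact (norm_cutP k _).trans ((LinearIsometryEquiv.norm_map _ _).trans_le (hM a ha))
  · obtain ⟨M₀, hM₀⟩ := isCompact_Icc.exists_bound_of_continuousOn
      (continuous_d2 Ψ.2.1).continuousOn (s := Icc 0 (per L))
    obtain ⟨M₁, hM₁⟩ := exists_bound_fam (B := fib L 0) (fib_continuous 0) Ψ
    obtain ⟨M₂, hM₂⟩ := exists_bound_fam (B := fun _ => emb ∘ₗ opN) (fun s => continuous_const) Ψ
    obtain ⟨K, hK0, hK⟩ := r.norm_W t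
    set c : ℂ := ((-(e ^ 2 / (2 * L)) : ℝ) : ℂ) with hc
    rw [show act e L A Ψ = (memLp_act e L _ (fib_continuous A) Ψ).toLp _ from rfl,
      liftTot_toLp (r.V t) (memLp_act e L _ (fib_continuous A) Ψ)
      (memLp_comp (r.V t) (memLp_act e L _ (fib_continuous A) Ψ)) fun a => rfl]
    have hF : ∀ k a, actFun e L (fib L B) (r.appVec t k Ψ).1 a = c • cutP k (r.V t (d2 Ψ.1 a)) +
        (cutP k (r.V t (fib L 0 a (Ψ.1 a))) + hat B (cutP k (r.W t (emb (opN (Ψ.1 a)))))) := by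
      intro k a
      rw [actFun_eq, d2_appVec, fib_apply, fib_apply]
      change _ + (emb (dg _ (r.app t k (Ψ.1 a))) + B (r.app t k (Ψ.1 a))) = _
      rw [dg_app, emb_app, ← opN_app, hat_opN hB, LinearMap.zero_apply, add_zero]
    refine tendsto_toLp (fun k => memLp_act e L _ (fib_continuous B) (r.appVec t k Ψ)) _
      (C := ‖c‖ * M₀ + (M₁ + ‖hat B‖ * (K * M₂))) (fun k a ha => ?_) fun a ha => ?_
    · rw [hF]
      refine (norm_add_le _ _).trans (add_le_add ?_ ((norm_add_le _ _).trans (add_le_add ?_ ?_)))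
      · rw [norm_smul]
        exact mul_le_mul_of_nonneg_left ((norm_cutP k _).trans
          ((LinearIsometryEquiv.norm_map _ _).trans_le (hM₀ a ha))) (norm_nonneg _)
      · exact (norm_cutP k _).trans ((LinearIsometryEquiv.norm_map _ _).trans_le (hM₁ a ha))
      · refine ((hat B).le_opNorm _).trans (mul_le_mul_of_nonneg_left ?_ (norm_nonneg _))
        exact (norm_cutP k _).trans ((hK _).trans (mul_le_mul_of_nonneg_left (hM₂ a ha) hK0))
    · have h1 : r.V t (actFun e L (fib L A) Ψ.1 a) = c • r.V t (d2 Ψ.1 a) +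
          (r.V t (fib L 0 a (Ψ.1 a)) + hat B (r.W t (emb (opN (Ψ.1 a))))) := by
        rw [actFun_eq, fib_apply, fib_apply, map_add, map_add, map_smul, ← hAB, hat_opN hA,
          LinearMap.zero_apply, add_zero]
      simp only [hF, h1]
      exact ((cutP_tendsto _).const_smul c).add ((cutP_tendsto _).add
        (((hat B).continuous.tendsto _).comp (cutP_tendsto _)))

theorem liftTot_symm (t : ℝ) (u : Tot L) : liftTot L (r.V (-t)) (liftTot L (r.V t) u) = u := by
  refine Lp.ext ?_
  have h1 := ContinuousLinearMap.coeFn_compLpL (p := 2) (μ := meas L)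
    ((r.V t).toContinuousLinearEquiv : Hilb0 →L[ℂ] Hilb0) u
  have h2 := ContinuousLinearMap.coeFn_compLpL (p := 2) (μ := meas L)
    ((r.V (-t)).toContinuousLinearEquiv : Hilb0 →L[ℂ] Hilb0) (liftTot L (r.V t) u)
  filter_upwards [h1, h2] with a h1 h2
  refine h2.trans ?_
  change r.V (-t) ((liftTot L (r.V t) u) a) = u a
  have h1' : (liftTot L (r.V t) u) a = r.V t (u a) := h1
  rw [h1', ← V_add, neg_add_cancel, V_zero]

theorem closure_transport_iff {t : ℝ} {A B : Fock0 →ₗ[ℂ] Hilb0} {C D : ℝ} (hA : NBdd A C)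
    (hB : NBdd B D) (hAB : ∀ ξ, r.V t (hat A ξ) = hat B (r.W t ξ)) (u v : Tot L) :
    (u, v) ∈ closure ((schr e L A).graph : Set (Tot L × Tot L)) ↔
    (liftTot L (r.V t) u, liftTot L (r.V t) v) ∈
      closure ((schr e L B).graph : Set (Tot L × Tot L)) := by
  refine ⟨r.closure_transport hA hB hAB, fun h => ?_⟩
  have := r.closure_transport hB hA (r.V_symm_intertwine hAB) h
  rwa [liftTot_symm, liftTot_symm] at this

end Rot

/-! ### The two Hamiltonians -/

theorem inner_liftTot (U : Hilb0 ≃ₗᵢ[ℂ] Hilb0) (u v : Tot L) :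
    inner ℂ (liftTot L U u) (liftTot L U v) = inner ℂ u v := by
  rw [L2.inner_def, L2.inner_def]
  refine integral_congr_ae ?_
  have h1 := ContinuousLinearMap.coeFn_compLpL (p := 2) (μ := meas L)
    (U.toContinuousLinearEquiv : Hilb0 →L[ℂ] Hilb0) u
  have h2 := ContinuousLinearMap.coeFn_compLpL (p := 2) (μ := meas L)
    (U.toContinuousLinearEquiv : Hilb0 →L[ℂ] Hilb0) v
  filter_upwards [h1, h2] with a h1 h2
  have h1' : (liftTot L U u) a = U (u a) := h1
  have h2' : (liftTot L U v) a = U (v a) := h2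
  rw [h1', h2', U.inner_map_map]

theorem Coef.isSymm {q : Coef} (h : q.adj = q) : IsSymm q.op := fun x y => by rw [q.inner_op, h]

theorem isSymm_hamCoef : IsSymm (hamCoef e L).op := Coef.isSymm rfl

theorem isSymm_dressedOp (he : 0 < e) (hL : 0 < L) : IsSymm (dressedOp he hL) := fun x y => by
  have h := Coef.isSymm (q := freeCoef he hL) rfl x y
  rw [dressedOp, LinearMap.add_apply, LinearMap.add_apply, LinearMap.smul_apply,
    LinearMap.smul_apply, inner_add_left, inner_add_right, h, inner_smul_left, inner_smul_right,
    Complex.conj_ofReal]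

theorem ham_eq_schr (hL : 0 < L) : ham e L = schr e L (hamCoef e L).op := ham_eq hL

theorem dressedHam_eq_schr (he : 0 < e) (hL : 0 < L) :
    dressedHam e L = schr e L (dressedOp he hL) := dressedHam_eq he hL

theorem ham_isClosable (hL : 0 < L) : (ham e L).IsClosable := by
  rw [ham_eq_schr hL]; exact schr_isClosable hL isSymm_hamCoef

theorem dressedHam_isClosable (he : 0 < e) (hL : 0 < L) : (dressedHam e L).IsClosable := by
  rw [dressedHam_eq_schr he hL]; exact schr_isClosable hL (isSymm_dressedOp he hL)

theorem ham_dressed (he : 0 < e) (hL : 0 < L) (u v : Tot L) : (u, v) ∈ (ham e L).closure.graph ↔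
    (liftTot L ((rot he hL).V 1) u, liftTot L ((rot he hL).V 1) v) ∈
      (dressedHam e L).closure.graph := by
  rw [mem_closure_graph (ham_isClosable hL), mem_closure_graph (dressedHam_isClosable he hL),
    ham_eq_schr hL, dressedHam_eq_schr he hL]
  exact (rot he hL).closure_transport_iff (hamCoef e L).nBdd_op (nBdd_dressedOp he hL)
    (V_ham he hL) u v

variable {e L : ℝ}

/-! ### The lower bound -/

/-- The axial charge truncated to finitely many configurations. -/
def axCut (S : Finset Cfg0) : Hilb0 →L[ℂ] Hilb0 := by
  classical
  exact diag (fun s => if s ∈ S then cfgAx s.1 else 0) (∑ s ∈ S, |cfgAx s.1|) fun s => by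
    split_ifs with h
    · exact Finset.single_le_sum (f := fun s : Cfg0 => |cfgAx s.1|) (fun _ _ => abs_nonneg _) h
    · rw [abs_zero]; exact Finset.sum_nonneg fun _ _ => abs_nonneg _

theorem axCut_sa (S : Finset Cfg0) (f g : Hilb0) :
    inner ℂ (axCut S f) g = inner ℂ f (axCut S g) := diag_sa _ f g

theorem axCut_emb {S : Finset Cfg0} {x : Fock0} (hx : x.support ⊆ S) :
    axCut S (emb x) = emb (ax x) := by
  classical
  rw [axCut, diag_emb]
  congr 1
  refine Finsupp.ext fun s => ?_
  rw [ax, dg_apply, dg_apply]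
  split_ifs with h
  · rfl
  · rw [Finsupp.notMem_support_iff.1 fun h' => h (hx h'), mul_zero, mul_zero]

/-- The regularized axial charge, truncated. -/
def regCut (L : ℝ) (S : Finset Cfg0) (Ψ : ℝ → Fock0) (a : ℝ) : Hilb0 :=
  axCut S (emb (Ψ a)) - (a * L / Real.pi + 1) • emb (Ψ a)

/-- The regularized axial charge as a diagonal operator. -/
def axReg (L a : ℝ) : Module.End ℂ Fock0 := dg fun s => cfgAx s.1 - (a * L / Real.pi + 1)

theorem axReg_apply (a : ℝ) (x : Fock0) :
    axReg L a x = ax x - ((a * L / Real.pi + 1 : ℝ) : ℂ) • x := Finsupp.ext fun s => by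
  rw [axReg, ax, Finsupp.sub_apply, Finsupp.smul_apply, dg_apply, dg_apply, smul_eq_mul]
  push_cast; ring

theorem inner_axReg (a : ℝ) (x y : Fock0) :
    inner ℂ (emb (axReg L a x)) (emb y) = inner ℂ (emb x) (emb (axReg L a y)) := inner_dg _ x y

theorem regCut_eq {S : Finset Cfg0} {Ψ : ℝ → Fock0} {a : ℝ} (h : (Ψ a).support ⊆ S) :
    regCut L S Ψ a = emb (axReg L a (Ψ a)) := by
  rw [regCut, axCut_emb h, axReg_apply, map_sub, map_smul, real_smul_eq]

theorem axReg_gam (hL : 0 < L) (x : Fock0) : axReg L 0 (gam x) = gam (axReg L (per L) x) := by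
  have hpi := Real.pi_pos
  have h1 : per L * L / Real.pi + 1 = 3 := by rw [per]; field_simp; norm_num
  rw [axReg_apply, axReg_apply, h1, ax_gam, map_sub, map_smul]
  push_cast
  rw [zero_mul, zero_div, zero_add, one_smul]
  module

theorem hasDerivAt_reg (S : Finset Cfg0) (Ψ : smoothDom L) (a : ℝ) :
    HasDerivAt (fun a => (inner ℂ (emb (Ψ.1 a)) (regCut L S Ψ.1 a)).re)
      (2 * (inner ℂ (d1 Ψ.1 a) (regCut L S Ψ.1 a)).re - L / Real.pi * ‖emb (Ψ.1 a)‖ ^ 2) a := by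
  have h0 := hasDerivAt_d1 Ψ.2.1 a
  have h1 : HasDerivAt (fun a : ℝ => a * L / Real.pi + 1) (L / Real.pi) a := by
    have := (((hasDerivAt_id a).mul_const L).div_const Real.pi).add_const 1
    rw [one_mul] at this
    exact this
  have h2 : HasDerivAt (regCut L S Ψ.1) (axCut S (d1 Ψ.1 a) -
      ((a * L / Real.pi + 1) • d1 Ψ.1 a + (L / Real.pi) • emb (Ψ.1 a))) a :=
    (clm_hasDerivAt (axCut S) h0).sub (h1.smul h0)
  have h3 := inner_hasDerivAt h0 h2
  have h4 : HasDerivAt (fun a => (inner ℂ (emb (Ψ.1 a)) (regCut L S Ψ.1 a)).re)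
      (inner ℂ (emb (Ψ.1 a)) (axCut S (d1 Ψ.1 a) -
      ((a * L / Real.pi + 1) • d1 Ψ.1 a + (L / Real.pi) • emb (Ψ.1 a))) +
      inner ℂ (d1 Ψ.1 a) (regCut L S Ψ.1 a)).re a :=
    Complex.reCLM.hasFDerivAt.comp_hasDerivAt a h3
  have h5 : (inner ℂ (emb (Ψ.1 a)) (axCut S (d1 Ψ.1 a) -
      ((a * L / Real.pi + 1) • d1 Ψ.1 a + (L / Real.pi) • emb (Ψ.1 a))) +
      inner ℂ (d1 Ψ.1 a) (regCut L S Ψ.1 a)).re =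
      2 * (inner ℂ (d1 Ψ.1 a) (regCut L S Ψ.1 a)).re - L / Real.pi * ‖emb (Ψ.1 a)‖ ^ 2 := by
    have h6 : inner ℂ (emb (Ψ.1 a)) (axCut S (d1 Ψ.1 a) -
      ((a * L / Real.pi + 1) • d1 Ψ.1 a + (L / Real.pi) • emb (Ψ.1 a))) =
      inner ℂ (regCut L S Ψ.1 a) (d1 Ψ.1 a) - ((L / Real.pi * ‖emb (Ψ.1 a)‖ ^ 2 : ℝ) : ℂ) := by
      rw [regCut, inner_sub_right, inner_add_right, inner_sub_left, axCut_sa, real_smul_eq,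
        real_smul_eq, real_smul_eq, inner_smul_right, inner_smul_right, inner_smul_left,
        inner_self_emb, Complex.conj_ofReal, Complex.ofReal_mul]
      ring
    rw [h6, ← inner_conj_symm (regCut L S Ψ.1 a)]
    simp only [Complex.add_re, Complex.sub_re, Complex.conj_re, Complex.ofReal_re]
    ring
  rw [h5] at h4
  exact h4

theorem continuous_regCut (S : Finset Cfg0) (Ψ : smoothDom L) : Continuous (regCut L S Ψ.1) := by
  have := Ψ.2.1.continuous
  unfold regCut
  fun_prop

/-- The virial identity. -/
theorem integral_reg (hL : 0 < L) {S : Finset Cfg0} (Ψ : smoothDom L)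
    (hS : ∀ a ∈ Icc 0 (per L), (Ψ.1 a).support ⊆ S) :
    ∫ a in (0)..(per L), (2 * (inner ℂ (d1 Ψ.1 a) (regCut L S Ψ.1 a)).re -
      L / Real.pi * ‖emb (Ψ.1 a)‖ ^ 2) = 0 := by
  have c0 := Ψ.2.1.continuous
  have c1 := continuous_d1 Ψ.2.1
  have c2 := continuous_regCut S Ψ
  have hT := per_pos hL
  rw [intervalIntegral.integral_eq_sub_of_hasDerivAt fun a _ => hasDerivAt_reg S Ψ a]
  · have h0 := regCut_eq (L := L) (hS 0 ⟨le_rfl, hT.le⟩)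
    have h1 := regCut_eq (L := L) (hS (per L) ⟨hT.le, le_rfl⟩)
    have h2 : Ψ.1 0 = gam (Ψ.1 (per L)) := by
      have := Ψ.2.2.2 0
      rw [zero_add] at this
      exact this.symm
    rw [h0, h1, h2, axReg_gam hL, inner_gam, sub_self]
  · have : Continuous fun a => 2 * (inner ℂ (d1 Ψ.1 a) (regCut L S Ψ.1 a)).re -
      L / Real.pi * ‖emb (Ψ.1 a)‖ ^ 2 := by
      have := Complex.continuous_re.comp (c1.inner (𝕜 := ℂ) c2)
      fun_prop
    exact this.intervalIntegrable _ _

theorem inner_pot {A : Fock0 →ₗ[ℂ] Hilb0} (a : ℝ) (x : Fock0) :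
    (inner ℂ (emb x) (fib L A a x)).re =
      Real.pi / (2 * L) * ‖emb (axReg L a x)‖ ^ 2 + (inner ℂ (emb x) (A x)).re := by
  have h1 : dg (fun s => Rot.pot L a (cfgAx s.1)) x =
      ((Real.pi / (2 * L) : ℝ) : ℂ) • axReg L a (axReg L a x) := Finsupp.ext fun s => by
    rw [Finsupp.smul_apply, axReg, dg_apply, dg_apply, dg_apply, Rot.pot, smul_eq_mul]
    push_cast; ring
  rw [Rot.fib_apply, h1, map_smul, inner_add_right, inner_smul_right, Complex.add_re,
    ← inner_axReg, inner_self_emb, ← Complex.ofReal_mul, Complex.ofReal_re]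

theorem act_lower (he : 0 < e) (hL : 0 < L) {A : Fock0 →ₗ[ℂ] Hilb0} {σ : ℝ}
    (hA : ∀ x, σ * ‖emb x‖ ^ 2 ≤ (inner ℂ (emb x) (A x)).re) (Ψ : smoothDom L) :
    (baseEnergy e + σ) * ‖domMap L Ψ‖ ^ 2 ≤ (inner ℂ (domMap L Ψ) (act e L A Ψ)).re := by
  obtain ⟨S, hS⟩ := Ψ.2.2.1
  have hpi := Real.pi_pos
  have hT := per_pos hL
  have c0 := Ψ.2.1.continuous
  have c1 := continuous_d1 Ψ.2.1
  have c2 := continuous_regCut S Ψ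
  have cfib := continuousOn_fam (fib_continuous (L := L) A) Ψ
  have cG : ContinuousOn (fun a => inner ℂ (emb (Ψ.1 a)) (fib L A a (Ψ.1 a))) (Icc 0 (per L)) :=
    c0.continuousOn.inner cfib
  have iG : IntervalIntegrable (fun a => inner ℂ (emb (Ψ.1 a)) (fib L A a (Ψ.1 a))) volume 0
      (per L) := cG.intervalIntegrable_of_Icc hT.le
  have iK : IntervalIntegrable (fun a => inner ℂ (d1 Ψ.1 a) (d1 Ψ.1 a)) volume 0 (per L) :=
    (c1.inner c1).intervalIntegrable _ _
  have e1 : (inner ℂ (domMap L Ψ) (act e L A Ψ)).re =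
      ∫ a in (0)..(per L), (e ^ 2 / (2 * L) * ‖d1 Ψ.1 a‖ ^ 2 +
        (inner ℂ (emb (Ψ.1 a)) (fib L A a (Ψ.1 a))).re) := by
    rw [inner_act hL, integral_meas hL, ← intervalIntegral.integral_const_mul,
      ← intervalIntegral.integral_add (iK.const_mul _) iG]
    refine (Complex.reCLM.intervalIntegral_comp_comm ((iK.const_mul _).add iG)).symm.trans ?_
    refine intervalIntegral.integral_congr fun a _ => ?_
    simp only [Complex.reCLM_apply, Complex.add_re, inner_self_eq_norm_sq_to_K]
    rw [Complex.re_ofReal_mul]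
    norm_cast
  have e2 : ‖domMap L Ψ‖ ^ 2 = ∫ a in (0)..(per L), ‖emb (Ψ.1 a)‖ ^ 2 := by
    rw [show domMap L Ψ = (memLp_emb L Ψ).toLp _ from rfl, norm_toLp_sq, integral_meas hL]
  have cR : Continuous fun a => (inner ℂ (d1 Ψ.1 a) (regCut L S Ψ.1 a)).re :=
    Complex.continuous_re.comp (c1.inner (𝕜 := ℂ) c2)
  have iV : IntervalIntegrable (fun a => 2 * (inner ℂ (d1 Ψ.1 a) (regCut L S Ψ.1 a)).re -
      L / Real.pi * ‖emb (Ψ.1 a)‖ ^ 2) volume 0 (per L) := by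
    apply Continuous.intervalIntegrable; fun_prop
  have iN : IntervalIntegrable (fun a => ‖emb (Ψ.1 a)‖ ^ 2) volume 0 (per L) := by
    apply Continuous.intervalIntegrable; fun_prop
  have e3 : (baseEnergy e + σ) * ‖domMap L Ψ‖ ^ 2 = ∫ a in (0)..(per L),
      (e * √Real.pi / (2 * L) * (2 * (inner ℂ (d1 Ψ.1 a) (regCut L S Ψ.1 a)).re -
        L / Real.pi * ‖emb (Ψ.1 a)‖ ^ 2) + (baseEnergy e + σ) * ‖emb (Ψ.1 a)‖ ^ 2) := by
    rw [intervalIntegral.integral_add (iV.const_mul _) (iN.const_mul _),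
      intervalIntegral.integral_const_mul, intervalIntegral.integral_const_mul,
      integral_reg hL Ψ hS, e2]
    ring
  rw [e1, e3]
  refine intervalIntegral.integral_mono_on hT.le ((iV.const_mul _).add (iN.const_mul _)) ?_
    fun a ha => ?_
  · refine IntervalIntegrable.add ?_ ?_
    · apply Continuous.intervalIntegrable; fun_prop
    · exact (Complex.continuous_re.comp_continuousOn cG).intervalIntegrable_of_Icc hT.le
  · rw [inner_pot, ← regCut_eq (hS a ha)]
    have h1 := hA (Ψ.1 a)
    set D := d1 Ψ.1 a
    set X := regCut L S Ψ.1 a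
    set s := √Real.pi with hs
    have hs0 : 0 < s := Real.sqrt_pos.2 hpi
    have hss : s ^ 2 = Real.pi := Real.sq_sqrt hpi.le
    have h2 : 0 ≤ ‖(e : ℂ) • D - (s : ℂ) • X‖ ^ 2 := sq_nonneg _
    rw [@norm_sub_sq ℂ, inner_smul_left, inner_smul_right, norm_smul, norm_smul, Complex.conj_ofReal,
      Complex.norm_real, Complex.norm_real, Real.norm_of_nonneg he.le, Real.norm_of_nonneg hs0.le,
      ← mul_assoc, ← Complex.ofReal_mul, RCLike.re_to_complex, Complex.re_ofReal_mul, mul_pow,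
      mul_pow, hss] at h2
    have h3 : baseEnergy e = e * s / (2 * L) * (L / Real.pi) := by
      rw [baseEnergy, ← hs, ← hss]; field_simp
    have h4 : 0 ≤ (1 / (2 * L)) * (e ^ 2 * ‖D‖ ^ 2 - 2 * (e * s * (inner ℂ D X).re) +
      Real.pi * ‖X‖ ^ 2) := mul_nonneg (by positivity) h2
    rw [h3]
    have h5 : (1 / (2 * L)) * (e ^ 2 * ‖D‖ ^ 2 - 2 * (e * s * (inner ℂ D X).re) +
      Real.pi * ‖X‖ ^ 2) = e ^ 2 / (2 * L) * ‖D‖ ^ 2 + Real.pi / (2 * L) * ‖X‖ ^ 2 -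
      e * s / (2 * L) * (2 * (inner ℂ D X).re) := by ring
    linarith

theorem closure_lower (he : 0 < e) (hL : 0 < L) {A : Fock0 →ₗ[ℂ] Hilb0} {σ : ℝ}
    (hA : ∀ x, σ * ‖emb x‖ ^ 2 ≤ (inner ℂ (emb x) (A x)).re) {u v : Tot L}
    (h : (u, v) ∈ closure ((schr e L A).graph : Set (Tot L × Tot L))) :
    (baseEnergy e + σ) * ‖u‖ ^ 2 ≤ (inner ℂ u v).re := by
  have c1 : Continuous fun p : Tot L × Tot L => (baseEnergy e + σ) * ‖p.1‖ ^ 2 := by fun_prop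
  have c2 : Continuous fun p : Tot L × Tot L => (inner ℂ p.1 p.2).re :=
    Complex.continuous_re.comp (continuous_fst.inner continuous_snd)
  have h1 : ((schr e L A).graph : Set (Tot L × Tot L)) ⊆
      {p | (baseEnergy e + σ) * ‖p.1‖ ^ 2 ≤ (inner ℂ p.1 p.2).re} := by
    rw [graph_schr]
    rintro _ ⟨Ψ, rfl⟩
    exact act_lower he hL hA Ψ
  have h2 := closure_minimal h1 (isClosed_le c1 c2) h
  rwa [Set.mem_ofPred_eq] at h2

theorem dressedOp_lower (he : 0 < e) (hL : 0 < L) (x : Fock0) :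
    shift e L * ‖emb x‖ ^ 2 ≤ (inner ℂ (emb x) (dressedOp he hL x)).re := by
  rw [dressedOp, LinearMap.add_apply, LinearMap.smul_apply, inner_add_right, inner_smul_right,
    inner_self_emb, ← Complex.ofReal_mul, Complex.add_re, Complex.ofReal_re]
  have h1 := Complex.reCLM.hasSum ((freeCoef he hL).hasSum_inner (emb x) x)
  have h2 : 0 ≤ (inner ℂ (emb x) ((freeCoef he hL).op x)).re := by
    refine h1.nonneg fun m => ?_
    have hf : 0 ≤ freq e L m := by
      have := Real.pi_pos; unfold freq; positivity
    rw [Complex.reCLM_apply, Coef.qm_apply]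
    simp only [freeCoef, Complex.ofReal_zero, zero_smul, zero_add]
    rw [map_smul, inner_smul_right, inner_nm_self, ← Complex.ofReal_mul, Complex.ofReal_re]
    positivity
  linarith

theorem ham_lower (he : 0 < e) (hL : 0 < L) {u v : Tot L} (h : (u, v) ∈ (ham e L).closure.graph) :
    (baseEnergy e + shift e L) * ‖u‖ ^ 2 ≤ (inner ℂ u v).re := by
  rw [ham_dressed he hL, mem_closure_graph (dressedHam_isClosable he hL),
    dressedHam_eq_schr he hL] at h
  have h1 := closure_lower he hL (dressedOp_lower he hL) h
  rw [inner_liftTot] at h1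
  have h2 : ‖liftTot L ((rot he hL).V 1) u‖ ^ 2 = ‖u‖ ^ 2 := by
    have := inner_liftTot ((rot he hL).V 1) u u
    simp only [inner_self_eq_norm_sq_to_K] at this
    exact_mod_cast this
  rwa [h2] at h1

variable {e L : ℝ}

/-! ### The Gaussian -/

/-- The decay rate of the Gaussian. -/
def rate (e L : ℝ) : ℝ := L / (√Real.pi * e)

theorem rate_pos (he : 0 < e) (hL : 0 < L) : 0 < rate e L := by
  have := Real.pi_pos; unfold rate; positivity

/-- The normalization of the Gaussian. -/
def gnorm (e L : ℝ) : ℝ := L ^ (1 / 4 : ℝ) / (Real.pi ^ (3 / 8 : ℝ) * e ^ (1 / 4 : ℝ))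

theorem gnorm_pos (he : 0 < e) (hL : 0 < L) : 0 < gnorm e L := by
  have := Real.pi_pos; unfold gnorm; positivity

theorem gauss_eq (he : 0 < e) (y : ℝ) :
    gauss e L y = gnorm e L * Real.exp (-(rate e L / 2) * y ^ 2) := by
  have := Real.sqrt_pos.2 Real.pi_pos
  rw [gauss, gnorm, rate]
  congr 2
  field_simp

theorem hasDerivAt_gauss (he : 0 < e) (y : ℝ) :
    HasDerivAt (gauss e L) (-rate e L * y * gauss e L y) y := by
  have h0 : gauss e L = fun y => gnorm e L * Real.exp (-(rate e L / 2) * y ^ 2) :=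
    funext fun y => gauss_eq he y
  have h1 : HasDerivAt (fun y : ℝ => -(rate e L / 2) * y ^ 2) (-(rate e L / 2) * (2 * y)) y := by
    simpa using (hasDerivAt_pow 2 y).const_mul (-(rate e L / 2))
  have h2 := h1.exp.const_mul (gnorm e L)
  rw [h0]
  have h3 : gnorm e L * (Real.exp (-(rate e L / 2) * y ^ 2) * (-(rate e L / 2) * (2 * y))) =
      -rate e L * y * (gnorm e L * Real.exp (-(rate e L / 2) * y ^ 2)) := by ring
  rw [h3] at h2
  exact h2

theorem contDiff_gauss (he : 0 < e) : ContDiff ℝ ∞ (gauss e L) := by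
  have h0 : gauss e L = fun y => gnorm e L * Real.exp (-(rate e L / 2) * y ^ 2) :=
    funext fun y => gauss_eq he y
  rw [h0]
  fun_prop

theorem gauss_nonneg (he : 0 < e) (hL : 0 < L) (y : ℝ) : 0 ≤ gauss e L y := by
  rw [gauss_eq he]; have := gnorm_pos he hL; positivity

theorem exists_gauss_le (he : 0 < e) (hL : 0 < L) :
    ∃ D, 0 < D ∧ ∀ y, (1 + y ^ 2) ^ 2 * gauss e L y ≤ D := by
  have hb := rate_pos he hL
  have hn := gnorm_pos he hL
  set s := rate e L / 2 with hs
  have hs0 : 0 < s := by positivity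
  refine ⟨gnorm e L * (1 + 2 / s + 2 / s ^ 2), by positivity, fun y => ?_⟩
  rw [gauss_eq he, ← hs]
  set u := s * y ^ 2 with hu
  have hu0 : 0 ≤ u := by positivity
  have h1 : 1 + u + u ^ 2 / 2 ≤ Real.exp u := Real.quadratic_le_exp_of_nonneg hu0
  have h2 : y ^ 2 = u / s := by rw [hu]; field_simp
  have h3 : (1 + y ^ 2) ^ 2 ≤ (1 + 2 / s + 2 / s ^ 2) * Real.exp u := by
    refine le_trans ?_ (mul_le_mul_of_nonneg_left h1 (by positivity))
    rw [h2]
    have e1 : (1 + u / s) ^ 2 = 1 + 2 / s * u + 2 / s ^ 2 * (u ^ 2 / 2) := by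
      field_simp; ring
    rw [e1]
    have p1 : 0 ≤ 2 / s := by positivity
    have p2 : 0 ≤ 2 / s ^ 2 := by positivity
    nlinarith [mul_nonneg p1 hu0, mul_nonneg p2 hu0, mul_nonneg p1 (sq_nonneg u),
      mul_nonneg p2 (sq_nonneg u)]
  have h4 : Real.exp (-s * y ^ 2) = (Real.exp u)⁻¹ := by rw [← Real.exp_neg, hu]; ring_nf
  rw [h4]
  have h5 : (1 + y ^ 2) ^ 2 * (Real.exp u)⁻¹ ≤ 1 + 2 / s + 2 / s ^ 2 := by
    rw [← div_eq_mul_inv, div_le_iff₀ (Real.exp_pos u)]; exact h3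
  nlinarith

theorem integral_gauss_sq (he : 0 < e) (hL : 0 < L) : ∫ y, gauss e L y ^ 2 = 1 := by
  have hpi := Real.pi_pos
  have hb := rate_pos he hL
  have hn := gnorm_pos he hL
  have h1 : ∀ y, gauss e L y ^ 2 = gnorm e L ^ 2 * Real.exp (-rate e L * y ^ 2) := fun y => by
    rw [gauss_eq he, mul_pow, ← Real.exp_nat_mul]; congr 2; push_cast; ring
  simp only [h1]
  rw [integral_const_mul, integral_gaussian]
  have h2 : gnorm e L ^ 4 * (Real.pi / rate e L) = 1 := by
    have hp : ∀ {x : ℝ}, 0 < x → (x ^ (1 / 4 : ℝ)) ^ 4 = x := fun {x} hx => by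
      rw [← Real.rpow_natCast, ← Real.rpow_mul hx.le]; norm_num
    have hq : (Real.pi ^ (3 / 8 : ℝ)) ^ 4 = Real.pi * √Real.pi := by
      rw [← Real.rpow_natCast, ← Real.rpow_mul hpi.le, Real.sqrt_eq_rpow]
      nth_rw 2 [← Real.rpow_one Real.pi]
      rw [← Real.rpow_add hpi]; norm_num
    have := Real.sqrt_pos.2 hpi
    rw [gnorm, div_pow, mul_pow, hp hL, hp he, hq, rate]
    field_simp
  have h3 : (gnorm e L ^ 2 * √(Real.pi / rate e L)) ^ 2 = 1 := by
    rw [mul_pow, Real.sq_sqrt (by positivity), ← h2]; ring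
  nlinarith [show 0 ≤ gnorm e L ^ 2 * √(Real.pi / rate e L) by positivity]

theorem integrable_gauss_sq (he : 0 < e) (hL : 0 < L) : Integrable fun y => gauss e L y ^ 2 := by
  have h1 : ∀ y, gauss e L y ^ 2 = gnorm e L ^ 2 * Real.exp (-rate e L * y ^ 2) := fun y => by
    rw [gauss_eq he, mul_pow, ← Real.exp_nat_mul]; congr 2; push_cast; ring
  simp only [h1]
  exact (integrable_exp_neg_mul_sq (rate_pos he hL)).const_mul _

/-! ### Trial functions -/

/-- A smooth cutoff function. -/
def bump : ContDiffBump (0 : ℝ) := ⟨1, 2, one_pos, one_lt_two⟩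

/-- The cutoff as a test function. -/
def bumpTest : Test where
  f := bump
  smooth := bump.contDiff
  M := 2
  zero a ha := bump.zero_of_le_dist (by rw [Real.dist_eq, sub_zero]; exact ha.le)

theorem Test.exists_bound (g : Test) : ∃ C, 0 ≤ C ∧ ∀ a, |g.f a| ≤ C := by
  obtain ⟨C, hC⟩ := isCompact_Icc.exists_bound_of_continuousOn
    (g.smooth.continuous.continuousOn (s := Icc (-g.M) g.M))
  refine ⟨max C 0, le_max_right _ _, fun a => ?_⟩
  by_cases h : |a| ≤ g.M
  · exact (hC a (abs_le.1 h)).trans (le_max_left _ _)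
  · rw [g.zero a (not_le.1 h), abs_zero]; exact le_max_right _ _

theorem Test.hasDerivAt (g : Test) (a : ℝ) : HasDerivAt g.f (g.der.f a) a :=
  (g.smooth.differentiable (by simp) a).hasDerivAt

/-- The truncated ground states. -/
def trial (he : 0 < e) (L : ℝ) (n : ℕ) : Test where
  f x := bumpTest.f ((n + 1 : ℝ)⁻¹ * (x + per L / 2)) * gauss e L (x + per L / 2)
  smooth := by
    have h1 := bumpTest.smooth
    have h2 := contDiff_gauss (L := L) he
    exact (h1.comp (contDiff_const.mul (contDiff_id.add contDiff_const))).mul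
      (h2.comp (contDiff_id.add contDiff_const))
  M := 2 * (n + 1) + |per L / 2|
  zero a ha := by
    rw [bumpTest.zero, zero_mul]
    have hn : (0 : ℝ) < n + 1 := by positivity
    rw [abs_mul, abs_of_pos (inv_pos.2 hn), inv_mul_eq_div, lt_div_iff₀ hn]
    change 2 * _ < _
    have := abs_sub_abs_le_abs_sub a (-(per L / 2))
    rw [abs_neg, sub_neg_eq_add] at this
    linarith

theorem trial_der2 (he : 0 < e) (n : ℕ) (x : ℝ) : (trial he L n).der.der.f x =
    (n + 1 : ℝ)⁻¹ ^ 2 * bumpTest.der.der.f ((n + 1 : ℝ)⁻¹ * (x + per L / 2)) *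
        gauss e L (x + per L / 2) -
      2 * (n + 1 : ℝ)⁻¹ * bumpTest.der.f ((n + 1 : ℝ)⁻¹ * (x + per L / 2)) *
        (rate e L * (x + per L / 2) * gauss e L (x + per L / 2)) +
      (trial he L n).f x * (rate e L ^ 2 * (x + per L / 2) ^ 2 - rate e L) := by
  set k := (n + 1 : ℝ)⁻¹ with hk
  set b := rate e L with hb
  have hl : ∀ x, HasDerivAt (fun x => k * (x + per L / 2)) k x := fun x => by
    simpa using ((hasDerivAt_id x).add_const (per L / 2)).const_mul k
  have hc : ∀ (g : Test) x, HasDerivAt (fun x => g.f (k * (x + per L / 2)))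
      (g.der.f (k * (x + per L / 2)) * k) x := fun g x => (g.hasDerivAt _).comp x (hl x)
  have hg : ∀ x, HasDerivAt (fun x => gauss e L (x + per L / 2))
      (-b * (x + per L / 2) * gauss e L (x + per L / 2)) x := fun x =>
    (hasDerivAt_gauss he _).comp_add_const x (per L / 2)
  have h1 : ∀ x, HasDerivAt (trial he L n).f (bumpTest.der.f (k * (x + per L / 2)) * k *
      gauss e L (x + per L / 2) + bumpTest.f (k * (x + per L / 2)) *
      (-b * (x + per L / 2) * gauss e L (x + per L / 2))) x := fun x => (hc bumpTest x).mul (hg x)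
  have h2 : (trial he L n).der.f = fun x => bumpTest.der.f (k * (x + per L / 2)) * k *
      gauss e L (x + per L / 2) + bumpTest.f (k * (x + per L / 2)) *
      (-b * (x + per L / 2) * gauss e L (x + per L / 2)) := funext fun x => (h1 x).deriv
  have hy : HasDerivAt (fun x => -b * (x + per L / 2)) (-b) x := by
    simpa using ((hasDerivAt_id x).add_const (per L / 2)).const_mul (-b)
  have h3 := (((hc bumpTest.der x).mul_const k).mul (hg x)).add
    ((hc bumpTest x).mul (hy.mul (hg x)))
  have h4 : (trial he L n).der.der.f x = deriv (trial he L n).der.f x := rfl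
  rw [h4, h2]
  refine h3.deriv.trans ?_
  simp only [Pi.mul_apply]
  change _ = _ + bumpTest.f (k * (x + per L / 2)) * gauss e L (x + per L / 2) * _
  ring

/-- The one-dimensional oscillator acting on the trial functions. -/
def osc (he : 0 < e) (L : ℝ) (n : ℕ) (x : ℝ) : ℝ :=
  -(e ^ 2 / (2 * L)) * (trial he L n).der.der.f x +
    L / (2 * Real.pi) * (x + per L / 2) ^ 2 * (trial he L n).f x

theorem osc_eq (he : 0 < e) (hL : 0 < L) (n : ℕ) (x : ℝ) : osc he L n x =
    baseEnergy e * (trial he L n).f x - (e ^ 2 / (2 * L)) *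
      ((n + 1 : ℝ)⁻¹ ^ 2 * bumpTest.der.der.f ((n + 1 : ℝ)⁻¹ * (x + per L / 2)) -
      2 * (n + 1 : ℝ)⁻¹ * bumpTest.der.f ((n + 1 : ℝ)⁻¹ * (x + per L / 2)) *
        (rate e L * (x + per L / 2))) * gauss e L (x + per L / 2) := by
  have hpi := Real.sqrt_pos.2 Real.pi_pos
  have hss : √Real.pi ^ 2 = Real.pi := Real.sq_sqrt Real.pi_pos.le
  have h1 : e ^ 2 / (2 * L) * rate e L ^ 2 = L / (2 * Real.pi) := by
    rw [rate, div_pow, mul_pow, hss]; field_simp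
  have h2 : e ^ 2 / (2 * L) * rate e L = baseEnergy e := by
    rw [rate, baseEnergy]; field_simp
  rw [osc, trial_der2, ← h1, ← h2]
  ring

theorem exists_trial_bound (he : 0 < e) (hL : 0 < L) : ∃ D, 0 < D ∧ ∀ n x,
    |(trial he L n).f x| ≤ D / (1 + (x + per L / 2) ^ 2) ∧
    |osc he L n x| ≤ D / (1 + (x + per L / 2) ^ 2) ∧
    |gauss e L (x + per L / 2)| ≤ D / (1 + (x + per L / 2) ^ 2) := by
  obtain ⟨D, hD, hg⟩ := exists_gauss_le he hL
  obtain ⟨C₀, p₀, h₀⟩ := bumpTest.exists_bound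
  obtain ⟨C₁, p₁, h₁⟩ := bumpTest.der.exists_bound
  obtain ⟨C₂, p₂, h₂⟩ := bumpTest.der.der.exists_bound
  have hb := rate_pos he hL
  have hE : 0 < baseEnergy e := by
    have := Real.sqrt_pos.2 Real.pi_pos; unfold baseEnergy; positivity
  set c := e ^ 2 / (2 * L) with hc
  have hc0 : 0 < c := by positivity
  refine ⟨(1 + C₀ + baseEnergy e * C₀ + c * (C₂ + 2 * C₁ * rate e L)) * D, by positivity,
    fun n x => ?_⟩
  set y := x + per L / 2 with hy
  set k := (n + 1 : ℝ)⁻¹ with hk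
  have hk0 : 0 ≤ k := by positivity
  have hk1 : k ≤ 1 := inv_le_one_of_one_le₀ (by linarith [Nat.cast_nonneg (α := ℝ) n])
  have hY : 0 < 1 + y ^ 2 := by positivity
  have g0 := gauss_nonneg he hL y
  have g1 : (1 + y ^ 2) * gauss e L y ≤ D / (1 + y ^ 2) := by
    rw [le_div_iff₀ hY]; linarith [hg y]
  have g2 : gauss e L y ≤ D / (1 + y ^ 2) :=
    le_trans (by nlinarith [sq_nonneg y]) g1
  have q0 : 0 ≤ D / (1 + y ^ 2) := by positivity
  have t1 : |(trial he L n).f x| ≤ C₀ * (D / (1 + y ^ 2)) := by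
    change |bumpTest.f (k * y) * gauss e L y| ≤ _
    rw [abs_mul, abs_of_nonneg g0]
    exact mul_le_mul (h₀ _) g2 g0 p₀
  have hya : |y| ≤ 1 + y ^ 2 := by rw [abs_le]; constructor <;> nlinarith [sq_nonneg (y - 1), sq_nonneg (y + 1)]
  have t2 : |(k ^ 2 * bumpTest.der.der.f (k * y) - 2 * k * bumpTest.der.f (k * y) *
      (rate e L * y)) * gauss e L y| ≤ (C₂ + 2 * C₁ * rate e L) * (D / (1 + y ^ 2)) := by
    have u1 : |k ^ 2 * bumpTest.der.der.f (k * y) - 2 * k * bumpTest.der.f (k * y) *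
        (rate e L * y)| ≤ (C₂ + 2 * C₁ * rate e L) * (1 + y ^ 2) := by
      refine (abs_sub _ _).trans ?_
      have v1 : |k ^ 2 * bumpTest.der.der.f (k * y)| ≤ C₂ * (1 + y ^ 2) := by
        rw [abs_mul, abs_of_nonneg (sq_nonneg k)]
        calc _ ≤ 1 * C₂ := mul_le_mul (pow_le_one₀ hk0 hk1) (h₂ _) (abs_nonneg _) zero_le_one
          _ ≤ _ := by nlinarith [sq_nonneg y]
      have v2 : |2 * k * bumpTest.der.f (k * y) * (rate e L * y)| ≤
          2 * C₁ * rate e L * (1 + y ^ 2) := by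
        rw [abs_mul, abs_mul, abs_mul, abs_mul, abs_of_pos hb, abs_of_nonneg hk0,
          abs_of_pos (two_pos : (0 : ℝ) < 2)]
        calc _ ≤ 2 * 1 * C₁ * (rate e L * (1 + y ^ 2)) := by
              gcongr; exact h₁ _
          _ = _ := by ring
      linarith
    rw [abs_mul, abs_of_nonneg g0]
    calc _ ≤ (C₂ + 2 * C₁ * rate e L) * (1 + y ^ 2) * gauss e L y :=
          mul_le_mul_of_nonneg_right u1 g0
      _ = (C₂ + 2 * C₁ * rate e L) * ((1 + y ^ 2) * gauss e L y) := by ring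
      _ ≤ _ := mul_le_mul_of_nonneg_left g1 (by positivity)
  have A0 : 0 ≤ baseEnergy e * C₀ := by positivity
  have A1 : 0 ≤ c * (C₂ + 2 * C₁ * rate e L) := by positivity
  have hmono : ∀ {B : ℝ}, B ≤ 1 + C₀ + baseEnergy e * C₀ + c * (C₂ + 2 * C₁ * rate e L) →
      B * (D / (1 + y ^ 2)) ≤
        (1 + C₀ + baseEnergy e * C₀ + c * (C₂ + 2 * C₁ * rate e L)) * D / (1 + y ^ 2) :=
    fun h => (mul_le_mul_of_nonneg_right h q0).trans_eq (mul_div_assoc _ _ _).symm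
  refine ⟨t1.trans (hmono (by linarith)), ?_, ?_⟩
  · refine le_trans ?_ (hmono (B := baseEnergy e * C₀ + c * (C₂ + 2 * C₁ * rate e L)) (by linarith))
    rw [osc_eq he hL, mul_assoc (e ^ 2 / (2 * L)), ← hc]
    refine (abs_sub _ _).trans ?_
    rw [abs_mul, abs_mul, abs_of_pos hE, abs_of_pos hc0]
    have := mul_le_mul_of_nonneg_left t1 hE.le
    have := mul_le_mul_of_nonneg_left t2 hc0.le
    linarith
  · rw [abs_of_nonneg g0]
    refine g2.trans (le_trans ?_ (hmono (B := 1) (by linarith)))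
    rw [one_mul]

theorem tendsto_trial (he : 0 < e) (x : ℝ) :
    Tendsto (fun n => (trial he L n).f x) atTop (𝓝 (gauss e L (x + per L / 2))) := by
  refine tendsto_const_nhds.congr' ?_
  obtain ⟨N, hN⟩ := exists_nat_ge |x + per L / 2|
  filter_upwards [eventually_ge_atTop N] with n hn
  change _ = bump ((n + 1 : ℝ)⁻¹ * (x + per L / 2)) * gauss e L (x + per L / 2)
  rw [bump.one_of_mem_closedBall, one_mul]
  rw [Metric.mem_closedBall, Real.dist_eq, sub_zero]
  have h0 : (0 : ℝ) < n + 1 := by positivity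
  have h1 : (N : ℝ) ≤ n := by exact_mod_cast hn
  rw [abs_mul, abs_of_pos (inv_pos.2 h0), inv_mul_eq_div]
  change _ / _ ≤ (1 : ℝ)
  rw [div_le_one h0]
  linarith

theorem tendsto_osc (he : 0 < e) (hL : 0 < L) (x : ℝ) :
    Tendsto (fun n => osc he L n x) atTop (𝓝 (baseEnergy e * gauss e L (x + per L / 2))) := by
  obtain ⟨C₁, p₁, h₁⟩ := bumpTest.der.exists_bound
  obtain ⟨C₂, p₂, h₂⟩ := bumpTest.der.der.exists_bound
  have hk : Tendsto (fun n : ℕ => (n + 1 : ℝ)⁻¹) atTop (𝓝 0) := by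
    simpa using tendsto_one_div_add_atTop_nhds_zero_nat (𝕜 := ℝ)
  have hz : ∀ {u v : ℕ → ℝ} {C : ℝ}, Tendsto u atTop (𝓝 0) → (∀ n, |v n| ≤ C) →
      Tendsto (fun n => u n * v n) atTop (𝓝 0) := fun hu hv =>
    hu.zero_mul_isBoundedUnder_le (isBoundedUnder_of ⟨_, hv⟩)
  have l1 := hz (by simpa using hk.pow 2) fun n : ℕ =>
    h₂ ((n + 1 : ℝ)⁻¹ * (x + per L / 2))
  have l2 := hz (by simpa using hk.const_mul 2) fun n : ℕ =>
    h₁ ((n + 1 : ℝ)⁻¹ * (x + per L / 2))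
  have l3 := ((tendsto_trial (L := L) he x).const_mul (baseEnergy e)).sub
    (((l1.sub (l2.mul_const (rate e L * (x + per L / 2)))).const_mul (e ^ 2 / (2 * L))).mul_const
      (gauss e L (x + per L / 2)))
  simp only [osc_eq he hL]
  simpa using l3

variable {e L : ℝ}

/-! ### The vacuum -/

theorem unexcited_eq_zpow (P : ℤ) : (gamE ^ (-P)) (unexcited 0) = unexcited P := by
  have h : ∀ Q : ℤ, gamE ((gamE ^ (-(Q + 1))) (unexcited 0)) = (gamE ^ (-Q)) (unexcited 0) :=
    fun Q => by
      have h1 : (-Q : ℤ) = 1 + -(Q + 1) := by ring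
      rw [h1, zpow_one_add]; rfl
  induction P using Int.induction_on with
  | zero => rfl
  | succ n ih => exact gamE.injective (by rw [h, ih, gamE_apply, gam_unexcited])
  | pred n ih =>
    have h2 := h (-n - 1)
    rw [sub_add_cancel, ih] at h2
    rw [← h2, gamE_apply, ← gam_unexcited (-n - 1), sub_add_cancel]

theorem inner_unexcited (P Q : ℤ) :
    inner ℂ (emb (unexcited P)) (emb (unexcited Q)) = if P = Q then (1 : ℂ) else 0 := by
  classical
  have h0 : ∀ {P Q : ℤ}, unexcited P = unexcited Q → P = Q := fun {P Q} h => by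
    have h1 := ax_unexcited P
    rw [h, ax_unexcited Q] at h1
    have h2 := smul_left_injective ℂ (show unexcited Q ≠ 0 from by
      simp [unexcited, basisVec0]) h1
    have h3 : (2 * Q : ℝ) = 2 * P := by exact_mod_cast h2
    have h4 : (2 * Q : ℤ) = 2 * P := by exact_mod_cast h3
    omega
  rw [unexcited, emb_basis, lp.inner_single_left, emb_apply, unexcited, basisVec0,
    Finsupp.single_apply]
  split_ifs with h1 h2 h2
  · simp
  · exact absurd (h0 (congrArg basisVec0 h1)).symm h2
  · subst h2; exact absurd rfl h1
  · simp

theorem norm_unexcited (P : ℤ) : ‖emb (unexcited P)‖ = 1 := by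
  have h := inner_self_eq_norm_sq (𝕜 := ℂ) (emb (unexcited P))
  rw [inner_unexcited, if_pos rfl, RCLike.one_re] at h
  exact (pow_eq_one_iff_of_nonneg (norm_nonneg _) two_ne_zero).1 h.symm

theorem summable_inv_one_add_sq : Summable fun j : ℤ => (1 + (j : ℝ) ^ 2)⁻¹ := by
  refine Summable.of_norm_bounded_eventually (Real.summable_one_div_int_pow.2 one_lt_two) ?_
  refine (Set.finite_singleton (0 : ℤ)).subset fun j hj => ?_
  by_contra h0
  have h1 : (0 : ℝ) < (j : ℝ) ^ 2 := by
    have : (j : ℝ) ≠ 0 := Int.cast_ne_zero.2 h0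
    positivity
  refine hj ?_
  change ‖(1 + (j : ℝ) ^ 2)⁻¹‖ ≤ 1 / (j : ℝ) ^ 2
  rw [Real.norm_of_nonneg (by positivity), ← one_div]
  exact one_div_le_one_div_of_le h1 (by linarith)

theorem exists_translate_bound (hL : 0 < L) (R : ℝ) : ∃ K, 0 < K ∧ ∀ a, |a| ≤ R → ∀ j : ℤ,
    (1 + (a - j * per L + per L / 2) ^ 2)⁻¹ ≤ K * (1 + (j : ℝ) ^ 2)⁻¹ := by
  have hT := per_pos hL
  set T := per L
  refine ⟨1 + 2 / T ^ 2 + 4 * (R / T) ^ 2 + 1, by positivity, fun a ha j => ?_⟩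
  set y := a - j * T + T / 2 with hy
  have h1 : (j : ℝ) = a / T + 1 / 2 - y / T := by rw [hy]; field_simp; ring
  have h2 : (a / T) ^ 2 ≤ (R / T) ^ 2 := by
    rw [div_pow, div_pow]
    gcongr ?_ / _
    exact sq_le_sq' (by linarith [neg_abs_le a]) (by linarith [le_abs_self a])
  have h3 : (j : ℝ) ^ 2 ≤ 4 * (a / T) ^ 2 + 1 + 2 * (y / T) ^ 2 := by
    rw [h1]
    nlinarith [sq_nonneg (a / T + 1 / 2 + y / T), sq_nonneg (a / T - 1 / 2)]
  have h4 : 2 * (y / T) ^ 2 = 2 / T ^ 2 * y ^ 2 := by field_simp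
  rw [← div_eq_mul_inv, ← one_div, div_le_div_iff₀ (by positivity) (by positivity)]
  have p1 : 0 ≤ 2 / T ^ 2 := by positivity
  nlinarith [sq_nonneg y, mul_nonneg (sq_nonneg (R / T)) (sq_nonneg y)]

/-- The superposition `∑ⱼ h(a - jT) Ωⱼ`. -/
def spread (L : ℝ) (h : ℝ → ℝ) (a : ℝ) : Hilb0 :=
  ∑' j : ℤ, (h (a - j * per L) : ℂ) • emb (unexcited j)

/-- The functions decaying quadratically away from `-T/2`. -/
def Decays (L D : ℝ) (h : ℝ → ℝ) : Prop := ∀ x, |h x| ≤ D / (1 + (x + per L / 2) ^ 2)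

theorem exists_decay_bound (hL : 0 < L) (R : ℝ) {D : ℝ} (hD : 0 < D) : ∃ K, 0 < K ∧
    ∀ h, Decays L D h → ∀ a, |a| ≤ R → ∀ j : ℤ,
      ‖(h (a - j * per L) : ℂ) • emb (unexcited j)‖ ≤ K * (1 + (j : ℝ) ^ 2)⁻¹ := by
  obtain ⟨K, hK, h1⟩ := exists_translate_bound hL R
  refine ⟨D * K, by positivity, fun h hh a ha j => ?_⟩
  rw [norm_smul, norm_unexcited, mul_one, Complex.norm_real, Real.norm_eq_abs]
  refine (hh _).trans ?_
  rw [div_eq_mul_inv, mul_assoc]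
  exact mul_le_mul_of_nonneg_left (h1 a ha j) hD.le

theorem Decays.hasSum (hL : 0 < L) {D : ℝ} (hD : 0 < D) {h : ℝ → ℝ} (hh : Decays L D h) (a : ℝ) :
    HasSum (fun j : ℤ => (h (a - j * per L) : ℂ) • emb (unexcited j)) (spread L h a) := by
  obtain ⟨K, -, hK⟩ := exists_decay_bound hL |a| hD
  exact (Summable.of_norm_bounded (summable_inv_one_add_sq.mul_left K)
    (hK h hh a le_rfl)).hasSum

theorem spread_const_mul (c : ℝ) (h : ℝ → ℝ) (a : ℝ) :
    spread L (fun x => c * h x) a = (c : ℂ) • spread L h a := by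
  rw [spread, spread, ← tsum_const_smul'']
  exact tsum_congr fun j => by rw [Complex.ofReal_mul, mul_smul]

theorem tendsto_spread (hL : 0 < L) {D : ℝ} (hD : 0 < D) {h : ℕ → ℝ → ℝ} {g : ℝ → ℝ}
    (hb : ∀ n, Decays L D (h n)) (hlim : ∀ x, Tendsto (fun n => h n x) atTop (𝓝 (g x)))
    {F : ℕ → ℝ → Hilb0} (hF : ∀ n a, F n a = spread L (h n) a)
    (hm : ∀ n, MemLp (F n) 2 (meas L)) :
    ∃ hG : MemLp (spread L g) 2 (meas L),
      Tendsto (fun n => (hm n).toLp (F n)) atTop (𝓝 (hG.toLp (spread L g))) := by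
  obtain ⟨K, -, hK⟩ := exists_decay_bound hL (per L) hD
  have hS := summable_inv_one_add_sq.mul_left K
  have habs : ∀ a ∈ Icc 0 (per L), |a| ≤ per L := fun a ha => by
    rw [abs_of_nonneg ha.1]; exact ha.2
  have h1 : ∀ a ∈ Icc 0 (per L), Tendsto (fun n => F n a) atTop (𝓝 (spread L g a)) := by
    intro a ha
    simp only [hF]
    refine tendsto_tsum_of_dominated_convergence hS (fun j => ?_)
      (Eventually.of_forall fun n => hK _ (hb n) a (habs a ha))
    exact ((Complex.continuous_ofReal.tendsto _).comp (hlim _)).smul_const _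
  have h2 : ∀ n, ∀ a ∈ Icc 0 (per L), ‖F n a‖ ≤ ∑' j : ℤ, K * (1 + (j : ℝ) ^ 2)⁻¹ := by
    intro n a ha
    rw [hF]
    exact tsum_of_norm_bounded hS.hasSum (hK _ (hb n) a (habs a ha))
  have hG : MemLp (spread L g) 2 (meas L) := by
    refine MemLp.of_bound (aestronglyMeasurable_of_tendsto_ae atTop (fun n => (hm n).1)
      (ae_meas h1)) (∑' j : ℤ, K * (1 + (j : ℝ) ^ 2)⁻¹) (ae_meas fun a ha => ?_)
    exact le_of_tendsto (h1 a ha).norm (Eventually.of_forall fun n => h2 n a ha)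
  exact ⟨hG, tendsto_toLp hm hG h2 h1⟩

theorem Test.hasSum_fold (g : Test) (hL : 0 < L) (Φ : Fock0 →ₗ[ℂ] Hilb0) (a : ℝ) :
    HasSum (fun j : ℤ => (g.f (a - j * per L) : ℂ) • Φ (unexcited j))
      (Φ (g.fold L (unexcited 0) a)) := by
  rw [g.fold_eq_sum hL _ (le_refl |a|), map_sum]
  simp only [unexcited_eq_zpow, map_smul]
  exact hasSum_sum_of_ne_finset_zero fun j hj => by
    rw [g.f_eq_zero hL le_rfl hj, Complex.ofReal_zero, zero_smul]

theorem dressedOp_unexcited (he : 0 < e) (hL : 0 < L) (P : ℤ) :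
    dressedOp he hL (unexcited P) = (shift e L : ℂ) • emb (unexcited P) := by
  have h1 : (freeCoef he hL).op (unexcited P) = 0 := by
    refine ((freeCoef he hL).hasSum_op (unexcited P)).unique (hasSum_zero.congr_fun fun m => ?_)
    rw [Coef.qm_apply, pa_apply, nm_apply, alpha_unexcited, beta_unexcited]
    simp [freeCoef]
  rw [dressedOp, LinearMap.add_apply, h1, zero_add, LinearMap.smul_apply]

theorem fib_unexcited (he : 0 < e) (hL : 0 < L) (a : ℝ) (P : ℤ) :
    fib L (dressedOp he hL) a (unexcited P) =
      ((L / (2 * Real.pi) * (a - P * per L + per L / 2) ^ 2 + shift e L : ℝ) : ℂ) •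
        emb (unexcited P) := by
  have h0 := ax_unexcited P
  have hpi := Real.pi_pos
  rw [Rot.fib_apply, dressedOp_unexcited, unexcited, dg_basis]
  rw [unexcited, ax, dg_basis] at h0
  have h1 := smul_left_injective ℂ (show basisVec0 _ ≠ 0 from by simp [basisVec0]) h0
  rw [Complex.ofReal_inj] at h1
  rw [h1, map_smul, ← add_smul, ← Complex.ofReal_add]
  congr 4
  rw [Rot.pot, per]
  field_simp
  ring

theorem actFun_trial (he : 0 < e) (hL : 0 < L) (n : ℕ) (a : ℝ) :
    actFun e L (fib L (dressedOp he hL)) ((trial he L n).fold L (unexcited 0)) a =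
      spread L (fun x => osc he L n x + shift e L * (trial he L n).f x) a := by
  have h1 := ((trial he L n).der.der.hasSum_fold hL emb a).const_smul
    ((-(e ^ 2 / (2 * L)) : ℝ) : ℂ)
  have h2 := (trial he L n).hasSum_fold hL (fib L (dressedOp he hL) a) a
  rw [actFun_eq, Test.d2_fold _ hL, ← (h1.add h2).tsum_eq, spread]
  refine tsum_congr fun j => ?_
  rw [fib_unexcited, smul_smul, smul_smul, ← add_smul, osc]
  congr 1
  push_cast
  ring

theorem spread_gauss_mem (he : 0 < e) (hL : 0 < L) :
    ∃ h : MemLp (spread L fun x => gauss e L (x + per L / 2)) 2 (meas L),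
      (h.toLp _, ((baseEnergy e + shift e L : ℝ) : ℂ) • (h.toLp _ : Tot L)) ∈
        (dressedHam e L).closure.graph := by
  obtain ⟨D, hD, hb⟩ := exists_trial_bound he hL
  set Ψ : ℕ → smoothDom L := fun n => (trial he L n).vec hL (unexcited 0)
  obtain ⟨h, t1⟩ := tendsto_spread hL hD (fun n x => (hb n x).1) (fun x => tendsto_trial he x)
    (F := fun n a => emb ((Ψ n).1 a))
    (fun n a => ((trial he L n).hasSum_fold hL emb a).tsum_eq.symm) fun n => memLp_emb L (Ψ n)
  obtain ⟨h', t2⟩ := tendsto_spread hL (D := D + |shift e L| * D) (by positivity)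
    (h := fun n x => osc he L n x + shift e L * (trial he L n).f x)
    (g := fun x => (baseEnergy e + shift e L) * gauss e L (x + per L / 2))
    (fun n x => by
      refine (abs_add_le _ _).trans ?_
      rw [add_div, abs_mul, mul_div_assoc]
      exact add_le_add (hb n x).2.1 (mul_le_mul_of_nonneg_left (hb n x).1 (abs_nonneg _)))
    (fun x => by
      rw [add_mul]
      exact (tendsto_osc he hL x).add ((tendsto_trial he x).const_mul _))
    (actFun_trial he hL) fun n => memLp_act e L _ (fib_continuous (dressedOp he hL)) (Ψ n)
  refine ⟨h, ?_⟩
  rw [mem_closure_graph (dressedHam_isClosable he hL), dressedHam_eq_schr he hL]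
  have h3 : ((baseEnergy e + shift e L : ℝ) : ℂ) • (h.toLp _ : Tot L) = h'.toLp _ := by
    rw [← MemLp.toLp_const_smul]
    exact MemLp.toLp_congr _ _ (Eventually.of_forall fun a => (spread_const_mul _ _ a).symm)
  rw [h3]
  refine mem_closure_of_tendsto (t1.prodMk_nhds t2) (Eventually.of_forall fun n => ?_)
  rw [graph_schr]
  exact ⟨Ψ n, rfl⟩

theorem Decays.hasSum_norm_sq (hL : 0 < L) {D : ℝ} (hD : 0 < D) {h : ℝ → ℝ} (hh : Decays L D h)
    (a : ℝ) : HasSum (fun j : ℤ => h (a - j * per L) ^ 2) (‖spread L h a‖ ^ 2) := by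
  have h0 := hh.hasSum hL hD a
  have h1 : ∀ i : ℤ, inner ℂ (emb (unexcited i)) (spread L h a) = (h (a - i * per L) : ℂ) := by
    intro i
    refine ((innerSL ℂ (emb (unexcited i))).hasSum h0).unique ?_
    have h2 : ∀ j : ℤ, (h (a - j * per L) : ℂ) *
        inner ℂ (emb (unexcited i)) (emb (unexcited j)) =
        if i = j then (h (a - i * per L) : ℂ) else 0 := fun j => by
      rw [inner_unexcited]
      split_ifs with hij
      · rw [hij, mul_one]
      · rw [mul_zero]
    simp only [innerSL_apply_apply, inner_smul_right, h2]
    exact hasSum_ite_eq' i _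
  have h3 := (innerSL ℂ (spread L h a)).hasSum h0
  simp only [innerSL_apply_apply, inner_smul_right] at h3
  have h4 := Complex.reCLM.hasSum h3
  have h5 : ‖spread L h a‖ ^ 2 = Complex.reCLM (inner ℂ (spread L h a) (spread L h a)) := by
    rw [inner_self_eq_norm_sq_to_K, Complex.reCLM_apply]
    norm_cast
  rw [h5]
  refine h4.congr_fun fun j => ?_
  rw [← inner_conj_symm, h1, Complex.conj_ofReal, ← Complex.ofReal_mul, Complex.reCLM_apply,
    Complex.ofReal_re, sq]

theorem hasSum_integral_translates (hL : 0 < L) {f : ℝ → ℝ} (hf : Integrable f) :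
    HasSum (fun j : ℤ => ∫ a, f (a - j * per L) ∂(meas L)) (∫ x, f x) := by
  have hT := per_pos hL
  have h1 := ((hf.comp_mul_left' hT.ne').const_mul (per L)).hasSum_intervalIntegral_comp_add_int
  rw [integral_const_mul, Measure.integral_comp_mul_left, smul_eq_mul, abs_of_pos (inv_pos.2 hT),
    mul_inv_cancel_left₀ hT.ne', ← (Equiv.neg ℤ).hasSum_iff] at h1
  refine h1.congr_fun fun j => ?_
  rw [integral_meas hL, Function.comp_apply, intervalIntegral.integral_const_mul]
  have h2 := intervalIntegral.integral_comp_mul_left (a := 0) (b := 1)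
    (fun u => f (u - j * per L)) hT.ne'
  rw [mul_zero, mul_one, smul_eq_mul] at h2
  rw [← mul_inv_cancel_left₀ hT.ne' (∫ a in (0)..(per L), f (a - j * per L)), ← h2]
  congr 1
  refine intervalIntegral.integral_congr fun x _ => ?_
  simp only [Equiv.neg_apply]
  push_cast
  ring_nf

theorem norm_spread (hL : 0 < L) {D : ℝ} (hD : 0 < D) {h : ℝ → ℝ} (hh : Decays L D h)
    (hi : Integrable fun x => h x ^ 2) (hm : MemLp (spread L h) 2 (meas L)) :
    ‖(hm.toLp _ : Tot L)‖ ^ 2 = ∫ x, h x ^ 2 := by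
  have h0 := hasSum_integral_translates hL hi
  rw [norm_toLp_sq]
  have h1 : ∀ a, ‖spread L h a‖ ^ 2 = ∑' j : ℤ, h (a - j * per L) ^ 2 := fun a =>
    (hh.hasSum_norm_sq hL hD a).tsum_eq.symm
  simp only [h1]
  refine (hasSum_integral_of_summable_integral_norm
    (F := fun (j : ℤ) a => h (a - j * per L) ^ 2) (fun j => ?_) ?_).unique h0
  · exact (hi.comp_sub_right _).restrict
  · refine h0.summable.congr fun j => ?_
    exact integral_congr_ae (Eventually.of_forall fun a => (Real.norm_of_nonneg (sq_nonneg _)).symm)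

theorem vacuumTerm_eq (U : Hilb0 ≃ₗᵢ[ℂ] Hilb0) (a : ℝ) (P : ℤ) : vacuumTerm e L U a P =
    U.symm ((gauss e L (a - P * per L + per L / 2) : ℂ) • emb (unexcited P)) := by
  rw [vacuumTerm, map_smul, per]
  congr 3
  ring_nf

theorem hasSum_vacuumTerm (he : 0 < e) (hL : 0 < L) (U : Hilb0 ≃ₗᵢ[ℂ] Hilb0) (a : ℝ) :
    HasSum (vacuumTerm e L U a) (U.symm (spread L (fun x => gauss e L (x + per L / 2)) a)) := by
  obtain ⟨D, hD, hb⟩ := exists_trial_bound he hL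
  have h1 := Decays.hasSum hL hD (fun x => (hb 0 x).2.2) a
  exact ((U.symm.toContinuousLinearEquiv : Hilb0 →L[ℂ] Hilb0).hasSum h1).congr_fun
    fun P => vacuumTerm_eq U a P

theorem exists_vacuum (he : 0 < e) (hL : 0 < L) : ∃ Ψ : Tot L,
    (Ψ =ᵐ[meas L] fun a => ∑' P, vacuumTerm e L ((rot he hL).V 1) a P) ∧ ‖Ψ‖ = 1 ∧
      (Ψ, ((baseEnergy e + shift e L : ℝ) : ℂ) • Ψ) ∈ (ham e L).closure.graph := by
  obtain ⟨D, hD, hb⟩ := exists_trial_bound he hL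
  obtain ⟨h, hg⟩ := spread_gauss_mem he hL
  set Φ : Tot L := h.toLp _ with hΦ
  have hn : ‖Φ‖ = 1 := by
    have h1 := norm_spread hL hD (fun x => (hb 0 x).2.2)
      ((integrable_gauss_sq he hL).comp_add_right (per L / 2)) h
    rw [integral_add_right_eq_self (fun y => gauss e L y ^ 2), integral_gauss_sq he hL] at h1
    exact (pow_eq_one_iff_of_nonneg (norm_nonneg _) two_ne_zero).1 h1
  have hV : liftTot L ((rot he hL).V 1) (liftTot L ((rot he hL).V (-1)) Φ) = Φ := by
    have := (rot he hL).liftTot_symm (-1) Φ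
    rwa [neg_neg] at this
  refine ⟨liftTot L ((rot he hL).V (-1)) Φ, ?_, ?_, ?_⟩
  · have h2 := ContinuousLinearMap.coeFn_compLpL (p := 2) (μ := meas L)
      (((rot he hL).V (-1)).toContinuousLinearEquiv : Hilb0 →L[ℂ] Hilb0) Φ
    filter_upwards [h2, h.coeFn_toLp] with a h2 h3
    refine h2.trans ?_
    rw [(hasSum_vacuumTerm he hL _ a).tsum_eq, ← (rot he hL).V_neg, ← h3]
    rfl
  · have h2 := inner_liftTot ((rot he hL).V (-1)) Φ Φ
    simp only [inner_self_eq_norm_sq_to_K, hn] at h2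
    have h3 : ‖liftTot L ((rot he hL).V (-1)) Φ‖ ^ 2 = 1 := by
      have : ‖liftTot L ((rot he hL).V (-1)) Φ‖ ^ 2 = 1 ^ 2 := by exact_mod_cast h2
      rw [this, one_pow]
    exact (pow_eq_one_iff_of_nonneg (norm_nonneg _) two_ne_zero).1 h3
  · rw [ham_dressed he hL, map_smul, hV]
    exact hg

theorem isLeast_energy (he : 0 < e) (hL : 0 < L) :
    IsLeast {E : ℝ | ∃ u : (ham e L).closure.domain, ‖(u : Tot L)‖ = 1 ∧
      E = (inner ℂ (u : Tot L) ((ham e L).closure u)).re} (baseEnergy e + shift e L) := by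
  constructor
  · obtain ⟨Ψ, -, hn, hg⟩ := exists_vacuum he hL
    obtain ⟨u, hu, hv⟩ := (LinearPMap.mem_graph_iff _).1 hg
    refine ⟨u, by rw [hu, hn], ?_⟩
    rw [hv, hu, inner_smul_right, inner_self_eq_norm_sq_to_K, hn]
    simp
  · rintro E ⟨u, hu, rfl⟩
    have h1 := ham_lower he hL ((ham e L).closure.mem_graph u)
    rwa [hu, one_pow, mul_one] at h1

end Schwinger

end

theorem mainTheorem4 (e L : ℝ) (he : 0 < e) (hL : 0 < L) :
    -- the infinite sums defining `:H_coul:`, `Z` and `C₀` converge, and `C₀ < 0`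
    (∀ s, Summable (coulombTerm e L s)) ∧
    (∀ s, Summable (bogoliubovTerm e L s)) ∧
    Summable (shiftTerm e L) ∧ shift e L < 0 ∧
    -- `H` is a densely defined symmetric operator, and the operators below have closures
    Dense ((ham e L).domain : Set (Tot L)) ∧
    (ham e L).IsFormalAdjoint (ham e L) ∧
    (ham e L).IsClosable ∧ (dressedHam e L).IsClosable ∧ (bogoliubov e L).IsClosable ∧
    -- `U = e^{iZ}` exists as a unitary operator
    ∃ U : Hilb0 ≃ₗᵢ[ℂ] Hilb0, IsExpI (bogoliubov e L).closure U ∧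
      -- `U H U⁻¹` is the dressed Hamiltonian
      (∀ u v : Tot L, (u, v) ∈ (ham e L).closure.graph ↔
        (liftTot L U u, liftTot L U v) ∈ (dressedHam e L).closure.graph) ∧
      -- the interacting vacuum is a normalized eigenvector with eigenvalue `E₀ + C₀`
      (∀ a, Summable (vacuumTerm e L U a)) ∧
      (∃ Ψ : Tot L, (Ψ =ᵐ[meas L] fun a => ∑' P, vacuumTerm e L U a P) ∧ ‖Ψ‖ = 1 ∧
        (Ψ, ((baseEnergy e + shift e L : ℝ) : ℂ) • Ψ) ∈ (ham e L).closure.graph) ∧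
      -- `E₀ + C₀` is the vacuum energy, i.e. the minimum of the energy over all normalized states
      IsLeast {E : ℝ | ∃ u : (ham e L).closure.domain, ‖(u : Tot L)‖ = 1 ∧
        E = (inner ℂ (u : Tot L) ((ham e L).closure u)).re} (baseEnergy e + shift e L) := by
  refine ⟨fun s => (hasSum_coulombTerm hL s).summable,
    fun s => (hasSum_bogoliubovTerm he hL s).summable, summable_shift he hL, shift_neg he hL,
    ?_, ?_, ham_isClosable hL, dressedHam_isClosable he hL, bogoliubov_isClosable he hL,
    (rot he hL).V 1, isExpI_bogoliubov he hL, ham_dressed he hL,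
    fun a => (hasSum_vacuumTerm he hL _ a).summable, exists_vacuum he hL, isLeast_energy he hL⟩
  · rw [ham_eq_schr hL]
    exact dense_schr hL _
  · rw [ham_eq_schr hL]
    exact schr_isFormalAdjoint hL isSymm_hamCoef
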